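/- **Setting.** Let $\Omega\subset\mathbb R^2$ be a bounded open set with Lipschitz boundary, star-shaped with respect to the origin. Let $X$ be the dual of the space $C^{0,1}_c(\Omega)$ of Lipschitz functions with compact support in $\Omega$ (with norm $\max\{\sup|\varphi|,\operatorname{Lip}\varphi\}$), with the dual norm. Let $V:=X\times L^2(\Omega;\mathbb R^2)$ carry the product of the norm topology of $X$ and the weak topology of $L^2(\Omega;\mathbb R^2)$. **Variational equivalence.** For families $F_\varepsilon,G_\varepsilon:V\to[0,+\infty]$ write $(G_\varepsilon)\preceq(F_\varepsilon)$ if there is a continuous, strictly increasing function $\varepsilon\mapsto\delta_\varepsilon$ on $[0,\infty)$ with $\delta_0=0$ such that, for every sequence $\varepsilon_n>0$ with $\varepsilon_n\to0$ and every $(p_n)\subset V$ with $\sup_nF_{\varepsilon_n}(p_n)<+\infty$, there is $(q_n)\subset V$ with (i) $\limsup_n\,(G_{\delta_{\varepsilon_n}}(q_n)-F_{\varepsilon_n}(p_n))\le0$ and (ii) either $(p_n)$ and $(q_n)$ are both unbounded, or $p_n-q_n\to0$ in $V$. The families are *variationally equivalent* if $(F_\varepsilon)\preceq(G_\varepsilon)$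 and $(G_\varepsilon)\preceq(F_\varepsilon)$. **Ginzburg–Landau.** For $w\in H^1(\Omega;\mathbb R^2)$ put $$GL_\varepsilon(w)=\int_\Omega\tfrac12|\nabla w|^2+\tfrac1{\varepsilon^2}(1-|w|)^2\,dx,\qquad Jw=\det\nabla w,\qquad j(w)=w_1\nabla w_2-w_2\nabla w_1,$$ where $Jw$ acts on $C^{0,1}_c(\Omega)$ by $\langle Jw,\varphi\rangle=\int_\Omega Jw\,\varphi\,dx$. With $B_1$ the closed unit disc, $$\mathbb{GL}_\varepsilon(\mu,j)=\inf\Big\{\tfrac{GL_\varepsilon(w)}{|\log\varepsilon|^2}:\ w\in H^1(\Omega;B_1),\ \tfrac{j(w)}{|\log\varepsilon|}=j,\ \tfrac{Jw}{\pi|\log\varepsilon|}=\mu\Big\}.$$ **Lattice.** Let $\Omega^0_\varepsilon=\varepsilon\mathbb Z^2\cap\Omega$; let $\Omega^1_\varepsilon$ be the set of pairs $(i,j)$ of points of $\Omega^0_\varepsilon$ with $j=i+\varepsilon e_1$ or $j=i+\varepsilon e_2$; and let $\Omega^2_\varepsilon$ be the set of $i\in\varepsilon\mathbb Z^2$ with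 $i+[0,\varepsilon]^2\subset\Omega$. For $t\in\mathbb R$ let $P(t)$ be the integer nearest to $t$, and the one of smaller modulus if there are two. **Screw dislocations.** For $u:\Omega^0_\varepsilon\to\mathbb R$ and $(i,j)\in\Omega_\varepsilon^1$ put $(\beta^e_u)_{i,j}=(u(j)-u(i))-P(u(j)-u(i))$, and $$SD_\varepsilon(u)=\tfrac12\sum_{(i,j)\in\Omega^1_\varepsilon}|(\beta^e_u)_{i,j}|^2,\qquad \mu_u=\sum_{i\in\Omega^2_\varepsilon}\alpha_u(i)\,\delta_{i+\frac12(\varepsilon,\varepsilon)},$$ where $\alpha_u(i)$ is the counterclockwise circulation of $\beta^e_u$ around the square $i+[0,\varepsilon]^2$: $$\alpha_u(i)=(\beta^e_u)_{i,i+\varepsilon e_1}+(\beta^e_u)_{i+\varepsilon e_1,i+\varepsilon e_1+\varepsilon e_2}-(\beta^e_u)_{i+\varepsilon e_2,i+\varepsilon e_1+\varepsilon e_2}-(\beta^e_u)_{i,i+\varepsilon e_2}.$$ Cut each square $i+[0,\varepsilon]^2$, $i\in\Omega^2_\varepsilon$, into two triangles along its diagonal of direction $(1,1)$. The field $\hat\beta^e_u:\Omega\to\mathbb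 R^2$ is constant on each triangle: its $l$-th component is $\varepsilon^{-1}$ times the value of $\beta^e_u$ on the side of the triangle parallel to $e_l$. It is $0$ outside these squares. Put $$\mathbb{SD}_\varepsilon(\mu,j)=\inf\Big\{\tfrac{4\pi^2}{|\log\varepsilon|^2}SD_\varepsilon(u):\ u:\Omega^0_\varepsilon\to\mathbb R,\ \tfrac{2\pi\hat\beta^e_u}{|\log\varepsilon|}=j,\ \tfrac{\mu_u}{|\log\varepsilon|}=\mu\Big\}.$$ **XY spins.** For $v:\Omega^0_\varepsilon\to\mathcal S^1$ let $\theta(v)\in[0,2\pi)$ be the phase, $v=e^{i\theta(v)}$, and put $\mu_v=\mu_{\theta(v)/2\pi}$, $\hat j_v=2\pi\hat\beta^e_{\theta(v)/2\pi}$, $XY_\varepsilon(v)=\frac12\sum_{(i,j)\in\Omega^1_\varepsilon}|v(i)-v(j)|^2$ and $$\mathbb{XY}_\varepsilon(\mu,j)=\inf\Big\{\tfrac{XY_\varepsilon(v)}{|\log\varepsilon|^2}:\ v:\Omega^0_\varepsilon\to\mathcal S^1,\ \tfrac{\hat j_v}{|\log\varepsilon|}=j,\ \tfrac{\mu_v}{|\log\varepsilon|}=\mu\Big\}.$$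 In all three definitions $\inf\emptyset=+\infty$. **Theorem.** The families $(\mathbb{GL}_\varepsilon)$, $(\mathbb{XY}_\varepsilon)$ and $(\mathbb{SD}_\varepsilon)$ on $V$ are pairwise variationally equivalent. -/

import Mathlib

open MeasureTheory Filter Topology
open scoped ENNReal NNReal ContDiff

noncomputable section

namespace VarEq

/-- The Euclidean plane. -/
abbrev E2 : Type := EuclideanSpace ℝ (Fin 2)

/-! ### Domains -/

/-- `Ω` has Lipschitz boundary: near every boundary point, in suitable orthonormal coordinates,
`Ω` is the strict epigraph of a Lipschitz function of one variable. -/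
def HasLipschitzBoundary (Ω : Set E2) : Prop :=
  ∀ x ∈ frontier Ω, ∃ (A : E2 ≃ₗᵢ[ℝ] E2) (γ : ℝ → ℝ) (K : ℝ≥0) (r : ℝ),
    0 < r ∧ LipschitzWith K γ ∧
      ∀ y ∈ Metric.ball x r, y ∈ Ω ↔ γ ((A y) 0) < (A y) 1

/-! ### Lipschitz functions with compact support, and the dual space `X` -/

/-- Lipschitz functions with compact support in `Ω` (extended by zero to the plane; for a function
with compact support in the open set `Ω` the extension has the same sup norm and the same Lipschitz
constant), as a vector space. -/
def lipSubmodule (Ω : Set E2) : Submodule ℝ (E2 → ℝ) where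
  carrier := {φ | (∃ K : ℝ≥0, LipschitzWith K φ) ∧ HasCompactSupport φ ∧ tsupport φ ⊆ Ω}
  add_mem' := by
    rintro f g ⟨⟨K, hK⟩, hf, hf'⟩ ⟨⟨L, hL⟩, hg, hg'⟩
    exact ⟨⟨K + L, hK.add hL⟩, hf.add hg,
      (tsupport_add f g).trans (Set.union_subset hf' hg')⟩
  zero_mem' := by
    refine ⟨⟨0, LipschitzWith.const 0⟩, HasCompactSupport.zero, ?_⟩
    have h : tsupport (0 : E2 → ℝ) = ∅ := by simp
    rw [h]
    exact Set.empty_subset _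
  smul_mem' := by
    rintro c f ⟨⟨K, hK⟩, hf, hf'⟩
    refine ⟨⟨‖c‖₊ * K, ?_⟩, ?_, ?_⟩
    · refine LipschitzWith.of_dist_le_mul fun x y => ?_
      have h := hK.dist_le_mul x y
      rw [Real.dist_eq] at h ⊢
      have h2 : (c • f) x - (c • f) y = c * (f x - f y) := by
        simp only [Pi.smul_apply, smul_eq_mul]; ring
      rw [h2, abs_mul, NNReal.coe_mul, mul_assoc]
      exact mul_le_mul_of_nonneg_left h (abs_nonneg c)
    · exact hf.smul_left (f := fun _ => c)
    · exact (tsupport_smul_subset_right (fun _ => c) f).trans hf'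

/-- The space `C_c^{0,1}(Ω)`; a type synonym, so that it does not carry the topology of pointwise
convergence. -/
def LipC (Ω : Set E2) : Type := lipSubmodule Ω

namespace LipC

variable {Ω : Set E2}

instance : AddCommGroup (LipC Ω) := inferInstanceAs (AddCommGroup (lipSubmodule Ω))

instance : Module ℝ (LipC Ω) := inferInstanceAs (Module ℝ (lipSubmodule Ω))

instance : CoeFun (LipC Ω) (fun _ => E2 → ℝ) := ⟨fun φ => φ.1⟩

theorem add_apply (φ ψ : LipC Ω) (x : E2) : (φ + ψ) x = φ x + ψ x := rfl

theorem smul_apply (c : ℝ) (φ : LipC Ω) (x : E2) : (c • φ) x = c * φ x := rfl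

theorem zero_apply (x : E2) : (0 : LipC Ω) x = 0 := rfl

/-- The constants that bound both `|φ|` and the Lipschitz constant of `φ`. -/
def bounds (φ : LipC Ω) : Set ℝ :=
  {C | 0 ≤ C ∧ (∀ x, |φ x| ≤ C) ∧ ∀ x y, |φ x - φ y| ≤ C * dist x y}

/-- The norm of `C_c^{0,1}(Ω)`: the larger one of `sup |φ|` and the Lipschitz constant of `φ`. -/
instance : Norm (LipC Ω) := ⟨fun φ => sInf (bounds φ)⟩

theorem norm_def (φ : LipC Ω) : ‖φ‖ = sInf (bounds φ) := rfl

theorem bounds_bddBelow (φ : LipC Ω) : BddBelow (bounds φ) := ⟨0, fun _ h => h.1⟩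

theorem bounds_nonempty (φ : LipC Ω) : (bounds φ).Nonempty := by
  obtain ⟨⟨K, hK⟩, hc, _⟩ := φ.2
  obtain ⟨M, hM⟩ := hc.exists_bound_of_continuous hK.continuous
  refine ⟨max M K, le_max_of_le_right K.2, fun x => (hM x).trans (le_max_left _ _), fun x y => ?_⟩
  exact (hK.dist_le_mul x y).trans (mul_le_mul_of_nonneg_right (le_max_right _ _) dist_nonneg)

theorem norm_mem_bounds (φ : LipC Ω) : ‖φ‖ ∈ bounds φ := by
  have hcl : IsClosed (bounds φ) := by
    have h : bounds φ = Set.Ici 0 ∩ ((⋂ x, {C : ℝ | |φ x| ≤ C}) ∩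
        ⋂ x, ⋂ y, {C : ℝ | |φ x - φ y| ≤ C * dist x y}) := by
      ext C; simp [bounds]
    rw [h]
    refine isClosed_Ici.inter (IsClosed.inter ?_ ?_)
    · exact isClosed_iInter fun x => isClosed_le continuous_const continuous_id
    · exact isClosed_iInter fun x => isClosed_iInter fun y =>
        isClosed_le continuous_const (continuous_id.mul continuous_const)
  exact hcl.csInf_mem (bounds_nonempty φ) (bounds_bddBelow φ)

theorem norm_le {φ : LipC Ω} {C : ℝ} (h : C ∈ bounds φ) : ‖φ‖ ≤ C :=
  csInf_le (bounds_bddBelow φ) h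

theorem norm_smul_le' (c : ℝ) (φ : LipC Ω) : ‖c • φ‖ ≤ |c| * ‖φ‖ := by
  obtain ⟨h0, h1, h2⟩ := norm_mem_bounds φ
  refine norm_le ⟨mul_nonneg (abs_nonneg c) h0, fun x => ?_, fun x y => ?_⟩
  · rw [smul_apply, abs_mul]
    exact mul_le_mul_of_nonneg_left (h1 x) (abs_nonneg c)
  · rw [smul_apply, smul_apply, ← mul_sub, abs_mul, mul_assoc]
    exact mul_le_mul_of_nonneg_left (h2 x y) (abs_nonneg c)

theorem core (Ω : Set E2) : NormedSpace.Core ℝ (LipC Ω) where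
  norm_nonneg φ := (norm_mem_bounds φ).1
  norm_smul c φ := by
    refine le_antisymm (norm_smul_le' c φ) ?_
    rcases eq_or_ne c 0 with rfl | hc
    · simpa using (norm_mem_bounds ((0 : ℝ) • φ)).1
    · have h := norm_smul_le' c⁻¹ (c • φ)
      rw [smul_smul, inv_mul_cancel₀ hc, one_smul, abs_inv] at h
      rw [Real.norm_eq_abs]
      have hc' : 0 < |c| := abs_pos.mpr hc
      calc |c| * ‖φ‖ ≤ |c| * (|c|⁻¹ * ‖c • φ‖) := mul_le_mul_of_nonneg_left h hc'.le
        _ = ‖c • φ‖ := by rw [← mul_assoc, mul_inv_cancel₀ hc'.ne', one_mul]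
  norm_triangle φ ψ := by
    obtain ⟨h0, h1, h2⟩ := norm_mem_bounds φ
    obtain ⟨k0, k1, k2⟩ := norm_mem_bounds ψ
    refine norm_le ⟨add_nonneg h0 k0, fun x => ?_, fun x y => ?_⟩
    · rw [add_apply]
      exact (abs_add_le _ _).trans (add_le_add (h1 x) (k1 x))
    · rw [add_apply, add_apply, add_sub_add_comm, add_mul]
      exact (abs_add_le _ _).trans (add_le_add (h2 x y) (k2 x y))
  norm_eq_zero_iff φ := by
    constructor
    · intro h
      obtain ⟨_, h1, _⟩ := norm_mem_bounds φ
      refine Subtype.ext (funext fun x => ?_)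
      have := h1 x
      rw [h] at this
      exact abs_nonpos_iff.mp this
    · rintro rfl
      refine le_antisymm (norm_le ⟨le_rfl, fun x => ?_, fun x y => ?_⟩)
        (norm_mem_bounds (0 : LipC Ω)).1
      · simp [zero_apply]
      · simp [zero_apply]

instance : NormedAddCommGroup (LipC Ω) := NormedAddCommGroup.ofCore (core Ω)

instance : NormedSpace ℝ (LipC Ω) := NormedSpace.ofCore (core Ω)

end LipC

/-- The Banach space `X`: the dual of `C_c^{0,1}(Ω)` with the dual norm. -/
abbrev X (Ω : Set E2) : Type := StrongDual ℝ (LipC Ω)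

/-- The space `L²(Ω; ℝ²)`. -/
abbrev L2 (Ω : Set E2) : Type := Lp E2 2 (volume.restrict Ω)

/-- The space `X × L²(Ω; ℝ²)`, with the product of the norm topology of `X` and the weak topology of
`L²(Ω; ℝ²)`. -/
abbrev PhaseSpace (Ω : Set E2) : Type := X Ω × WeakSpace ℝ (L2 Ω)

/-- The second component, as an element of `L²(Ω; ℝ²)`. -/
def PhaseSpace.field {Ω : Set E2} (p : PhaseSpace Ω) : L2 Ω := (toWeakSpace ℝ (L2 Ω)).symm p.2

/-! ### Variational equivalence -/

section Equivalence

variable {V : Type*} [AddCommGroup V] [Module ℝ V] [TopologicalSpace V]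

/-- The sequence `p` is bounded in the topological vector space `V`. -/
def IsBoundedSeq (p : ℕ → V) : Prop := Bornology.IsVonNBounded ℝ (Set.range p)

/-- The relation `(G_ε) ≼ (F_ε)` between two families of functionals on `V`. -/
def VarLE (G F : ℝ → V → ℝ≥0∞) : Prop :=
  ∃ δ : ℝ → ℝ, ContinuousOn δ (Set.Ici 0) ∧ StrictMonoOn δ (Set.Ici 0) ∧ δ 0 = 0 ∧
    ∀ ε : ℕ → ℝ, (∀ n, 0 < ε n) → Tendsto ε atTop (𝓝 0) →
      ∀ p : ℕ → V, (∃ C : ℝ≥0, ∀ n, F (ε n) (p n) ≤ C) →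
        ∃ q : ℕ → V,
          limsup (fun n => (G (δ (ε n)) (q n) : EReal) - (F (ε n) (p n) : EReal)) atTop ≤ 0 ∧
          ((¬ IsBoundedSeq p ∧ ¬ IsBoundedSeq q) ∨
            Tendsto (fun n => p n - q n) atTop (𝓝 0))

/-- Variational equivalence `(F_ε) ≃ (G_ε)` for `ε → 0`. -/
def VarEquiv (F G : ℝ → V → ℝ≥0∞) : Prop := VarLE F G ∧ VarLE G F

end Equivalence

/-! ### The Ginzburg-Landau functionals -/

/-- `g` is the weak gradient of `f` in `Ω`. -/
def HasWeakGradient (Ω : Set E2) (f : E2 → ℝ) (g : E2 → E2) : Prop :=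
  ∀ φ : E2 → ℝ, ContDiff ℝ ∞ φ → HasCompactSupport φ → tsupport φ ⊆ Ω → ∀ l : Fin 2,
    ∫ x in Ω, f x * fderiv ℝ φ x (EuclideanSpace.single l 1) = - ∫ x in Ω, g x l * φ x

/-- An element `w` of `H¹(Ω; ℝ²)`, together with the gradients of its two components. -/
structure H1Field (Ω : Set E2) where
  toFun : E2 → E2
  grad : Fin 2 → E2 → E2
  memLp_toFun : MemLp toFun 2 (volume.restrict Ω)
  memLp_grad : ∀ k, MemLp (grad k) 2 (volume.restrict Ω)
  weak_grad : ∀ k, HasWeakGradient Ω (fun x => toFun x k) (grad k)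

/-- `w` takes values in the closed unit ball `B₁`. -/
def H1Field.InBall {Ω : Set E2} (w : H1Field Ω) : Prop :=
  ∀ᵐ x ∂(volume.restrict Ω), ‖w.toFun x‖ ≤ 1

/-- `GL_ε(w) = ∫_Ω ½ |∇w|² + ε⁻² (1 - |w|)²`. -/
def H1Field.energy {Ω : Set E2} (ε : ℝ) (w : H1Field Ω) : ℝ :=
  ∫ x in Ω, ((1 / 2) * (‖w.grad 0 x‖ ^ 2 + ‖w.grad 1 x‖ ^ 2)
    + (1 / ε ^ 2) * (1 - ‖w.toFun x‖) ^ 2)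

/-- The Jacobian `J w = det ∇w`. -/
def H1Field.jac {Ω : Set E2} (w : H1Field Ω) (x : E2) : ℝ :=
  w.grad 0 x 0 * w.grad 1 x 1 - w.grad 0 x 1 * w.grad 1 x 0

/-- The current `j(w) = w₁ ∇w₂ - w₂ ∇w₁`. -/
def H1Field.current {Ω : Set E2} (w : H1Field Ω) (x : E2) : E2 :=
  w.toFun x 0 • w.grad 1 x - w.toFun x 1 • w.grad 0 x

/-- The functionals `𝔾𝕃_ε` on `X × L²(Ω; ℝ²)`. -/
def enrichedGL (Ω : Set E2) (ε : ℝ) (p : PhaseSpace Ω) : ℝ≥0∞ :=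
  ⨅ (w : H1Field Ω) (_ : w.InBall)
    (_ : p.field =ᵐ[volume.restrict Ω] fun x => (1 / |Real.log ε|) • w.current x)
    (_ : ∀ φ : LipC Ω,
      p.1 φ = (1 / (Real.pi * |Real.log ε|)) * ∫ x in Ω, w.jac x * φ x),
    ENNReal.ofReal ((1 / |Real.log ε| ^ 2) * w.energy ε)

/-! ### The lattice

A point `ε k` of the lattice `ε ℤ²` is represented by its index `k : ℤ × ℤ`. A function on
`Ω_ε⁰ = ε ℤ² ∩ Ω` is represented by a function on all of `ℤ × ℤ`; only its values at indices of
points of `Ω` enter the definitions below. -/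

/-- The lattice point `ε k`. -/
def pt (ε : ℝ) (k : ℤ × ℤ) : E2 := !₂[ε * (k.1 : ℝ), ε * (k.2 : ℝ)]

/-- The nearest neighbours `Ω_ε¹`: pairs `(i, j)` of lattice points of `Ω` with `j = i + ε e₁` or
`j = i + ε e₂`. -/
def bonds (Ω : Set E2) (ε : ℝ) : Set ((ℤ × ℤ) × (ℤ × ℤ)) :=
  {b | pt ε b.1 ∈ Ω ∧ pt ε b.2 ∈ Ω ∧ (b.2 = b.1 + (1, 0) ∨ b.2 = b.1 + (0, 1))}

/-- The closed lattice square `ε k + [0, ε]²`. -/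
def cell (ε : ℝ) (k : ℤ × ℤ) : Set E2 :=
  {x | x 0 ∈ Set.Icc (ε * (k.1 : ℝ)) (ε * (k.1 : ℝ) + ε) ∧
    x 1 ∈ Set.Icc (ε * (k.2 : ℝ)) (ε * (k.2 : ℝ) + ε)}

/-- The (indices of the) lattice squares contained in `Ω`, that is, `Ω_ε²`. -/
def cells (Ω : Set E2) (ε : ℝ) : Set (ℤ × ℤ) := {k | cell ε k ⊆ Ω}

/-- The centre of the lattice square with index `k`. -/
def centre (ε : ℝ) (k : ℤ × ℤ) : E2 := !₂[ε * (k.1 : ℝ) + ε / 2, ε * (k.2 : ℝ) + ε / 2]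

/-! ### Strains, dislocations, vortices -/

/-- The projection of `ℝ` onto `ℤ`: the integer nearest to `t`; of two nearest integers, the one with
the smaller modulus. -/
def nearestInt (t : ℝ) : ℤ := if 0 ≤ t then ⌈t - 1 / 2⌉ else ⌊t + 1 / 2⌋

/-- The elastic strain `β^e_u = du - P(du)` on the bond from `i` to `j`, where `du = u(j) - u(i)`. -/
def elastic (u : ℤ × ℤ → ℝ) (i j : ℤ × ℤ) : ℝ := (u j - u i) - (nearestInt (u j - u i) : ℝ)

/-- The discrete dislocation function `α_u`: the circulation of `β^e_u` along the boundary of a lattice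
square, in the counterclockwise sense. -/
def dislocation (u : ℤ × ℤ → ℝ) (k : ℤ × ℤ) : ℝ :=
  elastic u k (k + (1, 0)) + elastic u (k + (1, 0)) (k + (1, 1))
    - elastic u (k + (0, 1)) (k + (1, 1)) - elastic u k (k + (0, 1))

/-- The pairing of the measure `μ_u = ∑ α_u(i) δ_{i + (ε/2, ε/2)}`, where `i` runs through the
lattice squares contained in `Ω`, with a function `φ`. -/
def dislocationMeasure (Ω : Set E2) (ε : ℝ) (u : ℤ × ℤ → ℝ) (φ : E2 → ℝ) : ℝ :=
  ∑ᶠ k ∈ cells Ω ε, dislocation u k * φ (centre ε k)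

/-- The index of the half-open lattice square that contains `x`. -/
def cellIndex (ε : ℝ) (x : E2) : ℤ × ℤ := (⌊x 0 / ε⌋, ⌊x 1 / ε⌋)

open Classical in
/-- The strain field `β̂^e_u` of the discrete strain `β^e_u`. Every lattice square contained in `Ω` is
cut along its diagonal of direction `(1, 1)`; on each of the two triangles the `l`-th component is
`ε⁻¹ β^e_u` at the side of the triangle which is parallel to `e_l`. The field is zero outside
these squares. -/
def strainField (Ω : Set E2) (ε : ℝ) (u : ℤ × ℤ → ℝ) (x : E2) : E2 :=
  let k := cellIndex ε x
  if k ∈ cells Ω ε then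
    if x 1 - ε * (k.2 : ℝ) ≤ x 0 - ε * (k.1 : ℝ) then
      (1 / ε) • !₂[elastic u k (k + (1, 0)), elastic u (k + (1, 0)) (k + (1, 1))]
    else
      (1 / ε) • !₂[elastic u (k + (0, 1)) (k + (1, 1)), elastic u k (k + (0, 1))]
  else 0

/-- `SD_ε(u) = ½ ∑ |β^e_u|²`, where the sum is over the nearest neighbours in `Ω`. -/
def sdEnergy (Ω : Set E2) (ε : ℝ) (u : ℤ × ℤ → ℝ) : ℝ :=
  (1 / 2) * ∑ᶠ b ∈ bonds Ω ε, (elastic u b.1 b.2) ^ 2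

/-- The functionals `𝕊𝔻_ε` on `X × L²(Ω; ℝ²)`. -/
def enrichedSD (Ω : Set E2) (ε : ℝ) (p : PhaseSpace Ω) : ℝ≥0∞ :=
  ⨅ (u : ℤ × ℤ → ℝ)
    (_ : p.field =ᵐ[volume.restrict Ω]
      fun x => (1 / |Real.log ε|) • (2 * Real.pi) • strainField Ω ε u x)
    (_ : ∀ φ : LipC Ω, p.1 φ = (1 / |Real.log ε|) * dislocationMeasure Ω ε u φ),
    ENNReal.ofReal ((4 * Real.pi ^ 2 / |Real.log ε| ^ 2) * sdEnergy Ω ε u)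

/-- The phase `θ(v) ∈ [0, 2π)` of a point of the circle. -/
def phase (z : Circle) : ℝ := toIcoMod Real.two_pi_pos 0 (Complex.arg (z : ℂ))

/-- The displacement `u(v) = θ(v) / 2π` of a field `v` of unit vectors. -/
def displacement (v : ℤ × ℤ → Circle) (k : ℤ × ℤ) : ℝ := phase (v k) / (2 * Real.pi)

/-- The pairing of the vorticity measure `μ_v = ∑ γ_v(i) δ_{i + (ε/2, ε/2)}`, where
`γ_v = α_{θ(v)/2π}`, with a function `φ`. -/
def vorticityMeasure (Ω : Set E2) (ε : ℝ) (v : ℤ × ℤ → Circle) (φ : E2 → ℝ) : ℝ :=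
  dislocationMeasure Ω ε (displacement v) φ

/-- The field `ĵ_v = 2π β̂^e_{θ(v)/2π}`. -/
def vortexCurrent (Ω : Set E2) (ε : ℝ) (v : ℤ × ℤ → Circle) (x : E2) : E2 :=
  (2 * Real.pi) • strainField Ω ε (displacement v) x

/-- `XY_ε(v) = ½ ∑ |v(i) - v(j)|²`, where the sum is over the nearest neighbours in `Ω`. -/
def xyEnergy (Ω : Set E2) (ε : ℝ) (v : ℤ × ℤ → Circle) : ℝ :=
  (1 / 2) * ∑ᶠ b ∈ bonds Ω ε, ‖(v b.1 : ℂ) - (v b.2 : ℂ)‖ ^ 2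

/-- The functionals `𝕏𝕐_ε` on `X × L²(Ω; ℝ²)`. -/
def enrichedXY (Ω : Set E2) (ε : ℝ) (p : PhaseSpace Ω) : ℝ≥0∞ :=
  ⨅ (v : ℤ × ℤ → Circle)
    (_ : p.field =ᵐ[volume.restrict Ω] fun x => (1 / |Real.log ε|) • vortexCurrent Ω ε v x)
    (_ : ∀ φ : LipC Ω, p.1 φ = (1 / |Real.log ε|) * vorticityMeasure Ω ε v φ),
    ENNReal.ofReal ((1 / |Real.log ε| ^ 2) * xyEnergy Ω ε v)

end VarEq

end

noncomputable section

open MeasureTheory Filter Topology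
open Filter.Eventually (of_forall)
open EuclideanSpace (single proj)
open Real (cos exp log log_le_log log_neg norm_eq_abs norm_of_nonneg pi_gt_three pi_lt_d2 pi_pos sin
  sq_sqrt sqrt_le_iff sqrt_nonneg sqrt_pos two_pi_pos)
open Bornology (IsBounded)
open Int (fract fract_lt_one fract_nonneg)
open ContinuousLinearMap (lsmul)
open Set (indicator_of_mem mem_ofPred_eq mem_Ioi mem_univ mem_Ico sdiff_subset)
open ENNReal (ofReal)
open Finset (abs_sum_le_sum_abs mul_sum range sum_add_distrib sum_congr sum_insert sum_le_sum
  sum_le_sum_of_subset_of_nonneg sum_map sum_nonneg sum_sub_distrib)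
open scoped ENNReal NNReal ContDiff Real

namespace VarEq

/-! ### Quantitative comparison of families of functionals -/

section Abstract

variable {Ω : Set E2}

/-- Two points of the phase space are close when tested with Lipschitz functions. -/
def Close (p q : PhaseSpace Ω) (η : ℝ) : Prop :=
  (∀ φ : LipC Ω, |p.1 φ - q.1 φ| ≤ η * ‖φ‖) ∧
    ∀ (l : Fin 2) (φ : LipC Ω), |∫ x in Ω, (p.field x l - q.field x l) * φ x| ≤ η * ‖φ‖

/-- `AdmLE AF AG δ`: every configuration of the family `AF` with bounded energy is approximated by
configurations of the family `AG` at scale `δ ε`, with asymptotically no more energy. -/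
def AdmLE (AF AG : ℝ → PhaseSpace Ω → ℝ → Prop) (δ : ℝ → ℝ) : Prop :=
  ∀ C : ℝ, ∃ (ρ : ℝ → ℝ) (B : ℝ), Tendsto ρ (𝓝[>] 0) (𝓝 0) ∧ ∀ᶠ ε in 𝓝[>] (0 : ℝ),
    ∀ p e, AF ε p e → e ≤ C → ∃ q e', AG (δ ε) q e' ∧ e' ≤ e + ρ ε ∧ Close p q (ρ ε) ∧
      ‖p.field - q.field‖ ≤ B

theorem field_memLp (p : PhaseSpace Ω) (l : Fin 2) :
    MemLp (fun x => p.field x l) 2 (volume.restrict Ω) :=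
  (proj (𝕜 := ℝ) l).comp_memLp' (Lp.memLp p.field)

theorem LipC.abs_le (φ : LipC Ω) (x : E2) : |φ x| ≤ ‖φ‖ := (LipC.norm_mem_bounds φ).2.1 x

theorem LipC.abs_sub_le (φ : LipC Ω) (x y : E2) : |φ x - φ y| ≤ ‖φ‖ * dist x y :=
  (LipC.norm_mem_bounds φ).2.2 x y

theorem LipC.lipschitz (φ : LipC Ω) : LipschitzWith ‖φ‖₊ φ :=
  LipschitzWith.of_dist_le_mul fun x y => by
    simpa [Real.dist_eq] using φ.abs_sub_le x y

theorem LipC.continuous (φ : LipC Ω) : Continuous φ := φ.lipschitz.continuous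

theorem LipC.hasCompactSupport (φ : LipC Ω) : HasCompactSupport φ := φ.2.2.1

theorem LipC.tsupport_subset (φ : LipC Ω) : tsupport φ ⊆ Ω := φ.2.2.2

theorem LipC.eq_zero (φ : LipC Ω) {x : E2} (hx : x ∉ Ω) : φ x = 0 := by
  by_contra h
  exact hx (φ.tsupport_subset (subset_tsupport _ h))

theorem LipC.memLp (φ : LipC Ω) (μ : Measure E2) [IsFiniteMeasureOnCompacts μ] (p : ℝ≥0∞) :
    MemLp φ p μ :=
  φ.continuous.memLp_of_hasCompactSupport φ.hasCompactSupport

theorem integrable_field_mul (p : PhaseSpace Ω) (l : Fin 2) (φ : LipC Ω) :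
    IntegrableOn (fun x => p.field x l * φ x) Ω :=
  (field_memLp p l).integrable_mul (φ.memLp (volume.restrict Ω) 2)

theorem Close.trans {p q r : PhaseSpace Ω} {η θ : ℝ} (h : Close p q η) (k : Close q r θ) :
    Close p r (η + θ) := by
  refine ⟨fun φ => ?_, fun l φ => ?_⟩
  · have e : p.1 φ - r.1 φ = (p.1 φ - q.1 φ) + (q.1 φ - r.1 φ) := by ring
    rw [e, add_mul]
    exact (abs_add_le _ _).trans (add_le_add (h.1 φ) (k.1 φ))
  · have e : ∫ x in Ω, (p.field x l - r.field x l) * φ x =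
        (∫ x in Ω, (p.field x l - q.field x l) * φ x) +
          ∫ x in Ω, (q.field x l - r.field x l) * φ x := by
      rw [← integral_add]
      · congr 1; ext x; ring
      · simp only [sub_mul]
        exact (integrable_field_mul p l φ).sub (integrable_field_mul q l φ)
      · simp only [sub_mul]
        exact (integrable_field_mul q l φ).sub (integrable_field_mul r l φ)
    rw [e, add_mul]
    exact (abs_add_le _ _).trans (add_le_add (h.2 l φ) (k.2 l φ))

theorem AdmLE.trans {AF AG AH : ℝ → PhaseSpace Ω → ℝ → Prop} {δ δ' : ℝ → ℝ}
    (hδ : Tendsto δ (𝓝[>] 0) (𝓝[>] 0)) (h : AdmLE AF AG δ) (k : AdmLE AG AH δ') :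
    AdmLE AF AH (δ' ∘ δ) := by
  intro C
  obtain ⟨ρ, B, hρ, h⟩ := h C
  obtain ⟨ρ', B', hρ', k⟩ := k (C + 1)
  refine ⟨fun ε => ρ ε + ρ' (δ ε), B + B', ?_, ?_⟩
  · simpa using hρ.add (hρ'.comp hδ)
  · filter_upwards [h, hδ.eventually k, hρ.eventually (gt_mem_nhds one_pos)] with ε h k h1 p e hp he
    obtain ⟨q, e', hq, he', hc, hB⟩ := h p e hp he
    obtain ⟨r, e'', hr, he'', hc', hB'⟩ := k q e' hq (by linarith)
    refine ⟨r, e'', hr, by linarith, hc.trans hc', ?_⟩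
    calc ‖p.field - r.field‖ = ‖(p.field - q.field) + (q.field - r.field)‖ := by congr 1; abel
      _ ≤ _ := (norm_add_le _ _).trans (add_le_add hB hB')

/-- A bounded sequence in `L²(Ω; ℝ²)` that tends to zero when tested with Lipschitz functions with
compact support tends to zero weakly. -/
theorem tendsto_inner_zero (hΩ : IsOpen Ω) (g : ℕ → L2 Ω) (B : ℝ) (hB : ∀ᶠ n in atTop, ‖g n‖ ≤ B)
    (h : ∀ (l : Fin 2) (φ : LipC Ω),
      Tendsto (fun n => ∫ x in Ω, g n x l * φ x) atTop (𝓝 0)) (ζ : L2 Ω) :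
    Tendsto (fun n => inner ℝ ζ (g n)) atTop (𝓝 0) := by
  have hmem : ∀ (l : Fin 2) (φ : LipC Ω),
      MemLp (fun x => single l (φ x)) 2 (volume.restrict Ω) := by
    intro l φ
    refine MemLp.of_eval_piLp fun i => ?_
    by_cases hi : i = l
    · subst hi; simpa using φ.memLp (volume.restrict Ω) 2
    · simp [hi]
  have hinner : ∀ (l : Fin 2) (φ : LipC Ω) (f : L2 Ω),
      inner ℝ (hmem l φ).toLp f = ∫ x in Ω, f x l * φ x := by
    intro l φ f
    rw [MeasureTheory.L2.inner_def]
    refine integral_congr_ae ?_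
    filter_upwards [(hmem l φ).coeFn_toLp] with x hx
    rw [hx, EuclideanSpace.inner_single_left]
    simp [mul_comm]
  set T : Set (L2 Ω) := {f | ∃ (l : Fin 2) (φ : LipC Ω), f = (hmem l φ).toLp}
  have hT : (Submodule.span ℝ T).topologicalClosure = ⊤ := by
    rw [Submodule.topologicalClosure_eq_top_iff, Submodule.eq_bot_iff]
    intro f hf
    rw [Submodule.mem_orthogonal] at hf
    have h0 : ∀ l : Fin 2, ∀ᵐ x, x ∈ Ω → f x l = 0 := by
      intro l
      refine hΩ.ae_eq_zero_of_integral_contDiff_smul_eq_zero (f := fun x => f x l) ?_ ?_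
      · have : LocallyIntegrable (fun x => f x l) (volume.restrict Ω) :=
          ((proj (𝕜 := ℝ) l).comp_memLp' (Lp.memLp f)).locallyIntegrable
            (by norm_num)
        exact (locallyIntegrableOn_of_locallyIntegrable_restrict this)
      · intro ψ h1 h2 h3
        have hL : ∃ K : ℝ≥0, LipschitzWith K ψ :=
          (h1.of_le (by norm_num)).lipschitzWith_of_hasCompactSupport h2 one_ne_zero
        have := hf _ (Submodule.subset_span ⟨l, (⟨ψ, hL, h2, h3⟩ : LipC Ω), rfl⟩)
        rw [hinner l (⟨ψ, hL, h2, h3⟩ : LipC Ω) f] at this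
        rw [← this, ← setIntegral_eq_integral_of_forall_compl_eq_zero (s := Ω)]
        · refine integral_congr_ae (of_forall fun x => ?_)
          exact mul_comm _ _
        · intro x hx
          have : ψ x = 0 := by
            by_contra h; exact hx (h3 (subset_tsupport _ h))
          simp [this]
    rw [Lp.eq_zero_iff_ae_eq_zero]
    have h1 := fun l => (ae_restrict_iff' hΩ.measurableSet).2 (h0 l)
    filter_upwards [h1 0, h1 1] with x h0 h1
    ext i; fin_cases i <;> assumption
  have hspan : ∀ f ∈ Submodule.span ℝ T, Tendsto (fun n => inner ℝ f (g n)) atTop (𝓝 0) := by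
    intro f hf
    induction hf using Submodule.span_induction with
    | mem f hf =>
      obtain ⟨l, φ, rfl⟩ := hf
      simpa only [hinner] using h l φ
    | zero => simp
    | add f f' _ _ h1 h2 => simpa only [inner_add_left, add_zero] using h1.add h2
    | smul a f _ h1 => simpa only [real_inner_smul_left, mul_zero] using h1.const_mul a
  rw [Metric.tendsto_atTop']
  intro η hη
  have hζ : ζ ∈ closure (Submodule.span ℝ T : Set (L2 Ω)) := by
    rw [← Submodule.topologicalClosure_coe, hT]; trivial
  obtain ⟨f, hf, hd⟩ := Metric.mem_closure_iff.1 hζ (η / (2 * (|B| + 1))) (by positivity)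
  have h1 := (Metric.tendsto_nhds.1 (hspan f hf)) (η / 2) (by positivity)
  obtain ⟨N, hN⟩ := (h1.and hB).exists_forall_of_atTop
  refine ⟨N, fun n hn => ?_⟩
  obtain ⟨h1, h2⟩ := hN n hn.le
  rw [dist_zero_right] at h1 ⊢
  have e : inner ℝ ζ (g n) = inner ℝ (ζ - f) (g n) + inner ℝ f (g n) := by
    rw [inner_sub_left]; ring
  have h3 : ‖inner ℝ (ζ - f) (g n)‖ ≤ η / (2 * (|B| + 1)) * (|B| + 1) := by
    refine (norm_inner_le_norm _ _).trans ?_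
    rw [dist_eq_norm] at hd
    exact mul_le_mul hd.le (h2.trans (by linarith [le_abs_self B])) (norm_nonneg _) (by positivity)
  have h4 : η / (2 * (|B| + 1)) * (|B| + 1) = η / 2 := by field_simp
  rw [e]
  exact (norm_add_le _ _).trans_lt (by linarith)

theorem AdmLE.varLE (hΩ : IsOpen Ω) {AF AG : ℝ → PhaseSpace Ω → ℝ → Prop} {δ : ℝ → ℝ}
    {F G : ℝ → PhaseSpace Ω → ℝ≥0∞}
    (hδ : ContinuousOn δ (Set.Ici 0)) (hδ' : StrictMonoOn δ (Set.Ici 0)) (hδ0 : δ 0 = 0)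
    (hF : ∀ ε p (C η : ℝ≥0), F ε p ≤ C → 0 < η → ∃ e, AF ε p e ∧ ofReal e ≤ F ε p + η)
    (hG : ∀ ε p e, AG ε p e → G ε p ≤ ofReal e)
    (h : AdmLE AF AG δ) : VarLE G F := by
  refine ⟨δ, hδ, hδ', hδ0, fun ε hε hε0 p ⟨C, hC⟩ => ?_⟩
  obtain ⟨ρ, B, hρ, h⟩ := h (C + 1)
  have hεt : Tendsto ε atTop (𝓝[>] 0) :=
    tendsto_nhdsWithin_iff.2 ⟨hε0, of_forall hε⟩
  have hη : ∀ n : ℕ, (0 : ℝ≥0) < 1 / (n + 1) := fun n => by positivity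
  choose e he1 he2 using fun n => hF (ε n) (p n) C (1 / (n + 1)) (hC n) (hη n)
  have heC : ∀ n, e n ≤ C + 1 := by
    intro n
    have h1 : ofReal (e n) ≤ ((C + 1 : ℝ≥0) : ℝ≥0∞) := by
      refine (he2 n).trans ?_
      rw [ENNReal.coe_add]
      refine add_le_add (hC n) ?_
      rw [ENNReal.coe_le_coe, div_le_one (by positivity)]
      simp
    have := (ENNReal.ofReal_le_coe).1 h1
    simpa using this
  have key : ∀ n, ∃ q : PhaseSpace Ω,
      (∀ p' e', AF (ε n) p' e' → e' ≤ C + 1 → ∃ q e'', AG (δ (ε n)) q e'' ∧ e'' ≤ e' + ρ (ε n) ∧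
        Close p' q (ρ (ε n)) ∧ ‖p'.field - q.field‖ ≤ B) →
      G (δ (ε n)) q ≤ ofReal (e n + ρ (ε n)) ∧ Close (p n) q (ρ (ε n)) ∧
        ‖(p n).field - q.field‖ ≤ B := by
    intro n
    by_cases hn : ∀ p' e', AF (ε n) p' e' → e' ≤ C + 1 → ∃ q e'', AG (δ (ε n)) q e'' ∧
        e'' ≤ e' + ρ (ε n) ∧ Close p' q (ρ (ε n)) ∧ ‖p'.field - q.field‖ ≤ B
    · obtain ⟨q, e'', h1, h2, h3⟩ := hn (p n) (e n) (he1 n) (heC n)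
      exact ⟨q, fun _ => ⟨(hG _ _ _ h1).trans (ENNReal.ofReal_le_ofReal h2), h3⟩⟩
    · exact ⟨0, fun h => absurd h hn⟩
  choose q hq using key
  have hq' : ∀ᶠ n in atTop, G (δ (ε n)) (q n) ≤ ofReal (e n + ρ (ε n)) ∧
      Close (p n) (q n) (ρ (ε n)) ∧ ‖(p n).field - (q n).field‖ ≤ B := by
    filter_upwards [hεt.eventually h] with n hn
    exact hq n hn
  have hρn : Tendsto (fun n => ρ (ε n)) atTop (𝓝 0) := hρ.comp hεt
  refine ⟨q, ?_, Or.inr ?_⟩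
  · have hs : Tendsto (fun n : ℕ => ((1 / ((n : ℝ) + 1) + |ρ (ε n)| : ℝ) : EReal)) atTop
        (𝓝 ((0 : ℝ) : EReal)) := by
      refine (continuous_coe_real_ereal.tendsto 0).comp ?_
      simpa using tendsto_one_div_add_atTop_nhds_zero_nat.add (hρn.abs)
    have hlim := hs.limsup_eq
    rw [EReal.coe_zero] at hlim
    rw [← hlim]
    refine limsup_le_limsup ?_
    filter_upwards [hq'] with n hn
    have hFt : F (ε n) (p n) ≠ ⊤ := ne_top_of_le_ne_top ENNReal.coe_ne_top (hC n)
    have hG1 : G (δ (ε n)) (q n) ≤ F (ε n) (p n) + ofReal (1 / ((n : ℝ) + 1) + |ρ (ε n)|) := by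
      refine hn.1.trans (ENNReal.ofReal_add_le.trans ?_)
      rw [ENNReal.ofReal_add (by positivity) (by positivity), ← add_assoc]
      refine add_le_add ((he2 n).trans (add_le_add le_rfl ?_))
        (ENNReal.ofReal_le_ofReal (le_abs_self _))
      rw [← ENNReal.ofReal_coe_nnreal]
      simp
    have hG2 : G (δ (ε n)) (q n) ≠ ⊤ :=
      ne_top_of_le_ne_top (ENNReal.add_ne_top.2 ⟨hFt, ENNReal.ofReal_ne_top⟩) hG1
    lift G (δ (ε n)) (q n) to ℝ≥0 using hG2 with a
    lift F (ε n) (p n) to ℝ≥0 using hFt with b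
    have h0 : 0 ≤ 1 / ((n : ℝ) + 1) + |ρ (ε n)| := by positivity
    have h3 : (a : ℝ) ≤ b + (1 / ((n : ℝ) + 1) + |ρ (ε n)|) := by
      have := ENNReal.toReal_mono (by finiteness) hG1
      rwa [ENNReal.toReal_add (by finiteness) (by finiteness), ENNReal.toReal_ofReal h0,
        ENNReal.coe_toReal, ENNReal.coe_toReal] at this
    show ((a : ℝ) : EReal) - ((b : ℝ) : EReal) ≤ _
    rw [← EReal.coe_sub]
    exact EReal.coe_le_coe_iff.2 (by linarith)
  · rw [Prod.tendsto_iff] 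
    constructor
    · show Tendsto (fun n => (p n).1 - (q n).1) atTop (𝓝 0)
      refine squeeze_zero_norm' ?_ (by simpa using hρn.abs)
      filter_upwards [hq'] with n hn
      refine ContinuousLinearMap.opNorm_le_bound _ (abs_nonneg _) fun φ => ?_
      exact (hn.2.1.1 φ).trans (mul_le_mul_of_nonneg_right (le_abs_self _) (norm_nonneg _))
    · show Tendsto (fun n => (p n).2 - (q n).2) atTop (𝓝 0)
      refine (WeakBilin.tendsto_iff_forall_eval_tendsto (topDualPairing ℝ (L2 Ω)).flip (by
          intro x y hxy
          by_contra hne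
          obtain ⟨f, hf⟩ := SeparatingDual.exists_separating_of_ne (R := ℝ) hne
          exact hf (DFunLike.congr_fun hxy f))).2 ?_
      intro f
      obtain ⟨ζ, rfl⟩ := (InnerProductSpace.toDual ℝ (L2 Ω)).surjective f
      have := tendsto_inner_zero hΩ (fun n => (p n).field - (q n).field) B
        (hq'.mono fun n hn => hn.2.2) (fun l φ => ?_) ζ
      · have h0 : (topDualPairing ℝ (L2 Ω)).flip 0 ((InnerProductSpace.toDual ℝ (L2 Ω)) ζ) = 0 := by
          simp
        rw [← h0] at this
        exact this
      · refine squeeze_zero_norm' (a := fun n => |ρ (ε n)| * ‖φ‖) ?_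
          (by simpa using hρn.abs.mul_const ‖φ‖)
        filter_upwards [hq'] with n hn
        have := (hn.2.1.2 l φ).trans (mul_le_mul_of_nonneg_right (le_abs_self _) (norm_nonneg _))
        rw [norm_eq_abs]
        refine le_trans (le_of_eq ?_) this
        congr 1
        refine integral_congr_ae ?_
        filter_upwards [Lp.coeFn_sub (p n).field (q n).field] with x hx
        rw [hx]; rfl

end Abstract

/-! ### Pushing a Lipschitz domain into itself -/

section Push

open Metric

variable {Ω : Set E2}

/-- Near a boundary point of a Lipschitz domain there is a direction that points uniformly inward. -/
theorem HasLipschitzBoundary.exists_inward (hΩ : HasLipschitzBoundary Ω) {x : E2}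
    (hx : x ∈ frontier Ω) :
    ∃ (ν : E2) (r κ : ℝ), ‖ν‖ = 1 ∧ 0 < r ∧ 0 < κ ∧
      (∀ (y : E2) (s : ℝ), 0 ≤ s → y ∈ ball x r → y + s • ν ∈ ball x r → y ∈ Ω → y + s • ν ∈ Ω) ∧
      ∀ (y z : E2) (s : ℝ), y ∈ ball x r → z ∈ ball x r → y ∈ Ω → z ∈ ball (y + s • ν) (κ * s) →
        z ∈ Ω := by
  obtain ⟨A, γ, K, r, hr, hγ, h⟩ := hΩ x hx
  have hA : ∀ (y : E2) (s : ℝ), A (y + s • A.symm (single 1 1)) =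
      A y + s • single 1 1 := by
    intro y s; simp
  refine ⟨A.symm (single 1 1), r, 1 / (1 + K), by simp, hr, by positivity, ?_, ?_⟩
  · intro y s hs hy hy' hyΩ
    rw [h _ hy', hA]
    have := (h y hy).1 hyΩ
    simp only [PiLp.add_apply, PiLp.smul_apply, smul_eq_mul, PiLp.single_apply]
    norm_num
    linarith
  · intro y z s hy hz hyΩ hzy
    rw [h _ hz]
    have h1 := (h y hy).1 hyΩ
    have hd : ∀ i, |(A z) i - (A y + s • single 1 1 : E2) i| < 1 / (1 + K) * s := by
      intro i
      refine lt_of_le_of_lt ?_ hzy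
      rw [dist_eq_norm, ← A.norm_map, map_sub, hA, ← norm_eq_abs]
      exact PiLp.norm_apply_le (A z - (A y + s • single 1 1)) i
    have h0 := hd 0
    have h2 := hd 1
    simp only [PiLp.add_apply, PiLp.smul_apply, smul_eq_mul, PiLp.single_apply] at h0 h2
    norm_num at h0 h2
    have h3 := hγ.dist_le_mul ((A z) 0) ((A y) 0)
    rw [Real.dist_eq, Real.dist_eq] at h3
    have h4 : (1 + (K : ℝ))⁻¹ * s + K * ((1 + (K : ℝ))⁻¹ * s) = s := by
      have : (1 + (K : ℝ)) ≠ 0 := by positivity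
      field_simp
    have h5 : (K : ℝ) * |(A z) 0 - (A y) 0| ≤ K * ((1 + (K : ℝ))⁻¹ * s) :=
      mul_le_mul_of_nonneg_left h0.le K.2
    have h6 := abs_lt.1 h2
    have h7 := abs_le.1 (h3.trans h5)
    linarith [h6.1, h7.2]

/-- A map that is `C¹` and close to the identity, up to an error `C t`. -/
structure NearId (Φ : E2 → E2) (τ : ℝ) : Prop where
  contDiff : ContDiff ℝ 1 Φ
  norm_sub_le : ∀ x, ‖Φ x - x‖ ≤ τ
  norm_fderiv_le : ∀ x, ‖fderiv ℝ Φ x - ContinuousLinearMap.id ℝ E2‖ ≤ τ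

theorem NearId.mono {Φ : E2 → E2} {τ τ' : ℝ} (h : NearId Φ τ) (hτ : τ ≤ τ') : NearId Φ τ' :=
  ⟨h.1, fun x => (h.2 x).trans hτ, fun x => (h.3 x).trans hτ⟩

theorem NearId.comp {Φ Ψ : E2 → E2} {τ σ : ℝ} (h : NearId Φ τ) (k : NearId Ψ σ) (hτ : τ ≤ 1) :
    NearId (Ψ ∘ Φ) (2 * σ + τ) := by
  have hσ0 : 0 ≤ σ := (norm_nonneg _).trans (k.2 0)
  refine ⟨k.1.comp h.1, fun x => ?_, fun x => ?_⟩
  · calc ‖Ψ (Φ x) - x‖ = ‖(Ψ (Φ x) - Φ x) + (Φ x - x)‖ := by congr 1; abel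
      _ ≤ σ + τ := (norm_add_le _ _).trans (add_le_add (k.2 _) (h.2 _))
      _ ≤ _ := by linarith
  · rw [fderiv_comp x (k.1.differentiable one_ne_zero _) (h.1.differentiable one_ne_zero _)]
    set A := fderiv ℝ Ψ (Φ x)
    set B := fderiv ℝ Φ x
    have hB : ‖B‖ ≤ 2 := by
      calc ‖B‖ = ‖(B - ContinuousLinearMap.id ℝ E2) + ContinuousLinearMap.id ℝ E2‖ := by
            congr 1; abel
        _ ≤ 1 + 1 := (norm_add_le _ _).trans
            (add_le_add ((h.3 x).trans hτ) ContinuousLinearMap.norm_id_le)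
        _ = 2 := by norm_num
    have e : A.comp B - ContinuousLinearMap.id ℝ E2 =
        (A - ContinuousLinearMap.id ℝ E2).comp B + (B - ContinuousLinearMap.id ℝ E2) := by
      ext v; simp
    rw [e]
    refine (norm_add_le _ _).trans (add_le_add ?_ (h.3 x))
    refine (ContinuousLinearMap.opNorm_comp_le _ _).trans ?_
    rw [mul_comm]
    exact mul_le_mul hB (k.3 _) (norm_nonneg _) (by norm_num)

/-- Pushing inward in one boundary chart. -/
theorem HasLipschitzBoundary.exists_local_push (hΩ : HasLipschitzBoundary Ω) {x : E2}
    (hx : x ∈ frontier Ω) :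
    ∃ (r c C t₀ : ℝ), 0 < r ∧ 0 < c ∧ 0 < C ∧ 0 < t₀ ∧ ∀ t, 0 < t → t ≤ t₀ → ∃ Φ : E2 → E2,
      NearId Φ (C * t) ∧
      (∀ y ∈ Ω, Φ y ∈ Ω) ∧
      (∀ (y : E2) (ρ : ℝ), ρ ≤ c → ball y ρ ⊆ Ω → ball (Φ y) ρ ⊆ Ω) ∧
      ∀ y ∈ Ω, y ∈ ball x r → ball (Φ y) (c * t) ⊆ Ω := by
  obtain ⟨ν, r, κ, hν, hr, hκ, h1, h2⟩ := hΩ.exists_inward hx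
  let χ : ContDiffBump x := ⟨r / 4, r / 2, by linarith, by linarith⟩
  have hχ : ContDiff ℝ 1 (χ : E2 → ℝ) := χ.contDiff
  obtain ⟨M, hM⟩ := (hχ.continuous_fderiv one_ne_zero).bounded_above_of_compact_support
    (χ.hasCompactSupport.fderiv ℝ)
  have hM0 : 0 ≤ M := (norm_nonneg _).trans (hM 0)
  have hχzero : ∀ y, y ∉ ball x (r / 2) → χ y = 0 := by
    intro y hy
    exact χ.zero_of_le_dist (by simpa using hy)
  refine ⟨r / 4, min (r / 8) (min κ 1), M + 1, r / 8, by linarith, by positivity, by positivity,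
    by positivity, fun t ht ht0 => ⟨fun y => y + (t * χ y) • ν, ⟨?_, ?_, ?_⟩, ?_, ?_, ?_⟩⟩
  · exact contDiff_id.add ((contDiff_const.mul hχ).smul contDiff_const)
  · intro y
    simp only [add_sub_cancel_left, norm_smul, hν, mul_one, norm_mul, norm_eq_abs,
      abs_of_pos ht, abs_of_nonneg χ.nonneg]
    nlinarith [χ.le_one (x := y)]
  · intro y
    have hd : HasFDerivAt (fun y => y + (t * χ y) • ν)
        (ContinuousLinearMap.id ℝ E2 + (t • fderiv ℝ χ y).smulRight ν) y :=
      (hasFDerivAt_id y).add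
        (((hχ.differentiable one_ne_zero y).hasFDerivAt.const_mul t).smul_const ν)
    rw [hd.fderiv, add_sub_cancel_left, ContinuousLinearMap.norm_smulRight_apply, hν, mul_one,
      norm_smul, norm_eq_abs, abs_of_pos ht]
    nlinarith [hM y]
  · intro y hy
    by_cases hyr : y ∈ ball x (r / 2)
    · refine h1 y _ (mul_nonneg ht.le χ.nonneg) (ball_subset_ball (by linarith) hyr) ?_ hy
      rw [mem_ball, dist_eq_norm] at hyr ⊢
      calc ‖y + (t * χ y) • ν - x‖ = ‖(y - x) + (t * χ y) • ν‖ := by congr 1; abel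
        _ ≤ ‖y - x‖ + ‖(t * χ y) • ν‖ := norm_add_le _ _
        _ ≤ ‖y - x‖ + t := by
            rw [norm_smul, hν, mul_one, norm_eq_abs, abs_of_nonneg (mul_nonneg ht.le χ.nonneg)]
            nlinarith [χ.le_one (x := y)]
        _ < r := by linarith
    · simpa [hχzero y hyr] using hy
  · intro y ρ hρ hyρ
    by_cases hyr : y ∈ ball x (r / 2)
    · intro z hz
      have hρ8 : ρ ≤ r / 8 := hρ.trans (min_le_left _ _)
      have hs : t * χ y ≤ t := by nlinarith [χ.le_one (x := y)]
      have hs0 : 0 ≤ t * χ y := mul_nonneg ht.le χ.nonneg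
      set s := t * χ y
      have hz1 : z - s • ν ∈ ball y ρ := by
        rw [mem_ball, dist_eq_norm] at hz ⊢
        rwa [show z - s • ν - y = z - (y + s • ν) by abel]
      rw [mem_ball, dist_eq_norm] at hyr
      have hz2 : ‖z - s • ν - x‖ < r / 2 + r / 8 := by
        rw [mem_ball, dist_eq_norm] at hz1
        calc ‖z - s • ν - x‖ = ‖(z - s • ν - y) + (y - x)‖ := by congr 1; abel
          _ ≤ _ := norm_add_le _ _
          _ < _ := by linarith
      have hz3 : ‖z - x‖ < r := by
        calc ‖z - x‖ = ‖(z - s • ν - x) + s • ν‖ := by congr 1; abel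
          _ ≤ ‖z - s • ν - x‖ + s := (norm_add_le _ _).trans (by
              rw [norm_smul, hν, mul_one, norm_eq_abs, abs_of_nonneg hs0])
          _ < _ := by linarith
      have := h1 (z - s • ν) s hs0 (by rw [mem_ball, dist_eq_norm]; linarith)
        (by rw [sub_add_cancel, mem_ball, dist_eq_norm]; exact hz3) (hyρ hz1)
      rwa [sub_add_cancel] at this
    · simpa [hχzero y hyr] using hyρ
  · intro y hy hyr z hz
    have hχ1 : χ y = 1 := χ.one_of_mem_closedBall (ball_subset_closedBall hyr)
    simp only [hχ1, mul_one] at hz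
    rw [mem_ball, dist_eq_norm] at hyr
    refine h2 y z t ?_ ?_ hy ?_
    · rw [mem_ball, dist_eq_norm]; linarith
    · rw [mem_ball, dist_eq_norm] at hz ⊢
      have : min (r / 8) (min κ 1) * t ≤ t := by
        have : min (r / 8) (min κ 1) ≤ 1 := (min_le_right _ _).trans (min_le_right _ _)
        nlinarith
      calc ‖z - x‖ = ‖(z - (y + t • ν)) + (y - x) + t • ν‖ := by congr 1; abel
        _ ≤ ‖(z - (y + t • ν))‖ + ‖y - x‖ + ‖t • ν‖ := norm_add₃_le
        _ < r := by
          rw [norm_smul, hν, mul_one, norm_eq_abs, abs_of_pos ht]; linarith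
    · refine ball_subset_ball (mul_le_mul_of_nonneg_right ?_ ht.le) hz
      exact (min_le_right _ _).trans (min_le_left _ _)

/-- A bounded Lipschitz domain is mapped into itself, uniformly away from its boundary, by maps
that are close to the identity. -/
theorem HasLipschitzBoundary.exists_push (hΩ : HasLipschitzBoundary Ω) (ho : IsOpen Ω)
    (hb : IsBounded Ω) :
    ∃ (c C t₀ : ℝ), 0 < c ∧ 0 < C ∧ 0 < t₀ ∧ ∀ t, 0 < t → t ≤ t₀ → ∃ Φ : E2 → E2,
      NearId Φ (C * t) ∧ ∀ y ∈ Ω, ball (Φ y) (c * t) ⊆ Ω := by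
  choose! r c C t₀ hr hc hC ht₀ H using
    fun (x : E2) (hx : x ∈ frontier Ω) => hΩ.exists_local_push hx
  have hfc : IsCompact (frontier Ω) :=
    hb.isCompact_closure.of_isClosed_subset isClosed_frontier frontier_subset_closure
  obtain ⟨s, hs, hcov⟩ := hfc.elim_nhds_subcover (fun x => ball x (r x / 2))
    (fun x hx => ball_mem_nhds x (half_pos (hr x hx)))
  have key : ∀ s : Finset E2, (∀ x ∈ s, x ∈ frontier Ω) →
      ∃ (c' C' t' : ℝ), 0 < c' ∧ 0 < C' ∧ 0 < t' ∧ ∀ t, 0 < t → t ≤ t' → ∃ Φ : E2 → E2,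
        NearId Φ (C' * t) ∧ (∀ y ∈ Ω, Φ y ∈ Ω) ∧
        (∀ (y : E2) (ρ : ℝ), ρ ≤ c' → ball y ρ ⊆ Ω → ball (Φ y) ρ ⊆ Ω) ∧
        ∀ y ∈ Ω, y ∈ ⋃ x ∈ s, ball x (r x / 2) → ball (Φ y) (c' * t) ⊆ Ω := by
    intro s
    induction s using Finset.induction_on with
    | empty =>
      intro _
      refine ⟨1, 1, 1, one_pos, one_pos, one_pos, fun t ht _ => ⟨id, ⟨contDiff_id, fun x => ?_,
        fun x => ?_⟩, fun y hy => hy, fun y ρ _ h => h, fun y _ h => ?_⟩⟩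
      · simp [ht.le]
      · simp [ht.le]
      · simp at h
    | insert a s ha ih =>
      intro hs
      obtain ⟨c', C', t', hc', hC', ht', ih⟩ := ih fun x hx => hs x (Finset.mem_insert_of_mem hx)
      have haf := hs a (Finset.mem_insert_self a s)
      have := hr a haf; have := hc a haf; have := hC a haf; have := ht₀ a haf
      refine ⟨min c' (c a), 2 * C a + C', min (min t' (t₀ a)) (min (1 / C') (min (r a / (2 * C')) 1)),
        by positivity, by positivity, by positivity, fun t ht htt => ?_⟩
      simp only [le_min_iff] at htt
      obtain ⟨⟨ht1, ht2⟩, ht3, ht4, ht5⟩ := htt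
      obtain ⟨Φ, hΦ, hΦ1, hΦ2, hΦ3⟩ := ih t ht ht1
      obtain ⟨Ψ, hΨ, hΨ1, hΨ2, hΨ3⟩ := H a haf t ht ht2
      rw [le_div_iff₀ (by positivity)] at ht3 ht4
      refine ⟨Ψ ∘ Φ, (hΦ.comp hΨ (by linarith)).mono (by linarith), fun y hy => hΨ1 _ (hΦ1 y hy),
        fun y ρ hρ hy => hΨ2 _ ρ (hρ.trans (min_le_right _ _))
          (hΦ2 y ρ (hρ.trans (min_le_left _ _)) hy), fun y hy hys => ?_⟩
      rw [Finset.set_biUnion_insert] at hys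
      rcases hys with hys | hys
      · refine (ball_subset_ball ?_).trans (hΨ3 (Φ y) (hΦ1 y hy) ?_)
        · exact mul_le_mul_of_nonneg_right (min_le_right _ _) ht.le
        · rw [mem_ball, dist_eq_norm] at hys ⊢
          calc ‖Φ y - a‖ = ‖(Φ y - y) + (y - a)‖ := by congr 1; abel
            _ ≤ ‖Φ y - y‖ + ‖y - a‖ := norm_add_le _ _
            _ < r a := by linarith [hΦ.2 y]
      · refine hΨ2 _ _ ?_ ((ball_subset_ball ?_).trans (hΦ3 y hy hys))
        · have : min c' (c a) ≤ c a := min_le_right _ _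
          have : 0 < min c' (c a) := by positivity
          nlinarith
        · exact mul_le_mul_of_nonneg_right (min_le_left _ _) ht.le
  obtain ⟨c', C', t', hc', hC', ht', H'⟩ := key s hs
  have hK : IsCompact (closure Ω \ ⋃ x ∈ s, ball x (r x / 2)) :=
    hb.isCompact_closure.diff (isOpen_biUnion fun x _ => isOpen_ball)
  have hKΩ : closure Ω \ ⋃ x ∈ s, ball x (r x / 2) ⊆ Ω := by
    intro y hy
    by_contra hyΩ
    exact hy.2 (hcov ⟨hy.1, by rwa [ho.interior_eq]⟩)
  obtain ⟨δ, hδ, hKδ⟩ := hK.exists_thickening_subset_open ho hKΩ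
  refine ⟨min c' δ, C', min t' 1, by positivity, hC', by positivity, fun t ht htt => ?_⟩
  obtain ⟨Φ, h1, h2, h3, h4⟩ := H' t ht (htt.trans (min_le_left _ _))
  refine ⟨Φ, h1, fun y hy => ?_⟩
  have ht1 : t ≤ 1 := htt.trans (min_le_right _ _)
  have hm : 0 < min c' δ := by positivity
  by_cases hys : y ∈ ⋃ x ∈ s, ball x (r x / 2)
  · exact (ball_subset_ball (mul_le_mul_of_nonneg_right (min_le_left _ _) ht.le)).trans (h4 y hy hys)
  · refine h3 y _ ?_ ?_
    · nlinarith [min_le_left c' δ]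
    · refine (ball_subset_ball ?_).trans
        ((ball_subset_thickening (show y ∈ closure Ω \ ⋃ x ∈ s, ball x (r x / 2) from
          ⟨subset_closure hy, hys⟩) δ).trans hKδ)
      nlinarith [min_le_right c' δ]

end Push

/-! ### Partial derivatives, Jacobians and currents of maps of the plane -/

section Maps

/-- Cross product of two vectors of the plane. -/
def crs (a b : E2) : ℝ := a 0 * b 1 - a 1 * b 0

/-- The partial derivative `∂_l V`. -/
def pd (l : Fin 2) (V : E2 → E2) (x : E2) : E2 := fderiv ℝ V x (single l 1)

/-- The Jacobian `det ∇V`. -/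
def mjac (V : E2 → E2) (x : E2) : ℝ := crs (pd 0 V x) (pd 1 V x)

/-- The `l`-th component `V × ∂_l V` of the current of `V`. -/
def mcur (l : Fin 2) (V : E2 → E2) (x : E2) : ℝ := crs (V x) (pd l V x)

/-- The density `|∇V|²`. -/
def dens (V : E2 → E2) (x : E2) : ℝ := ‖pd 0 V x‖ ^ 2 + ‖pd 1 V x‖ ^ 2

theorem norm_sq_eq (a : E2) : ‖a‖ ^ 2 = a 0 ^ 2 + a 1 ^ 2 := by
  rw [EuclideanSpace.norm_sq_eq]; simp

theorem abs_apply_le (a : E2) (i : Fin 2) : |a i| ≤ ‖a‖ := PiLp.norm_apply_le a i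

theorem abs_crs_le (a b : E2) : |crs a b| ≤ ‖a‖ * ‖b‖ := by
  refine abs_le_of_sq_le_sq ?_ (by positivity)
  rw [mul_pow, norm_sq_eq, norm_sq_eq, crs]
  nlinarith [sq_nonneg (a 0 * b 0 + a 1 * b 1)]

theorem crs_add_right (a b c : E2) : crs a (b + c) = crs a b + crs a c := by
  simp [crs]; ring

theorem crs_smul_right (a b : E2) (c : ℝ) : crs a (c • b) = c * crs a b := by
  simp [crs]; ring

theorem crs_smul_left (a b : E2) (c : ℝ) : crs (c • a) b = c * crs a b := by
  simp [crs]; ring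

theorem crs_sub_right (a b c : E2) : crs a (b - c) = crs a b - crs a c := by
  simp [crs]; ring

theorem crs_self (a : E2) : crs a a = 0 := by simp [crs]; ring

theorem dens_nonneg (V : E2 → E2) (x : E2) : 0 ≤ dens V x := by unfold dens; positivity

theorem abs_mjac_le (V : E2 → E2) (x : E2) : |mjac V x| ≤ 1 / 2 * dens V x := by
  refine (abs_crs_le _ _).trans ?_
  unfold dens
  nlinarith [sq_nonneg (‖pd 0 V x‖ - ‖pd 1 V x‖)]

theorem eq_sum_single (v : E2) :
    v = v 0 • single 0 1 + v 1 • single 1 1 := by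
  ext i; fin_cases i <;> simp

theorem map_eq_pd (V : E2 → E2) (x v : E2) :
    fderiv ℝ V x v = v 0 • pd 0 V x + v 1 • pd 1 V x := by
  conv_lhs => rw [eq_sum_single v]
  rw [map_add, map_smul, map_smul]; rfl

theorem det_eq (L : E2 →L[ℝ] E2) :
    L.det = crs (L (single 0 1)) (L (single 1 1)) := by
  rw [ContinuousLinearMap.det, ← LinearMap.det_toMatrix (EuclideanSpace.basisFun (Fin 2) ℝ).toBasis,
    Matrix.det_fin_two]
  simp [LinearMap.toMatrix_apply, crs]
  ring

variable {V : E2 → E2} {Φ : E2 → E2}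

theorem pd_comp {x : E2} (hV : DifferentiableAt ℝ V (Φ x)) (hΦ : DifferentiableAt ℝ Φ x)
    (l : Fin 2) : pd l (V ∘ Φ) x = pd l Φ x 0 • pd 0 V (Φ x) + pd l Φ x 1 • pd 1 V (Φ x) := by
  rw [pd, fderiv_comp x hV hΦ, ContinuousLinearMap.comp_apply, map_eq_pd]; rfl

theorem mjac_comp {x : E2} (hV : DifferentiableAt ℝ V (Φ x)) (hΦ : DifferentiableAt ℝ Φ x) :
    mjac (V ∘ Φ) x = mjac V (Φ x) * (fderiv ℝ Φ x).det := by
  rw [mjac, pd_comp hV hΦ, pd_comp hV hΦ, det_eq, mjac]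
  simp only [crs, pd, PiLp.add_apply, PiLp.smul_apply, smul_eq_mul]; ring

theorem mcur_comp {x : E2} (hV : DifferentiableAt ℝ V (Φ x)) (hΦ : DifferentiableAt ℝ Φ x)
    (l : Fin 2) :
    mcur l (V ∘ Φ) x = mcur 0 V (Φ x) * pd l Φ x 0 + mcur 1 V (Φ x) * pd l Φ x 1 := by
  rw [mcur, pd_comp hV hΦ, crs_add_right, crs_smul_right, crs_smul_right, mcur, mcur]
  simp only [Function.comp]; ring

namespace NearId

variable {τ : ℝ}

theorem nonneg (h : NearId Φ τ) : 0 ≤ τ := (norm_nonneg _).trans (h.2 0)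

theorem differentiable (h : NearId Φ τ) : Differentiable ℝ Φ := h.1.differentiable one_ne_zero

theorem pd_sub_le (h : NearId Φ τ) (l i : Fin 2) (x : E2) :
    |pd l Φ x i - (if i = l then 1 else 0)| ≤ τ := by
  have := (abs_apply_le _ i).trans
    (((fderiv ℝ Φ x - ContinuousLinearMap.id ℝ E2).le_opNorm (single l 1)).trans
      (mul_le_mul_of_nonneg_right (h.3 x) (norm_nonneg _)))
  simpa [PiLp.single_apply, pd] using this

theorem abs_det_sub_one_le (h : NearId Φ τ) (hτ : τ ≤ 1 / 2) (x : E2) :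
    |(fderiv ℝ Φ x).det - 1| ≤ 3 * τ := by
  have h00 := h.pd_sub_le 0 0 x
  have h01 := h.pd_sub_le 0 1 x
  have h10 := h.pd_sub_le 1 0 x
  have h11 := h.pd_sub_le 1 1 x
  simp only [if_true, one_ne_zero, zero_ne_one, if_false, sub_zero] at h00 h01 h10 h11
  have h0 := h.nonneg
  rw [det_eq]
  change |crs (pd 0 Φ x) (pd 1 Φ x) - 1| ≤ _
  have e : crs (pd 0 Φ x) (pd 1 Φ x) - 1 = (pd 0 Φ x 0 - 1) + (pd 1 Φ x 1 - 1) +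
      ((pd 0 Φ x 0 - 1) * (pd 1 Φ x 1 - 1) - pd 0 Φ x 1 * pd 1 Φ x 0) := by
    simp only [crs]; ring
  rw [e]
  have m1 : |(pd 0 Φ x 0 - 1) * (pd 1 Φ x 1 - 1)| ≤ τ * τ := by
    rw [abs_mul]; exact mul_le_mul h00 h11 (abs_nonneg _) h0
  have m2 : |pd 0 Φ x 1 * pd 1 Φ x 0| ≤ τ * τ := by
    rw [abs_mul]; exact mul_le_mul h01 h10 (abs_nonneg _) h0
  rw [abs_le] at *
  constructor <;> nlinarith [m1.1, m1.2, m2.1, m2.2, h00.1, h00.2, h11.1, h11.2]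

theorem approximates (h : NearId Φ τ) :
    ApproximatesLinearOn Φ ((ContinuousLinearEquiv.refl ℝ E2 : E2 ≃L[ℝ] E2) : E2 →L[ℝ] E2)
      Set.univ τ.toNNReal := by
  refine fun x _ y _ => ?_
  have := convex_univ.norm_image_sub_le_of_norm_hasFDerivWithin_le
    (f := fun x => Φ x - x) (f' := fun x => fderiv ℝ Φ x - ContinuousLinearMap.id ℝ E2) (C := τ)
    (fun z _ => ((h.differentiable z).hasFDerivAt.sub (hasFDerivAt_id z)).hasFDerivWithinAt)
    (fun z _ => h.3 z) (mem_univ y) (mem_univ x)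
  rw [Real.coe_toNNReal _ h.nonneg]
  refine le_trans (le_of_eq ?_) this
  congr 1
  simp only [ContinuousLinearEquiv.coe_coe, ContinuousLinearEquiv.refl_apply]
  abel

theorem lt_inv (h : NearId Φ τ) (hτ : τ ≤ 1 / 2) : Subsingleton E2 ∨ τ.toNNReal <
    ‖((ContinuousLinearEquiv.refl ℝ E2).symm : E2 →L[ℝ] E2)‖₊⁻¹ := by
  right
  have : ‖((ContinuousLinearEquiv.refl ℝ E2).symm : E2 →L[ℝ] E2)‖₊ = 1 := by
    rw [ContinuousLinearEquiv.refl_symm]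
    exact NNReal.coe_injective ContinuousLinearMap.norm_id
  rw [this, inv_one, ← NNReal.coe_lt_coe, Real.coe_toNNReal _ h.nonneg, NNReal.coe_one]
  linarith

theorem injective (h : NearId Φ τ) (hτ : τ ≤ 1 / 2) : Function.Injective Φ :=
  Set.injOn_univ.1 (h.approximates.injOn (h.lt_inv hτ))

theorem range_eq (h : NearId Φ τ) (hτ : τ ≤ 1 / 2) : Φ '' Set.univ = Set.univ := by
  rw [Set.image_univ]
  exact (h.approximates.surjective (h.lt_inv hτ)).range_eq

theorem dist_le (h : NearId Φ τ) (hτ : τ ≤ 1 / 2) (x y : E2) :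
    dist (Φ x) (Φ y) ≤ 2 * dist x y := by
  have := h.approximates x (mem_univ x) y (mem_univ y)
  simp only [ContinuousLinearEquiv.coe_coe, ContinuousLinearEquiv.refl_apply] at this
  rw [Real.coe_toNNReal _ h.nonneg] at this
  rw [dist_eq_norm, dist_eq_norm]
  calc ‖Φ x - Φ y‖ = ‖(Φ x - Φ y - (x - y)) + (x - y)‖ := by congr 1; abel
    _ ≤ τ * ‖x - y‖ + ‖x - y‖ := (norm_add_le _ _).trans (by linarith)
    _ ≤ _ := by nlinarith [norm_nonneg (x - y)]

theorem integral_eq (h : NearId Φ τ) (hτ : τ ≤ 1 / 4) (g : E2 → ℝ) :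
    ∫ x, g x = ∫ x, |(fderiv ℝ Φ x).det| * g (Φ x) := by
  have := integral_image_eq_integral_abs_det_fderiv_smul volume MeasurableSet.univ
    (fun x _ => (h.differentiable x).hasFDerivAt.hasFDerivWithinAt)
    ((h.injective (by linarith)).injOn) g
  rw [h.range_eq (by linarith)] at this
  simpa using this

theorem det_pos (h : NearId Φ τ) (hτ : τ ≤ 1 / 4) (x : E2) : 1 / 4 ≤ (fderiv ℝ Φ x).det := by
  have := abs_le.1 (h.abs_det_sub_one_le (by linarith) x)
  linarith [this.1]

theorem continuous_det (h : NearId Φ τ) : Continuous fun x => (fderiv ℝ Φ x).det :=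
  ContinuousLinearMap.continuous_det.comp (h.1.continuous_fderiv one_ne_zero)

theorem integrable_comp (h : NearId Φ τ) (hτ : τ ≤ 1 / 4) {g : E2 → ℝ} (hg : Integrable g) :
    Integrable fun x => g (Φ x) := by
  have := integrableOn_image_iff_integrableOn_abs_det_fderiv_smul volume MeasurableSet.univ
    (fun x _ => (h.differentiable x).hasFDerivAt.hasFDerivWithinAt)
    ((h.injective (by linarith)).injOn) g
  rw [h.range_eq (by linarith), integrableOn_univ, integrableOn_univ] at this
  have h2 := this.1 hg
  have h3 := h2.bdd_mul (f := fun x => |(fderiv ℝ Φ x).det|⁻¹) (c := 4)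
    ((h.continuous_det.abs.inv₀ fun x => by
      have := h.det_pos hτ x
      rw [abs_of_pos (by linarith)]; linarith).aestronglyMeasurable)
    (of_forall fun x => by
      have := h.det_pos hτ x
      rw [norm_inv, norm_eq_abs, abs_abs, abs_of_pos (by linarith)]
      exact inv_le_of_inv_le₀ (by norm_num) (by linarith))
  refine h3.congr (of_forall fun x => ?_)
  have := h.det_pos hτ x
  have h4 : |(fderiv ℝ Φ x).det| ≠ 0 := by rw [abs_of_pos (by linarith)]; linarith
  simp [h4]

/-- Change of variables as an inequality. -/
theorem integral_comp_le (h : NearId Φ τ) (hτ : τ ≤ 1 / 8) {g : E2 → ℝ} (hg : Integrable g)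
    (h0 : ∀ x, 0 ≤ g x) : ∫ x, g (Φ x) ≤ (1 + 6 * τ) * ∫ x, g x := by
  have hn := h.nonneg
  rw [h.integral_eq (by linarith) g, ← integral_const_mul]
  have hi := h.integrable_comp (by linarith) hg
  refine integral_mono hi ?_ fun x => ?_
  · refine Integrable.const_mul ?_ _
    have := integrableOn_image_iff_integrableOn_abs_det_fderiv_smul volume MeasurableSet.univ
      (fun x _ => (h.differentiable x).hasFDerivAt.hasFDerivWithinAt)
      ((h.injective (by linarith)).injOn) g
    rw [h.range_eq (by linarith), integrableOn_univ, integrableOn_univ] at this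
    exact this.1 hg
  · have h1 := abs_le.1 (h.abs_det_sub_one_le (by linarith) x)
    have h2 : 1 ≤ (1 + 6 * τ) * |(fderiv ℝ Φ x).det| := by
      rw [abs_of_pos (by linarith [h1.1])]
      nlinarith [h1.1]
    show g (Φ x) ≤ (1 + 6 * τ) * (|(fderiv ℝ Φ x).det| * g (Φ x))
    nlinarith [h0 (Φ x)]

theorem setIntegral_comp_le (h : NearId Φ τ) (hτ : τ ≤ 1 / 8) {g : E2 → ℝ} {D U : Set E2}
    (hD : MeasurableSet D) (hU : MeasurableSet U)
    (hg : IntegrableOn g U) (h0 : ∀ x ∈ U, 0 ≤ g x) (hDU : ∀ x ∈ D, Φ x ∈ U) :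
    ∫ x in D, g (Φ x) ≤ (1 + 6 * τ) * ∫ x in U, g x := by
  have hg' : Integrable (U.indicator g) := (integrable_indicator_iff hU).2 hg
  have h0' : ∀ x, 0 ≤ U.indicator g x := Set.indicator_nonneg h0
  rw [← integral_indicator hU]
  refine le_trans ?_ (h.integral_comp_le hτ hg' h0')
  have hc := h.integrable_comp (by linarith) hg'
  calc ∫ x in D, g (Φ x) = ∫ x in D, U.indicator g (Φ x) :=
        setIntegral_congr_fun hD fun x hx => (indicator_of_mem (hDU x hx) g).symm
    _ ≤ _ := setIntegral_le_integral hc (of_forall fun x => h0' _)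

theorem ae_comp (h : NearId Φ τ) (hτ : τ ≤ 1 / 4) {p : E2 → Prop} (hp : ∀ᵐ x, p x) :
    ∀ᵐ x, p (Φ x) := by
  rw [ae_iff] at hp ⊢
  set N := toMeasurable volume {x | ¬ p x}
  have hN : volume N = 0 := (measure_toMeasurable _).trans hp
  have hm : MeasurableSet (Φ ⁻¹' N) :=
    h.1.continuous.measurable (measurableSet_toMeasurable _ _)
  refine measure_mono_null (t := Φ ⁻¹' N) (fun x hx => subset_toMeasurable _ _ hx) ?_
  have := lintegral_abs_det_fderiv_eq_addHaar_image volume hm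
    (fun x _ => (h.differentiable x).hasFDerivAt.hasFDerivWithinAt)
    ((h.injective (by linarith)).injOn)
  rw [measure_mono_null (Set.image_preimage_subset _ _) hN] at this
  rw [setLIntegral_eq_zero_iff hm (by
    exact (h.continuous_det.abs.measurable.ennreal_ofReal))] at this
  by_contra hne
  have hx : ∀ᵐ x ∂volume, x ∉ Φ ⁻¹' N := by
    filter_upwards [this] with x hx hxm
    have h1 := hx hxm
    rw [ENNReal.ofReal_eq_zero] at h1
    have := h.det_pos hτ x
    rw [abs_of_pos (by linarith)] at h1
    linarith
  exact hne (by rw [ae_iff] at hx; simp only [not_not] at hx; exact hx)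

/-- Composition with a map close to the identity is close to the identity when tested with Lipschitz
functions. -/
theorem abs_integral_comp_sub_le (h : NearId Φ τ) (hτ : τ ≤ 1 / 8) {Ω : Set E2} (φ : LipC Ω)
    {g : E2 → ℝ} (hg : Integrable g) {a : E2 → ℝ} (ha : Continuous a) {a₀ : ℝ} (ha₀ : |a₀| ≤ 1)
    (haτ : ∀ x, |a x - a₀| ≤ 3 * τ) :
    |(∫ x, g (Φ x) * a x * φ x) - a₀ * ∫ x, g x * φ x| ≤ 13 * τ * ‖φ‖ * ∫ x, |g x| := by
  have hn := h.nonneg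
  have hab : ∀ x, |a x| ≤ 2 := fun x => by
    have h1 := abs_le.1 (haτ x); have h2 := abs_le.1 ha₀
    rw [abs_le]; constructor <;> linarith [h1.1, h1.2, h2.1, h2.2]
  have hφ := φ.continuous
  have hdet := h.continuous_det
  have hgc := h.integrable_comp (by linarith) hg
  have i1 : Integrable fun x => g (Φ x) * a x * φ x := by
    have := hgc.mul_bdd (g := fun x => a x * φ x) (c := 2 * ‖φ‖)
      (ha.mul hφ).aestronglyMeasurable (of_forall fun x => by
        rw [norm_mul]; exact mul_le_mul (hab x) (φ.abs_le x) (abs_nonneg _) (by norm_num))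
    simpa only [mul_assoc] using this
  have hb : ∀ x, ‖|(fderiv ℝ Φ x).det| * φ (Φ x)‖ ≤ 2 * ‖φ‖ := fun x => by
    rw [norm_mul, norm_eq_abs, abs_abs]
    refine mul_le_mul ?_ (φ.abs_le _) (abs_nonneg _) (by norm_num)
    have h1 := abs_le.1 (h.abs_det_sub_one_le (by linarith) x)
    rw [abs_le]; constructor <;> linarith [h1.1, h1.2]
  have i2 : Integrable fun x => g (Φ x) * (|(fderiv ℝ Φ x).det| * φ (Φ x)) :=
    hgc.mul_bdd (c := 2 * ‖φ‖)
      (hdet.abs.mul (hφ.comp h.1.continuous)).aestronglyMeasurable (of_forall hb)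
  rw [h.integral_eq (by linarith) fun x => g x * φ x, ← integral_const_mul]
  have e : ∀ x, a₀ * (|(fderiv ℝ Φ x).det| * (g (Φ x) * φ (Φ x))) =
      a₀ * (g (Φ x) * (|(fderiv ℝ Φ x).det| * φ (Φ x))) := fun x => by ring
  simp_rw [e]
  rw [← integral_sub i1 (i2.const_mul _)]
  have hle : ∀ x, |g (Φ x) * a x * φ x - a₀ * (g (Φ x) * (|(fderiv ℝ Φ x).det| * φ (Φ x)))| ≤
      7 * τ * ‖φ‖ * |g (Φ x)| := by
    intro x
    have h1 := h.abs_det_sub_one_le (by linarith) x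
    have hd0 : 0 < (fderiv ℝ Φ x).det := by linarith [h.det_pos (by linarith) x]
    rw [abs_of_pos hd0]
    have e : g (Φ x) * a x * φ x - a₀ * (g (Φ x) * ((fderiv ℝ Φ x).det * φ (Φ x))) =
        g (Φ x) * ((a x - a₀) * φ x + a₀ * (φ x - φ (Φ x)) -
          a₀ * (((fderiv ℝ Φ x).det - 1) * φ (Φ x))) := by ring
    rw [e, abs_mul, mul_comm]
    refine mul_le_mul_of_nonneg_right ?_ (abs_nonneg _)
    have b1 : |(a x - a₀) * φ x| ≤ 3 * τ * ‖φ‖ := by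
      rw [abs_mul]; exact mul_le_mul (haτ x) (φ.abs_le x) (abs_nonneg _) (by linarith)
    have b2 : |a₀ * (φ x - φ (Φ x))| ≤ 1 * (‖φ‖ * τ) := by
      rw [abs_mul]
      refine mul_le_mul ha₀ ((φ.abs_sub_le _ _).trans ?_) (abs_nonneg _) zero_le_one
      rw [dist_comm, dist_eq_norm]
      exact mul_le_mul_of_nonneg_left (h.2 x) (norm_nonneg _)
    have b3 : |a₀ * (((fderiv ℝ Φ x).det - 1) * φ (Φ x))| ≤ 1 * (3 * τ * ‖φ‖) := by
      rw [abs_mul, abs_mul]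
      refine mul_le_mul ha₀ (mul_le_mul h1 (φ.abs_le _) (abs_nonneg _) (by linarith))
        (by positivity) zero_le_one
    rw [abs_le] at *
    constructor <;> linarith [b1.1, b1.2, b2.1, b2.2, b3.1, b3.2]
  have i3 := hgc.abs
  calc _ ≤ ∫ x, |g (Φ x) * a x * φ x - a₀ * (g (Φ x) * (|(fderiv ℝ Φ x).det| * φ (Φ x)))| :=
        abs_integral_le_integral_abs
    _ ≤ ∫ x, 7 * τ * ‖φ‖ * |g (Φ x)| :=
        integral_mono (i1.sub (i2.const_mul _)).abs (i3.const_mul _) hle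
    _ = 7 * τ * ‖φ‖ * ∫ x, |g (Φ x)| := integral_const_mul _ _
    _ ≤ 7 * τ * ‖φ‖ * ((1 + 6 * τ) * ∫ x, |g x|) := by
        refine mul_le_mul_of_nonneg_left ?_ (by positivity)
        exact h.integral_comp_le hτ hg.abs fun x => abs_nonneg _
    _ ≤ _ := by
        have : 0 ≤ τ * ‖φ‖ * ∫ x, |g x| :=
          mul_nonneg (by positivity) (integral_nonneg fun x => abs_nonneg _)
        nlinarith

end NearId

end Maps

section LipschitzCalculus

variable {Ω : Set E2}

theorem exists_lipschitzWith_mul {f g : E2 → ℝ} {K L : ℝ≥0} {M N : ℝ} (hf : LipschitzWith K f)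
    (hg : LipschitzWith L g) (hM : ∀ x, |f x| ≤ M) (hN : ∀ x, |g x| ≤ N) :
    ∃ C : ℝ≥0, LipschitzWith C fun x => f x * g x := by
  have hM0 : 0 ≤ M := (abs_nonneg _).trans (hM 0)
  have hN0 : 0 ≤ N := (abs_nonneg _).trans (hN 0)
  refine ⟨(K * N.toNNReal + M.toNNReal * L), LipschitzWith.of_dist_le_mul fun x y => ?_⟩
  have h1 := hf.dist_le_mul x y
  have h2 := hg.dist_le_mul x y
  rw [Real.dist_eq] at *
  push_cast
  rw [Real.coe_toNNReal _ hM0, Real.coe_toNNReal _ hN0]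
  have e : f x * g x - f y * g y = (f x - f y) * g x + f y * (g x - g y) := by ring
  rw [e]
  refine (abs_add_le _ _).trans ?_
  rw [abs_mul, abs_mul, add_mul]
  refine add_le_add ?_ ?_
  · calc |f x - f y| * |g x| ≤ (K * dist x y) * N :=
        mul_le_mul h1 (hN x) (abs_nonneg _) (by positivity)
      _ = _ := by ring
  · calc |f y| * |g x - g y| ≤ M * (L * dist x y) :=
        mul_le_mul (hM y) h2 (abs_nonneg _) hM0
      _ = _ := by ring

theorem integrable_lineDeriv_mul {f h : E2 → ℝ} {K : ℝ≥0} (hf : LipschitzWith K f)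
    (hc : HasCompactSupport f) (hh : Continuous h) (v : E2) :
    Integrable fun x => lineDeriv ℝ f x v * h x := by
  have h0 : ∀ x ∉ tsupport f, lineDeriv ℝ f x v = 0 := by
    intro x hx
    have : f =ᶠ[𝓝 x] fun _ => 0 := notMem_tsupport_iff_eventuallyEq.1 hx
    rw [this.lineDeriv_eq]
    simp [lineDeriv]
  have h1 : IntegrableOn (fun x => lineDeriv ℝ f x v) (tsupport f) := by
    refine Measure.integrableOn_of_bounded (M := K * ‖v‖) hc.measure_lt_top.ne
      (stronglyMeasurable_lineDeriv hf.continuous).aestronglyMeasurable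
      (of_forall fun x => norm_lineDeriv_le_of_lipschitz ℝ hf)
  have h2 := h1.mul_continuousOn hh.continuousOn hc
  refine ((integrable_indicator_iff (isClosed_tsupport f).measurableSet).2 h2).congr
    (of_forall fun x => ?_)
  by_cases hx : x ∈ tsupport f
  · simp [hx]
  · simp [hx, h0 x hx]

theorem integrable_lineDeriv {f : E2 → ℝ} {K : ℝ≥0} (hf : LipschitzWith K f)
    (hc : HasCompactSupport f) (v : E2) : Integrable fun x => lineDeriv ℝ f x v := by
  simpa using integrable_lineDeriv_mul hf hc (continuous_const (y := (1 : ℝ))) v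

/-- For Lipschitz functions `F` and `g` of two variables, one with compact support, the integral of
the Jacobian of `(F, g)` vanishes. -/
theorem integral_lineDeriv_mul_lineDeriv_comm {F g : E2 → ℝ} {K L : ℝ≥0} (hF : LipschitzWith K F)
    (hFc : HasCompactSupport F) (hg : LipschitzWith L g) (v w : E2) :
    ∫ x, lineDeriv ℝ F x v * lineDeriv ℝ g x w = ∫ x, lineDeriv ℝ F x w * lineDeriv ℝ g x v := by
  set S := Metric.cthickening ‖v‖ (tsupport F)
  have hS : IsCompact S := hFc.cthickening
  set G : E2 → ℝ := S.indicator fun x => lineDeriv ℝ g x w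
  have hGi : Integrable G := by
    refine (integrable_indicator_iff hS.isClosed.measurableSet).2 ?_
    refine Measure.integrableOn_of_bounded (M := L * ‖w‖) hS.measure_lt_top.ne
      (stronglyMeasurable_lineDeriv hg.continuous).aestronglyMeasurable
      (of_forall fun x => norm_lineDeriv_le_of_lipschitz ℝ hg)
  have hF0 : ∀ x ∉ S, F x = 0 := fun x hx => by
    by_contra h
    exact hx (Metric.self_subset_cthickening _ (subset_tsupport F h))
  have A := hF.integral_inv_smul_sub_mul_tendsto_integral_lineDeriv_mul hGi v
  have B := hg.integral_inv_smul_sub_mul_tendsto_integral_lineDeriv_mul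
    (integrable_lineDeriv hF hFc (-w)) (-v)
  have hA : ∫ x, lineDeriv ℝ F x v * G x = ∫ x, lineDeriv ℝ F x v * lineDeriv ℝ g x w := by
    refine integral_congr_ae (of_forall fun x => ?_)
    by_cases hx : x ∈ S
    · simp [G, hx]
    · have hx' : x ∉ tsupport F := fun h => hx (Metric.self_subset_cthickening _ h)
      have : F =ᶠ[𝓝 x] fun _ => 0 := notMem_tsupport_iff_eventuallyEq.1 hx'
      have h0 : lineDeriv ℝ F x v = 0 := by rw [this.lineDeriv_eq]; simp [lineDeriv]
      simp [h0]
  have hB : ∫ x, lineDeriv ℝ g x (-v) * lineDeriv ℝ F x (-w) =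
      ∫ x, lineDeriv ℝ F x w * lineDeriv ℝ g x v := by
    congr 1; ext x; rw [lineDeriv_neg, lineDeriv_neg]; ring
  rw [← hA, ← hB]
  refine tendsto_nhds_unique_of_eventuallyEq A B ?_
  have ht1 : ∀ᶠ t : ℝ in 𝓝[>] 0, t ∈ Set.Ioo (0 : ℝ) 1 := Ioo_mem_nhdsGT one_pos
  filter_upwards [ht1] with t ht
  simp only [smul_eq_mul, mul_assoc, integral_const_mul]
  congr 1
  set a := t • v
  have hFa : LipschitzWith K fun x => F (x + a) := by
    refine LipschitzWith.of_dist_le_mul fun x y => ?_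
    simpa using hF.dist_le_mul (x + a) (y + a)
  have hFac : HasCompactSupport fun x => F (x + a) :=
    hFc.comp_homeomorph (Homeomorph.addRight a)
  have i1 := hg.integral_lineDeriv_mul_eq (μ := volume) hFa hFac w
  have i2 := hg.integral_lineDeriv_mul_eq (μ := volume) hF hFc w
  have hb : ∀ {H : E2 → ℝ}, Continuous H → HasCompactSupport H →
      Integrable fun x => lineDeriv ℝ g x w * H x := fun hH hHc =>
    (hH.integrable_of_hasCompactSupport hHc).bdd_mul (c := L * ‖w‖)
      (stronglyMeasurable_lineDeriv hg.continuous).aestronglyMeasurable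
      (of_forall fun x => norm_lineDeriv_le_of_lipschitz ℝ hg)
  have hd : ∀ x, lineDeriv ℝ (fun x => F (x + a)) x (-w) = lineDeriv ℝ F (x + a) (-w) := by
    intro x
    simp only [lineDeriv, add_right_comm]
  have i3 : ∫ x, lineDeriv ℝ (fun x => F (x + a)) x (-w) * g x =
      ∫ x, lineDeriv ℝ F x (-w) * g (x + t • -v) := by
    simp_rw [hd]
    rw [← integral_add_right_eq_self _ (t • (-v))]
    simp [a]
  calc ∫ x, (F (x + a) - F x) * G x
      = ∫ x, (lineDeriv ℝ g x w * F (x + a) - lineDeriv ℝ g x w * F x) := by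
        refine integral_congr_ae (of_forall fun x => ?_)
        by_cases hx : x ∈ S
        · simp [G, hx]; ring
        · have h1 : F (x + a) = 0 := by
            by_contra h
            refine hx (Metric.mem_cthickening_of_dist_le _ (x + a) _ _ (subset_tsupport F h) ?_)
            rw [dist_eq_norm]
            simp only [sub_add_cancel_left, norm_neg, a, norm_smul, norm_eq_abs,
              abs_of_pos ht.1]
            nlinarith [norm_nonneg v, ht.2]
          simp [G, hx, h1, hF0 x hx]
    _ = ∫ x, (lineDeriv ℝ F x (-w) * g (x + t • -v) - lineDeriv ℝ F x (-w) * g x) := by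
        rw [integral_sub (hb hFa.continuous hFac) (hb hF.continuous hFc), i1, i2, i3,
          ← integral_sub]
        · exact integrable_lineDeriv_mul hF hFc
            (hg.continuous.comp (continuous_id.add continuous_const)) (-w)
        · exact integrable_lineDeriv_mul hF hFc hg.continuous (-w)
    _ = _ := by
        congr 1; ext x; ring


/-- The unit vectors of the coordinate axes. -/
abbrev bv (l : Fin 2) : E2 := single l 1

theorem norm_bv (l : Fin 2) : ‖bv l‖ = 1 := by simp

/-- The Jacobian of two scalar functions. -/
def sjac (f g : E2 → ℝ) (x : E2) : ℝ :=
  lineDeriv ℝ f x (bv 0) * lineDeriv ℝ g x (bv 1) - lineDeriv ℝ f x (bv 1) * lineDeriv ℝ g x (bv 0)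

theorem ae_differentiableAt_lipschitz {F : Type*} [NormedAddCommGroup F] [NormedSpace ℝ F]
    [FiniteDimensional ℝ F] {f : E2 → F} {K : ℝ≥0} (hf : LipschitzWith K f) :
    ∀ᵐ x, DifferentiableAt ℝ f x := hf.ae_differentiableAt

theorem integral_sjac_eq_zero {f g : E2 → ℝ} {K L : ℝ≥0} (hf : LipschitzWith K f)
    (hfc : HasCompactSupport f) (hg : LipschitzWith L g) : ∫ x, sjac f g x = 0 := by
  have hb : ∀ v w, Integrable fun x => lineDeriv ℝ f x v * lineDeriv ℝ g x w := fun v w =>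
    (integrable_lineDeriv hf hfc v).mul_bdd (c := L * ‖w‖)
      (stronglyMeasurable_lineDeriv hg.continuous).aestronglyMeasurable
      (of_forall fun x => norm_lineDeriv_le_of_lipschitz ℝ hg)
  unfold sjac
  rw [integral_sub (hb _ _) (hb _ _),
    integral_lineDeriv_mul_lineDeriv_comm hf hfc hg (bv 0) (bv 1), sub_self]

theorem LipC.abs_lineDeriv_le (φ : LipC Ω) (l : Fin 2) (x : E2) :
    |lineDeriv ℝ (fun x => φ x) x (bv l)| ≤ ‖φ‖ := by
  have := norm_lineDeriv_le_of_lipschitz ℝ φ.lipschitz (x₀ := x) (v := bv l)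
  rwa [norm_bv, mul_one] at this

theorem LipC.lineDeriv_eq_zero (φ : LipC Ω) (l : Fin 2) {x : E2} (hx : x ∉ Ω) :
    lineDeriv ℝ (fun x => φ x) x (bv l) = 0 := by
  have hx' : x ∉ tsupport φ := fun h => hx (φ.tsupport_subset h)
  have : (fun x => φ x) =ᶠ[𝓝 x] fun _ => 0 := notMem_tsupport_iff_eventuallyEq.1 hx'
  rw [this.lineDeriv_eq]; simp [lineDeriv]

theorem measurable_lineDeriv_lip {f : E2 → ℝ} {K : ℝ≥0} (hf : LipschitzWith K f) (v : E2) :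
    Measurable fun x => lineDeriv ℝ f x v := measurable_lineDeriv hf.continuous

/-- The Jacobian of a pair of Lipschitz functions, tested with a Lipschitz function, is controlled
by the size of the first function and the gradient of the second. -/
theorem abs_integral_sjac_mul_le (hb : IsBounded Ω)
    {f g : E2 → ℝ} {K L : ℝ≥0} {M : ℝ} (hf : LipschitzWith K f)
    (hM : ∀ x, |f x| ≤ M) (hg : LipschitzWith L g) (φ : LipC Ω) :
    |∫ x in Ω, sjac f g x * φ x| ≤ ‖φ‖ * ∫ x in Ω, |f x| *
      (|lineDeriv ℝ g x (bv 0)| + |lineDeriv ℝ g x (bv 1)|) := by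
  have hφ := φ.lipschitz
  obtain ⟨C, hC⟩ := exists_lipschitzWith_mul hf hφ hM φ.abs_le
  have hCc : HasCompactSupport fun x => f x * φ x := φ.hasCompactSupport.mul_left
  have h0 := integral_sjac_eq_zero hC hCc hg
  have hfin : volume Ω ≠ ⊤ := hb.measure_lt_top.ne
  have hae : ∀ᵐ x, sjac (fun x => f x * φ x) g x =
      sjac f g x * φ x + f x * sjac (fun x => φ x) g x := by
    filter_upwards [ae_differentiableAt_lipschitz hf, ae_differentiableAt_lipschitz hφ] with x h1 h2
    have hd : ∀ v, lineDeriv ℝ (fun x => f x * φ x) x v =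
        lineDeriv ℝ f x v * φ x + f x * lineDeriv ℝ (fun x => φ x) x v := by
      intro v
      have h3 : DifferentiableAt ℝ (fun x => f x * φ x) x := h1.mul h2
      have e2 : lineDeriv ℝ (fun x => φ x) x v = fderiv ℝ (fun x => φ x) x v :=
        DifferentiableAt.lineDeriv_eq_fderiv h2
      rw [h3.lineDeriv_eq_fderiv, h1.lineDeriv_eq_fderiv, e2]
      have e3 : fderiv ℝ (fun x => f x * φ x) x =
          f x • fderiv ℝ (fun x => φ x) x + φ x • fderiv ℝ f x := fderiv_mul h1 h2
      rw [e3]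
      simp; ring
    simp only [sjac, hd]; ring
  have mf := fun v => measurable_lineDeriv_lip hf v
  have mg := fun v => measurable_lineDeriv_lip hg v
  have mφ := fun v => measurable_lineDeriv_lip hφ v
  have bf : ∀ v x, |lineDeriv ℝ f x v| ≤ K * ‖v‖ := fun v x => norm_lineDeriv_le_of_lipschitz ℝ hf
  have bg : ∀ v x, |lineDeriv ℝ g x v| ≤ L * ‖v‖ := fun v x => norm_lineDeriv_le_of_lipschitz ℝ hg
  have hfm := hf.continuous.measurable
  have hφm := φ.continuous.measurable
  have hM0 : 0 ≤ M := (abs_nonneg _).trans (hM 0)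
  have hsj : ∀ x, |f x * sjac (fun x => φ x) g x| ≤ ‖φ‖ * (|f x| *
      (|lineDeriv ℝ g x (bv 0)| + |lineDeriv ℝ g x (bv 1)|)) := by
    intro x
    rw [abs_mul]
    have : |sjac (fun x => φ x) g x| ≤
        ‖φ‖ * |lineDeriv ℝ g x (bv 1)| + ‖φ‖ * |lineDeriv ℝ g x (bv 0)| := by
      refine (abs_sub _ _).trans ?_
      rw [abs_mul, abs_mul]
      exact add_le_add (mul_le_mul_of_nonneg_right (φ.abs_lineDeriv_le 0 x) (abs_nonneg _))
        (mul_le_mul_of_nonneg_right (φ.abs_lineDeriv_le 1 x) (abs_nonneg _))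
    calc |f x| * |sjac (fun x => φ x) g x| ≤ |f x| * _ :=
          mul_le_mul_of_nonneg_left this (abs_nonneg _)
      _ = _ := by ring
  have hbd : ∀ x, ‖|f x| * (|lineDeriv ℝ g x (bv 0)| + |lineDeriv ℝ g x (bv 1)|)‖ ≤
      M * (L + L) := by
    intro x
    rw [norm_eq_abs, abs_of_nonneg (by positivity)]
    have h0 := bg (bv 0) x
    have h1 := bg (bv 1) x
    rw [norm_bv, mul_one] at h0 h1
    exact mul_le_mul (hM x) (add_le_add h0 h1) (by positivity) hM0
  have iR : IntegrableOn (fun x => |f x| *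
      (|lineDeriv ℝ g x (bv 0)| + |lineDeriv ℝ g x (bv 1)|)) Ω :=
    Measure.integrableOn_of_bounded hfin
      (hfm.abs.mul ((mg _).abs.add (mg _).abs)).aestronglyMeasurable (of_forall hbd)
  have i2 : IntegrableOn (fun x => f x * sjac (fun x => φ x) g x) Ω := by
    refine (iR.const_mul ‖φ‖).mono' ?_ (of_forall hsj)
    exact (hfm.mul (((mφ _).mul (mg _)).sub ((mφ _).mul (mg _)))).aestronglyMeasurable
  have i1 : IntegrableOn (fun x => sjac f g x * φ x) Ω := by
    refine Measure.integrableOn_of_bounded (M := (K * L + K * L) * ‖φ‖) hfin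
      ((((mf _).mul (mg _)).sub ((mf _).mul (mg _))).mul hφm).aestronglyMeasurable
      (of_forall fun x => ?_)
    rw [norm_mul]
    refine mul_le_mul ?_ (φ.abs_le x) (abs_nonneg _) (by positivity)
    refine (abs_sub _ _).trans ?_
    rw [abs_mul, abs_mul]
    have f0 := bf (bv 0) x; have f1 := bf (bv 1) x
    have g0 := bg (bv 0) x; have g1 := bg (bv 1) x
    rw [norm_bv, mul_one] at f0 f1 g0 g1
    exact add_le_add (mul_le_mul f0 g1 (abs_nonneg _) K.2) (mul_le_mul f1 g0 (abs_nonneg _) K.2)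
  have h1 : ∫ x in Ω, sjac f g x * φ x = - ∫ x in Ω, f x * sjac (fun x => φ x) g x := by
    rw [eq_neg_iff_add_eq_zero, ← integral_add i1 i2, ← h0, integral_congr_ae hae]
    refine setIntegral_eq_integral_of_forall_compl_eq_zero fun x hx => ?_
    simp [sjac, φ.eq_zero hx, φ.lineDeriv_eq_zero 0 hx, φ.lineDeriv_eq_zero 1 hx]
  rw [h1, abs_neg, ← integral_const_mul]
  exact abs_integral_le_integral_abs.trans
    (integral_mono i2.abs (iR.const_mul _) hsj)

end LipschitzCalculus

section BoundedMeasurable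

/-- Bounded measurable functions. -/
structure BM (f : E2 → ℝ) : Prop where
  measurable : Measurable f
  bdd : ∃ C, ∀ x, |f x| ≤ C

namespace BM

variable {f g : E2 → ℝ}

theorem const (c : ℝ) : BM fun _ => c := ⟨measurable_const, |c|, fun _ => le_rfl⟩

theorem add (hf : BM f) (hg : BM g) : BM fun x => f x + g x := by
  obtain ⟨C, hC⟩ := hf.2; obtain ⟨D, hD⟩ := hg.2
  exact ⟨hf.1.add hg.1, C + D, fun x => (abs_add_le _ _).trans (add_le_add (hC x) (hD x))⟩

theorem sub (hf : BM f) (hg : BM g) : BM fun x => f x - g x := by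
  obtain ⟨C, hC⟩ := hf.2; obtain ⟨D, hD⟩ := hg.2
  exact ⟨hf.1.sub hg.1, C + D, fun x => (abs_sub _ _).trans (add_le_add (hC x) (hD x))⟩

theorem mul (hf : BM f) (hg : BM g) : BM fun x => f x * g x := by
  obtain ⟨C, hC⟩ := hf.2; obtain ⟨D, hD⟩ := hg.2
  refine ⟨hf.1.mul hg.1, C * D, fun x => ?_⟩
  rw [abs_mul]
  exact mul_le_mul (hC x) (hD x) (abs_nonneg _) ((abs_nonneg _).trans (hC x))

theorem pow (hf : BM f) (n : ℕ) : BM fun x => f x ^ n := by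
  obtain ⟨C, hC⟩ := hf.2
  refine ⟨hf.1.pow_const n, C ^ n, fun x => ?_⟩
  rw [abs_pow]
  exact pow_le_pow_left₀ (abs_nonneg _) (hC x) n

theorem abs (hf : BM f) : BM fun x => |f x| := by
  obtain ⟨C, hC⟩ := hf.2
  exact ⟨hf.1.abs, C, fun x => by rw [abs_abs]; exact hC x⟩

theorem integrableOn (hf : BM f) {Ω : Set E2} (hb : volume Ω ≠ ⊤) : IntegrableOn f Ω := by
  obtain ⟨C, hC⟩ := hf.2
  exact Measure.integrableOn_of_bounded hb hf.1.aestronglyMeasurable (of_forall hC)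

theorem memLp (hf : BM f) {Ω : Set E2} (hb : volume Ω ≠ ⊤) (p : ℝ≥0∞) :
    MemLp f p (volume.restrict Ω) := by
  obtain ⟨C, hC⟩ := hf.2
  have : IsFiniteMeasure (volume.restrict Ω) := ⟨by simpa using hb.lt_top⟩
  exact MemLp.of_bound hf.1.aestronglyMeasurable C (of_forall hC)

end BM

theorem LipC.bm {Ω : Set E2} (φ : LipC Ω) : BM fun x => φ x :=
  ⟨φ.continuous.measurable, ‖φ‖, φ.abs_le⟩

/-- The Cauchy-Schwarz inequality for bounded functions. -/
theorem integral_mul_le_sqrt {Ω : Set E2} (hb : volume Ω ≠ ⊤) {f g : E2 → ℝ} (hf : BM f) (hg : BM g) :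
    ∫ x in Ω, |f x| * |g x| ≤ √(∫ x in Ω, f x ^ 2) * √(∫ x in Ω, g x ^ 2) := by
  have := integral_mul_le_Lp_mul_Lq_of_nonneg (μ := volume.restrict Ω) Real.HolderConjugate.two_two
    (f := fun x => |f x|) (g := fun x => |g x|)
    (of_forall fun x => abs_nonneg _) (of_forall fun x => abs_nonneg _)
    (hf.abs.memLp hb _) (hg.abs.memLp hb _)
  simpa [Real.sqrt_eq_rpow] using this

/-- Bounded Lipschitz maps of the plane. -/
structure LipBdd (V : E2 → E2) : Prop where
  lip : ∃ K : ℝ≥0, LipschitzWith K V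
  bdd : ∃ M : ℝ, ∀ x, ‖V x‖ ≤ M

namespace LipBdd

variable {V W : E2 → E2} (hV : LipBdd V) (hW : LipBdd W)
include hV

theorem continuous : Continuous V := by
  obtain ⟨K, hK⟩ := hV.1
  exact hK.continuous

theorem ae_diff : ∀ᵐ x, DifferentiableAt ℝ V x := by
  obtain ⟨K, hK⟩ := hV.1
  exact hK.ae_differentiableAt

theorem comp_lip (i : Fin 2) : ∃ K : ℝ≥0, LipschitzWith K fun x => V x i := by
  obtain ⟨K, hK⟩ := hV.1
  refine ⟨K, LipschitzWith.of_dist_le_mul fun x y => ?_⟩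
  refine le_trans ?_ (hK.dist_le_mul x y)
  rw [Real.dist_eq, dist_eq_norm]
  exact abs_apply_le (V x - V y) i

theorem comp_bdd (i : Fin 2) : ∃ M : ℝ, ∀ x, |V x i| ≤ M := by
  obtain ⟨M, hM⟩ := hV.2
  exact ⟨M, fun x => (abs_apply_le _ _).trans (hM x)⟩

theorem bm (i : Fin 2) : BM fun x => V x i := by
  obtain ⟨K, hK⟩ := hV.comp_lip i
  exact ⟨hK.continuous.measurable, hV.comp_bdd i⟩

theorem measurable_pd (l : Fin 2) : Measurable (pd l V) := measurable_fderiv_apply_const ℝ V _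

theorem exists_pd_le : ∃ K : ℝ, 0 ≤ K ∧ ∀ l x, ‖pd l V x‖ ≤ K := by
  obtain ⟨K, hK⟩ := hV.1
  refine ⟨K, K.2, fun l x => ?_⟩
  refine ((fderiv ℝ V x).le_opNorm _).trans ?_
  rw [norm_bv, mul_one]
  exact norm_fderiv_le_of_lipschitz ℝ hK

theorem bm_pd (l i : Fin 2) : BM fun x => pd l V x i := by
  obtain ⟨K, -, hK⟩ := hV.exists_pd_le
  refine ⟨?_, K, fun x => (abs_apply_le _ _).trans (hK l x)⟩
  exact (proj (𝕜 := ℝ) i).measurable.comp (hV.measurable_pd l)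

theorem bm_norm_pd (l : Fin 2) : BM fun x => ‖pd l V x‖ := by
  obtain ⟨K, -, hK⟩ := hV.exists_pd_le
  exact ⟨(hV.measurable_pd l).norm, K, fun x => by rw [abs_norm]; exact hK l x⟩

theorem bm_norm : BM fun x => ‖V x‖ := by
  obtain ⟨M, hM⟩ := hV.2
  exact ⟨hV.continuous.measurable.norm, M, fun x => by rw [abs_norm]; exact hM x⟩

theorem bm_mjac : BM (mjac V) :=
  ((hV.bm_pd 0 0).mul (hV.bm_pd 1 1)).sub ((hV.bm_pd 0 1).mul (hV.bm_pd 1 0))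

theorem bm_mcur (l : Fin 2) : BM (mcur l V) :=
  ((hV.bm 0).mul (hV.bm_pd l 1)).sub ((hV.bm 1).mul (hV.bm_pd l 0))

theorem bm_dens : BM (dens V) := ((hV.bm_norm_pd 0).pow 2).add ((hV.bm_norm_pd 1).pow 2)

theorem ae_lineDeriv : ∀ᵐ x, ∀ l i : Fin 2, lineDeriv ℝ (fun x => V x i) x (bv l) = pd l V x i := by
  filter_upwards [hV.ae_diff] with x hx l i
  have h1 : HasFDerivAt (fun x => V x i)
      ((proj (𝕜 := ℝ) i : E2 →L[ℝ] ℝ).comp (fderiv ℝ V x)) x :=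
    (proj (𝕜 := ℝ) i).hasFDerivAt.comp x hx.hasFDerivAt
  rw [h1.differentiableAt.lineDeriv_eq_fderiv, h1.fderiv]
  rfl

include hW

theorem sub : LipBdd fun x => W x - V x := by
  obtain ⟨K, hK⟩ := hV.1; obtain ⟨L, hL⟩ := hW.1
  obtain ⟨M, hM⟩ := hV.2; obtain ⟨N, hN⟩ := hW.2
  exact ⟨⟨L + K, hL.sub hK⟩, N + M, fun x => (norm_sub_le _ _).trans (add_le_add (hN x) (hM x))⟩

/-- The Jacobians of two maps that are close in `L²` are close when tested with Lipschitz
functions. -/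
theorem abs_integral_mjac_sub_le {Ω : Set E2} (hb : IsBounded Ω) (φ : LipC Ω) :
    |∫ x in Ω, (mjac W x - mjac V x) * φ x| ≤ ‖φ‖ * ∫ x in Ω, ‖W x - V x‖ *
      ((‖pd 0 W x‖ + ‖pd 1 W x‖) + (‖pd 0 V x‖ + ‖pd 1 V x‖)) := by
  have hS := sub hV hW
  have hfin : volume Ω ≠ ⊤ := hb.measure_lt_top.ne
  obtain ⟨K0, hK0⟩ := hS.comp_lip 0
  obtain ⟨K1, hK1⟩ := hS.comp_lip 1
  obtain ⟨M0, hM0⟩ := hS.comp_bdd 0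
  obtain ⟨M1, hM1⟩ := hS.comp_bdd 1
  obtain ⟨L1, hL1⟩ := hW.comp_lip 1
  obtain ⟨L0, hL0⟩ := hV.comp_lip 0
  have h1 := abs_integral_sjac_mul_le hb hK0 hM0 hL1 φ
  have h2 := abs_integral_sjac_mul_le hb hK1 hM1 hL0 φ
  have bW := fun l => hW.bm_norm_pd l
  have bV := fun l => hV.bm_norm_pd l
  have bS := hS.bm_norm
  have e : ∫ x in Ω, (mjac W x - mjac V x) * φ x =
      (∫ x in Ω, sjac (fun x => (W x - V x) 0) (fun x => W x 1) x * φ x) -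
        ∫ x in Ω, sjac (fun x => (W x - V x) 1) (fun x => V x 0) x * φ x := by
    have hae : ∀ (i j : Fin 2) {U : E2 → E2} (hU : LipBdd U),
        (fun x => (pd 0 (fun x => W x - V x) x i * pd 1 U x j -
          pd 1 (fun x => W x - V x) x i * pd 0 U x j) * φ x) =ᵐ[volume.restrict Ω]
        fun x => sjac (fun x => (W x - V x) i) (fun x => U x j) x * φ x := by
      intro i j U hU
      refine ae_restrict_of_ae ?_
      filter_upwards [hS.ae_lineDeriv, hU.ae_lineDeriv] with x h1 h2
      simp only [sjac, h1, h2]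
    rw [← integral_congr_ae (hae 0 1 hW), ← integral_congr_ae (hae 1 0 hV), ← integral_sub]
    · refine integral_congr_ae (ae_restrict_of_ae ?_)
      filter_upwards [hV.ae_diff, hW.ae_diff] with x h1 h2
      have hp : ∀ l, pd l (fun x => W x - V x) x = pd l W x - pd l V x := by
        intro l
        have : fderiv ℝ (fun x => W x - V x) x = fderiv ℝ W x - fderiv ℝ V x := fderiv_sub h2 h1
        simp only [pd, this]; rfl
      simp only [hp, mjac, crs, PiLp.sub_apply]; ring
    · exact ((((hS.bm_pd 0 0).mul (hW.bm_pd 1 1)).sub ((hS.bm_pd 1 0).mul (hW.bm_pd 0 1))).mul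
        φ.bm).integrableOn hfin
    · exact ((((hS.bm_pd 0 1).mul (hV.bm_pd 1 0)).sub ((hS.bm_pd 1 1).mul (hV.bm_pd 0 0))).mul
        φ.bm).integrableOn hfin
  have hle : ∀ (i j : Fin 2) {U : E2 → E2} (hU : LipBdd U),
      ∫ x in Ω, |(W x - V x) i| * (|lineDeriv ℝ (fun x => U x j) x (bv 0)| +
        |lineDeriv ℝ (fun x => U x j) x (bv 1)|) ≤
      ∫ x in Ω, ‖W x - V x‖ * (‖pd 0 U x‖ + ‖pd 1 U x‖) := by
    intro i j U hU
    refine integral_mono_of_nonneg (of_forall fun x => by positivity)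
      ((bS.mul ((hU.bm_norm_pd 0).add (hU.bm_norm_pd 1))).integrableOn hfin)
      (ae_restrict_of_ae ?_)
    filter_upwards [hU.ae_lineDeriv] with x h1
    rw [h1, h1]
    exact mul_le_mul (abs_apply_le _ _) (add_le_add (abs_apply_le _ _) (abs_apply_le _ _))
      (by positivity) (norm_nonneg _)
  rw [e]
  refine (abs_sub _ _).trans ((add_le_add h1 h2).trans ?_)
  rw [← mul_add]
  refine mul_le_mul_of_nonneg_left ?_ (norm_nonneg _)
  refine (add_le_add (hle 0 1 hW) (hle 1 0 hV)).trans (le_of_eq ?_)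
  rw [← integral_add ((bS.mul ((bW 0).add (bW 1))).integrableOn hfin)
    ((bS.mul ((bV 0).add (bV 1))).integrableOn hfin)]
  congr 1; ext x; ring

/-- The currents of two maps that are close in `L²` are close when tested with Lipschitz
functions. -/
theorem abs_integral_mcur_sub_le {Ω : Set E2} (ho : IsOpen Ω) (hb : IsBounded Ω)
    (hV1 : ∀ x ∈ Ω, ‖V x‖ ≤ 1) (φ : LipC Ω) (l : Fin 2) :
    |∫ x in Ω, (mcur l W x - mcur l V x) * φ x| ≤ ‖φ‖ * ∫ x in Ω, ‖W x - V x‖ *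
      (‖pd l W x‖ + ‖pd l V x‖ + 1) := by
  have hS := sub hV hW
  have hfin : volume Ω ≠ ⊤ := hb.measure_lt_top.ne
  have bW := hW.bm_norm_pd l
  have bV := hV.bm_norm_pd l
  have bS := hS.bm_norm
  obtain ⟨C, hC⟩ : ∃ C : ℝ≥0, LipschitzWith C fun x => crs (V x) (W x) := by
    obtain ⟨K0, hK0⟩ := hV.comp_lip 0
    obtain ⟨K1, hK1⟩ := hV.comp_lip 1
    obtain ⟨M0, hM0⟩ := hV.comp_bdd 0
    obtain ⟨M1, hM1⟩ := hV.comp_bdd 1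
    obtain ⟨K0', hK0'⟩ := hW.comp_lip 0
    obtain ⟨K1', hK1'⟩ := hW.comp_lip 1
    obtain ⟨M0', hM0'⟩ := hW.comp_bdd 0
    obtain ⟨M1', hM1'⟩ := hW.comp_bdd 1
    obtain ⟨C, hC⟩ := exists_lipschitzWith_mul hK0 hK1' hM0 hM1'
    obtain ⟨D, hD⟩ := exists_lipschitzWith_mul hK1 hK0' hM1 hM0'
    exact ⟨C + D, hC.sub hD⟩
  have hpart := hC.integral_lineDeriv_mul_eq (μ := volume) φ.lipschitz φ.hasCompactSupport (bv l)
  have hdiff : ∀ᵐ x, lineDeriv ℝ (fun x => crs (V x) (W x)) x (bv l) =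
      crs (pd l V x) (W x) + crs (V x) (pd l W x) := by
    filter_upwards [hV.ae_diff, hW.ae_diff] with x h1 h2
    have hc : ∀ {U : E2 → E2} (_ : DifferentiableAt ℝ U x) (i : Fin 2), HasFDerivAt (fun x => U x i)
        ((proj (𝕜 := ℝ) i : E2 →L[ℝ] ℝ).comp (fderiv ℝ U x)) x := fun hU i =>
      (proj (𝕜 := ℝ) i).hasFDerivAt.comp x hU.hasFDerivAt
    have h3 := ((hc h1 0).mul (hc h2 1)).sub ((hc h1 1).mul (hc h2 0))
    have h4 : HasFDerivAt (fun x => crs (V x) (W x)) _ x := h3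
    rw [h4.differentiableAt.lineDeriv_eq_fderiv, h4.fderiv]
    simp [crs, pd]
    ring
  have bcr : ∀ {f g : E2 → E2}, (∀ i, BM fun x => f x i) → (∀ i, BM fun x => g x i) →
      BM fun x => crs (f x) (g x) := fun hf hg => ((hf 0).mul (hg 1)).sub ((hf 1).mul (hg 0))
  have b1 : BM fun x => crs (W x - V x) (pd l W x) + crs (W x - V x) (pd l V x) :=
    (bcr hS.bm (hW.bm_pd l)).add (bcr hS.bm (hV.bm_pd l))
  have b2 : BM fun x => crs (pd l V x) (W x) + crs (V x) (pd l W x) :=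
    (bcr (hV.bm_pd l) hW.bm).add (bcr hV.bm (hW.bm_pd l))
  have e : ∫ x in Ω, (mcur l W x - mcur l V x) * φ x =
      (∫ x in Ω, (crs (W x - V x) (pd l W x) + crs (W x - V x) (pd l V x)) * φ x) -
        ∫ x in Ω, lineDeriv ℝ (fun x => φ x) x (bv l) * crs (V x) (W x - V x) := by
    have e1 : -∫ x in Ω, lineDeriv ℝ (fun x => φ x) x (bv l) * crs (V x) (W x - V x) =
        ∫ x in Ω, (crs (pd l V x) (W x) + crs (V x) (pd l W x)) * φ x := by
      rw [setIntegral_eq_integral_of_forall_compl_eq_zero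
          (fun x hx => by rw [φ.lineDeriv_eq_zero l hx, zero_mul]),
        setIntegral_eq_integral_of_forall_compl_eq_zero
          (fun x hx => by rw [φ.eq_zero hx, mul_zero]), ← integral_neg]
      calc _ = ∫ x, lineDeriv ℝ (fun x => φ x) x (-bv l) * crs (V x) (W x) := by
            congr 1; ext x; rw [lineDeriv_neg, crs_sub_right, crs_self]; ring
        _ = _ := by
            rw [← hpart]
            refine integral_congr_ae ?_
            filter_upwards [hdiff] with x hx
            rw [hx]
    rw [sub_eq_add_neg, e1, ← integral_add ((b1.mul φ.bm).integrableOn hfin)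
      ((b2.mul φ.bm).integrableOn hfin)]
    congr 1; ext x
    simp only [mcur, crs, PiLp.sub_apply]; ring
  have bφ : BM fun x => lineDeriv ℝ (fun x => φ x) x (bv l) :=
    ⟨measurable_lineDeriv_lip φ.lipschitz _, ‖φ‖, φ.abs_lineDeriv_le l⟩
  have i1 : IntegrableOn (fun x => ‖φ‖ * (‖W x - V x‖ * (‖pd l W x‖ + ‖pd l V x‖))) Ω :=
    ((BM.const _).mul (bS.mul (bW.add bV))).integrableOn hfin
  have i2 : IntegrableOn (fun x => ‖φ‖ * ‖W x - V x‖) Ω :=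
    ((BM.const _).mul bS).integrableOn hfin
  rw [e, ← integral_const_mul]
  refine (abs_sub _ _).trans ((add_le_add
    (abs_integral_le_integral_abs.trans (integral_mono_of_nonneg
      (of_forall fun x => abs_nonneg _) i1 (of_forall fun x => ?_)))
    (abs_integral_le_integral_abs.trans (integral_mono_of_nonneg
      (of_forall fun x => abs_nonneg _) i2
      (ae_restrict_of_forall_mem ho.measurableSet fun x hx => ?_)))).trans
    (le_of_eq ?_))
  · show |(crs (W x - V x) (pd l W x) + crs (W x - V x) (pd l V x)) * φ x| ≤ _
    rw [abs_mul, mul_comm]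
    refine mul_le_mul (φ.abs_le x) ?_ (abs_nonneg _) (norm_nonneg _)
    rw [mul_add]
    exact (abs_add_le _ _).trans (add_le_add (abs_crs_le _ _) (abs_crs_le _ _))
  · show |lineDeriv ℝ (fun x => φ x) x (bv l) * crs (V x) (W x - V x)| ≤ _
    rw [abs_mul]
    refine mul_le_mul (φ.abs_lineDeriv_le l x) ((abs_crs_le _ _).trans ?_) (abs_nonneg _)
      (norm_nonneg _)
    exact mul_le_of_le_one_left (norm_nonneg _) (hV1 x hx)
  · rw [← integral_add i1 i2]
    congr 1; ext x; ring

end LipBdd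

end BoundedMeasurable

section PushMaps

variable {Ω : Set E2} {V W Φ : E2 → E2} {τ : ℝ}

theorem LipBdd.comp_nearId (hV : LipBdd V) (h : NearId Φ τ) (hτ : τ ≤ 1 / 8) :
    LipBdd (V ∘ Φ) := by
  obtain ⟨K, hK⟩ := hV.1; obtain ⟨M, hM⟩ := hV.2
  have : LipschitzWith 2 Φ := LipschitzWith.of_dist_le_mul fun x y => h.dist_le (by linarith) x y
  exact ⟨⟨K * 2, hK.comp this⟩, M, fun x => hM _⟩

theorem NearId.continuous_pd_apply (h : NearId Φ τ) (l i : Fin 2) :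
    Continuous fun x => pd l Φ x i :=
  (proj (𝕜 := ℝ) i).continuous.comp
    ((ContinuousLinearMap.apply ℝ E2 (bv l)).continuous.comp
      (h.1.continuous_fderiv one_ne_zero))

theorem integral_indicator_mul {U : Set E2} (hU : MeasurableSet U) (f : E2 → ℝ) (φ : E2 → ℝ) :
    ∫ x, U.indicator f x * φ x = ∫ x in U, f x * φ x := by
  rw [← integral_indicator hU]
  congr 1; ext x
  by_cases hx : x ∈ U <;> simp [hx]

theorem integral_abs_indicator {U : Set E2} (hU : MeasurableSet U) (f : E2 → ℝ) :
    ∫ x, |U.indicator f x| = ∫ x in U, |f x| := by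
  rw [← integral_indicator hU]
  congr 1; ext x
  by_cases hx : x ∈ U <;> simp [hx]

theorem setIntegral_eq_integral_mul (φ : LipC Ω) (f : E2 → ℝ) :
    ∫ x in Ω, f x * φ x = ∫ x, f x * φ x :=
  setIntegral_eq_integral_of_forall_compl_eq_zero fun x hx => by rw [φ.eq_zero hx, mul_zero]

theorem LipBdd.abs_integral_mjac_comp_sub_le (hV : LipBdd V) (h : NearId Φ τ) (hτ : τ ≤ 1 / 8)
    (φ : LipC Ω) {U : Set E2} (hU : MeasurableSet U) (hUfin : volume U ≠ ⊤)
    (hΦ : ∀ x ∈ Ω, Φ x ∈ U) :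
    |(∫ x in Ω, mjac (V ∘ Φ) x * φ x) - ∫ x in U, mjac V x * φ x| ≤
      13 * τ * ‖φ‖ * ∫ x in U, |mjac V x| := by
  have hg : Integrable (U.indicator (mjac V)) :=
    (integrable_indicator_iff hU).2 (hV.bm_mjac.integrableOn hUfin)
  have := h.abs_integral_comp_sub_le hτ φ hg h.continuous_det (a₀ := 1) (by simp)
    (h.abs_det_sub_one_le (by linarith))
  rw [integral_indicator_mul hU, integral_abs_indicator hU, one_mul] at this
  convert this using 3
  rw [setIntegral_eq_integral_mul]
  refine integral_congr_ae ?_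
  filter_upwards [h.ae_comp (by linarith) hV.ae_diff] with x hx
  by_cases hxΩ : x ∈ Ω
  · rw [indicator_of_mem (hΦ x hxΩ), mjac_comp hx (h.differentiable x)]
  · rw [φ.eq_zero hxΩ, mul_zero, mul_zero]

theorem LipBdd.abs_integral_mcur_comp_sub_le (hV : LipBdd V) (h : NearId Φ τ) (hτ : τ ≤ 1 / 8)
    (φ : LipC Ω) {U : Set E2} (hU : MeasurableSet U) (hUfin : volume U ≠ ⊤)
    (hΦ : ∀ x ∈ Ω, Φ x ∈ U) (l : Fin 2) :
    |(∫ x in Ω, mcur l (V ∘ Φ) x * φ x) - ∫ x in U, mcur l V x * φ x| ≤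
      13 * τ * ‖φ‖ * ((∫ x in U, |mcur 0 V x|) + ∫ x in U, |mcur 1 V x|) := by
  have hg : ∀ m, Integrable (U.indicator (mcur m V)) := fun m =>
    (integrable_indicator_iff hU).2 ((hV.bm_mcur m).integrableOn hUfin)
  have hτ0 := h.nonneg
  have H := fun m => h.abs_integral_comp_sub_le hτ φ (hg m) (h.continuous_pd_apply l m)
    (a₀ := if m = l then 1 else 0) (by split_ifs <;> simp)
    (fun x => (h.pd_sub_le l m x).trans (by linarith))
  simp only [integral_indicator_mul hU, integral_abs_indicator hU] at H
  have hi : ∀ m, Integrable fun x => U.indicator (mcur m V) (Φ x) * pd l Φ x m * φ x := by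
    intro m
    have := (h.integrable_comp (by linarith) (hg m)).mul_bdd (g := fun x => pd l Φ x m * φ x)
      (c := 2 * ‖φ‖) ((h.continuous_pd_apply l m).mul φ.continuous).aestronglyMeasurable
      (of_forall fun x => by
        rw [norm_mul]
        refine mul_le_mul ?_ (φ.abs_le x) (abs_nonneg _) (by norm_num)
        have := abs_le.1 (h.pd_sub_le l m x)
        rw [norm_eq_abs, abs_le]
        split_ifs at this <;> constructor <;> linarith [this.1, this.2])
    simpa only [mul_assoc] using this
  have e : ∫ x in Ω, mcur l (V ∘ Φ) x * φ x =
      (∫ x, U.indicator (mcur 0 V) (Φ x) * pd l Φ x 0 * φ x) +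
        ∫ x, U.indicator (mcur 1 V) (Φ x) * pd l Φ x 1 * φ x := by
    rw [setIntegral_eq_integral_mul, ← integral_add (hi 0) (hi 1)]
    refine integral_congr_ae ?_
    filter_upwards [h.ae_comp (by linarith) hV.ae_diff] with x hx
    by_cases hxΩ : x ∈ Ω
    · rw [indicator_of_mem (hΦ x hxΩ), indicator_of_mem (hΦ x hxΩ),
        mcur_comp hx (h.differentiable x)]
      ring
    · rw [φ.eq_zero hxΩ]; ring
  have e2 : ∫ x in U, mcur l V x * φ x =
      (if (0 : Fin 2) = l then 1 else 0) * (∫ x in U, mcur 0 V x * φ x) +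
        (if (1 : Fin 2) = l then 1 else 0) * ∫ x in U, mcur 1 V x * φ x := by
    fin_cases l <;> simp
  rw [e, e2, mul_add, add_sub_add_comm]
  exact (abs_add_le _ _).trans (add_le_add (H 0) (H 1))

theorem dens_comp_le (h : NearId Φ τ) (hτ : τ ≤ 1 / 8) {x : E2} (hx : DifferentiableAt ℝ V (Φ x)) :
    dens (V ∘ Φ) x ≤ (1 + 8 * τ) * dens V (Φ x) := by
  have h0 := h.nonneg
  have hb : ∀ l, ‖pd l (V ∘ Φ) x‖ ≤ ‖pd l V (Φ x)‖ + τ * (‖pd 0 V (Φ x)‖ + ‖pd 1 V (Φ x)‖) := by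
    intro l
    have hp := pd_comp hx (h.differentiable x) l
    have hm := fun m => h.pd_sub_le l m x
    have e : pd l (V ∘ Φ) x = pd l V (Φ x) +
        ((pd l Φ x 0 - if (0 : Fin 2) = l then 1 else 0) • pd 0 V (Φ x) +
          (pd l Φ x 1 - if (1 : Fin 2) = l then 1 else 0) • pd 1 V (Φ x)) := by
      rw [hp]; fin_cases l <;> simp [sub_smul] <;> abel
    rw [e]
    refine (norm_add_le _ _).trans (add_le_add_right ((norm_add_le _ _).trans ?_) _)
    rw [norm_smul, norm_smul, mul_add, norm_eq_abs, norm_eq_abs]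
    exact add_le_add (mul_le_mul_of_nonneg_right (hm 0) (norm_nonneg _))
      (mul_le_mul_of_nonneg_right (hm 1) (norm_nonneg _))
  have h1 := hb 0
  have h2 := hb 1
  unfold dens
  set a := ‖pd 0 V (Φ x)‖
  set b := ‖pd 1 V (Φ x)‖
  have ha : 0 ≤ a := norm_nonneg _
  have hb : 0 ≤ b := norm_nonneg _
  have h3 := pow_le_pow_left₀ (norm_nonneg _) h1 2
  have h4 := pow_le_pow_left₀ (norm_nonneg _) h2 2
  have h5 : (a + τ * (a + b)) ^ 2 + (b + τ * (a + b)) ^ 2 =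
      a ^ 2 + b ^ 2 + (2 * τ + 2 * τ ^ 2) * (a + b) ^ 2 := by ring
  have h6 : (a + b) ^ 2 ≤ 2 * (a ^ 2 + b ^ 2) := by nlinarith [sq_nonneg (a - b)]
  have h7 : (2 * τ + 2 * τ ^ 2) * (a + b) ^ 2 ≤ (2 * τ + 2 * τ ^ 2) * (2 * (a ^ 2 + b ^ 2)) :=
    mul_le_mul_of_nonneg_left h6 (by positivity)
  have h8 : (2 * τ + 2 * τ ^ 2) * 2 ≤ 8 * τ := by nlinarith
  nlinarith [mul_le_mul_of_nonneg_right h8 (by positivity : 0 ≤ a ^ 2 + b ^ 2)]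

theorem LipBdd.integral_dens_comp_le (hV : LipBdd V) (h : NearId Φ τ) (hτ : τ ≤ 1 / 8)
    {D U : Set E2} (hD : MeasurableSet D) (hU : MeasurableSet U) (hUfin : volume U ≠ ⊤)
    (hDfin : volume D ≠ ⊤) (hΦ : ∀ x ∈ D, Φ x ∈ U) :
    ∫ x in D, dens (V ∘ Φ) x ≤ (1 + 21 * τ) * ∫ x in U, dens V x := by
  have h0 := h.nonneg
  have hI : 0 ≤ ∫ x in U, dens V x := integral_nonneg fun x => dens_nonneg V x
  obtain ⟨M, hM⟩ := hV.bm_dens.2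
  have hi : IntegrableOn (fun x => dens V (Φ x)) D :=
    Measure.integrableOn_of_bounded hDfin
      (hV.bm_dens.1.comp h.1.continuous.measurable).aestronglyMeasurable
      (of_forall fun x => hM (Φ x))
  calc ∫ x in D, dens (V ∘ Φ) x ≤ ∫ x in D, (1 + 8 * τ) * dens V (Φ x) := by
        refine integral_mono_ae ((hV.comp_nearId h hτ).bm_dens.integrableOn hDfin)
          (hi.const_mul _) (ae_restrict_of_ae ?_)
        filter_upwards [h.ae_comp (by linarith) hV.ae_diff] with x hx using dens_comp_le h hτ hx
    _ = (1 + 8 * τ) * ∫ x in D, dens V (Φ x) := integral_const_mul _ _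
    _ ≤ (1 + 8 * τ) * ((1 + 6 * τ) * ∫ x in U, dens V x) :=
        mul_le_mul_of_nonneg_left (h.setIntegral_comp_le hτ hD hU (hV.bm_dens.integrableOn hUfin)
          (fun x _ => dens_nonneg V x) hΦ) (by positivity)
    _ ≤ _ := by
        rw [← mul_assoc]
        exact mul_le_mul_of_nonneg_right (by nlinarith) hI

theorem integral_norm_mul_pd_le (hb : volume Ω ≠ ⊤) (hS : LipBdd W) (hV : LipBdd V) {d m : ℝ}
    (hd : 0 ≤ d) (hm : 0 ≤ m)
    (h1 : ∫ x in Ω, ‖W x‖ ^ 2 ≤ d ^ 2) (h2 : ∫ x in Ω, dens V x ≤ m ^ 2) (l : Fin 2) :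
    ∫ x in Ω, ‖W x‖ * ‖pd l V x‖ ≤ d * m := by
  have := integral_mul_le_sqrt hb hS.bm_norm (hV.bm_norm_pd l)
  simp only [abs_norm] at this
  refine this.trans (mul_le_mul ?_ ?_ (sqrt_nonneg _) hd)
  · exact sqrt_le_iff.2 ⟨hd, h1⟩
  · refine sqrt_le_iff.2 ⟨hm, le_trans ?_ h2⟩
    refine integral_mono (((hV.bm_norm_pd l).pow 2).integrableOn hb) (hV.bm_dens.integrableOn hb)
      fun x => ?_
    unfold dens
    fin_cases l
    · exact le_add_of_nonneg_right (by positivity)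
    · exact le_add_of_nonneg_left (by positivity)

theorem integral_norm_le (hb : volume Ω ≠ ⊤) (hS : LipBdd W) {d : ℝ} (hd : 0 ≤ d)
    (h1 : ∫ x in Ω, ‖W x‖ ^ 2 ≤ d ^ 2) : ∫ x in Ω, ‖W x‖ ≤ d * √(volume.real Ω) := by
  have := integral_mul_le_sqrt hb hS.bm_norm (BM.const 1)
  simp only [abs_norm, abs_one, mul_one, one_pow, integral_const, smul_eq_mul,
    measureReal_restrict_apply_univ] at this
  exact this.trans (mul_le_mul_of_nonneg_right (sqrt_le_iff.2 ⟨hd, h1⟩) (sqrt_nonneg _))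

theorem LipBdd.abs_integral_mjac_sub_le' (hV : LipBdd V) (hW : LipBdd W)
    (hb : IsBounded Ω) (φ : LipC Ω) {d m : ℝ} (hd : 0 ≤ d) (hm : 0 ≤ m)
    (h1 : ∫ x in Ω, ‖W x - V x‖ ^ 2 ≤ d ^ 2) (h2 : ∫ x in Ω, dens W x ≤ m ^ 2)
    (h3 : ∫ x in Ω, dens V x ≤ m ^ 2) :
    |(∫ x in Ω, mjac W x * φ x) - ∫ x in Ω, mjac V x * φ x| ≤ 4 * (d * m) * ‖φ‖ := by
  have hfin : volume Ω ≠ ⊤ := hb.measure_lt_top.ne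
  have hS := hV.sub hW
  have bS := hS.bm_norm
  have H := hV.abs_integral_mjac_sub_le hW hb φ
  have i : ∀ {U : E2 → E2} (_ : LipBdd U) (l : Fin 2),
      IntegrableOn (fun x => ‖W x - V x‖ * ‖pd l U x‖) Ω := fun hU l =>
    (bS.mul (hU.bm_norm_pd l)).integrableOn hfin
  rw [← integral_sub ((hW.bm_mjac.mul φ.bm).integrableOn hfin)
    ((hV.bm_mjac.mul φ.bm).integrableOn hfin)]
  simp only [← sub_mul]
  refine H.trans ?_
  rw [mul_comm]
  refine mul_le_mul_of_nonneg_right ?_ (norm_nonneg _)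
  simp only [mul_add]
  have ia : ∀ {f g : E2 → ℝ}, IntegrableOn f Ω → IntegrableOn g Ω →
      IntegrableOn (fun x => f x + g x) Ω := fun hf hg => hf.add hg
  rw [integral_add (ia (i hW 0) (i hW 1)) (ia (i hV 0) (i hV 1)), integral_add (i hW 0) (i hW 1),
    integral_add (i hV 0) (i hV 1)]
  have a1 := fun l => integral_norm_mul_pd_le hfin hS hW hd hm h1 h2 l
  have a2 := fun l => integral_norm_mul_pd_le hfin hS hV hd hm h1 h3 l
  linarith [a1 0, a1 1, a2 0, a2 1]

theorem LipBdd.abs_integral_mcur_sub_le' (hV : LipBdd V) (hW : LipBdd W) (ho : IsOpen Ω)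
    (hb : IsBounded Ω) (hV1 : ∀ x ∈ Ω, ‖V x‖ ≤ 1) (φ : LipC Ω) (l : Fin 2) {d m : ℝ}
    (hd : 0 ≤ d) (hm : 0 ≤ m)
    (h1 : ∫ x in Ω, ‖W x - V x‖ ^ 2 ≤ d ^ 2) (h2 : ∫ x in Ω, dens W x ≤ m ^ 2)
    (h3 : ∫ x in Ω, dens V x ≤ m ^ 2) :
    |(∫ x in Ω, mcur l W x * φ x) - ∫ x in Ω, mcur l V x * φ x| ≤
      (d * (2 * m + √(volume.real Ω))) * ‖φ‖ := by
  have hfin : volume Ω ≠ ⊤ := hb.measure_lt_top.ne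
  have hS := hV.sub hW
  have bS := hS.bm_norm
  have H := hV.abs_integral_mcur_sub_le hW ho hb hV1 φ l
  have i : ∀ {U : E2 → E2} (_ : LipBdd U) (l : Fin 2),
      IntegrableOn (fun x => ‖W x - V x‖ * ‖pd l U x‖) Ω := fun hU l =>
    (bS.mul (hU.bm_norm_pd l)).integrableOn hfin
  rw [← integral_sub (((hW.bm_mcur l).mul φ.bm).integrableOn hfin)
    (((hV.bm_mcur l).mul φ.bm).integrableOn hfin)]
  simp only [← sub_mul]
  refine H.trans ?_
  rw [mul_comm]
  refine mul_le_mul_of_nonneg_right ?_ (norm_nonneg _)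
  simp only [mul_add, mul_one]
  have ia : IntegrableOn (fun x => ‖W x - V x‖ * ‖pd l W x‖ + ‖W x - V x‖ * ‖pd l V x‖) Ω :=
    (i hW l).add (i hV l)
  rw [integral_add ia (bS.integrableOn hfin), integral_add (i hW l) (i hV l)]
  have a1 := integral_norm_mul_pd_le hfin hS hW hd hm h1 h2 l
  have a2 := integral_norm_mul_pd_le hfin hS hV hd hm h1 h3 l
  have a3 := integral_norm_le hfin hS hd h1
  linarith

end PushMaps

section SobolevOfLipschitz

variable {Ω : Set E2} {V : E2 → E2}

/-- A bounded Lipschitz map, as a Sobolev field. -/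
def LipBdd.toH1 (hV : LipBdd V) (hb : IsBounded Ω) : H1Field Ω where
  toFun := V
  grad k x := !₂[pd 0 V x k, pd 1 V x k]
  memLp_toFun := by
    refine MemLp.of_eval_piLp fun i => ?_
    exact (hV.bm i).memLp hb.measure_lt_top.ne 2
  memLp_grad k := by
    refine MemLp.of_eval_piLp fun i => ?_
    fin_cases i
    · exact (hV.bm_pd 0 k).memLp hb.measure_lt_top.ne 2
    · exact (hV.bm_pd 1 k).memLp hb.measure_lt_top.ne 2
  weak_grad k φ h1 h2 h3 l := by
    obtain ⟨K, hK⟩ := hV.comp_lip k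
    obtain ⟨L, hL⟩ : ∃ L : ℝ≥0, LipschitzWith L φ :=
      (h1.of_le (by norm_num)).lipschitzWith_of_hasCompactSupport h2 one_ne_zero
    have := hK.integral_lineDeriv_mul_eq (μ := volume) hL h2 (bv l)
    have h0 : ∀ x ∉ Ω, φ x = 0 := fun x hx => by
      by_contra h; exact hx (h3 (subset_tsupport _ h))
    have h0' : ∀ x ∉ Ω, fderiv ℝ φ x = 0 := fun x hx => by
      have hx' : x ∉ tsupport φ := fun h => hx (h3 h)
      have : φ =ᶠ[𝓝 x] fun _ => 0 := notMem_tsupport_iff_eventuallyEq.1 hx'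
      rw [this.fderiv_eq]; simp
    rw [setIntegral_eq_integral_of_forall_compl_eq_zero (fun x hx => by rw [h0' x hx]; simp),
      setIntegral_eq_integral_of_forall_compl_eq_zero (fun x hx => by rw [h0 x hx, mul_zero])]
    have e1 : ∫ x, (!₂[pd 0 V x k, pd 1 V x k] : E2) l * φ x =
        ∫ x, lineDeriv ℝ (fun x => V x k) x (bv l) * φ x := by
      refine integral_congr_ae ?_
      filter_upwards [hV.ae_lineDeriv] with x hx
      rw [hx]
      fin_cases l <;> rfl
    rw [e1, this, ← integral_neg]
    congr 1; ext x
    have hd : DifferentiableAt ℝ φ x := (h1.differentiable (by simp)) x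
    rw [lineDeriv_neg, hd.lineDeriv_eq_fderiv]
    ring

theorem LipBdd.toH1_jac (hV : LipBdd V) (hb : IsBounded Ω) (x : E2) :
    (hV.toH1 hb : H1Field Ω).jac x = mjac V x := by
  simp [H1Field.jac, toH1, mjac, crs]; ring

theorem LipBdd.toH1_current (hV : LipBdd V) (hb : IsBounded Ω) (x : E2) (l : Fin 2) :
    (hV.toH1 hb : H1Field Ω).current x l = mcur l V x := by
  fin_cases l <;> simp [H1Field.current, toH1, mcur, crs]

theorem H1Field.integrable_dens (w : H1Field Ω) :
    IntegrableOn (fun x => ‖w.grad 0 x‖ ^ 2 + ‖w.grad 1 x‖ ^ 2) Ω :=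
  (w.memLp_grad 0).norm.integrable_sq.add (w.memLp_grad 1).norm.integrable_sq

theorem H1Field.energy_eq (hb : IsBounded Ω) (w : H1Field Ω) (ε : ℝ) :
    w.energy ε = 1 / 2 * (∫ x in Ω, (‖w.grad 0 x‖ ^ 2 + ‖w.grad 1 x‖ ^ 2)) +
      1 / ε ^ 2 * ∫ x in Ω, (1 - ‖w.toFun x‖) ^ 2 := by
  have : IsFiniteMeasure (volume.restrict Ω) := ⟨by simpa using hb.measure_lt_top⟩
  have ip : IntegrableOn (fun x => (1 - ‖w.toFun x‖) ^ 2) Ω :=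
    ((memLp_const 1).sub w.memLp_toFun.norm).integrable_sq
  rw [H1Field.energy, integral_add (w.integrable_dens.const_mul _) (ip.const_mul _),
    integral_const_mul, integral_const_mul]

theorem LipBdd.toH1_energy (hV : LipBdd V) (hb : IsBounded Ω) (ε : ℝ) :
    (hV.toH1 hb : H1Field Ω).energy ε =
      1 / 2 * (∫ x in Ω, dens V x) + 1 / ε ^ 2 * ∫ x in Ω, (1 - ‖V x‖) ^ 2 := by
  have e : ∀ x, ‖(hV.toH1 hb : H1Field Ω).grad 0 x‖ ^ 2 + ‖(hV.toH1 hb : H1Field Ω).grad 1 x‖ ^ 2 =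
      dens V x := fun x => by simp [toH1, dens, norm_sq_eq]; ring
  simp only [H1Field.energy_eq hb, e]
  rfl

end SobolevOfLipschitz

/-! ### Lattice squares and triangles -/

section LatticeGeometry

variable {ε : ℝ}

theorem measurable_coord (i : Fin 2) : Measurable fun x : E2 => x i :=
  (proj (𝕜 := ℝ) i).measurable

theorem measurable_cellIndex (ε : ℝ) : Measurable (cellIndex ε) :=
  (Int.measurable_floor.comp ((measurable_coord 0).div_const ε)).prodMk
    (Int.measurable_floor.comp ((measurable_coord 1).div_const ε))

/-- The lower triangle of the lattice square that contains `x`. -/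
def low (ε : ℝ) (x : E2) : Prop := fract (x 1 / ε) ≤ fract (x 0 / ε)

theorem measurableSet_low (ε : ℝ) : MeasurableSet {x | low ε x} :=
  measurableSet_le (measurable_fract.comp ((measurable_coord 1).div_const ε))
    (measurable_fract.comp ((measurable_coord 0).div_const ε))

/-- The half-open lattice squares with index in `T`. -/
def squares (ε : ℝ) (T : Finset (ℤ × ℤ)) : Set E2 := {x | cellIndex ε x ∈ T}

theorem measurableSet_squares (ε : ℝ) (T : Finset (ℤ × ℤ)) : MeasurableSet (squares ε T) :=
  measurable_cellIndex ε T.measurableSet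

theorem coord_eq (hε : 0 < ε) (x : E2) :
    x 0 = ε * ((cellIndex ε x).1 + fract (x 0 / ε)) ∧
      x 1 = ε * ((cellIndex ε x).2 + fract (x 1 / ε)) := by
  simp only [cellIndex, Int.floor_add_fract]
  constructor <;> field_simp

theorem cellIndex_eq_iff (hε : 0 < ε) (x : E2) (k : ℤ × ℤ) :
    cellIndex ε x = k ↔ x 0 ∈ Set.Ico (ε * k.1) (ε * k.1 + ε) ∧
      x 1 ∈ Set.Ico (ε * k.2) (ε * k.2 + ε) := by
  have h : ∀ (t : ℝ) (m : ℤ), ⌊t / ε⌋ = m ↔ t ∈ Set.Ico (ε * m) (ε * m + ε) := by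
    intro t m
    rw [Int.floor_eq_iff, le_div_iff₀ hε, div_lt_iff₀ hε, mem_Ico]
    constructor <;> rintro ⟨h1, h2⟩ <;> constructor <;> linarith
  rw [cellIndex, Prod.ext_iff, h, h]

theorem mem_cell_of_cellIndex (hε : 0 < ε) {x : E2} {k : ℤ × ℤ} (h : cellIndex ε x = k) :
    x ∈ cell ε k := by
  rw [cellIndex_eq_iff hε] at h
  exact ⟨Set.Ico_subset_Icc_self h.1, Set.Ico_subset_Icc_self h.2⟩

theorem low_iff (hε : 0 < ε) (x : E2) :
    low ε x ↔ x 1 - ε * ((cellIndex ε x).2 : ℝ) ≤ x 0 - ε * ((cellIndex ε x).1 : ℝ) := by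
  obtain ⟨h0, h1⟩ := coord_eq hε x
  rw [low]
  set s := fract (x 0 / ε)
  set r := fract (x 1 / ε)
  rw [h0, h1]
  constructor
  · intro h; nlinarith
  · intro h
    have : ε * r ≤ ε * s := by linarith
    exact le_of_mul_le_mul_left this hε

theorem volume_hyperplane (L : E2 →ₗ[ℝ] ℝ) (hL : L ≠ 0) (c : ℝ) : volume {x | L x = c} = 0 := by
  by_cases hne : ∃ x₀, L x₀ = c
  · obtain ⟨x₀, h0⟩ := hne
    have h1 : {x | L x = c} = (fun x => x + -x₀) ⁻¹' (LinearMap.ker L : Set E2) := by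
      ext x; simp [← h0, sub_eq_zero, ← sub_eq_add_neg]
    rw [h1, measure_preimage_add_right]
    refine Measure.addHaar_submodule _ _ fun h => hL ?_
    exact LinearMap.ker_eq_top.1 h
  · have : {x | L x = c} = ∅ := by
      ext x; simp only [mem_ofPred_eq, Set.mem_empty_iff_false, iff_false]
      exact fun h => hne ⟨x, h⟩
    rw [this, measure_empty]

/-- Almost every point lies in the interior of a lattice triangle. -/
theorem ae_interior (ε : ℝ) : ∀ᵐ x : E2, ∀ n : ℤ, x 0 ≠ ε * n ∧ x 1 ≠ ε * n ∧ x 0 - x 1 ≠ ε * n := by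
  rw [ae_all_iff]
  intro n
  have h : ∀ (L : E2 →ₗ[ℝ] ℝ), L ≠ 0 → ∀ᵐ x : E2, L x ≠ ε * n := fun L hL => by
    rw [ae_iff]; simpa using volume_hyperplane L hL _
  have p : ∀ i : Fin 2, ((proj (𝕜 := ℝ) i : E2 →L[ℝ] ℝ) : E2 →ₗ[ℝ] ℝ) ≠ 0 := by
    intro i h0
    have := LinearMap.congr_fun h0 (single i 1)
    simp at this
  have q : ((proj (𝕜 := ℝ) (0 : Fin 2) : E2 →L[ℝ] ℝ) : E2 →ₗ[ℝ] ℝ) -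
      ((proj (𝕜 := ℝ) (1 : Fin 2) : E2 →L[ℝ] ℝ) : E2 →ₗ[ℝ] ℝ) ≠ 0 := by
    intro h0
    have := LinearMap.congr_fun h0 (single 0 1)
    simp at this
  filter_upwards [h _ (p 0), h _ (p 1), h _ q] with x h0 h1 h2
  exact ⟨h0, h1, h2⟩

theorem fract_interior (hε : 0 < ε) {x : E2}
    (hx : ∀ n : ℤ, x 0 ≠ ε * n ∧ x 1 ≠ ε * n ∧ x 0 - x 1 ≠ ε * n) :
    0 < fract (x 0 / ε) ∧ 0 < fract (x 1 / ε) ∧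
      fract (x 0 / ε) ≠ fract (x 1 / ε) := by
  obtain ⟨h0, h1⟩ := coord_eq hε x
  refine ⟨lt_of_le_of_ne (fract_nonneg _) fun h => (hx (cellIndex ε x).1).1 ?_,
    lt_of_le_of_ne (fract_nonneg _) fun h => (hx (cellIndex ε x).2).2.1 ?_,
    fun h => (hx ((cellIndex ε x).1 - (cellIndex ε x).2)).2.2 ?_⟩
  · rw [← h, add_zero] at h0; exact h0
  · rw [← h, add_zero] at h1; exact h1
  · rw [← h] at h1
    push_cast
    linear_combination h0 - h1

theorem volume_square (hε : 0 < ε) (k : ℤ × ℤ) :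
    volume {x | cellIndex ε x = k} = ofReal (ε ^ 2) := by
  have h1 : {x : E2 | cellIndex ε x = k} = (@WithLp.ofLp 2 (Fin 2 → ℝ)) ⁻¹'
      (Set.pi Set.univ fun i => Set.Ico (![ε * k.1, ε * k.2] i) (![ε * k.1 + ε, ε * k.2 + ε] i)) := by
    ext x
    simp only [mem_ofPred_eq, cellIndex_eq_iff hε, Set.mem_preimage, Set.mem_pi, mem_univ,
      true_imp_iff, Fin.forall_fin_two]
    rfl
  rw [h1, (PiLp.volume_preserving_ofLp (Fin 2)).measure_preimage
    (MeasurableSet.univ_pi fun i => measurableSet_Ico).nullMeasurableSet, Real.volume_pi_Ico]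
  simp [Fin.prod_univ_two, ← ENNReal.ofReal_mul hε.le, sq]

theorem volume_low_eq_high (hε : 0 < ε) (k : ℤ × ℤ) :
    volume ({x | cellIndex ε x = k} ∩ {x | low ε x}) =
      volume ({x | cellIndex ε x = k} ∩ {x | low ε x}ᶜ) := by
  set c : E2 := !₂[ε * (2 * k.1 + 1), ε * (2 * k.2 + 1)]
  have hm : MeasurableSet ({x | cellIndex ε x = k} ∩ {x | low ε x}) :=
    (measurable_cellIndex ε (measurableSet_singleton k)).inter (measurableSet_low ε)
  have hp := (Measure.measurePreserving_sub_left (volume : Measure E2) c).measure_preimage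
    hm.nullMeasurableSet
  rw [← hp]
  refine measure_congr ?_
  filter_upwards [ae_interior ε] with x hx
  have hf := fract_interior hε hx
  obtain ⟨h0, h1⟩ := coord_eq hε x
  have f0 := fract_lt_one (x 0 / ε)
  have f1 := fract_lt_one (x 1 / ε)
  refine propext (Iff.intro ?_ ?_)
  · rintro ⟨hk, hl⟩
    simp only [mem_ofPred_eq] at hk hl
    have e := (cellIndex_eq_iff hε _ _).1 hk
    rw [low_iff hε, hk] at hl
    have c0 : (c - x) 0 = ε * (2 * k.1 + 1) - x 0 := rfl
    have c1 : (c - x) 1 = ε * (2 * k.2 + 1) - x 1 := rfl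
    rw [c0, c1] at e hl
    have hk' : cellIndex ε x = k := by
      rw [cellIndex_eq_iff hε]
      simp only [mem_Ico] at e ⊢
      have n0 := (hx (k.1 + 1)).1
      have n1 := (hx (k.2 + 1)).2.1
      push_cast at n0 n1
      refine ⟨⟨by linarith [e.1.2], lt_of_le_of_ne (by linarith [e.1.1]) fun h => n0 (by linarith)⟩,
        ⟨by linarith [e.2.2], lt_of_le_of_ne (by linarith [e.2.1]) fun h => n1 (by linarith)⟩⟩
    refine ⟨hk', ?_⟩
    simp only [Set.mem_compl_iff, mem_ofPred_eq]
    rw [low_iff hε, hk', not_le]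
    refine lt_of_le_of_ne (by linarith) fun h => (hx (k.1 - k.2)).2.2 ?_
    push_cast; linarith
  · rintro ⟨hk, hl⟩
    simp only [mem_ofPred_eq, Set.mem_compl_iff] at hk hl
    have e := (cellIndex_eq_iff hε _ _).1 hk
    rw [low_iff hε, hk, not_le] at hl
    have c0 : (c - x) 0 = ε * (2 * k.1 + 1) - x 0 := rfl
    have c1 : (c - x) 1 = ε * (2 * k.2 + 1) - x 1 := rfl
    have hk' : cellIndex ε (c - x) = k := by
      rw [cellIndex_eq_iff hε, c0, c1]
      simp only [mem_Ico] at e ⊢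
      have n0 := (hx k.1).1
      have n1 := (hx k.2).2.1
      have := lt_of_le_of_ne e.1.1 (Ne.symm n0)
      have := lt_of_le_of_ne e.2.1 (Ne.symm n1)
      refine ⟨⟨by linarith [e.1.2], by linarith⟩, ⟨by linarith [e.2.2], by linarith⟩⟩
    refine ⟨hk', ?_⟩
    simp only [mem_ofPred_eq]
    rw [low_iff hε, hk', c0, c1]
    linarith

theorem volume_real_low (hε : 0 < ε) (k : ℤ × ℤ) :
    volume.real ({x | cellIndex ε x = k} ∩ {x | low ε x}) = ε ^ 2 / 2 ∧
      volume.real ({x | cellIndex ε x = k} ∩ {x | low ε x}ᶜ) = ε ^ 2 / 2 := by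
  have h1 := measureReal_inter_add_sdiff (μ := volume) (s := {x | cellIndex ε x = k}) (measurableSet_low ε)
    (by rw [volume_square hε]; exact ENNReal.ofReal_ne_top)
  have h2 : volume.real {x : E2 | cellIndex ε x = k} = ε ^ 2 := by
    rw [measureReal_def, volume_square hε, ENNReal.toReal_ofReal (by positivity)]
  have h3 : volume.real ({x | cellIndex ε x = k} ∩ {x | low ε x}) =
      volume.real ({x | cellIndex ε x = k} ∩ {x | low ε x}ᶜ) := by
    rw [measureReal_def, measureReal_def, volume_low_eq_high hε]
  rw [Set.sdiff_eq, h2, ← h3] at h1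
  rw [← h3]
  exact ⟨by linarith, by linarith⟩

theorem volume_squares_ne_top (hε : 0 < ε) (T : Finset (ℤ × ℤ)) : volume (squares ε T) ≠ ⊤ := by
  have : squares ε T = ⋃ k ∈ T, {x | cellIndex ε x = k} := by ext x; simp [squares]
  rw [this]
  refine ((measure_biUnion_finset_le T _).trans_lt (ENNReal.sum_lt_top.2 fun k _ => ?_)).ne
  rw [volume_square hε]; exact ENNReal.ofReal_lt_top

open Classical in
/-- The integral of a function that is constant on the lattice triangles. -/
theorem integral_tri (hε : 0 < ε) (T : Finset (ℤ × ℤ)) (A B : ℤ × ℤ → ℝ) :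
    IntegrableOn (fun x => if low ε x then A (cellIndex ε x) else B (cellIndex ε x)) (squares ε T) ∧
    ∫ x in squares ε T, (if low ε x then A (cellIndex ε x) else B (cellIndex ε x)) =
      ∑ k ∈ T, ε ^ 2 / 2 * (A k + B k) := by
  have e : squares ε T = ⋃ k ∈ T, {x | cellIndex ε x = k} := by ext x; simp [squares]
  have hm : ∀ k, MeasurableSet {x : E2 | cellIndex ε x = k} := fun k =>
    measurable_cellIndex ε (measurableSet_singleton k)
  set f : E2 → ℝ := fun x => if low ε x then A (cellIndex ε x) else B (cellIndex ε x)
  have hl : ∀ k, Set.EqOn f (fun _ => A k) ({x | cellIndex ε x = k} ∩ {x | low ε x}) := by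
    rintro k x ⟨h1, h2⟩
    simp only [mem_ofPred_eq] at h1 h2
    simp [f, h1, h2]
  have hh : ∀ k, Set.EqOn f (fun _ => B k) ({x | cellIndex ε x = k} ∩ {x | low ε x}ᶜ) := by
    rintro k x ⟨h1, h2⟩
    simp only [mem_ofPred_eq, Set.mem_compl_iff] at h1 h2
    simp [f, h1, h2]
  have hlt : ∀ k (s : Set E2), volume ({x : E2 | cellIndex ε x = k} ∩ s) ≠ ⊤ := fun k s =>
    ne_top_of_le_ne_top (by rw [volume_square hε]; exact ENNReal.ofReal_ne_top)
      (measure_mono Set.inter_subset_left)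
  have il : ∀ k, IntegrableOn f ({x | cellIndex ε x = k} ∩ {x | low ε x}) := fun k =>
    (integrableOn_const (hlt k _)).congr_fun (hl k).symm ((hm k).inter (measurableSet_low ε))
  have ih : ∀ k, IntegrableOn f ({x | cellIndex ε x = k} ∩ {x | low ε x}ᶜ) := fun k =>
    (integrableOn_const (hlt k _)).congr_fun (hh k).symm ((hm k).inter (measurableSet_low ε).compl)
  have hi : ∀ k, IntegrableOn f {x | cellIndex ε x = k} := fun k => by
    have := (il k).union (ih k)
    rwa [Set.inter_union_compl] at this
  rw [e]
  refine ⟨integrableOn_finset_iUnion.2 fun k _ => hi k, ?_⟩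
  rw [integral_biUnion_finset T (fun k _ => hm k) ?_ fun k _ => hi k]
  · refine sum_congr rfl fun k _ => ?_
    rw [← integral_inter_add_sdiff (measurableSet_low ε) (hi k), Set.sdiff_eq,
      setIntegral_congr_fun ((hm k).inter (measurableSet_low ε)) (hl k),
      setIntegral_congr_fun ((hm k).inter (measurableSet_low ε).compl) (hh k),
      setIntegral_const, setIntegral_const, (volume_real_low hε k).1, (volume_real_low hε k).2]
    simp only [smul_eq_mul]; ring
  · intro a _ b _ hab
    rw [Function.onFun, Set.disjoint_left]
    intro x h1 h2
    exact hab (h1.symm.trans h2)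

end LatticeGeometry

/-! ### Piecewise affine interpolation -/

section Interpolation

/-- The piecewise affine function on the triangulated lattice `ℤ²` that is `1` at the origin and
`0` at the other lattice points. -/
def hat (a b : ℝ) : ℝ := max 0 (min (min (1 - |a|) (1 - |b|)) (1 - |a - b|))

/-- The piecewise affine interpolation of the values `v k`, `k ∈ S`. -/
def interp (S : Finset (ℤ × ℤ)) (ε : ℝ) (v : ℤ × ℤ → E2) (x : E2) : E2 :=
  ∑ k ∈ S, hat (x 0 / ε - k.1) (x 1 / ε - k.2) • v k

/-- The corners of a lattice square. -/
def corners (k : ℤ × ℤ) : Finset (ℤ × ℤ) := {k, k + (1, 0), k + (0, 1), k + (1, 1)}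

theorem hat_nonneg (a b : ℝ) : 0 ≤ hat a b := le_max_left _ _

theorem hat_le_one (a b : ℝ) : hat a b ≤ 1 := by
  refine max_le zero_le_one ((min_le_left _ _).trans ((min_le_left _ _).trans ?_))
  linarith [abs_nonneg a]

theorem abs_hat_sub_le (a b a' b' : ℝ) : |hat a b - hat a' b'| ≤ |a - a'| + |b - b'| := by
  have key : ∀ a b a' b' : ℝ, hat a b ≤ hat a' b' + (|a - a'| + |b - b'|) := by
    intro a b a' b'
    have h1 : |a'| ≤ |a| + |a - a'| := by
      have := abs_sub_abs_le_abs_sub a' a; rw [abs_sub_comm] at this; linarith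
    have h2 : |b'| ≤ |b| + |b - b'| := by
      have := abs_sub_abs_le_abs_sub b' b; rw [abs_sub_comm] at this; linarith
    have h3 : |a' - b'| ≤ |a - b| + (|a - a'| + |b - b'|) := by
      have := abs_sub_abs_le_abs_sub (a' - b') (a - b)
      have h4 := abs_sub (b - b') (a - a')
      rw [show a' - b' - (a - b) = b - b' - (a - a') by ring] at this
      linarith
    have n1 := abs_nonneg (a - a')
    have n2 := abs_nonneg (b - b')
    refine max_le (by linarith [hat_nonneg a' b']) ?_
    rw [← sub_le_iff_le_add]
    refine le_max_of_le_right (le_min (le_min ?_ ?_) ?_)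
    · linarith [min_le_left (min (1 - |a|) (1 - |b|)) (1 - |a - b|), min_le_left (1 - |a|) (1 - |b|)]
    · linarith [min_le_left (min (1 - |a|) (1 - |b|)) (1 - |a - b|), min_le_right (1 - |a|) (1 - |b|)]
    · linarith [min_le_right (min (1 - |a|) (1 - |b|)) (1 - |a - b|)]
  have h1 := key a b a' b'
  have h2 := key a' b' a b
  rw [abs_sub_comm a', abs_sub_comm b'] at h2
  exact abs_le.2 ⟨by linarith, by linarith⟩

theorem hat_eq_zero {a b : ℝ} (h : 1 ≤ |a| ∨ 1 ≤ |b| ∨ 1 ≤ |a - b|) : hat a b = 0 := by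
  refine max_eq_left ?_
  rcases h with h | h | h
  · exact (min_le_left _ _).trans ((min_le_left _ _).trans (by linarith))
  · exact (min_le_left _ _).trans ((min_le_right _ _).trans (by linarith))
  · exact (min_le_right _ _).trans (by linarith)

theorem LipBdd.interp {S : Finset (ℤ × ℤ)} {ε : ℝ} (hε : 0 < ε) (v : ℤ × ℤ → E2) :
    LipBdd (interp S ε v) := by
  refine ⟨⟨∑ k ∈ S, (2 / ε).toNNReal * ‖v k‖₊, ?_⟩, ∑ k ∈ S, ‖v k‖, fun x => ?_⟩
  · refine LipschitzWith.of_dist_le_mul fun x y => ?_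
    rw [dist_eq_norm, VarEq.interp, VarEq.interp, ← sum_sub_distrib, NNReal.coe_sum,
      Finset.sum_mul]
    refine (norm_sum_le _ _).trans (sum_le_sum fun k _ => ?_)
    rw [← sub_smul, norm_smul, norm_eq_abs, NNReal.coe_mul, Real.coe_toNNReal _ (by positivity),
      coe_nnnorm]
    have h := abs_hat_sub_le (x 0 / ε - k.1) (x 1 / ε - k.2) (y 0 / ε - k.1) (y 1 / ε - k.2)
    have e : ∀ i : Fin 2, ∀ m : ℤ, |x i / ε - m - (y i / ε - m)| ≤ dist x y / ε := by
      intro i m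
      rw [show x i / ε - m - (y i / ε - m) = (x - y) i / ε by simp; ring, abs_div, abs_of_pos hε,
        dist_eq_norm]
      exact div_le_div_of_nonneg_right (abs_apply_le _ _) hε.le
    have h2 := h.trans (add_le_add (e 0 k.1) (e 1 k.2))
    calc _ ≤ (dist x y / ε + dist x y / ε) * ‖v k‖ := mul_le_mul_of_nonneg_right h2 (norm_nonneg _)
      _ = _ := by ring
  · refine (norm_sum_le _ _).trans (sum_le_sum fun k _ => ?_)
    rw [norm_smul, norm_eq_abs, abs_of_nonneg (hat_nonneg _ _)]
    exact mul_le_of_le_one_left (norm_nonneg _) (hat_le_one _ _)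

theorem sum_corners {M : Type*} [AddCommMonoid M] (k : ℤ × ℤ) (f : ℤ × ℤ → M) :
    ∑ m ∈ corners k, f m = f k + (f (k + (1, 0)) + (f (k + (0, 1)) + f (k + (1, 1)))) := by
  have h : ∀ a b : ℤ × ℤ, k + a = k + b ↔ a = b := fun a b => add_right_inj k
  rw [corners, sum_insert, sum_insert, sum_insert, Finset.sum_singleton]
  · simp
  · simp
  · simp

variable {S : Finset (ℤ × ℤ)} {ε : ℝ} (v : ℤ × ℤ → E2)

theorem interp_eq {x : E2} {k : ℤ × ℤ} (hε : 0 < ε) (hk : cellIndex ε x = k) (hS : corners k ⊆ S) :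
    interp S ε v x =
      hat (fract (x 0 / ε)) (fract (x 1 / ε)) • v k +
      (hat (fract (x 0 / ε) - 1) (fract (x 1 / ε)) • v (k + (1, 0)) +
      (hat (fract (x 0 / ε)) (fract (x 1 / ε) - 1) • v (k + (0, 1)) +
      hat (fract (x 0 / ε) - 1) (fract (x 1 / ε) - 1) • v (k + (1, 1)))) := by
  have e0 : ∀ m : ℤ, x 0 / ε - m = fract (x 0 / ε) - ((m - k.1 : ℤ) : ℝ) := by
    intro m; rw [← hk]; simp only [cellIndex, fract]; push_cast; ring
  have e1 : ∀ m : ℤ, x 1 / ε - m = fract (x 1 / ε) - ((m - k.2 : ℤ) : ℝ) := by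
    intro m; rw [← hk]; simp only [cellIndex, fract]; push_cast; ring
  rw [interp, ← Finset.sum_subset hS, sum_corners]
  · simp only [e0, e1, Prod.fst_add, Prod.snd_add, add_sub_cancel_left]
    simp
  · intro m _ hm
    rw [hat_eq_zero, zero_smul]
    rw [e0, e1]
    have s0 := fract_nonneg (x 0 / ε)
    have s1 := fract_lt_one (x 0 / ε)
    have r0 := fract_nonneg (x 1 / ε)
    have r1 := fract_lt_one (x 1 / ε)
    by_contra! hc
    refine hm ?_
    obtain ⟨h1, h2, -⟩ := hc
    rw [abs_lt] at h1 h2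
    have a1 : -1 < m.1 - k.1 := by
      have : (-1 : ℝ) < ((m.1 - k.1 : ℤ) : ℝ) := by linarith
      exact_mod_cast this
    have a2 : m.1 - k.1 < 2 := by
      have : ((m.1 - k.1 : ℤ) : ℝ) < 2 := by linarith
      exact_mod_cast this
    have a3 : -1 < m.2 - k.2 := by
      have : (-1 : ℝ) < ((m.2 - k.2 : ℤ) : ℝ) := by linarith
      exact_mod_cast this
    have a4 : m.2 - k.2 < 2 := by
      have : ((m.2 - k.2 : ℤ) : ℝ) < 2 := by linarith
      exact_mod_cast this
    simp only [corners, Finset.mem_insert, Finset.mem_singleton, Prod.ext_iff, Prod.fst_add,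
      Prod.snd_add]
    omega

theorem hat_low {s r : ℝ} (hr : 0 ≤ r) (hs : s ≤ 1) (h : r ≤ s) :
    hat s r = 1 - s ∧ hat (s - 1) r = s - r ∧ hat s (r - 1) = 0 ∧ hat (s - 1) (r - 1) = r := by
  have a1 : |s| = s := abs_of_nonneg (hr.trans h)
  have a2 : |r| = r := abs_of_nonneg hr
  have a3 : |s - r| = s - r := abs_of_nonneg (by linarith)
  have a4 : |s - 1| = 1 - s := by rw [abs_of_nonpos (by linarith)]; ring
  have a5 : |r - 1| = 1 - r := by rw [abs_of_nonpos (by linarith)]; ring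
  have a6 : |s - 1 - r| = 1 - s + r := by rw [abs_of_nonpos (by linarith)]; ring
  have a7 : |s - (r - 1)| = 1 + s - r := by rw [abs_of_nonneg (by linarith)]; ring
  have a8 : |s - 1 - (r - 1)| = s - r := by rw [abs_of_nonneg (by linarith)]; ring
  refine ⟨?_, ?_, hat_eq_zero (Or.inr (Or.inr (by linarith))), ?_⟩
  · rw [hat, a1, a2, a3, min_eq_left (a := 1 - s) (by linarith), min_eq_left (by linarith),
      max_eq_right (by linarith)]
  · rw [hat, a4, a2, a6, min_eq_right (a := min _ _) (le_min (by linarith) (by linarith)),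
      max_eq_right (by linarith)]; ring
  · rw [hat, a4, a5, a8, min_eq_right (a := 1 - (1 - s)) (by linarith), min_eq_left (by linarith),
      max_eq_right (by linarith)]; ring

theorem hat_comm (a b : ℝ) : hat a b = hat b a := by
  rw [hat, hat, min_comm (1 - |a|), abs_sub_comm]

open Classical in
/-- On each lattice triangle, the interpolation is affine. -/
theorem interp_eq_affine {x : E2} {k : ℤ × ℤ} (hε : 0 < ε) (hk : cellIndex ε x = k)
    (hS : corners k ⊆ S) :
    interp S ε v x = if low ε x then
      v k + (x 0 / ε - k.1) • (v (k + (1, 0)) - v k) +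
        (x 1 / ε - k.2) • (v (k + (1, 1)) - v (k + (1, 0)))
    else
      v k + (x 0 / ε - k.1) • (v (k + (1, 1)) - v (k + (0, 1))) +
        (x 1 / ε - k.2) • (v (k + (0, 1)) - v k) := by
  rw [interp_eq v hε hk hS]
  have e0 : x 0 / ε - k.1 = fract (x 0 / ε) := by rw [← hk]; rfl
  have e1 : x 1 / ε - k.2 = fract (x 1 / ε) := by rw [← hk]; rfl
  have s0 := fract_nonneg (x 0 / ε)
  have s1 := (fract_lt_one (x 0 / ε)).le
  have r0 := fract_nonneg (x 1 / ε)
  have r1 := (fract_lt_one (x 1 / ε)).le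
  rw [e0, e1]
  split_ifs with h
  · obtain ⟨h1, h2, h3, h4⟩ := hat_low r0 s1 h
    rw [h1, h2, h3, h4]; module
  · rw [low, not_le] at h
    obtain ⟨h1, h2, h3, h4⟩ := hat_low s0 r1 h.le
    rw [hat_comm, hat_comm _ (fract (x 1 / ε)), hat_comm (fract (x 0 / ε)) (_ - 1),
      hat_comm (fract (x 0 / ε) - 1) (_ - 1), h1, h2, h3, h4]; module

theorem norm_interp_le_one {x : E2} (hε : 0 < ε) (hS : corners (cellIndex ε x) ⊆ S)
    (hv : ∀ k, ‖v k‖ ≤ 1) : ‖interp S ε v x‖ ≤ 1 := by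
  have s0 := fract_nonneg (x 0 / ε)
  have s1 := (fract_lt_one (x 0 / ε)).le
  have r0 := fract_nonneg (x 1 / ε)
  have r1 := (fract_lt_one (x 1 / ε)).le
  have key : hat (fract (x 0 / ε)) (fract (x 1 / ε)) +
      (hat (fract (x 0 / ε) - 1) (fract (x 1 / ε)) +
      (hat (fract (x 0 / ε)) (fract (x 1 / ε) - 1) +
      hat (fract (x 0 / ε) - 1) (fract (x 1 / ε) - 1))) = 1 := by
    rcases le_total (fract (x 1 / ε)) (fract (x 0 / ε)) with h | h
    · obtain ⟨h1, h2, h3, h4⟩ := hat_low r0 s1 h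
      rw [h1, h2, h3, h4]; ring
    · obtain ⟨h1, h2, h3, h4⟩ := hat_low s0 r1 h
      rw [hat_comm, hat_comm _ (fract (x 1 / ε)), hat_comm (fract (x 0 / ε)) (_ - 1),
        hat_comm (fract (x 0 / ε) - 1) (_ - 1), h1, h2, h3, h4]; ring
  have b : ∀ a b k, ‖hat a b • v k‖ ≤ hat a b := fun a b k => by
    rw [norm_smul, norm_eq_abs, abs_of_nonneg (hat_nonneg _ _)]
    exact mul_le_of_le_one_right (hat_nonneg _ _) (hv k)
  rw [interp_eq v hε rfl hS]
  refine le_trans ?_ key.le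
  exact (norm_add_le _ _).trans (add_le_add (b _ _ _) ((norm_add_le _ _).trans (add_le_add (b _ _ _)
    ((norm_add_le _ _).trans (add_le_add (b _ _ _) (b _ _ _))))))

/-- The distance of the interpolation to the value at the lower left corner. -/
theorem norm_interp_sub_le {x : E2} (hε : 0 < ε) {k : ℤ × ℤ} (hk : cellIndex ε x = k)
    (hS : corners k ⊆ S) :
    ‖interp S ε v x - v k‖ ≤ ‖v (k + (1, 0)) - v k‖ + ‖v (k + (1, 1)) - v (k + (1, 0))‖ +
      ‖v (k + (1, 1)) - v (k + (0, 1))‖ + ‖v (k + (0, 1)) - v k‖ := by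
  have e0 : x 0 / ε - k.1 = fract (x 0 / ε) := by rw [← hk]; rfl
  have e1 : x 1 / ε - k.2 = fract (x 1 / ε) := by rw [← hk]; rfl
  have b : ∀ (t : ℝ) (a : E2), ‖fract t • a‖ ≤ ‖a‖ := fun t a => by
    rw [norm_smul, norm_eq_abs, Int.abs_fract]
    exact mul_le_of_le_one_left (norm_nonneg _) (fract_lt_one t).le
  rw [interp_eq_affine v hε hk hS, e0, e1]
  have p1 := norm_nonneg (v (k + (1, 0)) - v k)
  have p2 := norm_nonneg (v (k + (1, 1)) - v (k + (1, 0)))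
  have p3 := norm_nonneg (v (k + (1, 1)) - v (k + (0, 1)))
  have p4 := norm_nonneg (v (k + (0, 1)) - v k)
  split_ifs
  · rw [add_assoc, add_sub_cancel_left]
    refine (norm_add_le _ _).trans ?_
    linarith [b (x 0 / ε) (v (k + (1, 0)) - v k), b (x 1 / ε) (v (k + (1, 1)) - v (k + (1, 0)))]
  · rw [add_assoc, add_sub_cancel_left]
    refine (norm_add_le _ _).trans ?_
    linarith [b (x 0 / ε) (v (k + (1, 1)) - v (k + (0, 1))), b (x 1 / ε) (v (k + (0, 1)) - v k)]

/-- Interior points of a lattice triangle have a neighbourhood in it. -/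
theorem eventually_same_triangle (hε : 0 < ε) {x : E2}
    (hx : ∀ n : ℤ, x 0 ≠ ε * n ∧ x 1 ≠ ε * n ∧ x 0 - x 1 ≠ ε * n) :
    ∀ᶠ y in 𝓝 x, cellIndex ε y = cellIndex ε x ∧ (low ε y ↔ low ε x) := by
  have c0 : Continuous fun y : E2 => y 0 := by fun_prop
  have c1 : Continuous fun y : E2 => y 1 := by fun_prop
  have hk := (cellIndex_eq_iff hε x _).1 rfl
  set k := cellIndex ε x with hkdef
  have l0 := lt_of_le_of_ne hk.1.1 (Ne.symm (hx k.1).1)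
  have l1 := lt_of_le_of_ne hk.2.1 (Ne.symm (hx k.2).2.1)
  have E1 : ∀ᶠ y in 𝓝 x, cellIndex ε y = k := by
    filter_upwards [c0.continuousAt.eventually_mem (Ioo_mem_nhds l0 hk.1.2),
      c1.continuousAt.eventually_mem (Ioo_mem_nhds l1 hk.2.2)] with y h0 h1
    exact (cellIndex_eq_iff hε y k).2 ⟨Set.Ioo_subset_Ico_self h0, Set.Ioo_subset_Ico_self h1⟩
  have hne : x 1 - ε * k.2 ≠ x 0 - ε * k.1 := fun h =>
    (hx (k.1 - k.2)).2.2 (by push_cast; linarith)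
  rcases lt_or_gt_of_ne hne with h | h
  · have E2 := (ContinuousAt.eventually_lt (f := fun y : E2 => y 1 - ε * k.2)
      (g := fun y : E2 => y 0 - ε * k.1) (by fun_prop) (by fun_prop) h)
    filter_upwards [E1, E2] with y h1 h2
    refine ⟨h1, ?_⟩
    rw [low_iff hε, low_iff hε, h1, ← hkdef]
    exact ⟨fun _ => h.le, fun _ => h2.le⟩
  · have E2 := (ContinuousAt.eventually_lt (f := fun y : E2 => y 0 - ε * k.1)
      (g := fun y : E2 => y 1 - ε * k.2) (by fun_prop) (by fun_prop) h)
    filter_upwards [E1, E2] with y h1 h2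
    refine ⟨h1, ?_⟩
    rw [low_iff hε, low_iff hε, h1, ← hkdef]
    exact ⟨fun h' => absurd h' h2.not_ge, fun h' => absurd h' h.not_ge⟩

theorem hasFDerivAt_affine (a b c : E2) (s t : ℝ) (x : E2) :
    HasFDerivAt (fun y : E2 => a + (y 0 / ε - s) • b + (y 1 / ε - t) • c)
      ((1 / ε) • (proj (𝕜 := ℝ) 0 : E2 →L[ℝ] ℝ).smulRight b +
        (1 / ε) • (proj (𝕜 := ℝ) 1 : E2 →L[ℝ] ℝ).smulRight c) x := by
  set L : E2 →L[ℝ] E2 := (1 / ε) • (proj (𝕜 := ℝ) 0 : E2 →L[ℝ] ℝ).smulRight b +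
        (1 / ε) • (proj (𝕜 := ℝ) 1 : E2 →L[ℝ] ℝ).smulRight c
  have e : (fun y : E2 => a + (y 0 / ε - s) • b + (y 1 / ε - t) • c) =
      fun y => L y + (a - s • b - t • c) := by
    ext1 y
    simp only [L, add_apply, smul_apply,
      ContinuousLinearMap.smulRight_apply, proj, PiLp.proj_apply]
    module
  rw [e]
  exact L.hasFDerivAt.add_const _

open Classical in
/-- The gradient of the interpolation. -/
theorem pd_interp (hε : 0 < ε) {x : E2}
    (hx : ∀ n : ℤ, x 0 ≠ ε * n ∧ x 1 ≠ ε * n ∧ x 0 - x 1 ≠ ε * n) {k : ℤ × ℤ}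
    (hk : cellIndex ε x = k) (hS : corners k ⊆ S) :
    pd 0 (interp S ε v) x = (1 / ε) • (if low ε x then v (k + (1, 0)) - v k
      else v (k + (1, 1)) - v (k + (0, 1))) ∧
    pd 1 (interp S ε v) x = (1 / ε) • (if low ε x then v (k + (1, 1)) - v (k + (1, 0))
      else v (k + (0, 1)) - v k) := by
  have hev := eventually_same_triangle hε hx
  rw [hk] at hev
  split_ifs with h
  · have e : interp S ε v =ᶠ[𝓝 x] fun y => v k + (y 0 / ε - k.1) • (v (k + (1, 0)) - v k) +
        (y 1 / ε - k.2) • (v (k + (1, 1)) - v (k + (1, 0))) := by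
      filter_upwards [hev] with y hy
      rw [interp_eq_affine v hε hy.1 hS, if_pos (hy.2.2 h)]
    rw [pd, pd, e.fderiv_eq, (hasFDerivAt_affine _ _ _ _ _ x).fderiv]
    simp
  · have e : interp S ε v =ᶠ[𝓝 x] fun y => v k +
        (y 0 / ε - k.1) • (v (k + (1, 1)) - v (k + (0, 1))) +
        (y 1 / ε - k.2) • (v (k + (0, 1)) - v k) := by
      filter_upwards [hev] with y hy
      rw [interp_eq_affine v hε hy.1 hS, if_neg fun h' => h (hy.2.1 h')]
    rw [pd, pd, e.fderiv_eq, (hasFDerivAt_affine _ _ _ _ _ x).fderiv]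
    simp

end Interpolation

/-! ### Lattice fields with values in the circle -/

section Edges

/-- The elastic strain on the horizontal bond at `k`. -/
def strainH (u : ℤ × ℤ → ℝ) (k : ℤ × ℤ) : ℝ := elastic u k (k + (1, 0))

/-- The elastic strain on the vertical bond at `k`. -/
def strainV (u : ℤ × ℤ → ℝ) (k : ℤ × ℤ) : ℝ := elastic u k (k + (0, 1))

/-- The sum over the four edges of a lattice square. -/
def edgeSum (f g : ℤ × ℤ → ℝ) (k : ℤ × ℤ) : ℝ := f k + g (k + (1, 0)) + f (k + (0, 1)) + g k

/-- The circulation around a lattice square. -/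
def circ (f g : ℤ × ℤ → ℝ) (k : ℤ × ℤ) : ℝ := f k + g (k + (1, 0)) - f (k + (0, 1)) - g k

theorem add_right_up (k : ℤ × ℤ) : k + (1, 0) + (0, 1) = k + (1, 1) := by
  rw [add_assoc]; rfl

theorem add_up_right (k : ℤ × ℤ) : k + (0, 1) + (1, 0) = k + (1, 1) := by
  rw [add_assoc]; rfl

theorem dislocation_eq (u : ℤ × ℤ → ℝ) (k : ℤ × ℤ) :
    dislocation u k = circ (strainH u) (strainV u) k := by
  rw [dislocation, circ, strainH, strainV, strainH, strainV, add_right_up, add_up_right]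

theorem abs_sub_nearestInt_le (t : ℝ) : |t - nearestInt t| ≤ 1 / 2 := by
  rw [nearestInt, abs_le]
  split_ifs
  · have h1 := Int.le_ceil (t - 1 / 2)
    have h2 := Int.ceil_lt_add_one (t - 1 / 2)
    constructor <;> linarith
  · have h1 := Int.floor_le (t + 1 / 2)
    have h2 := Int.lt_floor_add_one (t + 1 / 2)
    constructor <;> linarith

theorem abs_elastic_le (u : ℤ × ℤ → ℝ) (i j : ℤ × ℤ) : |elastic u i j| ≤ 1 / 2 :=
  abs_sub_nearestInt_le _

/-- The point of the circle with phase `2 π t`. -/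
def uv (t : ℝ) : E2 := !₂[cos (2 * π * t), sin (2 * π * t)]

theorem norm_uv (t : ℝ) : ‖uv t‖ = 1 := by
  have h : ‖uv t‖ ^ 2 = 1 := by
    rw [norm_sq_eq]; simp [uv]
  nlinarith [norm_nonneg (uv t), sq_nonneg (‖uv t‖ - 1)]

theorem crs_uv (s t : ℝ) : crs (uv s) (uv t) = sin (2 * π * (t - s)) := by
  rw [mul_sub, Real.sin_sub]; simp [crs, uv]; ring

theorem norm_uv_sub_sq (s t : ℝ) : ‖uv t - uv s‖ ^ 2 = 4 * sin (π * (t - s)) ^ 2 := by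
  have h1 : cos (2 * (π * (t - s))) = cos (2 * π * t) *
      cos (2 * π * s) + sin (2 * π * t) * sin (2 * π * s) := by
    rw [← Real.cos_sub]; congr 1; ring
  rw [Real.cos_two_mul, Real.cos_sq'] at h1
  rw [norm_sq_eq]
  simp only [uv, PiLp.sub_apply]
  simp
  nlinarith [Real.sin_sq_add_cos_sq (2 * π * t), Real.sin_sq_add_cos_sq (2 * π * s)]

theorem abs_sin_sub_le {x : ℝ} (hx : |x| ≤ π) : |sin x - x| ≤ x ^ 2 := by
  have key : ∀ y : ℝ, 0 ≤ y → y ≤ π → |sin y - y| ≤ y ^ 2 := by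
    intro y h0 h1
    have hs := Real.sin_le h0
    have hp := Real.sin_nonneg_of_nonneg_of_le_pi h0 h1
    rw [abs_of_nonpos (by linarith)]
    rcases le_or_gt y 1 with h | h
    · rcases h0.eq_or_lt with h0 | h0
      · rw [← h0]; simp
      · have := Real.sin_gt_sub_cube h0
        nlinarith [mul_nonneg (sq_nonneg y) (sub_nonneg.2 h)]
    · nlinarith
  rcases le_total 0 x with h | h
  · exact key x h ((le_abs_self x).trans hx)
  · have := key (-x) (by linarith) ((neg_le_abs x).trans hx)
    rw [Real.sin_neg, neg_sub_neg, abs_sub_comm] at this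
    simpa using this

variable (u : ℤ × ℤ → ℝ) (i j : ℤ × ℤ)

theorem crs_uv_elastic : crs (uv (u i)) (uv (u j)) = sin (2 * π * elastic u i j) := by
  rw [crs_uv, elastic, ← Real.sin_sub_int_mul_two_pi _ (nearestInt (u j - u i))]
  congr 1; ring

theorem norm_uv_sub_sq_elastic :
    ‖uv (u j) - uv (u i)‖ ^ 2 = 4 * sin (π * elastic u i j) ^ 2 := by
  rw [norm_uv_sub_sq, elastic, mul_sub π (u j - u i), mul_comm π (nearestInt _ : ℝ),
    Real.sin_sub_int_mul_pi, mul_pow, ← zpow_natCast ((-1 : ℝ) ^ _) 2, ← zpow_mul, mul_comm (nearestInt _)]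
  rw [zpow_mul]; simp

theorem abs_crs_uv_sub_le :
    |crs (uv (u i)) (uv (u j)) - 2 * π * elastic u i j| ≤
      4 * π ^ 2 * elastic u i j ^ 2 := by
  rw [crs_uv_elastic]
  refine (abs_sin_sub_le ?_).trans (le_of_eq (by ring))
  rw [abs_mul, abs_of_pos two_pi_pos]
  nlinarith [abs_elastic_le u i j, pi_pos]

theorem norm_uv_sub_sq_le : ‖uv (u j) - uv (u i)‖ ^ 2 ≤ 4 * π ^ 2 * elastic u i j ^ 2 := by
  rw [norm_uv_sub_sq_elastic]
  have h := Real.abs_sin_le_abs (x := π * elastic u i j)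
  have := sq_le_sq.2 h
  nlinarith

end Edges

section LatticeSums

variable {Ω : Set E2} {ε : ℝ}

theorem dist_centre_le (hε : 0 < ε) {k : ℤ × ℤ} {x : E2} (hx : x ∈ cell ε k) :
    dist x (centre ε k) ≤ ε := by
  rw [dist_eq_norm]
  refine abs_le_of_sq_le_sq' ?_ hε.le |>.2
  obtain ⟨⟨h1, h2⟩, h3, h4⟩ := hx
  rw [norm_sq_eq]
  simp [centre]
  nlinarith

theorem dist_centre_centre_le (hε : 0 < ε) (k : ℤ × ℤ) {e : ℤ × ℤ} (he : e = (1, 0) ∨ e = (0, 1)) :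
    dist (centre ε k) (centre ε (k + e)) ≤ ε := by
  rw [dist_eq_norm]
  refine abs_le_of_sq_le_sq' ?_ hε.le |>.2
  rw [norm_sq_eq]
  rcases he with rfl | rfl <;> simp [centre] <;> nlinarith

theorem LipC.abs_centre_le (hε : 0 < ε) (φ : LipC Ω) {k : ℤ × ℤ} (hk : k ∉ cells Ω ε) :
    |φ (centre ε k)| ≤ ε * ‖φ‖ := by
  obtain ⟨y, hy, hyΩ⟩ := Set.not_subset.1 hk
  have := φ.abs_sub_le (centre ε k) y
  rw [φ.eq_zero hyΩ, sub_zero, dist_comm] at this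
  nlinarith [dist_centre_le hε hy, norm_nonneg φ]

theorem LipC.abs_centre_sub_le (hε : 0 < ε) (φ : LipC Ω) (k : ℤ × ℤ) {e : ℤ × ℤ}
    (he : e = (1, 0) ∨ e = (0, 1)) :
    |φ (centre ε k) - φ (centre ε (k + e))| ≤ ε * ‖φ‖ := by
  have := φ.abs_sub_le (centre ε k) (centre ε (k + e))
  nlinarith [dist_centre_centre_le hε k he, norm_nonneg φ]

/-- Summation by parts over the lattice squares of `Ω`. -/
theorem abs_sum_diff_le (hε : 0 < ε) {T : Finset (ℤ × ℤ)} (hT : ∀ k, k ∈ T ↔ k ∈ cells Ω ε)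
    (φ : LipC Ω) (g : ℤ × ℤ → ℝ) {e : ℤ × ℤ} (he : e = (1, 0) ∨ e = (0, 1)) :
    |∑ k ∈ T, φ (centre ε k) * (g k - g (k + e))| ≤
      3 * ε * ‖φ‖ * ∑ k ∈ T, (|g k| + |g (k + e)|) := by
  have hN := norm_nonneg φ
  set F : ℤ × ℤ → ℝ := fun k => φ (centre ε k) * g k with hF
  set T' := T.map (addRightEmbedding e) with hT'
  have e1 : ∑ k ∈ T, φ (centre ε k) * (g k - g (k + e)) =
      (∑ k ∈ T, F k - ∑ k ∈ T', F k) +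
        ∑ k ∈ T, (φ (centre ε (k + e)) - φ (centre ε k)) * g (k + e) := by
    rw [hT', sum_map, ← sum_sub_distrib, ← sum_add_distrib]
    refine sum_congr rfl fun k _ => ?_
    simp only [hF, addRightEmbedding_apply]; ring
  have b3 : |∑ k ∈ T, (φ (centre ε (k + e)) - φ (centre ε k)) * g (k + e)| ≤
      ε * ‖φ‖ * ∑ k ∈ T, |g (k + e)| := by
    rw [mul_sum]
    refine (abs_sum_le_sum_abs _ _).trans (sum_le_sum fun k _ => ?_)
    rw [abs_mul, abs_sub_comm]
    exact mul_le_mul_of_nonneg_right (φ.abs_centre_sub_le hε k he) (abs_nonneg _)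
  have b1 : |∑ k ∈ T \ T', F k| ≤ 2 * ε * ‖φ‖ * ∑ k ∈ T, |g k| := by
    refine (abs_sum_le_sum_abs _ _).trans ?_
    rw [mul_sum]
    refine (sum_le_sum fun k hk => ?_).trans
      (sum_le_sum_of_subset_of_nonneg Finset.sdiff_subset fun k _ _ => by positivity)
    rw [Finset.mem_sdiff, hT', Finset.mem_map] at hk
    have hk' : k - e ∉ cells Ω ε := fun h => hk.2 ⟨k - e, (hT _).2 h, by simp⟩
    have h1 := φ.abs_centre_le hε hk'
    have h2 := φ.abs_centre_sub_le hε (k - e) he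
    rw [sub_add_cancel, abs_sub_comm] at h2
    rw [hF, abs_mul]
    refine mul_le_mul_of_nonneg_right ?_ (abs_nonneg _)
    have := abs_sub_abs_le_abs_sub (φ (centre ε k)) (φ (centre ε (k - e)))
    linarith
  have b2 : |∑ k ∈ T' \ T, F k| ≤ ε * ‖φ‖ * ∑ k ∈ T, |g (k + e)| := by
    refine (abs_sum_le_sum_abs _ _).trans ?_
    have : ∑ k ∈ T, |g (k + e)| = ∑ k ∈ T', |g k| := by
      rw [hT', sum_map]; rfl
    rw [this, mul_sum]
    refine (sum_le_sum fun k hk => ?_).trans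
      (sum_le_sum_of_subset_of_nonneg Finset.sdiff_subset fun k _ _ => by positivity)
    rw [Finset.mem_sdiff, hT] at hk
    rw [hF, abs_mul]
    exact mul_le_mul_of_nonneg_right (φ.abs_centre_le hε hk.2) (abs_nonneg _)
  rw [e1, ← Finset.sum_sdiff_sub_sum_sdiff, sum_add_distrib]
  have t1 := abs_add_le (∑ k ∈ T \ T', F k - ∑ k ∈ T' \ T, F k)
    (∑ k ∈ T, (φ (centre ε (k + e)) - φ (centre ε k)) * g (k + e))
  have t2 := abs_sub (∑ k ∈ T \ T', F k) (∑ k ∈ T' \ T, F k)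
  have p1 : 0 ≤ ε * ‖φ‖ * ∑ k ∈ T, |g k| := by positivity
  have p2 : 0 ≤ ε * ‖φ‖ * ∑ k ∈ T, |g (k + e)| := by positivity
  nlinarith

theorem abs_sum_circ_le (hε : 0 < ε) {T : Finset (ℤ × ℤ)} (hT : ∀ k, k ∈ T ↔ k ∈ cells Ω ε)
    (φ : LipC Ω) (f g : ℤ × ℤ → ℝ) :
    |∑ k ∈ T, φ (centre ε k) * circ f g k| ≤
      3 * ε * ‖φ‖ * ∑ k ∈ T, edgeSum (fun k => |f k|) (fun k => |g k|) k := by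
  have e1 : ∑ k ∈ T, φ (centre ε k) * circ f g k =
      ∑ k ∈ T, φ (centre ε k) * (f k - f (k + (0, 1))) -
        ∑ k ∈ T, φ (centre ε k) * (g k - g (k + (1, 0))) := by
    rw [← sum_sub_distrib]
    exact sum_congr rfl fun k _ => by rw [circ]; ring
  have e2 : ∑ k ∈ T, edgeSum (fun k => |f k|) (fun k => |g k|) k =
      ∑ k ∈ T, (|f k| + |f (k + (0, 1))|) + ∑ k ∈ T, (|g k| + |g (k + (1, 0))|) := by
    rw [← sum_add_distrib]
    exact sum_congr rfl fun k _ => by rw [edgeSum]; ring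
  rw [e1, e2, mul_add]
  exact (abs_sub _ _).trans (add_le_add (abs_sum_diff_le hε hT φ f (Or.inr rfl))
    (abs_sum_diff_le hε hT φ g (Or.inl rfl)))

end LatticeSums

/-! ### The interpolation of a lattice field and its singular and absolutely continuous strains -/

section InterpolatedPhase

variable {Ω : Set E2} {ε : ℝ} (u : ℤ × ℤ → ℝ)

/-- The squared length of the strain, summed over the edges of a square. -/
def cellStrain (u : ℤ × ℤ → ℝ) : ℤ × ℤ → ℝ :=
  edgeSum (fun k => strainH u k ^ 2) fun k => strainV u k ^ 2

/-- The squared increments, summed over the edges of a square. -/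
def cellIncr (v : ℤ × ℤ → E2) : ℤ × ℤ → ℝ :=
  edgeSum (fun k => ‖v (k + (1, 0)) - v k‖ ^ 2) fun k => ‖v (k + (0, 1)) - v k‖ ^ 2

theorem cellStrain_nonneg (k : ℤ × ℤ) : 0 ≤ cellStrain u k := by
  unfold cellStrain edgeSum; positivity

theorem cellIncr_nonneg (v : ℤ × ℤ → E2) (k : ℤ × ℤ) : 0 ≤ cellIncr v k := by
  unfold cellIncr edgeSum; positivity

theorem cellIncr_eq (v : ℤ × ℤ → E2) (k : ℤ × ℤ) : cellIncr v k =
    ‖v (k + (1, 0)) - v k‖ ^ 2 + ‖v (k + (1, 1)) - v (k + (1, 0))‖ ^ 2 +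
      ‖v (k + (1, 1)) - v (k + (0, 1))‖ ^ 2 + ‖v (k + (0, 1)) - v k‖ ^ 2 := by
  rw [cellIncr, edgeSum, add_right_up, add_up_right]

theorem cellIncr_uv_le (k : ℤ × ℤ) :
    cellIncr (fun k => uv (u k)) k ≤ 4 * π ^ 2 * cellStrain u k := by
  rw [cellIncr, cellStrain, edgeSum, edgeSum, mul_add, mul_add, mul_add]
  gcongr <;> exact norm_uv_sub_sq_le u _ _

variable {S T : Finset (ℤ × ℤ)}

open Classical in
/-- The integral over lattice squares, from the values on the triangles. -/
theorem integral_squares_eq (hε : 0 < ε) (T : Finset (ℤ × ℤ)) (A B : ℤ × ℤ → ℝ) {f : E2 → ℝ}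
    (hf : ∀ x : E2, (∀ n : ℤ, x 0 ≠ ε * n ∧ x 1 ≠ ε * n ∧ x 0 - x 1 ≠ ε * n) → cellIndex ε x ∈ T →
      f x = if low ε x then A (cellIndex ε x) else B (cellIndex ε x)) :
    IntegrableOn f (squares ε T) ∧ ∫ x in squares ε T, f x = ∑ k ∈ T, ε ^ 2 / 2 * (A k + B k) := by
  obtain ⟨h1, h2⟩ := integral_tri hε T A B
  have e : f =ᵐ[volume.restrict (squares ε T)]
      fun x => if low ε x then A (cellIndex ε x) else B (cellIndex ε x) := by
    filter_upwards [ae_restrict_mem (measurableSet_squares ε T),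
      ae_restrict_of_ae (ae_interior ε)] with x h h'
    exact hf x h' h
  exact ⟨h1.congr e.symm, (integral_congr_ae e).trans h2⟩

theorem integral_dens_interp (v : ℤ × ℤ → E2) (hε : 0 < ε) (hS : ∀ k ∈ T, corners k ⊆ S) :
    ∫ x in squares ε T, dens (interp S ε v) x = 1 / 2 * ∑ k ∈ T, cellIncr v k := by
  classical
  obtain ⟨-, h⟩ := integral_squares_eq hε T
    (fun k => 1 / ε ^ 2 * (‖v (k + (1, 0)) - v k‖ ^ 2 + ‖v (k + (1, 1)) - v (k + (1, 0))‖ ^ 2))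
    (fun k => 1 / ε ^ 2 * (‖v (k + (1, 1)) - v (k + (0, 1))‖ ^ 2 + ‖v (k + (0, 1)) - v k‖ ^ 2))
    (f := dens (interp S ε v)) (fun x hx hk => by
      obtain ⟨h0, h1⟩ := pd_interp v hε hx rfl (hS _ hk)
      rw [dens, h0, h1, norm_smul, norm_smul, mul_pow, mul_pow]
      have : ‖1 / ε‖ ^ 2 = 1 / ε ^ 2 := by rw [norm_eq_abs, sq_abs]; ring
      rw [this]
      split_ifs <;> ring)
  rw [h, mul_sum]
  refine sum_congr rfl fun k _ => ?_
  rw [cellIncr_eq]; field_simp; ring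

theorem integral_dist_le {f g : E2 → ℝ} {s : Set E2} (hs : MeasurableSet s) (hf : IntegrableOn f s)
    (hg : IntegrableOn g s) {h : E2 → ℝ} (hh : IntegrableOn h s)
    (H : ∀ᵐ x, x ∈ s → |f x - g x| ≤ h x) :
    |(∫ x in s, f x) - ∫ x in s, g x| ≤ ∫ x in s, h x := by
  rw [← integral_sub hf hg]
  refine (abs_integral_le_integral_abs).trans (integral_mono_ae (hf.sub hg).abs hh ?_)
  filter_upwards [ae_restrict_mem hs, ae_restrict_of_ae H] with x h1 h2 using h2 h1

theorem integrableOn_cell (hε : 0 < ε) (T : Finset (ℤ × ℤ)) (A : ℤ × ℤ → ℝ) :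
    IntegrableOn (fun x => A (cellIndex ε x)) (squares ε T) ∧
      ∫ x in squares ε T, A (cellIndex ε x) = ε ^ 2 * ∑ k ∈ T, A k := by
  obtain ⟨h1, h2⟩ := integral_squares_eq hε T A A (f := fun x => A (cellIndex ε x)) (by simp)
  refine ⟨h1, h2.trans ?_⟩
  rw [mul_sum]; exact sum_congr rfl fun k _ => by ring

theorem crs_triangle (p q r : E2) : crs (q - p) (r - q) = crs p q + crs q r - crs p r := by
  simp [crs]; ring

/-- The Jacobian of the interpolation and the dislocation measure. -/
theorem abs_integral_mjac_interp_sub_le (hε : 0 < ε) (hT : ∀ k, k ∈ T ↔ k ∈ cells Ω ε)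
    (hS : ∀ k ∈ T, corners k ⊆ S) (φ : LipC Ω) :
    |(∫ x in squares ε T, mjac (interp S ε fun k => uv (u k)) x * φ x) -
      π * ∑ k ∈ T, dislocation u k * φ (centre ε k)| ≤
      7 * π ^ 2 * ε * (∑ k ∈ T, cellStrain u k) * ‖φ‖ := by
  classical
  set v : ℤ × ℤ → E2 := fun k => uv (u k) with hv
  set w := interp S ε v with hw
  have hL : LipBdd w := LipBdd.interp hε v
  have hfin := volume_squares_ne_top hε T
  have hN := norm_nonneg φ
  obtain ⟨i1, e1⟩ := integral_squares_eq hε T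
    (fun k => 1 / ε ^ 2 * (crs (v (k + (1, 0)) - v k) (v (k + (1, 1)) - v (k + (1, 0)))) * φ (centre ε k))
    (fun k => 1 / ε ^ 2 * (crs (v (k + (1, 1)) - v (k + (0, 1))) (v (k + (0, 1)) - v k)) * φ (centre ε k))
    (f := fun x => mjac w x * φ (centre ε (cellIndex ε x))) (fun x hx hk => by
      obtain ⟨h0, h1⟩ := pd_interp v hε hx rfl (hS _ hk)
      simp only [mjac, hw, h0, h1, crs_smul_left, crs_smul_right]
      split_ifs <;> ring)
  have s1 : |(∫ x in squares ε T, mjac w x * φ x) -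
      ∫ x in squares ε T, mjac w x * φ (centre ε (cellIndex ε x))| ≤
      π ^ 2 * ε * (∑ k ∈ T, cellStrain u k) * ‖φ‖ := by
    refine (integral_dist_le (measurableSet_squares ε T) ((hL.bm_mjac.mul φ.bm).integrableOn hfin) i1
      (h := fun x => ε * ‖φ‖ * (1 / 2 * dens w x))
      (((BM.const _).mul ((BM.const _).mul hL.bm_dens)).integrableOn hfin) (ae_of_all _ ?_)).trans ?_
    · intro x _
      rw [← mul_sub, abs_mul, mul_comm]
      refine mul_le_mul ?_ (abs_mjac_le w x) (abs_nonneg _) (by positivity)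
      have := φ.abs_sub_le x (centre ε (cellIndex ε x))
      nlinarith [dist_centre_le hε (mem_cell_of_cellIndex hε (x := x) rfl)]
    · rw [integral_const_mul, integral_const_mul, integral_dens_interp v hε hS]
      have : ∑ k ∈ T, cellIncr v k ≤ 4 * π ^ 2 * ∑ k ∈ T, cellStrain u k := by
        rw [mul_sum]; exact sum_le_sum fun k _ => cellIncr_uv_le u k
      have h2 := mul_le_mul_of_nonneg_left this (by positivity : 0 ≤ ε * ‖φ‖ * (1 / 2 * (1 / 2)))
      linarith
  set gh : ℤ × ℤ → ℝ := fun k => crs (v k) (v (k + (1, 0))) - 2 * π * strainH u k with hgh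
  set gv : ℤ × ℤ → ℝ := fun k => crs (v k) (v (k + (0, 1))) - 2 * π * strainV u k with hgv
  have s2 : (∫ x in squares ε T, mjac w x * φ (centre ε (cellIndex ε x))) -
      π * ∑ k ∈ T, dislocation u k * φ (centre ε k) =
      1 / 2 * ∑ k ∈ T, φ (centre ε k) * circ gh gv k := by
    rw [e1, mul_sum, mul_sum, ← sum_sub_distrib]
    refine sum_congr rfl fun k _ => ?_
    have t2 : crs (v (k + (1, 1)) - v (k + (0, 1))) (v (k + (0, 1)) - v k) =
        - crs (v (k + (0, 1))) (v (k + (1, 1))) - crs (v k) (v (k + (0, 1))) +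
          crs (v k) (v (k + (1, 1))) := by simp [crs]; ring
    rw [crs_triangle, t2, dislocation_eq, circ, circ, hgh, hgv]
    simp only [add_right_up, add_up_right]
    field_simp; ring
  have s3 := abs_sum_circ_le hε hT φ gh gv
  have s4 : ∑ k ∈ T, edgeSum (fun k => |gh k|) (fun k => |gv k|) k ≤
      4 * π ^ 2 * ∑ k ∈ T, cellStrain u k := by
    rw [mul_sum]
    refine sum_le_sum fun k _ => ?_
    rw [cellStrain, edgeSum, edgeSum, mul_add, mul_add, mul_add]
    gcongr <;> exact abs_crs_uv_sub_le u _ _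
  have s5 := mul_le_mul_of_nonneg_left s4 (by positivity : 0 ≤ 3 * ε * ‖φ‖)
  have s6 : |(∫ x in squares ε T, mjac w x * φ (centre ε (cellIndex ε x))) -
      π * ∑ k ∈ T, dislocation u k * φ (centre ε k)| ≤
      6 * π ^ 2 * ε * (∑ k ∈ T, cellStrain u k) * ‖φ‖ := by
    rw [s2, abs_mul, abs_of_pos (by norm_num : (0 : ℝ) < 1 / 2)]
    linarith
  have := abs_sub_le (∫ x in squares ε T, mjac w x * φ x)
    (∫ x in squares ε T, mjac w x * φ (centre ε (cellIndex ε x)))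
    (π * ∑ k ∈ T, dislocation u k * φ (centre ε k))
  linarith

theorem dist_corner_le (v : ℤ × ℤ → E2) {k j : ℤ × ℤ} (hj : j ∈ corners k) :
    ‖v j - v k‖ ≤ edgeSum (fun k => ‖v (k + (1, 0)) - v k‖) (fun k => ‖v (k + (0, 1)) - v k‖) k := by
  simp only [edgeSum, add_right_up, add_up_right]
  have p1 := norm_nonneg (v (k + (1, 0)) - v k)
  have p2 := norm_nonneg (v (k + (1, 1)) - v (k + (1, 0)))
  have p3 := norm_nonneg (v (k + (1, 1)) - v (k + (0, 1)))
  have p4 := norm_nonneg (v (k + (0, 1)) - v k)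
  simp only [corners, Finset.mem_insert, Finset.mem_singleton] at hj
  rcases hj with rfl | rfl | rfl | rfl
  · rw [sub_self, norm_zero]; linarith
  · linarith
  · linarith
  · have := norm_sub_le_norm_sub_add_norm_sub (v (k + (1, 1))) (v (k + (1, 0))) (v k)
    linarith

theorem sq_edgeSum_le (f g : ℤ × ℤ → ℝ) (k : ℤ × ℤ) :
    edgeSum f g k ^ 2 ≤ 4 * edgeSum (fun k => f k ^ 2) (fun k => g k ^ 2) k := by
  simp only [edgeSum]
  nlinarith [sq_nonneg (f k - g (k + (1, 0))), sq_nonneg (f k - f (k + (0, 1))),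
    sq_nonneg (f k - g k), sq_nonneg (g (k + (1, 0)) - f (k + (0, 1))),
    sq_nonneg (g (k + (1, 0)) - g k), sq_nonneg (f (k + (0, 1)) - g k)]

theorem abs_mcur_edge_le (hε : 0 < ε) {x : E2} {k : ℤ × ℤ} (hk : cellIndex ε x = k)
    (hS : corners k ⊆ S) {i j : ℤ × ℤ} (hi : i ∈ corners k)
    (hb : elastic u i j ^ 2 ≤ cellStrain u k) :
    |crs (interp S ε (fun k => uv (u k)) x) (uv (u j) - uv (u i)) - 2 * π * elastic u i j| ≤
      20 * π ^ 2 * cellStrain u k := by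
  set v : ℤ × ℤ → E2 := fun k => uv (u k) with hv
  set M := edgeSum (fun k => ‖v (k + (1, 0)) - v k‖) (fun k => ‖v (k + (0, 1)) - v k‖) k with hM
  have h1 : ‖interp S ε v x - v k‖ ≤ M := by
    have := norm_interp_sub_le v hε hk hS
    simp only [hM, edgeSum, add_right_up, add_up_right]
    exact this
  have h2 := dist_corner_le v hi
  have h3 : ‖interp S ε v x - v i‖ ≤ 2 * M := by
    have := norm_sub_le_norm_sub_add_norm_sub (interp S ε v x) (v k) (v i)
    rw [norm_sub_rev (v k)] at this; linarith
  have hM2 : M ^ 2 ≤ 16 * π ^ 2 * cellStrain u k := by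
    have a := sq_edgeSum_le (fun k => ‖v (k + (1, 0)) - v k‖) (fun k => ‖v (k + (0, 1)) - v k‖) k
    have b := cellIncr_uv_le u k
    rw [cellIncr] at b
    linarith
  have h4 := norm_uv_sub_sq_le u i j
  have h5 := abs_crs_uv_sub_le u i j
  have e : crs (interp S ε v x) (uv (u j) - uv (u i)) - 2 * π * elastic u i j =
      crs (interp S ε v x - v i) (uv (u j) - uv (u i)) +
        (crs (uv (u i)) (uv (u j)) - 2 * π * elastic u i j) := by
    simp [crs, hv]; ring
  rw [e]
  have h6 := abs_crs_le (interp S ε v x - v i) (uv (u j) - uv (u i))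
  have h7 : ‖interp S ε v x - v i‖ * ‖uv (u j) - uv (u i)‖ ≤ 16 * π ^ 2 * cellStrain u k := by
    have hp : 4 * π ^ 2 * elastic u i j ^ 2 ≤ 4 * π ^ 2 * cellStrain u k := by gcongr
    have a := mul_le_mul_of_nonneg_right h3 (norm_nonneg (uv (u j) - uv (u i)))
    nlinarith [sq_nonneg (M / 2 - 2 * ‖uv (u j) - uv (u i)‖)]
  have h8 : 4 * π ^ 2 * elastic u i j ^ 2 ≤ 4 * π ^ 2 * cellStrain u k := by gcongr
  have := abs_add_le (crs (interp S ε v x - v i) (uv (u j) - uv (u i)))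
    (crs (uv (u i)) (uv (u j)) - 2 * π * elastic u i j)
  linarith

theorem abs_mcur_interp_sub_le (hε : 0 < ε) {x : E2}
    (hx : ∀ n : ℤ, x 0 ≠ ε * n ∧ x 1 ≠ ε * n ∧ x 0 - x 1 ≠ ε * n) {k : ℤ × ℤ}
    (hk : cellIndex ε x = k) (hS : corners k ⊆ S) (hkΩ : k ∈ cells Ω ε) (l : Fin 2) :
    |mcur l (interp S ε fun k => uv (u k)) x - 2 * π * strainField Ω ε u x l| ≤
      20 * π ^ 2 / ε * cellStrain u k := by
  classical
  obtain ⟨h0, h1⟩ := pd_interp (fun k => uv (u k)) hε hx hk hS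
  have hE : cellStrain u k = strainH u k ^ 2 + strainV u (k + (1, 0)) ^ 2 +
    strainH u (k + (0, 1)) ^ 2 + strainV u k ^ 2 := rfl
  have q1 : elastic u k (k + (1, 0)) ^ 2 ≤ cellStrain u k := by
    rw [hE, strainH]; nlinarith [sq_nonneg (strainV u (k + (1, 0))), sq_nonneg (strainH u (k + (0, 1))),
      sq_nonneg (strainV u k)]
  have q2 : elastic u (k + (1, 0)) (k + (1, 1)) ^ 2 ≤ cellStrain u k := by
    rw [hE, ← add_right_up, strainV]; nlinarith [sq_nonneg (strainH u k),
      sq_nonneg (strainH u (k + (0, 1))), sq_nonneg (strainV u k)]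
  have q3 : elastic u (k + (0, 1)) (k + (1, 1)) ^ 2 ≤ cellStrain u k := by
    rw [hE, ← add_up_right]
    have : elastic u (k + (0, 1)) (k + (0, 1) + (1, 0)) = strainH u (k + (0, 1)) := rfl
    rw [this]
    nlinarith [sq_nonneg (strainH u k), sq_nonneg (strainV u (k + (1, 0))), sq_nonneg (strainV u k)]
  have q4 : elastic u k (k + (0, 1)) ^ 2 ≤ cellStrain u k := by
    rw [hE, strainV, strainV]; nlinarith [sq_nonneg (strainH u k),
      sq_nonneg (elastic u (k + (1, 0)) (k + (1, 0) + (0, 1))), sq_nonneg (strainH u (k + (0, 1)))]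
  have c1 : k ∈ corners k := by simp [corners]
  have c2 : k + (1, 0) ∈ corners k := by simp [corners]
  have c3 : k + (0, 1) ∈ corners k := by simp [corners]
  have key : ∀ i j, i ∈ corners k → elastic u i j ^ 2 ≤ cellStrain u k →
      |1 / ε * crs (interp S ε (fun k => uv (u k)) x) (uv (u j) - uv (u i)) -
        2 * π * (1 / ε * elastic u i j)| ≤ 20 * π ^ 2 / ε * cellStrain u k := by
    intro i j hi hb
    have := abs_mcur_edge_le u hε hk hS hi hb
    rw [show ∀ a : ℝ, 1 / ε * a - 2 * π * (1 / ε * elastic u i j) =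
      1 / ε * (a - 2 * π * elastic u i j) from fun a => by ring, abs_mul, abs_of_pos (by positivity)]
    calc _ ≤ 1 / ε * (20 * π ^ 2 * cellStrain u k) := by gcongr
      _ = _ := by ring
  have hl := low_iff hε x
  rw [hk] at hl
  simp only [strainField, hk, if_pos hkΩ, ← hl]
  fin_cases l
  · simp only [Fin.zero_eta, mcur, h0, crs_smul_right]
    split_ifs
    · simpa using key _ _ c1 q1
    · simpa using key _ _ c3 q3
  · simp only [Fin.mk_one, mcur, h1, crs_smul_right]
    split_ifs
    · simpa using key _ _ c2 q2
    · simpa using key _ _ c1 q4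

end InterpolatedPhase

/-! ### Lattices in bounded domains -/

section BoundedDomain

variable {Ω : Set E2} {ε : ℝ}

theorem finite_pts (hb : IsBounded Ω) (hε : 0 < ε) : {k : ℤ × ℤ | pt ε k ∈ Ω}.Finite := by
  obtain ⟨R, hR⟩ := hb.exists_norm_le
  refine (Set.finite_Icc ((-⌈R / ε⌉, -⌈R / ε⌉) : ℤ × ℤ) (⌈R / ε⌉, ⌈R / ε⌉)).subset fun k hk => ?_
  have h := hR _ hk
  have key : ∀ m : ℤ, |ε * m| ≤ R → -⌈R / ε⌉ ≤ m ∧ m ≤ ⌈R / ε⌉ := by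
    intro m hm
    rw [abs_mul, abs_of_pos hε, mul_comm, ← le_div_iff₀ hε] at hm
    have h1 := abs_le.1 (hm.trans (Int.le_ceil _))
    constructor
    · have : ((-⌈R / ε⌉ : ℤ) : ℝ) ≤ m := by push_cast; exact h1.1
      exact_mod_cast this
    · exact_mod_cast h1.2
  have h0 := key k.1 ((abs_apply_le (pt ε k) 0).trans h)
  have h1 := key k.2 ((abs_apply_le (pt ε k) 1).trans h)
  exact ⟨⟨h0.1, h1.1⟩, ⟨h0.2, h1.2⟩⟩

theorem corner_mem_cell (hε : 0 < ε) {k j : ℤ × ℤ} (hj : j ∈ corners k) : pt ε j ∈ cell ε k := by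
  simp only [corners, Finset.mem_insert, Finset.mem_singleton] at hj
  rcases hj with rfl | rfl | rfl | rfl <;> refine ⟨⟨?_, ?_⟩, ⟨?_, ?_⟩⟩ <;>
    simp [pt, mul_add, hε.le]

theorem finite_cells (hb : IsBounded Ω) (hε : 0 < ε) : (cells Ω ε).Finite :=
  (finite_pts hb hε).subset fun k hk => hk (corner_mem_cell hε (by simp [corners]))

variable {T : Finset (ℤ × ℤ)}

theorem dislocationMeasure_eq (hT : ∀ k, k ∈ T ↔ k ∈ cells Ω ε) (u : ℤ × ℤ → ℝ) (φ : E2 → ℝ) :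
    dislocationMeasure Ω ε u φ = ∑ k ∈ T, dislocation u k * φ (centre ε k) := by
  have : cells Ω ε = (T : Set (ℤ × ℤ)) := by ext k; rw [Finset.mem_coe, hT]
  rw [dislocationMeasure, this, finsum_mem_coe_finset]

theorem squares_subset (hε : 0 < ε) (hT : ∀ k, k ∈ T ↔ k ∈ cells Ω ε) : squares ε T ⊆ Ω := by
  intro x hx
  exact (hT _).1 hx (mem_cell_of_cellIndex hε rfl)

theorem sum_squares_le (hb : IsBounded Ω) (hε : 0 < ε) (hT : ∀ k, k ∈ T ↔ k ∈ cells Ω ε) :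
    ε ^ 2 * (T.card : ℝ) ≤ volume.real Ω := by
  have h := (integrableOn_cell hε T fun _ => 1).2
  simp only [setIntegral_const, smul_eq_mul, mul_one, Finset.sum_const, nsmul_eq_mul] at h
  rw [← h]
  exact measureReal_mono (squares_subset hε hT) hb.measure_lt_top.ne

/-- A bound for the dislocation measure in terms of the strains. -/
theorem abs_dislocationMeasure_le (hb : IsBounded Ω) (hε : 0 < ε)
    (hT : ∀ k, k ∈ T ↔ k ∈ cells Ω ε) (u : ℤ × ℤ → ℝ) (φ : LipC Ω) :
    |dislocationMeasure Ω ε u φ| ≤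
      6 * √(volume.real Ω) * √(∑ k ∈ T, cellStrain u k) * ‖φ‖ := by
  rw [dislocationMeasure_eq hT]
  have h1 := abs_sum_circ_le hε hT φ (strainH u) (strainV u)
  have e : ∑ k ∈ T, dislocation u k * φ (centre ε k) =
      ∑ k ∈ T, φ (centre ε k) * circ (strainH u) (strainV u) k :=
    sum_congr rfl fun k _ => by rw [dislocation_eq, mul_comm]
  rw [e]
  refine h1.trans ?_
  set A := ∑ k ∈ T, edgeSum (fun k => |strainH u k|) (fun k => |strainV u k|) k with hA
  have h2 : A ^ 2 ≤ T.card * (4 * ∑ k ∈ T, cellStrain u k) := by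
    have a := sq_sum_le_card_mul_sum_sq (s := T)
      (f := fun k => edgeSum (fun k => |strainH u k|) (fun k => |strainV u k|) k)
    refine a.trans (mul_le_mul_of_nonneg_left ?_ (by positivity))
    rw [mul_sum]
    refine sum_le_sum fun k _ => (sq_edgeSum_le _ _ k).trans (le_of_eq ?_)
    simp only [sq_abs, cellStrain]
  have hE : 0 ≤ ∑ k ∈ T, cellStrain u k := sum_nonneg fun k _ => cellStrain_nonneg u k
  have h3 : ε * A ≤ 2 * (√(volume.real Ω) * √(∑ k ∈ T, cellStrain u k)) := by
    refine abs_le_of_sq_le_sq' ?_ (by positivity) |>.2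
    rw [mul_pow, mul_pow, mul_pow, sq_sqrt measureReal_nonneg, sq_sqrt hE]
    have := sum_squares_le hb hε hT
    calc ε ^ 2 * A ^ 2 ≤ ε ^ 2 * (T.card * (4 * ∑ k ∈ T, cellStrain u k)) := by gcongr
      _ = 2 ^ 2 * (ε ^ 2 * T.card * ∑ k ∈ T, cellStrain u k) := by ring
      _ ≤ _ := by gcongr
  have := mul_le_mul_of_nonneg_left h3 (by positivity : 0 ≤ 3 * ‖φ‖)
  linarith

theorem measurable_strainField (Ω : Set E2) (ε : ℝ) (hε : 0 < ε) (u : ℤ × ℤ → ℝ) :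
    Measurable (strainField Ω ε u) := by
  classical
  have m : ∀ A : ℤ × ℤ → E2, Measurable fun x => A (cellIndex ε x) := fun A =>
    (measurable_of_countable A).comp (measurable_cellIndex ε)
  have e : strainField Ω ε u = fun x => if cellIndex ε x ∈ cells Ω ε then
      (if low ε x then (fun k => (1 / ε) • (!₂[elastic u k (k + (1, 0)),
        elastic u (k + (1, 0)) (k + (1, 1))] : E2)) (cellIndex ε x)
      else (fun k => (1 / ε) • (!₂[elastic u (k + (0, 1)) (k + (1, 1)),
        elastic u k (k + (0, 1))] : E2)) (cellIndex ε x)) else 0 := by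
    ext1 x
    simp only [strainField, low_iff hε]
  rw [e]
  exact Measurable.ite (measurable_cellIndex ε (Set.to_countable _).measurableSet)
    (Measurable.ite (measurableSet_low ε) (m fun k => (1 / ε) • (!₂[elastic u k (k + (1, 0)),
        elastic u (k + (1, 0)) (k + (1, 1))] : E2))
      (m fun k => (1 / ε) • (!₂[elastic u (k + (0, 1)) (k + (1, 1)),
        elastic u k (k + (0, 1))] : E2))) measurable_const

theorem strainField_of_notMem (hT : ∀ k, k ∈ T ↔ k ∈ cells Ω ε) (u : ℤ × ℤ → ℝ) {x : E2}
    (hx : x ∉ squares ε T) : strainField Ω ε u x = 0 := by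
  simp only [strainField]
  rw [if_neg]
  exact fun h => hx ((hT _).2 h)

theorem norm_strainField_sq_le (hε : 0 < ε) (u : ℤ × ℤ → ℝ) (x : E2) :
    ‖strainField Ω ε u x‖ ^ 2 ≤ 1 / ε ^ 2 * cellStrain u (cellIndex ε x) := by
  simp only [strainField, cellStrain, edgeSum, strainH, strainV, add_right_up, add_up_right]
  have h : 0 ≤ 1 / ε ^ 2 := by positivity
  have e : ∀ a b : ℝ, ‖(1 / ε) • (!₂[a, b] : E2)‖ ^ 2 = 1 / ε ^ 2 * (a ^ 2 + b ^ 2) := by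
    intro a b
    rw [norm_smul, mul_pow, norm_sq_eq, norm_eq_abs, sq_abs]; simp
  split_ifs
  · rw [e]
    refine mul_le_mul_of_nonneg_left ?_ h
    nlinarith [sq_nonneg (elastic u (cellIndex ε x + (0, 1)) (cellIndex ε x + (1, 1))),
      sq_nonneg (elastic u (cellIndex ε x) (cellIndex ε x + (0, 1)))]
  · rw [e]
    refine mul_le_mul_of_nonneg_left ?_ h
    nlinarith [sq_nonneg (elastic u (cellIndex ε x) (cellIndex ε x + (1, 0))),
      sq_nonneg (elastic u (cellIndex ε x + (1, 0)) (cellIndex ε x + (1, 1)))]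
  · rw [norm_zero, zero_pow two_ne_zero]; positivity

theorem cellStrain_le_one (u : ℤ × ℤ → ℝ) (k : ℤ × ℤ) : cellStrain u k ≤ 1 := by
  have h : ∀ i j, elastic u i j ^ 2 ≤ 1 / 4 := fun i j => by
    have := abs_elastic_le u i j
    rw [← sq_abs]; nlinarith [abs_nonneg (elastic u i j)]
  simp only [cellStrain, edgeSum, strainH, strainV]
  linarith [h k (k + (1, 0)), h (k + (1, 0)) (k + (1, 0) + (0, 1)),
    h (k + (0, 1)) (k + (0, 1) + (1, 0)), h k (k + (0, 1))]

theorem bm_strainField (Ω : Set E2) (hε : 0 < ε) (u : ℤ × ℤ → ℝ) (l : Fin 2) :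
    BM fun x => strainField Ω ε u x l := by
  refine ⟨(measurable_coord l).comp (measurable_strainField Ω ε hε u), 1 / ε, fun x => ?_⟩
  refine (abs_apply_le _ _).trans (abs_le_of_sq_le_sq' ?_ (by positivity)).2
  refine (norm_strainField_sq_le hε u x).trans ?_
  have := cellStrain_le_one u (cellIndex ε x)
  calc _ ≤ 1 / ε ^ 2 * 1 := by gcongr
    _ = _ := by ring

theorem memLp_strainField (hb : IsBounded Ω) (hε : 0 < ε) (u : ℤ × ℤ → ℝ) :
    MemLp (strainField Ω ε u) 2 (volume.restrict Ω) :=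
  MemLp.of_eval_piLp fun i => (bm_strainField Ω hε u i).memLp hb.measure_lt_top.ne 2

theorem integral_norm_strainField_sq_le (hε : 0 < ε) (ho : IsOpen Ω)
    (hT : ∀ k, k ∈ T ↔ k ∈ cells Ω ε) (u : ℤ × ℤ → ℝ) :
    ∫ x in Ω, ‖strainField Ω ε u x‖ ^ 2 ≤ ∑ k ∈ T, cellStrain u k := by
  have e : ∫ x in Ω, ‖strainField Ω ε u x‖ ^ 2 = ∫ x in squares ε T, ‖strainField Ω ε u x‖ ^ 2 := by
    refine setIntegral_eq_of_subset_of_forall_sdiff_eq_zero ho.measurableSet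
      (squares_subset hε hT) fun x hx => ?_
    rw [strainField_of_notMem hT u hx.2]; simp
  obtain ⟨h1, h2⟩ := integrableOn_cell hε T fun k => 1 / ε ^ 2 * cellStrain u k
  rw [e]
  refine (integral_mono_of_nonneg (ae_of_all _ fun x => by positivity) h1
    (ae_of_all _ fun x => norm_strainField_sq_le hε u x)).trans (le_of_eq ?_)
  rw [h2, ← mul_sum]; field_simp

/-- The current of the interpolation and the strain field. -/
theorem abs_integral_mcur_interp_sub_le {S : Finset (ℤ × ℤ)} (hε : 0 < ε) (ho : IsOpen Ω)
    (hT : ∀ k, k ∈ T ↔ k ∈ cells Ω ε) (hS : ∀ k ∈ T, corners k ⊆ S) (u : ℤ × ℤ → ℝ) (φ : LipC Ω)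
    (l : Fin 2) :
    |(∫ x in squares ε T, mcur l (interp S ε fun k => uv (u k)) x * φ x) -
      ∫ x in Ω, 2 * π * strainField Ω ε u x l * φ x| ≤
      20 * π ^ 2 * ε * (∑ k ∈ T, cellStrain u k) * ‖φ‖ := by
  have e : ∫ x in Ω, 2 * π * strainField Ω ε u x l * φ x =
      ∫ x in squares ε T, 2 * π * strainField Ω ε u x l * φ x := by
    refine setIntegral_eq_of_subset_of_forall_sdiff_eq_zero ho.measurableSet
      (squares_subset hε hT) fun x hx => ?_
    rw [strainField_of_notMem hT u hx.2]; simp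
  have hL : LipBdd (interp S ε fun k => uv (u k)) := LipBdd.interp hε _
  have hfin := volume_squares_ne_top hε T
  obtain ⟨h1, h2⟩ := integrableOn_cell hε T fun k => ‖φ‖ * (20 * π ^ 2 / ε * cellStrain u k)
  rw [e]
  refine (integral_dist_le (measurableSet_squares ε T) (((hL.bm_mcur l).mul φ.bm).integrableOn hfin)
    ((((BM.const _).mul (bm_strainField Ω hε u l)).mul φ.bm).integrableOn hfin) h1 ?_).trans
    (le_of_eq ?_)
  · filter_upwards [ae_interior ε] with x hx hxT
    rw [← sub_mul, abs_mul, mul_comm]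
    exact mul_le_mul (φ.abs_le x) (abs_mcur_interp_sub_le u hε hx rfl (hS _ hxT) ((hT _).1 hxT) l)
      (abs_nonneg _) (norm_nonneg _)
  · rw [h2, ← mul_sum, ← mul_sum]; field_simp

/-- The squares with one of the given points as a corner. -/
def nodes (T : Finset (ℤ × ℤ)) : Finset (ℤ × ℤ) := T.biUnion corners

theorem corners_subset_nodes {k : ℤ × ℤ} (hk : k ∈ T) : corners k ⊆ nodes T :=
  Finset.subset_biUnion_of_mem corners hk

/-- A sum over the bonds is a sum over the horizontal and the vertical bonds. -/
theorem finsum_bonds (hb : IsBounded Ω) (hε : 0 < ε) :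
    ∃ H W : Finset (ℤ × ℤ), (∀ k, k ∈ H ↔ pt ε k ∈ Ω ∧ pt ε (k + (1, 0)) ∈ Ω) ∧
      (∀ k, k ∈ W ↔ pt ε k ∈ Ω ∧ pt ε (k + (0, 1)) ∈ Ω) ∧
      ∀ F : (ℤ × ℤ) × (ℤ × ℤ) → ℝ, ∑ᶠ b ∈ bonds Ω ε, F b =
        ∑ k ∈ H, F (k, k + (1, 0)) + ∑ k ∈ W, F (k, k + (0, 1)) := by
  have fin : ∀ e : ℤ × ℤ, {k : ℤ × ℤ | pt ε k ∈ Ω ∧ pt ε (k + e) ∈ Ω}.Finite := fun e =>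
    (finite_pts hb hε).subset fun k hk => hk.1
  refine ⟨(fin (1, 0)).toFinset, (fin (0, 1)).toFinset, by simp, by simp, fun F => ?_⟩
  have e : bonds Ω ε = (fun k => (k, k + (1, 0))) '' ((fin (1, 0)).toFinset : Set (ℤ × ℤ)) ∪
      (fun k => (k, k + (0, 1))) '' ((fin (0, 1)).toFinset : Set (ℤ × ℤ)) := by
    ext ⟨i, j⟩
    simp only [bonds, Set.mem_union, Set.mem_image, Set.Finite.coe_toFinset, mem_ofPred_eq,
      Prod.mk.injEq]
    constructor
    · rintro ⟨h1, h2, h | h⟩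
      · subst h; exact Or.inl ⟨i, ⟨h1, h2⟩, rfl, rfl⟩
      · subst h; exact Or.inr ⟨i, ⟨h1, h2⟩, rfl, rfl⟩
    · rintro (⟨k, ⟨h1, h2⟩, rfl, rfl⟩ | ⟨k, ⟨h1, h2⟩, rfl, rfl⟩)
      · exact ⟨h1, h2, Or.inl rfl⟩
      · exact ⟨h1, h2, Or.inr rfl⟩
  have inj : ∀ e : ℤ × ℤ, Function.Injective fun k : ℤ × ℤ => (k, k + e) := fun e a b h =>
    (Prod.ext_iff.1 h).1
  rw [e, finsum_mem_union, finsum_mem_image (inj _).injOn, finsum_mem_image (inj _).injOn,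
    finsum_mem_coe_finset, finsum_mem_coe_finset]
  · rw [Set.disjoint_left]
    rintro _ ⟨k, _, rfl⟩ ⟨m, _, h⟩
    simp only [Prod.mk.injEq] at h
    obtain ⟨rfl, h⟩ := h
    rw [add_right_inj] at h
    exact absurd h (by decide)
  · exact (Finset.finite_toSet _).image _
  · exact (Finset.finite_toSet _).image _

/-- Every bond is an edge of at most two squares. -/
theorem sum_edgeSum_le {f g : ℤ × ℤ → ℝ} (hf : ∀ k, 0 ≤ f k) (hg : ∀ k, 0 ≤ g k)
    {T H W : Finset (ℤ × ℤ)} (h1 : ∀ k ∈ T, k ∈ H ∧ k + (0, 1) ∈ H ∧ k ∈ W ∧ k + (1, 0) ∈ W) :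
    ∑ k ∈ T, edgeSum f g k ≤ 2 * (∑ k ∈ H, f k + ∑ k ∈ W, g k) := by
  have shift : ∀ (p : ℤ × ℤ → ℝ) (hp : ∀ k, 0 ≤ p k) (P : Finset (ℤ × ℤ)) (e : ℤ × ℤ),
      (∀ k ∈ T, k + e ∈ P) → ∑ k ∈ T, p (k + e) ≤ ∑ k ∈ P, p k := by
    intro p hp P e he
    have : ∑ k ∈ T, p (k + e) = ∑ k ∈ T.map (addRightEmbedding e), p k := by
      rw [sum_map]; rfl
    rw [this]
    refine sum_le_sum_of_subset_of_nonneg ?_ fun k _ _ => hp k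
    intro j hj
    obtain ⟨k, hk, rfl⟩ := Finset.mem_map.1 hj
    exact he k hk
  have a1 := shift f hf H 0 fun k hk => by simpa using (h1 k hk).1
  have a2 := shift f hf H (0, 1) fun k hk => (h1 k hk).2.1
  have a3 := shift g hg W 0 fun k hk => by simpa using (h1 k hk).2.2.1
  have a4 := shift g hg W (1, 0) fun k hk => (h1 k hk).2.2.2
  simp only [add_zero] at a1 a3
  simp only [edgeSum, sum_add_distrib]
  linarith

theorem cells_bonds (hε : 0 < ε) {k : ℤ × ℤ} (hk : k ∈ cells Ω ε) :
    (pt ε k ∈ Ω ∧ pt ε (k + (1, 0)) ∈ Ω) ∧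
    (pt ε (k + (0, 1)) ∈ Ω ∧ pt ε (k + (0, 1) + (1, 0)) ∈ Ω) ∧
    (pt ε k ∈ Ω ∧ pt ε (k + (0, 1)) ∈ Ω) ∧
    (pt ε (k + (1, 0)) ∈ Ω ∧ pt ε (k + (1, 0) + (0, 1)) ∈ Ω) := by
  rw [add_up_right, add_right_up]
  have h0 := hk (corner_mem_cell hε (j := k) (by simp [corners]))
  have h1 := hk (corner_mem_cell hε (j := k + (1, 0)) (by simp [corners]))
  have h2 := hk (corner_mem_cell hε (j := k + (0, 1)) (by simp [corners]))
  have h3 := hk (corner_mem_cell hε (j := k + (1, 1)) (by simp [corners]))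
  exact ⟨⟨h0, h1⟩, ⟨h2, h3⟩, ⟨h0, h2⟩, ⟨h1, h3⟩⟩

theorem sum_cells_le (hb : IsBounded Ω) (hε : 0 < ε) (hT : ∀ k, k ∈ T ↔ k ∈ cells Ω ε)
    {F : (ℤ × ℤ) × (ℤ × ℤ) → ℝ} (hF : ∀ b, 0 ≤ F b) :
    ∑ k ∈ T, edgeSum (fun k => F (k, k + (1, 0))) (fun k => F (k, k + (0, 1))) k ≤
      2 * ∑ᶠ b ∈ bonds Ω ε, F b := by
  obtain ⟨H, W, hH, hW, h⟩ := finsum_bonds hb hε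
  rw [h]
  refine sum_edgeSum_le (fun k => hF _) (fun k => hF _) fun k hk => ?_
  rw [hH, hH, hW, hW]
  exact cells_bonds hε ((hT k).1 hk)

theorem sum_cellStrain_le (hb : IsBounded Ω) (hε : 0 < ε)
    (hT : ∀ k, k ∈ T ↔ k ∈ cells Ω ε) (u : ℤ × ℤ → ℝ) :
    ∑ k ∈ T, cellStrain u k ≤ 4 * sdEnergy Ω ε u := by
  have := sum_cells_le hb hε hT (F := fun b => elastic u b.1 b.2 ^ 2) fun b => sq_nonneg _
  rw [sdEnergy]
  refine (this.trans (le_of_eq ?_))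
  ring

end BoundedDomain

/-! ### Admissible configurations -/

section Admissible

variable {Ω : Set E2} {ε : ℝ}

/-- `p` is realised by a displacement of normalised energy `e`. -/
def AdmSD (Ω : Set E2) (ε : ℝ) (p : PhaseSpace Ω) (e : ℝ) : Prop :=
  ∃ u : ℤ × ℤ → ℝ, (p.field =ᵐ[volume.restrict Ω]
      fun x => (1 / |log ε|) • (2 * π) • strainField Ω ε u x) ∧
    (∀ φ : LipC Ω, p.1 φ = (1 / |log ε|) * dislocationMeasure Ω ε u φ) ∧
    e = (4 * π ^ 2 / |log ε| ^ 2) * sdEnergy Ω ε u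

/-- `p` is realised by a spin field of normalised energy `e`. -/
def AdmXY (Ω : Set E2) (ε : ℝ) (p : PhaseSpace Ω) (e : ℝ) : Prop :=
  ∃ v : ℤ × ℤ → Circle, (p.field =ᵐ[volume.restrict Ω]
      fun x => (1 / |log ε|) • vortexCurrent Ω ε v x) ∧
    (∀ φ : LipC Ω, p.1 φ = (1 / |log ε|) * vorticityMeasure Ω ε v φ) ∧
    e = (1 / |log ε| ^ 2) * xyEnergy Ω ε v

/-- `p` is realised by an order parameter of normalised energy `e`. -/
def AdmGL (Ω : Set E2) (ε : ℝ) (p : PhaseSpace Ω) (e : ℝ) : Prop :=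
  ∃ w : H1Field Ω, w.InBall ∧ (p.field =ᵐ[volume.restrict Ω]
      fun x => (1 / |log ε|) • w.current x) ∧
    (∀ φ : LipC Ω, p.1 φ = (1 / (π * |log ε|)) * ∫ x in Ω, w.jac x * φ x) ∧
    e = (1 / |log ε| ^ 2) * w.energy ε

theorem lt_add_of_le {a : ℝ≥0∞} {C η : ℝ≥0} (h : a ≤ C) (hη : 0 < η) : a < a + η :=
  ENNReal.lt_add_right (ne_top_of_le_ne_top ENNReal.coe_ne_top h) (by simpa using hη.ne')

theorem exists_admSD (ε : ℝ) (p : PhaseSpace Ω) (C η : ℝ≥0) (h : enrichedSD Ω ε p ≤ C) (hη : 0 < η) :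
    ∃ e, AdmSD Ω ε p e ∧ ofReal e ≤ enrichedSD Ω ε p + η := by
  obtain ⟨t, ht⟩ : ∃ t, t = enrichedSD Ω ε p + η := ⟨_, rfl⟩
  have h1 := lt_add_of_le h hη
  rw [← ht] at h1 ⊢
  simp only [enrichedSD, iInf_lt_iff] at h1
  obtain ⟨u, h2, h3, h4⟩ := h1
  exact ⟨_, ⟨u, h2, h3, rfl⟩, h4.le⟩

theorem exists_admXY (ε : ℝ) (p : PhaseSpace Ω) (C η : ℝ≥0) (h : enrichedXY Ω ε p ≤ C) (hη : 0 < η) :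
    ∃ e, AdmXY Ω ε p e ∧ ofReal e ≤ enrichedXY Ω ε p + η := by
  obtain ⟨t, ht⟩ : ∃ t, t = enrichedXY Ω ε p + η := ⟨_, rfl⟩
  have h1 := lt_add_of_le h hη
  rw [← ht] at h1 ⊢
  simp only [enrichedXY, iInf_lt_iff] at h1
  obtain ⟨u, h2, h3, h4⟩ := h1
  exact ⟨_, ⟨u, h2, h3, rfl⟩, h4.le⟩

theorem exists_admGL (ε : ℝ) (p : PhaseSpace Ω) (C η : ℝ≥0) (h : enrichedGL Ω ε p ≤ C) (hη : 0 < η) :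
    ∃ e, AdmGL Ω ε p e ∧ ofReal e ≤ enrichedGL Ω ε p + η := by
  obtain ⟨t, ht⟩ : ∃ t, t = enrichedGL Ω ε p + η := ⟨_, rfl⟩
  have h1 := lt_add_of_le h hη
  rw [← ht] at h1 ⊢
  simp only [enrichedGL, iInf_lt_iff] at h1
  obtain ⟨u, h2, h3, h4, h5⟩ := h1
  exact ⟨_, ⟨u, h2, h3, h4, rfl⟩, h5.le⟩

theorem enrichedSD_le (ε : ℝ) (p : PhaseSpace Ω) (e : ℝ) (h : AdmSD Ω ε p e) :
    enrichedSD Ω ε p ≤ ofReal e := by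
  obtain ⟨u, h1, h2, rfl⟩ := h
  exact iInf_le_of_le u (iInf₂_le h1 h2)

theorem enrichedXY_le (ε : ℝ) (p : PhaseSpace Ω) (e : ℝ) (h : AdmXY Ω ε p e) :
    enrichedXY Ω ε p ≤ ofReal e := by
  obtain ⟨u, h1, h2, rfl⟩ := h
  exact iInf_le_of_le u (iInf₂_le h1 h2)

theorem enrichedGL_le (ε : ℝ) (p : PhaseSpace Ω) (e : ℝ) (h : AdmGL Ω ε p e) :
    enrichedGL Ω ε p ≤ ofReal e := by
  obtain ⟨u, h0, h1, h2, rfl⟩ := h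
  exact iInf_le_of_le u (iInf_le_of_le h0 (iInf₂_le h1 h2))

theorem exists_phaseSpace {f : E2 → E2} (hf : MemLp f 2 (volume.restrict Ω)) (Λ : LipC Ω →ₗ[ℝ] ℝ)
    {C : ℝ} (hΛ : ∀ φ, |Λ φ| ≤ C * ‖φ‖) :
    ∃ q : PhaseSpace Ω, q.field =ᵐ[volume.restrict Ω] f ∧ ∀ φ : LipC Ω, q.1 φ = Λ φ := by
  refine ⟨(Λ.mkContinuous C hΛ, toWeakSpace ℝ (L2 Ω) (hf.toLp f)), ?_, fun φ => rfl⟩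
  rw [PhaseSpace.field, LinearEquiv.symm_apply_apply]
  exact hf.coeFn_toLp

theorem norm_field_sq (p : PhaseSpace Ω) : ‖p.field‖ ^ 2 = ∫ x in Ω, ‖p.field x‖ ^ 2 := by
  rw [← real_inner_self_eq_norm_sq, L2.inner_def]
  refine integral_congr_ae (ae_of_all _ fun x => ?_)
  exact real_inner_self_eq_norm_sq _

theorem norm_field_le (p : PhaseSpace Ω) {f : E2 → E2} (hf : p.field =ᵐ[volume.restrict Ω] f) {B : ℝ}
    (hB : 0 ≤ B) (h : ∫ x in Ω, ‖f x‖ ^ 2 ≤ B ^ 2) : ‖p.field‖ ≤ B := by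
  refine abs_le_of_sq_le_sq' ?_ hB |>.2
  rw [norm_field_sq]
  refine (integral_congr_ae ?_).trans_le h
  filter_upwards [hf] with x hx
  rw [hx]

theorem integral_field_sub_mul (p q : PhaseSpace Ω) {f g : E2 → E2}
    (hf : p.field =ᵐ[volume.restrict Ω] f) (hg : q.field =ᵐ[volume.restrict Ω] g) (l : Fin 2)
    (φ : LipC Ω) :
    ∫ x in Ω, (p.field x l - q.field x l) * φ x = (∫ x in Ω, f x l * φ x) - ∫ x in Ω, g x l * φ x := by
  have ef : (fun x => p.field x l * φ x) =ᵐ[volume.restrict Ω] fun x => f x l * φ x := by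
    filter_upwards [hf] with x hx; rw [hx]
  have eg : (fun x => q.field x l * φ x) =ᵐ[volume.restrict Ω] fun x => g x l * φ x := by
    filter_upwards [hg] with x hx; rw [hx]
  rw [← integral_congr_ae ef, ← integral_congr_ae eg,
    ← integral_sub (integrable_field_mul p l φ) (integrable_field_mul q l φ)]
  simp only [sub_mul]

theorem exists_admSD_of_displacement (hb : IsBounded Ω) (hε : 0 < ε) (u : ℤ × ℤ → ℝ) :
    ∃ q : PhaseSpace Ω, (q.field =ᵐ[volume.restrict Ω]
      fun x => (1 / |log ε|) • (2 * π) • strainField Ω ε u x) ∧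
    (∀ φ : LipC Ω, q.1 φ = (1 / |log ε|) * dislocationMeasure Ω ε u φ) := by
  have hT : ∀ k, k ∈ (finite_cells hb hε).toFinset ↔ k ∈ cells Ω ε := fun k => by simp
  set T := (finite_cells hb hε).toFinset
  set Λ : LipC Ω →ₗ[ℝ] ℝ :=
    { toFun := fun φ => (1 / |log ε|) * dislocationMeasure Ω ε u φ
      map_add' := fun φ ψ => by
        simp only [dislocationMeasure_eq hT, LipC.add_apply, mul_add, sum_add_distrib]
      map_smul' := fun c φ => by
        simp only [dislocationMeasure_eq hT, LipC.smul_apply, RingHom.id_apply, smul_eq_mul,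
          mul_sum]
        exact sum_congr rfl fun k _ => by ring }
  refine exists_phaseSpace (((memLp_strainField hb hε u).const_smul (2 * π)).const_smul
    (1 / |log ε|)) Λ (C := 1 / |log ε| * (6 * √(volume.real Ω) *
      √(∑ k ∈ T, cellStrain u k))) fun φ => ?_
  change |(1 / |log ε|) * dislocationMeasure Ω ε u φ| ≤ _
  rw [abs_mul, abs_of_nonneg (by positivity), mul_assoc]
  exact mul_le_mul_of_nonneg_left (abs_dislocationMeasure_le hb hε hT u φ) (by positivity)

theorem LipBdd.exists_admGL {V : E2 → E2} (hV : LipBdd V) (hb : IsBounded Ω)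
    (h1 : ∀ x ∈ Ω, ‖V x‖ ≤ 1) (ho : IsOpen Ω) (ε : ℝ) :
    ∃ q : PhaseSpace Ω, (q.field =ᵐ[volume.restrict Ω]
        fun x => (1 / |log ε|) • (hV.toH1 hb : H1Field Ω).current x) ∧
      (∀ φ : LipC Ω, q.1 φ = (1 / (π * |log ε|)) * ∫ x in Ω, mjac V x * φ x) ∧
      AdmGL Ω ε q ((1 / |log ε| ^ 2) *
        (1 / 2 * (∫ x in Ω, dens V x) + 1 / ε ^ 2 * ∫ x in Ω, (1 - ‖V x‖) ^ 2)) := by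
  have hfin : volume Ω ≠ ⊤ := hb.measure_lt_top.ne
  have hi : ∀ φ : LipC Ω, IntegrableOn (fun x => mjac V x * φ x) Ω := fun φ =>
    (hV.bm_mjac.mul φ.bm).integrableOn hfin
  set Λ : LipC Ω →ₗ[ℝ] ℝ :=
    { toFun := fun φ => (1 / (π * |log ε|)) * ∫ x in Ω, mjac V x * φ x
      map_add' := fun φ ψ => by
        simp only [LipC.add_apply, mul_add]
        rw [integral_add (hi φ) (hi ψ), mul_add]
      map_smul' := fun c φ => by
        simp only [LipC.smul_apply, RingHom.id_apply, smul_eq_mul]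
        simp only [mul_left_comm _ c, integral_const_mul] }
  have hm : MemLp (fun x => (1 / |log ε|) • (hV.toH1 hb : H1Field Ω).current x) 2
      (volume.restrict Ω) := by
    have hc : MemLp (hV.toH1 hb : H1Field Ω).current 2 (volume.restrict Ω) := by
      refine MemLp.of_eval_piLp fun l => ?_
      simp only [hV.toH1_current hb]
      exact (hV.bm_mcur l).memLp hfin 2
    exact hc.const_smul (1 / |log ε|)
  obtain ⟨q, h2, h3⟩ := exists_phaseSpace hm Λ
    (C := 1 / (π * |log ε|) * ∫ x in Ω, |mjac V x|) fun φ => by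
      change |(1 / (π * |log ε|)) * ∫ x in Ω, mjac V x * φ x| ≤ _
      have hp := pi_pos
      rw [abs_mul, abs_of_nonneg (by positivity), mul_assoc]
      refine mul_le_mul_of_nonneg_left ?_ (by positivity)
      rw [← integral_mul_const]
      refine (abs_integral_le_integral_abs).trans (integral_mono (hi φ).abs
        ((hV.bm_mjac.abs.mul (BM.const _)).integrableOn hfin) fun x => ?_)
      simp only [abs_mul]
      exact mul_le_mul_of_nonneg_left (φ.abs_le x) (abs_nonneg _)
  refine ⟨q, h2, h3, hV.toH1 hb, ?_, h2, fun φ => ?_, by rw [hV.toH1_energy hb]⟩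
  · exact (ae_restrict_iff' ho.measurableSet).2 (ae_of_all _ h1)
  · rw [h3 φ]
    simp only [hV.toH1_jac hb]
    rfl

end Admissible

/-! ### Spins and displacements -/

section Spins

variable {Ω : Set E2} {ε : ℝ}

theorem uv_displacement (v : ℤ × ℤ → Circle) (k : ℤ × ℤ) :
    uv (displacement v k) = !₂[(v k : ℂ).re, (v k : ℂ).im] := by
  have h : 2 * π * displacement v k = phase (v k) := by
    rw [displacement]; field_simp
  have hn : ‖(v k : ℂ)‖ = 1 := Circle.norm_coe (v k)
  have e : phase (v k) = Complex.arg (v k : ℂ) -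
      (toIcoDiv two_pi_pos 0 (Complex.arg (v k : ℂ)) : ℝ) * (2 * π) := by
    rw [phase, self_sub_toIcoDiv_mul]
  have h1 := Complex.norm_mul_cos_arg (v k : ℂ)
  have h2 := Complex.norm_mul_sin_arg (v k : ℂ)
  rw [hn, one_mul] at h1 h2
  rw [uv, h, e, Real.cos_sub_int_mul_two_pi, Real.sin_sub_int_mul_two_pi, h1, h2]

theorem norm_spin_sub_sq (v : ℤ × ℤ → Circle) (i j : ℤ × ℤ) :
    ‖(v i : ℂ) - (v j : ℂ)‖ ^ 2 = ‖uv (displacement v j) - uv (displacement v i)‖ ^ 2 := by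
  rw [uv_displacement, uv_displacement, norm_sq_eq, Complex.sq_norm, Complex.normSq_apply]
  simp; ring

/-- The spins with phases `2 π u`. -/
def spin (u : ℤ × ℤ → ℝ) (k : ℤ × ℤ) : Circle := Circle.exp (2 * π * u k)

theorem uv_displacement_spin (u : ℤ × ℤ → ℝ) (k : ℤ × ℤ) :
    uv (displacement (spin u) k) = uv (u k) := by
  rw [uv_displacement, spin, Circle.coe_exp, Complex.exp_ofReal_mul_I_re,
    Complex.exp_ofReal_mul_I_im, uv]

theorem elastic_sq_le (u : ℤ × ℤ → ℝ) (i j : ℤ × ℤ) :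
    16 * elastic u i j ^ 2 ≤ ‖uv (u j) - uv (u i)‖ ^ 2 := by
  rw [norm_uv_sub_sq_elastic]
  set b := elastic u i j
  have hb : |b| ≤ 1 / 2 := abs_elastic_le u i j
  have hp := pi_pos
  have h1 := Real.mul_le_sin (x := π * |b|) (by positivity) (by nlinarith)
  have e : 2 / π * (π * |b|) = 2 * |b| := by field_simp
  have e2 : sin (π * b) ^ 2 = sin (π * |b|) ^ 2 := by
    rcases abs_choice b with h | h
    · rw [h]
    · rw [h, mul_neg, Real.sin_neg, neg_sq]
  rw [e] at h1
  rw [e2, ← sq_abs b]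
  have : (2 * |b|) ^ 2 ≤ sin (π * |b|) ^ 2 := by gcongr
  linarith

theorem finsum_bonds_le (hb : IsBounded Ω) (hε : 0 < ε)
    {F G : (ℤ × ℤ) × (ℤ × ℤ) → ℝ} (h : ∀ b, F b ≤ G b) :
    ∑ᶠ b ∈ bonds Ω ε, F b ≤ ∑ᶠ b ∈ bonds Ω ε, G b := by
  obtain ⟨H, W, -, -, e⟩ := finsum_bonds hb hε
  rw [e, e]
  exact add_le_add (sum_le_sum fun k _ => h _) (sum_le_sum fun k _ => h _)

theorem finsum_bonds_mul (hb : IsBounded Ω) (hε : 0 < ε)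
    (F : (ℤ × ℤ) × (ℤ × ℤ) → ℝ) (c : ℝ) :
    ∑ᶠ b ∈ bonds Ω ε, c * F b = c * ∑ᶠ b ∈ bonds Ω ε, F b := by
  obtain ⟨H, W, -, -, e⟩ := finsum_bonds hb hε
  rw [e, e, mul_add, mul_sum, mul_sum]

theorem sdEnergy_displacement_le (hb : IsBounded Ω) (hε : 0 < ε) (v : ℤ × ℤ → Circle) :
    16 * sdEnergy Ω ε (displacement v) ≤ xyEnergy Ω ε v := by
  rw [sdEnergy, xyEnergy, mul_left_comm, ← finsum_bonds_mul hb hε]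
  refine mul_le_mul_of_nonneg_left (finsum_bonds_le hb hε fun b => ?_) (by norm_num)
  rw [norm_spin_sub_sq]
  exact elastic_sq_le _ _ _

theorem xyEnergy_spin_le (hb : IsBounded Ω) (hε : 0 < ε) (u : ℤ × ℤ → ℝ) :
    xyEnergy Ω ε (spin u) ≤ 4 * π ^ 2 * sdEnergy Ω ε u := by
  rw [sdEnergy, xyEnergy, mul_left_comm, ← finsum_bonds_mul hb hε _ (4 * π ^ 2)]
  refine mul_le_mul_of_nonneg_left (finsum_bonds_le hb hε fun b => ?_) (by norm_num)
  rw [norm_spin_sub_sq, uv_displacement_spin, uv_displacement_spin]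
  exact norm_uv_sub_sq_le _ _ _

theorem sdEnergy_nonneg (hb : IsBounded Ω) (hε : 0 < ε) (u : ℤ × ℤ → ℝ) :
    0 ≤ sdEnergy Ω ε u := by
  obtain ⟨H, W, -, -, e⟩ := finsum_bonds hb hε
  rw [sdEnergy, e fun b => elastic u b.1 b.2 ^ 2]; positivity

theorem xyEnergy_nonneg (hb : IsBounded Ω) (hε : 0 < ε) (v : ℤ × ℤ → Circle) :
    0 ≤ xyEnergy Ω ε v := by
  linarith [sdEnergy_displacement_le hb hε v, sdEnergy_nonneg hb hε (displacement v)]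

/-- Two displacements with the same spins have nearly the same dislocations and strains. -/
theorem abs_sub_of_same_spin (ho : IsOpen Ω) (hε : 0 < ε)
    {T : Finset (ℤ × ℤ)} (hT : ∀ k, k ∈ T ↔ k ∈ cells Ω ε) {u u' : ℤ × ℤ → ℝ}
    (h : ∀ k, uv (u k) = uv (u' k)) (φ : LipC Ω) :
    |dislocationMeasure Ω ε u φ - dislocationMeasure Ω ε u' φ| ≤
      7 * π * ε * (∑ k ∈ T, cellStrain u k + ∑ k ∈ T, cellStrain u' k) * ‖φ‖ ∧
    ∀ l, |(∫ x in Ω, 2 * π * strainField Ω ε u x l * φ x) -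
      ∫ x in Ω, 2 * π * strainField Ω ε u' x l * φ x| ≤
      20 * π ^ 2 * ε * (∑ k ∈ T, cellStrain u k + ∑ k ∈ T, cellStrain u' k) * ‖φ‖ := by
  have e : (fun k => uv (u k)) = fun k => uv (u' k) := funext h
  have hS : ∀ k ∈ T, corners k ⊆ nodes T := fun k hk => corners_subset_nodes hk
  constructor
  · have a := abs_integral_mjac_interp_sub_le u hε hT hS φ
    have b := abs_integral_mjac_interp_sub_le u' hε hT hS φ
    rw [e] at a
    rw [dislocationMeasure_eq hT, dislocationMeasure_eq hT]
    have t := abs_sub_le (π * ∑ k ∈ T, dislocation u k * φ (centre ε k))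
      (∫ x in squares ε T, mjac (interp (nodes T) ε fun k => uv (u' k)) x * φ x)
      (π * ∑ k ∈ T, dislocation u' k * φ (centre ε k))
    rw [abs_sub_comm] at a
    rw [← mul_sub, abs_mul, abs_of_pos pi_pos] at t
    refine le_of_mul_le_mul_left ?_ pi_pos
    refine (t.trans (add_le_add a b)).trans (le_of_eq (by ring))
  · intro l
    have a := abs_integral_mcur_interp_sub_le hε ho hT hS u φ l
    have b := abs_integral_mcur_interp_sub_le hε ho hT hS u' φ l
    rw [e] at a
    rw [abs_sub_comm] at a
    have t := abs_sub_le (∫ x in Ω, 2 * π * strainField Ω ε u x l * φ x)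
      (∫ x in squares ε T, mcur l (interp (nodes T) ε fun k => uv (u' k)) x * φ x)
      (∫ x in Ω, 2 * π * strainField Ω ε u' x l * φ x)
    linarith

theorem integral_lattice_field_mul (L : ℝ) (u : ℤ × ℤ → ℝ) (l : Fin 2) (φ : E2 → ℝ) :
    ∫ x in Ω, ((1 / L) • (2 * π) • strainField Ω ε u x) l * φ x =
      1 / L * ∫ x in Ω, 2 * π * strainField Ω ε u x l * φ x := by
  rw [← integral_const_mul]
  congr 1; ext x
  simp only [PiLp.smul_apply, smul_eq_mul]; ring

theorem norm_lattice_field_le (ho : IsOpen Ω) (hb : IsBounded Ω) (hε : 0 < ε)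
    (p : PhaseSpace Ω) {L : ℝ} {u : ℤ × ℤ → ℝ} (hp : p.field =ᵐ[volume.restrict Ω]
      fun x => (1 / L) • (2 * π) • strainField Ω ε u x) {B : ℝ} (hB : 0 ≤ B)
    (h : 16 * π ^ 2 / L ^ 2 * sdEnergy Ω ε u ≤ B ^ 2) : ‖p.field‖ ≤ B := by
  have hT : ∀ k, k ∈ (finite_cells hb hε).toFinset ↔ k ∈ cells Ω ε := fun k => by simp
  refine norm_field_le p hp hB (le_trans ?_ h)
  have e : ∀ x, ‖(1 / L) • (2 * π) • strainField Ω ε u x‖ ^ 2 =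
      4 * π ^ 2 / L ^ 2 * ‖strainField Ω ε u x‖ ^ 2 := by
    intro x
    rw [norm_smul, norm_smul, mul_pow, mul_pow, norm_eq_abs, norm_eq_abs, sq_abs, sq_abs]
    ring
  simp only [e]
  rw [integral_const_mul]
  have := (integral_norm_strainField_sq_le hε ho hT u).trans (sum_cellStrain_le hb hε hT u)
  calc _ ≤ 4 * π ^ 2 / L ^ 2 * (4 * sdEnergy Ω ε u) := by gcongr
    _ = _ := by ring

theorem tendsto_mul_log_zero : Tendsto (fun ε : ℝ => ε * |log ε|) (𝓝[>] 0) (𝓝 0) := by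
  have h := tendsto_log_mul_rpow_nhdsGT_zero zero_lt_one
  have h2 := h.abs
  rw [abs_zero] at h2
  refine h2.congr' ?_
  filter_upwards [self_mem_nhdsWithin] with ε hε
  rw [Real.rpow_one, abs_mul, abs_of_pos (mem_Ioi.1 hε), mul_comm]

theorem pi_sq_le_ten : π ^ 2 ≤ 10 := by
  have := pi_lt_d2; nlinarith [pi_pos]

theorem admLE_SD_XY (ho : IsOpen Ω) (hb : IsBounded Ω) :
    AdmLE (AdmSD Ω) (AdmXY Ω) id := by
  intro C
  refine ⟨fun ε => 200 * |C| * (ε * |log ε|), 6 * √|C|, ?_, ?_⟩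
  · simpa using tendsto_mul_log_zero.const_mul (200 * |C|)
  have ev : ∀ᶠ ε in 𝓝[>] (0 : ℝ), ε < 1 := nhdsWithin_le_nhds (eventually_lt_nhds one_pos)
  filter_upwards [self_mem_nhdsWithin, ev] with ε hε hε1
  rintro p e ⟨u, hp1, hp2, rfl⟩ he
  rw [mem_Ioi] at hε
  set L := |log ε| with hL
  have hL0 : 0 < L := abs_pos.2 (log_neg hε hε1).ne
  have hpi := pi_pos
  set v := spin u with hv
  obtain ⟨q, hq1, hq2⟩ := exists_admSD_of_displacement hb hε (displacement v)
  have hT : ∀ k, k ∈ (finite_cells hb hε).toFinset ↔ k ∈ cells Ω ε := fun k => by simp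
  set T := (finite_cells hb hε).toFinset with hTdef
  have hxy := xyEnergy_spin_le hb hε u
  have hsd := sdEnergy_displacement_le hb hε v
  have hsd0 := sdEnergy_nonneg hb hε u
  set D := sdEnergy Ω ε u with hD
  have hDC : 4 * π ^ 2 * D ≤ |C| * L ^ 2 := by
    have := he.trans (le_abs_self C)
    rwa [div_mul_eq_mul_div, div_le_iff₀ (by positivity)] at this
  have hE : ∑ k ∈ T, cellStrain u k + ∑ k ∈ T, cellStrain (displacement v) k ≤ |C| * L ^ 2 := by
    have a := sum_cellStrain_le hb hε hT u
    have b := sum_cellStrain_le hb hε hT (displacement v)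
    have := pi_sq_le_ten
    have := pi_gt_three
    have : 9 * D ≤ π ^ 2 * D := by gcongr; nlinarith
    linarith
  set E := ∑ k ∈ T, cellStrain u k + ∑ k ∈ T, cellStrain (displacement v) k with hEdef
  have key := fun φ => abs_sub_of_same_spin ho hε hT (u := u) (u' := displacement v)
    (fun k => (uv_displacement_spin u k).symm) φ
  have final : ∀ (c : ℝ) (φ : LipC Ω), 0 ≤ c → c ≤ 200 → 1 / L * (c * ε * E * ‖φ‖) ≤
      200 * |C| * (ε * L) * ‖φ‖ := by
    intro c φ h1 h2
    have hE0 : 0 ≤ E := add_nonneg (sum_nonneg fun k _ => cellStrain_nonneg _ k)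
      (sum_nonneg fun k _ => cellStrain_nonneg _ k)
    have : c * ε * E * ‖φ‖ ≤ 200 * ε * (|C| * L ^ 2) * ‖φ‖ := by gcongr
    calc _ ≤ 1 / L * (200 * ε * (|C| * L ^ 2) * ‖φ‖) := by gcongr
      _ = _ := by field_simp
  refine ⟨q, _, ⟨v, hq1, hq2, rfl⟩, ?_, ⟨fun φ => ?_, fun l φ => ?_⟩, ?_⟩
  · have : (1 / L ^ 2) * xyEnergy Ω ε v ≤ (1 / L ^ 2) * (4 * π ^ 2 * D) := by gcongr
    have p0 : 0 ≤ 200 * |C| * (ε * L) := by positivity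
    calc _ ≤ (1 / L ^ 2) * (4 * π ^ 2 * D) := this
      _ = 4 * π ^ 2 / L ^ 2 * D := by ring
      _ ≤ _ := by linarith
  · rw [hp2, hq2, ← mul_sub, abs_mul, abs_of_nonneg (by positivity)]
    refine le_trans ?_ (final (7 * π) φ (by positivity) (by nlinarith [pi_lt_d2]))
    exact mul_le_mul_of_nonneg_left (key φ).1 (by positivity)
  · rw [integral_field_sub_mul p q hp1 hq1, integral_lattice_field_mul, integral_lattice_field_mul,
      ← mul_sub, abs_mul, abs_of_nonneg (by positivity)]
    refine le_trans ?_ (final (20 * π ^ 2) φ (by positivity) (by nlinarith [pi_sq_le_ten]))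
    exact mul_le_mul_of_nonneg_left ((key φ).2 l) (by positivity)
  · have hs : √|C| ^ 2 = |C| := sq_sqrt (abs_nonneg C)
    have h1 : ‖p.field‖ ≤ 2 * √|C| := norm_lattice_field_le ho hb hε p hp1 (by positivity) (by
      rw [mul_pow, hs, ← hD, div_mul_eq_mul_div, div_le_iff₀ (by positivity)]; linarith)
    have h2 : ‖q.field‖ ≤ 4 * √|C| := norm_lattice_field_le ho hb hε q hq1 (by positivity) (by
      rw [mul_pow, hs, div_mul_eq_mul_div, div_le_iff₀ (by positivity)]
      have a1 := mul_le_mul_of_nonneg_left (hsd.trans hxy) (by positivity : 0 ≤ π ^ 2)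
      have a2 := mul_le_mul_of_nonneg_left hDC (by positivity : 0 ≤ π ^ 2)
      have a3 := mul_le_mul_of_nonneg_right pi_sq_le_ten (by positivity : 0 ≤ |C| * L ^ 2)
      have a4 : 0 ≤ |C| * L ^ 2 := by positivity
      linarith)
    have := norm_sub_le p.field q.field
    linarith

end Spins

/-! ### The change of scale -/

section Scale

/-- The change of scale `ε (4 + log (1 + 1 / ε))³`. -/
def scale (ε : ℝ) : ℝ := ε * (4 + log (1 + 1 / ε)) ^ 3

theorem scale_zero : scale 0 = 0 := by simp [scale]

theorem log_one_add_inv_nonneg {ε : ℝ} (hε : 0 < ε) : 0 ≤ log (1 + 1 / ε) :=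
  Real.log_nonneg (by have : 0 < 1 / ε := by positivity
                      linarith)

theorem scale_pos {ε : ℝ} (hε : 0 < ε) : 0 < scale ε := by
  have := log_one_add_inv_nonneg hε
  unfold scale; positivity

theorem log_one_add_inv_le {ε : ℝ} (hε : 0 < ε) (h1 : ε < 1) :
    log (1 + 1 / ε) ≤ 1 + |log ε| := by
  have h2 : 1 < 1 / ε := by rw [lt_div_iff₀ hε]; linarith
  have h3 : log (1 + 1 / ε) ≤ log (2 * (1 / ε)) :=
    log_le_log (by linarith) (by linarith)
  rw [Real.log_mul two_ne_zero (by positivity), one_div, Real.log_inv] at h3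
  rw [abs_of_neg (log_neg hε h1), one_div]
  linarith [Real.log_two_lt_d9]

theorem abs_log_le_log_one_add_inv {ε : ℝ} (hε : 0 < ε) (h1 : ε < 1) :
    |log ε| ≤ log (1 + 1 / ε) := by
  rw [abs_of_neg (log_neg hε h1), ← Real.log_inv, ← one_div]
  exact log_le_log (by positivity) (by linarith)

theorem mul_abs_log_pow_le_scale {ε : ℝ} (hε : 0 < ε) (h1 : ε < 1) :
    ε * |log ε| ^ 3 ≤ scale ε := by
  have := abs_log_le_log_one_add_inv hε h1
  unfold scale
  gcongr
  linarith

theorem tendsto_rpow_mul_log : Tendsto (fun ε : ℝ => ε ^ (1 / 3 : ℝ) * (5 + |log ε|)) (𝓝[>] 0)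
    (𝓝 0) := by
  have h := (tendsto_log_mul_rpow_nhdsGT_zero (r := 1 / 3) (by norm_num)).abs
  have h2 : Tendsto (fun ε : ℝ => ε ^ (1 / 3 : ℝ)) (𝓝[>] 0) (𝓝 0) := by
    have := (Real.continuousAt_rpow_const (0 : ℝ) (1 / 3) (Or.inr (by norm_num))).tendsto
    rw [Real.zero_rpow (by norm_num)] at this
    exact this.mono_left nhdsWithin_le_nhds
  have h3 := (h2.const_mul 5).add h
  rw [abs_zero, mul_zero, add_zero] at h3
  refine h3.congr' ?_
  filter_upwards [self_mem_nhdsWithin] with ε hε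
  rw [abs_mul, abs_of_pos (Real.rpow_pos_of_pos (mem_Ioi.1 hε) _)]
  ring

theorem eventually_lt_one : ∀ᶠ ε in 𝓝[>] (0 : ℝ), ε < 1 :=
  nhdsWithin_le_nhds (eventually_lt_nhds one_pos)

theorem tendsto_scale : Tendsto scale (𝓝[>] 0) (𝓝[>] 0) := by
  refine tendsto_nhdsWithin_iff.2 ⟨?_, ?_⟩
  · have h := tendsto_rpow_mul_log.pow 3
    rw [zero_pow three_ne_zero] at h
    refine tendsto_of_tendsto_of_tendsto_of_le_of_le' tendsto_const_nhds h ?_ ?_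
    · filter_upwards [self_mem_nhdsWithin] with ε hε using (scale_pos hε).le
    · filter_upwards [self_mem_nhdsWithin, eventually_lt_one] with ε hε h1
      have h2 := log_one_add_inv_le hε h1
      have h0 := log_one_add_inv_nonneg hε
      rw [mem_Ioi] at hε
      have e : (ε ^ (1 / 3 : ℝ)) ^ 3 = ε := by
        rw [← Real.rpow_natCast, ← Real.rpow_mul hε.le]; norm_num
      rw [mul_pow, e, scale]
      exact mul_le_mul_of_nonneg_left (pow_le_pow_left₀ (by linarith) (by linarith) 3) hε.le
  · filter_upwards [self_mem_nhdsWithin] with ε hε using scale_pos hε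

theorem hasDerivAt_scale {ε : ℝ} (hε : 0 < ε) : HasDerivAt scale
    ((4 + log (1 + 1 / ε)) ^ 2 * (4 + log (1 + 1 / ε) - 3 / (1 + ε))) ε := by
  have h1 : HasDerivAt (fun x : ℝ => 1 + 1 / x) (-(ε ^ 2)⁻¹) ε := by
    simpa using (hasDerivAt_inv hε.ne').const_add 1
  have h2 := ((h1.log (by positivity)).const_add 4).pow 3
  have h3 := (hasDerivAt_id ε).mul h2
  refine h3.congr_deriv ?_
  simp only [id, Pi.pow_apply]
  field_simp
  ring

theorem continuousOn_scale : ContinuousOn scale (Set.Ici 0) := by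
  intro x hx
  rcases (Set.mem_Ici.1 hx).eq_or_lt with rfl | h
  · have : ContinuousWithinAt scale (Set.Ioi 0) 0 := by
      rw [ContinuousWithinAt, scale_zero]
      exact tendsto_scale.mono_right nhdsWithin_le_nhds
    rw [← Set.Ioi_insert]
    exact this.insert
  · exact (hasDerivAt_scale h).continuousAt.continuousWithinAt

theorem strictMonoOn_scale : StrictMonoOn scale (Set.Ici 0) := by
  refine strictMonoOn_of_deriv_pos (convex_Ici 0) continuousOn_scale fun x hx => ?_
  rw [interior_Ici, mem_Ioi] at hx
  rw [(hasDerivAt_scale hx).deriv]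
  have h0 := log_one_add_inv_nonneg hx
  have h1 : 3 / (1 + x) < 3 := by rw [div_lt_iff₀ (by linarith)]; linarith
  have : 0 < 4 + log (1 + 1 / x) - 3 / (1 + x) := by linarith
  positivity

theorem tendsto_abs_log : Tendsto (fun ε : ℝ => |log ε|) (𝓝[>] 0) atTop :=
  tendsto_abs_atBot_atTop.comp Real.tendsto_log_nhdsGT_zero

theorem tendsto_log_scale : Tendsto (fun ε : ℝ => |log (scale ε)| / |log ε|) (𝓝[>] 0)
    (𝓝 1) := by
  have hsmall : ∀ᶠ ε in 𝓝[>] (0 : ℝ), scale ε < 1 := tendsto_scale.eventually eventually_lt_one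
  have h1 : Tendsto (fun x : ℝ => 3 * (log (5 + x) / x)) atTop (𝓝 0) := by
    have a : Tendsto (fun x : ℝ => log x / x) atTop (𝓝 0) :=
      Real.isLittleO_log_id_atTop.tendsto_div_nhds_zero
    have b : Tendsto (fun x : ℝ => log (5 + x) / (5 + x)) atTop (𝓝 0) :=
      a.comp (tendsto_atTop_add_const_left _ _ tendsto_id)
    have d : Tendsto (fun x : ℝ => 5 / x + 1) atTop (𝓝 (0 + 1)) :=
      (tendsto_const_nhds.div_atTop tendsto_id).add tendsto_const_nhds
    have := (b.mul d).const_mul 3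
    rw [zero_mul, mul_zero] at this
    refine this.congr' ?_
    filter_upwards [eventually_gt_atTop 0] with x hx
    field_simp
  have h2 := (h1.comp tendsto_abs_log).const_sub 1
  rw [sub_zero] at h2
  refine tendsto_of_tendsto_of_tendsto_of_le_of_le' h2 tendsto_const_nhds ?_ ?_
  · filter_upwards [self_mem_nhdsWithin, eventually_lt_one, hsmall] with ε hε hε1 hs
    rw [mem_Ioi] at hε
    have hl := log_neg hε hε1
    have h0 := log_one_add_inv_nonneg hε
    have hu := log_one_add_inv_le hε hε1
    have hp : 0 < |log ε| := abs_pos.2 hl.ne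
    have e : log (scale ε) = log ε + 3 * log (4 + log (1 + 1 / ε)) := by
      rw [scale, Real.log_mul hε.ne' (by positivity), Real.log_pow]; norm_num
    have h3 : log (4 + log (1 + 1 / ε)) ≤ log (5 + |log ε|) :=
      log_le_log (by linarith) (by linarith)
    simp only [Function.comp]
    rw [le_div_iff₀ hp, abs_of_neg (log_neg (scale_pos hε) hs), e, sub_mul, one_mul, mul_assoc,
      div_mul_cancel₀ _ hp.ne', neg_add, ← abs_of_neg hl]
    linarith
  · filter_upwards [self_mem_nhdsWithin, eventually_lt_one, hsmall] with ε hε hε1 hs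
    rw [mem_Ioi] at hε
    have hl := log_neg hε hε1
    have h0 := log_one_add_inv_nonneg hε
    have hp : 0 < |log ε| := abs_pos.2 hl.ne
    rw [div_le_one hp, abs_of_neg (log_neg (scale_pos hε) hs), abs_of_neg hl]
    refine neg_le_neg (log_le_log hε ?_)
    rw [scale]
    exact le_mul_of_one_le_right hε.le (one_le_pow₀ (by linarith))

end Scale

/-! ### From spins to order parameters -/

section SpinToGL

variable {Ω : Set E2} {ε : ℝ}

theorem LipBdd.norm_current_sq_le {V : E2 → E2} (hV : LipBdd V) (hb : IsBounded Ω) {x : E2}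
    (hx : ‖V x‖ ≤ 1) : ‖(hV.toH1 hb : H1Field Ω).current x‖ ^ 2 ≤ dens V x := by
  rw [norm_sq_eq, hV.toH1_current hb, hV.toH1_current hb, dens]
  have h : ∀ l, mcur l V x ^ 2 ≤ ‖pd l V x‖ ^ 2 := fun l => by
    have a := (abs_crs_le (V x) (pd l V x)).trans (mul_le_of_le_one_left (norm_nonneg _) hx)
    rw [← sq_abs (mcur l V x)]
    exact pow_le_pow_left₀ (abs_nonneg _) a 2
  exact add_le_add (h 0) (h 1)

/-- The pairing with a lattice strain field. -/
theorem abs_integral_strainField_le (ho : IsOpen Ω) (hb : IsBounded Ω) (hε : 0 < ε)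
    {T : Finset (ℤ × ℤ)} (hT : ∀ k, k ∈ T ↔ k ∈ cells Ω ε) (u : ℤ × ℤ → ℝ) (φ : LipC Ω) (l : Fin 2) :
    |∫ x in Ω, 2 * π * strainField Ω ε u x l * φ x| ≤
      2 * π * √(volume.real Ω) * √(∑ k ∈ T, cellStrain u k) * ‖φ‖ := by
  have hfin : volume Ω ≠ ⊤ := hb.measure_lt_top.ne
  have hp := pi_pos
  have bs := bm_strainField Ω hε u l
  have h1 := integral_mul_le_sqrt hfin bs (BM.const 1)
  simp only [abs_one, mul_one, one_pow, integral_const, smul_eq_mul,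
    measureReal_restrict_apply_univ] at h1
  have h2 : ∫ x in Ω, strainField Ω ε u x l ^ 2 ≤ ∑ k ∈ T, cellStrain u k := by
    refine le_trans (integral_mono ((bs.pow 2).integrableOn hfin) ?_ fun x => ?_)
      (integral_norm_strainField_sq_le hε ho hT u)
    · exact (memLp_strainField hb hε u).integrable_norm_pow two_ne_zero
    · change strainField Ω ε u x l ^ 2 ≤ ‖strainField Ω ε u x‖ ^ 2
      rw [← sq_abs]
      exact pow_le_pow_left₀ (abs_nonneg _) (abs_apply_le _ l) 2
  have h3 : ∫ x in Ω, |strainField Ω ε u x l| ≤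
      √(∑ k ∈ T, cellStrain u k) * √(volume.real Ω) :=
    h1.trans (mul_le_mul_of_nonneg_right (Real.sqrt_le_sqrt h2) (sqrt_nonneg _))
  calc |∫ x in Ω, 2 * π * strainField Ω ε u x l * φ x|
      ≤ ∫ x in Ω, 2 * π * ‖φ‖ * |strainField Ω ε u x l| := by
        refine (abs_integral_le_integral_abs).trans (integral_mono
          (((BM.const _).mul bs).mul φ.bm |>.integrableOn hfin).abs
          (((BM.const _).mul bs.abs).integrableOn hfin) fun x => ?_)
        simp only [abs_mul, abs_of_pos hp, abs_two]
        rw [mul_right_comm]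
        have := φ.abs_le x
        gcongr
    _ = 2 * π * ‖φ‖ * ∫ x in Ω, |strainField Ω ε u x l| := integral_const_mul _ _
    _ ≤ 2 * π * ‖φ‖ * (√(∑ k ∈ T, cellStrain u k) * √(volume.real Ω)) := by gcongr
    _ = _ := by ring

/-- The interpolation of unit vectors is nearly a unit vector. -/
theorem one_sub_norm_interp_sq_le {S : Finset (ℤ × ℤ)} (v : ℤ × ℤ → E2) (hv : ∀ k, ‖v k‖ = 1)
    (hε : 0 < ε) {x : E2} (hS : corners (cellIndex ε x) ⊆ S) :
    (1 - ‖interp S ε v x‖) ^ 2 ≤ 4 * cellIncr v (cellIndex ε x) := by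
  set k := cellIndex ε x with hk
  have h1 := norm_interp_sub_le v hε hk.symm hS
  have h2 := abs_norm_sub_norm_le (v k) (interp S ε v x)
  rw [hv k, norm_sub_rev] at h2
  have h3 := sq_edgeSum_le (fun k => ‖v (k + (1, 0)) - v k‖) (fun k => ‖v (k + (0, 1)) - v k‖) k
  rw [← cellIncr] at h3
  refine le_trans ?_ h3
  rw [← sq_abs]
  refine pow_le_pow_left₀ (abs_nonneg _) (h2.trans ?_) 2
  simp only [edgeSum, add_right_up, add_up_right]
  exact h1

theorem cell_subset_of_ball (hε : 0 < ε) {y : E2} {R : ℝ} (hR : 2 * ε ≤ R)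
    (h : Metric.ball y R ⊆ Ω) : cellIndex ε y ∈ cells Ω ε := by
  intro z hz
  refine h (Metric.mem_ball.2 ?_)
  have hy := mem_cell_of_cellIndex hε (x := y) rfl
  refine lt_of_lt_of_le ?_ hR
  rw [dist_eq_norm]
  refine lt_of_pow_lt_pow_left₀ 2 (by positivity) ?_
  rw [norm_sq_eq]
  obtain ⟨⟨a1, a2⟩, a3, a4⟩ := hy
  obtain ⟨⟨b1, b2⟩, b3, b4⟩ := hz
  simp only [PiLp.sub_apply]
  have c1 : |z 0 - y 0| ≤ ε := abs_le.2 ⟨by linarith, by linarith⟩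
  have c2 : |z 1 - y 1| ≤ ε := abs_le.2 ⟨by linarith, by linarith⟩
  have d1 := pow_le_pow_left₀ (abs_nonneg _) c1 2
  have d2 := pow_le_pow_left₀ (abs_nonneg _) c2 2
  rw [sq_abs] at d1 d2
  nlinarith

/-- Estimates for the interpolation of a lattice field, transported into the domain. -/
theorem exists_interpolation (ho : IsOpen Ω) (hb : IsBounded Ω) (hε : 0 < ε)
    (v : ℤ × ℤ → Circle) {Φ : E2 → E2} {τ R : ℝ} (hΦ : NearId Φ τ) (hτ : τ ≤ 1 / 8) (hR : 2 * ε ≤ R)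
    (hball : ∀ y ∈ Ω, Metric.ball (Φ y) R ⊆ Ω) :
    ∃ W : E2 → E2, LipBdd W ∧ (∀ x ∈ Ω, ‖W x‖ ≤ 1) ∧
      1 / 2 * ∫ x in Ω, dens W x ≤ (1 + 21 * τ) * xyEnergy Ω ε v ∧
      ∫ x in Ω, (1 - ‖W x‖) ^ 2 ≤ 32 * ε ^ 2 * xyEnergy Ω ε v ∧
      (∀ φ : LipC Ω, |(∫ x in Ω, mjac W x * φ x) - π * vorticityMeasure Ω ε v φ| ≤
        (13 * τ + 20 * ε) * xyEnergy Ω ε v * ‖φ‖) ∧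
      ∀ (φ : LipC Ω) (l : Fin 2), |(∫ x in Ω, mcur l W x * φ x) -
        ∫ x in Ω, 2 * π * strainField Ω ε (displacement v) x l * φ x| ≤
        (13 * τ * (volume.real Ω + xyEnergy Ω ε v) + 50 * ε * xyEnergy Ω ε v) * ‖φ‖ := by
  have hT : ∀ k, k ∈ (finite_cells hb hε).toFinset ↔ k ∈ cells Ω ε := fun k => by simp
  set T := (finite_cells hb hε).toFinset with hTdef
  set u := displacement v with hu
  set X := xyEnergy Ω ε v with hX
  set w := interp (nodes T) ε fun k => uv (u k) with hw
  have hS : ∀ k ∈ T, corners k ⊆ nodes T := fun k hk => corners_subset_nodes hk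
  have hL : LipBdd w := LipBdd.interp hε _
  have hτ0 := hΦ.nonneg
  have hX0 : 0 ≤ X := xyEnergy_nonneg hb hε v
  have hU := measurableSet_squares ε T
  have hUfin := volume_squares_ne_top hε T
  have hfin : volume Ω ≠ ⊤ := hb.measure_lt_top.ne
  have hmap : ∀ x ∈ Ω, Φ x ∈ squares ε T := fun x hx =>
    (hT _).2 (cell_subset_of_ball hε hR (hball x hx))
  have hincr : ∑ k ∈ T, cellIncr (fun k => uv (u k)) k ≤ 4 * X := by
    have := sum_cells_le hb hε hT (F := fun b => ‖uv (u b.2) - uv (u b.1)‖ ^ 2) fun b => sq_nonneg _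
    refine this.trans (le_of_eq ?_)
    rw [hX, xyEnergy]
    simp only [norm_spin_sub_sq]
    ring
  have hstrain : ∑ k ∈ T, cellStrain u k ≤ 1 / 4 * X := by
    have a := sum_cellStrain_le hb hε hT u
    have b := sdEnergy_displacement_le hb hε v
    linarith
  have hE0 : 0 ≤ ∑ k ∈ T, cellStrain u k := sum_nonneg fun k _ => cellStrain_nonneg u k
  have hdens : ∫ x in squares ε T, dens w x ≤ 2 * X := by
    rw [integral_dens_interp _ hε hS]; linarith
  have hw1 : ∀ x ∈ squares ε T, ‖w x‖ ≤ 1 := fun x hx =>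
    norm_interp_le_one _ hε (hS _ hx) fun k => (norm_uv _).le
  have hN := fun φ : LipC Ω => norm_nonneg φ
  have hpi := pi_sq_le_ten
  have hpi0 := pi_pos
  refine ⟨w ∘ Φ, hL.comp_nearId hΦ hτ, fun x hx => hw1 _ (hmap x hx), ?_, ?_, fun φ => ?_,
    fun φ l => ?_⟩
  · have := hL.integral_dens_comp_le hΦ hτ ho.measurableSet hU hUfin hfin hmap
    have h2 := mul_le_mul_of_nonneg_left hdens (by positivity : 0 ≤ 1 + 21 * τ)
    linarith
  · have bi : IntegrableOn (fun x => (1 - ‖w x‖) ^ 2) (squares ε T) :=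
      (((BM.const 1).sub hL.bm_norm).pow 2).integrableOn hUfin
    have h1 := hΦ.setIntegral_comp_le hτ (g := fun x => (1 - ‖w x‖) ^ 2) ho.measurableSet hU bi
      (fun x _ => sq_nonneg _) hmap
    obtain ⟨i2, e2⟩ := integrableOn_cell hε T fun k => 4 * cellIncr (fun k => uv (u k)) k
    have h2 : ∫ x in squares ε T, (1 - ‖w x‖) ^ 2 ≤ ε ^ 2 * (4 * (4 * X)) := by
      refine (setIntegral_mono_on bi i2 hU fun x hx => one_sub_norm_interp_sq_le _
        (fun k => norm_uv _) hε (hS _ hx)).trans ?_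
      rw [e2, ← mul_sum]
      gcongr
    have h3 : (1 + 6 * τ) * ∫ x in squares ε T, (1 - ‖w x‖) ^ 2 ≤ 2 * (ε ^ 2 * (4 * (4 * X))) := by
      have : 0 ≤ ∫ x in squares ε T, (1 - ‖w x‖) ^ 2 := integral_nonneg fun x => sq_nonneg _
      gcongr; linarith
    simp only [Function.comp]
    linarith
  · have a := hL.abs_integral_mjac_comp_sub_le hΦ hτ φ hU hUfin hmap
    have b := abs_integral_mjac_interp_sub_le u hε hT hS φ
    have h1 : ∫ x in squares ε T, |mjac w x| ≤ X := by
      refine (integral_mono (hL.bm_mjac.abs.integrableOn hUfin)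
        (((BM.const (1 / 2)).mul hL.bm_dens).integrableOn hUfin) fun x => abs_mjac_le w x).trans ?_
      rw [integral_const_mul]; linarith
    rw [vorticityMeasure, dislocationMeasure_eq hT]
    have t := abs_sub_le (∫ x in Ω, mjac (w ∘ Φ) x * φ x) (∫ x in squares ε T, mjac w x * φ x)
      (π * ∑ k ∈ T, dislocation u k * φ (centre ε k))
    have a' : 13 * τ * ‖φ‖ * ∫ x in squares ε T, |mjac w x| ≤ 13 * τ * ‖φ‖ * X := by
      have := hN φ; gcongr
    have b' : 7 * π ^ 2 * ε * (∑ k ∈ T, cellStrain u k) * ‖φ‖ ≤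
        7 * 10 * ε * (1 / 4 * X) * ‖φ‖ := by
      have := hN φ
      gcongr
    have : 0 ≤ ε * X * ‖φ‖ := by have := hN φ; positivity
    linarith
  · have a := hL.abs_integral_mcur_comp_sub_le hΦ hτ φ hU hUfin hmap l
    have b := abs_integral_mcur_interp_sub_le hε ho hT hS u φ l
    have hcur : ∀ m, ∀ x ∈ squares ε T, |mcur m w x| ≤ 1 / 2 + 1 / 2 * ‖pd m w x‖ ^ 2 := by
      intro m x hx
      have := (abs_crs_le (w x) (pd m w x)).trans
        (mul_le_of_le_one_left (norm_nonneg _) (hw1 x hx))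
      refine this.trans ?_
      nlinarith [sq_nonneg (‖pd m w x‖ - 1)]
    have h1 : (∫ x in squares ε T, |mcur 0 w x|) + ∫ x in squares ε T, |mcur 1 w x| ≤
        volume.real Ω + X := by
      rw [← integral_add ((hL.bm_mcur 0).abs.integrableOn hUfin)
        ((hL.bm_mcur 1).abs.integrableOn hUfin)]
      have i1 : IntegrableOn (fun x => (1 : ℝ) + 1 / 2 * dens w x) (squares ε T) :=
        ((BM.const 1).add ((BM.const (1 / 2)).mul hL.bm_dens)).integrableOn hUfin
      refine (setIntegral_mono_on (((hL.bm_mcur 0).abs.add (hL.bm_mcur 1).abs).integrableOn hUfin)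
        i1 hU fun x hx => ?_).trans ?_
      · have := hcur 0 x hx
        have := hcur 1 x hx
        rw [dens]; linarith
      · rw [integral_add ((BM.const 1).integrableOn hUfin)
          (((BM.const (1 / 2)).mul hL.bm_dens).integrableOn hUfin), integral_const_mul,
          setIntegral_const, smul_eq_mul, mul_one]
        have := measureReal_mono (squares_subset hε hT) hfin
        linarith
    have t := abs_sub_le (∫ x in Ω, mcur l (w ∘ Φ) x * φ x) (∫ x in squares ε T, mcur l w x * φ x)
      (∫ x in Ω, 2 * π * strainField Ω ε u x l * φ x)
    have a' := mul_le_mul_of_nonneg_left h1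
      (by have := hN φ; positivity : 0 ≤ 13 * τ * ‖φ‖)
    have b' : 20 * π ^ 2 * ε * (∑ k ∈ T, cellStrain u k) * ‖φ‖ ≤
        20 * 10 * ε * (1 / 4 * X) * ‖φ‖ := by
      have := hN φ
      gcongr
    linarith

end SpinToGL

section SpinToGL

variable {Ω : Set E2} {ε : ℝ}

theorem abs_scaled_sub_le {L L' a b η M : ℝ} (hL : 0 < L) (hL' : 0 < L') (h1 : |a| ≤ M * L)
    (h2 : |b - a| ≤ η) : |1 / L * a - 1 / L' * b| ≤ |1 - L / L'| * M + 1 / L' * η := by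
  have e : 1 / L * a - 1 / L' * b = (1 - L / L') * (a / L) - 1 / L' * (b - a) := by
    field_simp; ring
  rw [e]
  refine (abs_sub _ _).trans (add_le_add ?_ ?_)
  · rw [abs_mul, abs_div, abs_of_pos hL]
    exact mul_le_mul_of_nonneg_left ((div_le_iff₀ hL).2 h1) (abs_nonneg _)
  · rw [abs_mul, abs_of_pos (by positivity : 0 < 1 / L')]
    exact mul_le_mul_of_nonneg_left h2 (by positivity)

theorem tendsto_sqrt_zero : Tendsto (fun ε : ℝ => √ε) (𝓝[>] 0) (𝓝 0) := by
  have := Real.continuous_sqrt.tendsto 0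
  rw [Real.sqrt_zero] at this
  exact this.mono_left nhdsWithin_le_nhds

theorem tendsto_sqrt_mul_log : Tendsto (fun ε : ℝ => √ε * |log ε|) (𝓝[>] 0) (𝓝 0) := by
  have h := (tendsto_log_mul_rpow_nhdsGT_zero (r := 1 / 2) (by norm_num)).abs
  rw [abs_zero] at h
  refine h.congr fun ε => ?_
  rw [← Real.sqrt_eq_rpow, abs_mul, abs_of_nonneg (sqrt_nonneg ε), mul_comm]

theorem tendsto_log_ratio : Tendsto (fun ε : ℝ => |log ε| / |log (scale ε)|) (𝓝[>] 0)
    (𝓝 1) := by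
  have := tendsto_log_scale.inv₀ one_ne_zero
  simpa using this

theorem LipBdd.norm_field_le_of_dens {V : E2 → E2} (hV : LipBdd V) (ho : IsOpen Ω)
    (hb : IsBounded Ω) (h1 : ∀ x ∈ Ω, ‖V x‖ ≤ 1) (q : PhaseSpace Ω) {L : ℝ}
    (hq : q.field =ᵐ[volume.restrict Ω] fun x => (1 / L) • (hV.toH1 hb : H1Field Ω).current x)
    {B : ℝ} (hB : 0 ≤ B) (h : 1 / L ^ 2 * ∫ x in Ω, dens V x ≤ B ^ 2) : ‖q.field‖ ≤ B := by
  refine norm_field_le q hq hB (le_trans ?_ h)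
  have hfin : volume Ω ≠ ⊤ := hb.measure_lt_top.ne
  rw [← integral_const_mul]
  refine integral_mono_of_nonneg (ae_of_all _ fun x => by positivity)
    (((BM.const _).mul hV.bm_dens).integrableOn hfin) ?_
  filter_upwards [ae_restrict_mem ho.measurableSet] with x hx
  rw [norm_smul, mul_pow, norm_eq_abs, sq_abs, div_pow, one_pow]
  exact mul_le_mul_of_nonneg_left (hV.norm_current_sq_le hb (h1 x hx)) (by positivity)

theorem LipBdd.integral_current_mul {V : E2 → E2} (hV : LipBdd V) (hb : IsBounded Ω) (L : ℝ)
    (l : Fin 2) (φ : E2 → ℝ) :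
    ∫ x in Ω, ((1 / L) • (hV.toH1 hb : H1Field Ω).current x) l * φ x =
      1 / L * ∫ x in Ω, mcur l V x * φ x := by
  rw [← integral_const_mul]
  congr 1; ext x
  rw [PiLp.smul_apply, hV.toH1_current hb, smul_eq_mul, mul_assoc]

theorem abs_inv_pi_mul_sub_le {a b η : ℝ} (h : |a - π * b| ≤ η) : |1 / π * a - b| ≤ η := by
  rw [show 1 / π * a - b = 1 / π * (a - π * b) by field_simp, abs_mul, abs_of_pos (by positivity)]
  exact (mul_le_of_le_one_left (abs_nonneg _)
    ((div_le_one pi_pos).2 (by linarith [pi_gt_three]))).trans h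

set_option maxHeartbeats 1000000 in
theorem admLE_XY_GL (ho : IsOpen Ω) (hb : IsBounded Ω) (hlip : HasLipschitzBoundary Ω) :
    AdmLE (AdmXY Ω) (AdmGL Ω) scale := by
  obtain ⟨c, C₀, t₀, hc, ht₀, hpush⟩ : ∃ c C t₀ : ℝ, 0 < c ∧ 0 < t₀ ∧ ∀ t, 0 < t → t ≤ t₀ →
      ∃ Φ, NearId Φ (C * t) ∧ ∀ y ∈ Ω, Metric.ball (Φ y) (c * t) ⊆ Ω := by
    obtain ⟨c, C, t₀, h⟩ := hlip.exists_push ho hb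
    exact ⟨c, C, t₀, by tauto⟩
  intro C
  set V := volume.real Ω with hV
  set s : ℝ → ℝ := fun ε => |log ε| / |log (scale ε)| with hs
  set R : ℝ → ℝ := fun ε => s ε ^ 2 * (1 + 21 * (C₀ * √ε) + 32 * (1 / |log ε| ^ 3) ^ 2) with hR
  have ts : Tendsto s (𝓝[>] 0) (𝓝 1) := tendsto_log_ratio
  have tinv : Tendsto (fun ε : ℝ => 1 / |log ε| ^ 3) (𝓝[>] 0) (𝓝 0) :=
    tendsto_const_nhds.div_atTop ((tendsto_pow_atTop three_ne_zero).comp tendsto_abs_log)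
  have tτ : Tendsto (fun ε : ℝ => C₀ * √ε) (𝓝[>] 0) (𝓝 0) := by
    simpa using tendsto_sqrt_zero.const_mul C₀
  have tτL : Tendsto (fun ε : ℝ => C₀ * √ε * |log ε|) (𝓝[>] 0) (𝓝 0) := by
    simpa [mul_assoc] using tendsto_sqrt_mul_log.const_mul C₀
  have tR : Tendsto R (𝓝[>] 0) (𝓝 1) := by
    have := (ts.pow 2).mul (((tτ.const_mul 21).const_add 1).add ((tinv.pow 2).const_mul 32))
    rw [show (1 : ℝ) ^ 2 * (1 + 21 * 0 + 32 * 0 ^ 2) = 1 by norm_num] at this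
    exact this
  refine ⟨fun ε => |C| * |R ε - 1| + |1 - s ε| * (4 * √V * √|C|) +
    s ε * (13 * (C₀ * √ε) * V + (13 * (C₀ * √ε * |log ε|) + 50 * (ε * |log ε|)) * |C|),
    6 * √|C|, ?_, ?_⟩
  · have a1 := ((tR.sub_const 1).abs.const_mul |C|)
    have a2 := ((ts.const_sub 1).abs.mul_const (4 * √V * √|C|))
    have a3 := ts.mul (((tτ.const_mul 13).mul_const V).add
      (((tτL.const_mul 13).add (tendsto_mul_log_zero.const_mul 50)).mul_const |C|))
    have := (a1.add a2).add a3
    simpa using this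
  have evL : ∀ᶠ ε in 𝓝[>] (0 : ℝ), 1 ≤ |log ε| := tendsto_abs_log.eventually_ge_atTop 1
  have evR : ∀ᶠ ε in 𝓝[>] (0 : ℝ), R ε ≤ 2 :=
    (tR.eventually_lt_const (by norm_num : (1 : ℝ) < 2)).mono fun _ h => h.le
  have evτ : ∀ᶠ ε in 𝓝[>] (0 : ℝ), C₀ * √ε ≤ 1 / 8 :=
    (tτ.eventually_lt_const (by norm_num : (0 : ℝ) < 1 / 8)).mono fun _ h => h.le
  have evt : ∀ᶠ ε in 𝓝[>] (0 : ℝ), √ε ≤ t₀ :=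
    (tendsto_sqrt_zero.eventually_lt_const ht₀).mono fun _ h => h.le
  have evc : ∀ᶠ ε in 𝓝[>] (0 : ℝ), √ε ≤ c / 2 :=
    (tendsto_sqrt_zero.eventually_lt_const (by positivity : 0 < c / 2)).mono fun _ h => h.le
  have evs : ∀ᶠ ε in 𝓝[>] (0 : ℝ), scale ε < 1 := tendsto_scale.eventually eventually_lt_one
  filter_upwards [self_mem_nhdsWithin, eventually_lt_one, evL, evR, evτ, evt, evc, evs] with
    ε hε hε1 hL1 hR2 hτ8 ht hcε hs1
  rintro p e ⟨v, hp1, hp2, rfl⟩ he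
  rw [mem_Ioi] at hε
  obtain ⟨Φ, hΦ, hball⟩ := hpush (√ε) (sqrt_pos.2 hε) ht
  have hτ0 := hΦ.nonneg
  have hsq : √ε ^ 2 = ε := sq_sqrt hε.le
  have hR' : 2 * ε ≤ c * √ε := by nlinarith [sqrt_nonneg ε]
  obtain ⟨W, hW, hW1, hE1, hE2, hJ, hj⟩ := exists_interpolation ho hb hε v hΦ hτ8 hR' hball
  set X := xyEnergy Ω ε v with hX
  have hX0 : 0 ≤ X := xyEnergy_nonneg hb hε v
  set τ := C₀ * √ε with hτdef
  set δ := scale ε with hδ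
  set L := |log ε| with hL
  set L' := |log δ| with hL'
  have hδ0 : 0 < δ := scale_pos hε
  have hL0 : 0 < L := by linarith
  have hL'0 : 0 < L' := abs_pos.2 (log_neg hδ0 hs1).ne
  obtain ⟨q, hq1, hq2, hq3⟩ := hW.exists_admGL hb hW1 ho δ
  have hXC : X ≤ |C| * L ^ 2 := by
    have := he.trans (le_abs_self C)
    rwa [one_div, inv_mul_le_iff₀ (by positivity), mul_comm] at this
  have hsval : s ε = L / L' := rfl
  have hs0 : 0 < L / L' := by positivity
  have hRval : R ε = (L / L') ^ 2 * (1 + 21 * τ + 32 * (1 / L ^ 3) ^ 2) := rfl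
  have hεδ : ε / δ ≤ 1 / L ^ 3 := by
    rw [div_le_div_iff₀ hδ0 (by positivity), one_mul]
    exact mul_abs_log_pow_le_scale hε hε1
  have hen : (1 / L' ^ 2) * (1 / 2 * (∫ x in Ω, dens W x) + 1 / δ ^ 2 * ∫ x in Ω, (1 - ‖W x‖) ^ 2) ≤
      1 / L ^ 2 * X * R ε := by
    have b2 : 1 / δ ^ 2 * ∫ x in Ω, (1 - ‖W x‖) ^ 2 ≤ 32 * (1 / L ^ 3) ^ 2 * X := by
      calc _ ≤ 1 / δ ^ 2 * (32 * ε ^ 2 * X) := by gcongr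
        _ = 32 * (ε / δ) ^ 2 * X := by ring
        _ ≤ _ := by gcongr
    calc _ ≤ (1 / L' ^ 2) * ((1 + 21 * τ) * X + 32 * (1 / L ^ 3) ^ 2 * X) := by gcongr
      _ = _ := by rw [hRval]; field_simp
  have he0 : 0 ≤ 1 / L ^ 2 * X := by positivity
  set e := 1 / L ^ 2 * X with hedef
  have hE : ∀ T : Finset (ℤ × ℤ), (∀ k, k ∈ T ↔ k ∈ cells Ω ε) →
      √(∑ k ∈ T, cellStrain (displacement v) k) ≤ √|C| * L / 2 := by
    intro T hT
    refine sqrt_le_iff.2 ⟨by positivity, ?_⟩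
    rw [div_pow, mul_pow, sq_sqrt (abs_nonneg C)]
    have a := sum_cellStrain_le hb hε hT (displacement v)
    have b := sdEnergy_displacement_le hb hε v
    linarith
  have hT : ∀ k, k ∈ (finite_cells hb hε).toFinset ↔ k ∈ cells Ω ε := fun k => by simp
  have n0 : 0 ≤ |C| * |R ε - 1| := by positivity
  have n1 : 0 ≤ |1 - s ε| * (4 * √V * √|C|) := by positivity
  have n2 : 0 ≤ s ε * (13 * τ * V + (13 * (τ * L) + 50 * (ε * L)) * |C|) := by
    have : 0 ≤ V := measureReal_nonneg
    rw [hsval]; positivity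
  have hV0 : 0 ≤ V := measureReal_nonneg
  refine ⟨q, _, hq3, ?_, ⟨fun φ => ?_, fun l φ => ?_⟩, ?_⟩
  · refine hen.trans ?_
    have : e * (R ε - 1) ≤ |C| * |R ε - 1| := by
      refine (mul_le_mul_of_nonneg_left (le_abs_self _) he0).trans ?_
      exact mul_le_mul_of_nonneg_right (he.trans (le_abs_self C)) (abs_nonneg _)
    linarith
  · have hN := norm_nonneg φ
    have e0 : q.1 φ = 1 / L' * (1 / π * ∫ x in Ω, mjac W x * φ x) := by
      rw [hq2, ← hL']; field_simp
    rw [hp2, e0]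
    have h1 : |vorticityMeasure Ω ε v φ| ≤ (3 * √V * √|C| * ‖φ‖) * L := by
      refine (abs_dislocationMeasure_le hb hε hT (displacement v) φ).trans ?_
      have := mul_le_mul_of_nonneg_left (hE _ hT) (by positivity : 0 ≤ 6 * √V * ‖φ‖)
      linarith
    have h2 : |1 / π * (∫ x in Ω, mjac W x * φ x) - vorticityMeasure Ω ε v φ| ≤
        (13 * τ + 20 * ε) * (|C| * L ^ 2) * ‖φ‖ :=
      abs_inv_pi_mul_sub_le ((hJ φ).trans (by gcongr))
    refine (abs_scaled_sub_le hL0 hL'0 h1 h2).trans ?_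
    have e2 : 1 / L' * ((13 * τ + 20 * ε) * (|C| * L ^ 2) * ‖φ‖) =
        s ε * ((13 * (τ * L) + 20 * (ε * L)) * |C|) * ‖φ‖ := by
      rw [hsval]; field_simp
    rw [e2]
    have e3 : s ε * ((13 * (τ * L) + 20 * (ε * L)) * |C|) ≤
        s ε * (13 * τ * V + (13 * (τ * L) + 50 * (ε * L)) * |C|) := by
      refine mul_le_mul_of_nonneg_left ?_ hs0.le
      have : 0 ≤ 13 * τ * V := by positivity
      have : 0 ≤ 30 * (ε * L) * |C| := by positivity
      linarith
    have e4 : |1 - L / L'| * (3 * √V * √|C| * ‖φ‖) ≤ |1 - s ε| * (4 * √V * √|C|) * ‖φ‖ := by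
      rw [hsval]
      have : 0 ≤ |1 - L / L'| * (√V * √|C| * ‖φ‖) := by positivity
      linarith
    have := mul_le_mul_of_nonneg_right e3 hN
    have := mul_nonneg n0 hN
    linarith
  · have hN := norm_nonneg φ
    simp only [vortexCurrent] at hp1
    rw [integral_field_sub_mul p q hp1 hq1, integral_lattice_field_mul, hW.integral_current_mul]
    have h1 : |∫ x in Ω, 2 * π * strainField Ω ε (displacement v) x l * φ x| ≤
        (π * √V * √|C| * ‖φ‖) * L := by
      refine (abs_integral_strainField_le ho hb hε hT (displacement v) φ l).trans ?_
      have := mul_le_mul_of_nonneg_left (hE _ hT) (by positivity : 0 ≤ 2 * π * √V * ‖φ‖)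
      linarith
    have h2 := hj φ l
    refine (abs_scaled_sub_le hL0 hL'0 h1 h2).trans ?_
    have e2 : 1 / L' * ((13 * τ * (V + X) + 50 * ε * X) * ‖φ‖) ≤
        s ε * (13 * τ * V + (13 * (τ * L) + 50 * (ε * L)) * |C|) * ‖φ‖ := by
      have f1 : 13 * τ * (V + X) + 50 * ε * X ≤
          L * (13 * τ * V + (13 * (τ * L) + 50 * (ε * L)) * |C|) := by
        have g1 : 13 * τ * V ≤ L * (13 * τ * V) := le_mul_of_one_le_left (by positivity) hL1
        have g2 := mul_le_mul_of_nonneg_left hXC (by positivity : 0 ≤ 13 * τ + 50 * ε)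
        linarith
      calc _ ≤ 1 / L' * (L * (13 * τ * V + (13 * (τ * L) + 50 * (ε * L)) * |C|) * ‖φ‖) := by gcongr
        _ = _ := by rw [hsval]; field_simp
    have e4 : |1 - L / L'| * (π * √V * √|C| * ‖φ‖) ≤ |1 - s ε| * (4 * √V * √|C|) * ‖φ‖ := by
      rw [hsval]
      have := pi_lt_d2
      calc _ ≤ |1 - L / L'| * (4 * √V * √|C| * ‖φ‖) := by gcongr; linarith
        _ = _ := by ring
    have := mul_nonneg n0 hN
    linarith
  · have hsC : √|C| ^ 2 = |C| := sq_sqrt (abs_nonneg C)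
    have h1 : ‖p.field‖ ≤ 4 * √|C| := norm_lattice_field_le ho hb hε p hp1 (by positivity) (by
      rw [mul_pow, hsC, div_mul_eq_mul_div, div_le_iff₀ (by positivity)]
      have a1 := mul_le_mul_of_nonneg_left ((sdEnergy_displacement_le hb hε v).trans hXC)
        (by positivity : 0 ≤ π ^ 2)
      have a3 := mul_le_mul_of_nonneg_right pi_sq_le_ten (by positivity : 0 ≤ |C| * L ^ 2)
      have a4 : 0 ≤ |C| * L ^ 2 := by positivity
      linarith)
    have h2 : ‖q.field‖ ≤ 2 * √|C| := hW.norm_field_le_of_dens ho hb hW1 q hq1 (by positivity) (by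
      rw [mul_pow, hsC]
      have a1 : 0 ≤ 1 / L' ^ 2 * (1 / δ ^ 2 * ∫ x in Ω, (1 - ‖W x‖) ^ 2) := by
        have : 0 ≤ ∫ x in Ω, (1 - ‖W x‖) ^ 2 := integral_nonneg fun x => sq_nonneg _
        positivity
      have a2 : e * R ε ≤ |C| * 2 :=
        mul_le_mul (he.trans (le_abs_self C)) hR2 (by rw [hRval]; positivity) (abs_nonneg C)
      linarith)
    have := norm_sub_le p.field q.field
    linarith

end SpinToGL

/-! ### Dyadic refinement of lattice fields -/

section Refinement

/-- `bh` and `bv` are admissible strains for `u`. -/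
structure IsStrain (u bh bv : ℤ × ℤ → ℝ) : Prop where
  horizontal : ∀ k, ∃ n : ℤ, u (k + (1, 0)) - u k = bh k + n
  vertical : ∀ k, ∃ n : ℤ, u (k + (0, 1)) - u k = bv k + n
  abs_horizontal_le : ∀ k, |bh k| ≤ 1 / 2
  abs_vertical_le : ∀ k, |bv k| ≤ 1 / 2

/-- The lattice square of twice the size that contains the given one. -/
def parent (j : ℤ × ℤ) : ℤ × ℤ := (j.1 / 2, j.2 / 2)

/-- A function of a lattice point given by the parent and the parity. -/
def byParity {M : Type*} (A B C D : ℤ × ℤ → M) (j : ℤ × ℤ) : M :=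
  if j.1 % 2 = 0 then (if j.2 % 2 = 0 then A (parent j) else C (parent j))
  else (if j.2 % 2 = 0 then B (parent j) else D (parent j))

section ByParity

variable {M : Type*} (A B C D : ℤ × ℤ → M) (a b : ℤ)

theorem parent_00 : parent (2 * a, 2 * b) = (a, b) := by
  simp only [parent, Prod.mk.injEq]; omega

theorem parent_10 : parent (2 * a + 1, 2 * b) = (a, b) := by
  simp only [parent, Prod.mk.injEq]; omega

theorem parent_01 : parent (2 * a, 2 * b + 1) = (a, b) := by
  simp only [parent, Prod.mk.injEq]; omega

theorem parent_11 : parent (2 * a + 1, 2 * b + 1) = (a, b) := by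
  simp only [parent, Prod.mk.injEq]; omega

theorem byParity_00 : byParity A B C D (2 * a, 2 * b) = A (a, b) := by
  simp only [byParity, parent_00]; rw [if_pos (by omega), if_pos (by omega)]

theorem byParity_10 : byParity A B C D (2 * a + 1, 2 * b) = B (a, b) := by
  simp only [byParity, parent_10]; rw [if_neg (by omega), if_pos (by omega)]

theorem byParity_01 : byParity A B C D (2 * a, 2 * b + 1) = C (a, b) := by
  simp only [byParity, parent_01]; rw [if_pos (by omega), if_neg (by omega)]

theorem byParity_11 : byParity A B C D (2 * a + 1, 2 * b + 1) = D (a, b) := by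
  simp only [byParity, parent_11]; rw [if_neg (by omega), if_neg (by omega)]

end ByParity

/-- Every lattice point is one of the four children of its parent. -/
theorem parity_cases {p : ℤ × ℤ → Prop} (h00 : ∀ a b, p (2 * a, 2 * b))
    (h10 : ∀ a b, p (2 * a + 1, 2 * b)) (h01 : ∀ a b, p (2 * a, 2 * b + 1))
    (h11 : ∀ a b, p (2 * a + 1, 2 * b + 1)) (j : ℤ × ℤ) : p j := by
  obtain ⟨x, y⟩ := j
  rcases Int.emod_two_eq_zero_or_one x with hx | hx <;>
    rcases Int.emod_two_eq_zero_or_one y with hy | hy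
  · have := h00 (x / 2) (y / 2)
    rwa [show 2 * (x / 2) = x by omega, show 2 * (y / 2) = y by omega] at this
  · have := h01 (x / 2) (y / 2)
    rwa [show 2 * (x / 2) = x by omega, show 2 * (y / 2) + 1 = y by omega] at this
  · have := h10 (x / 2) (y / 2)
    rwa [show 2 * (x / 2) + 1 = x by omega, show 2 * (y / 2) = y by omega] at this
  · have := h11 (x / 2) (y / 2)
    rwa [show 2 * (x / 2) + 1 = x by omega, show 2 * (y / 2) + 1 = y by omega] at this

variable (u bh bv : ℤ × ℤ → ℝ)

/-- The lifted strain between the midpoint of the left edge and that of the right edge. -/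
def crossing (k : ℤ × ℤ) : ℝ := bh k + bv (k + (1, 0)) / 2 - bv k / 2

open Classical in
/-- The value at the centre of a square: the mean of the corners, or the value at the midpoint of
the right edge if the square contains a vortex. -/
def centreValue (k : ℤ × ℤ) : ℝ :=
  if circ bh bv k = 0 then u k + (2 * bh k + bv (k + (1, 0)) + bv k) / 4
  else u k + bh k + bv (k + (1, 0)) / 2

/-- The refined displacement. -/
def refine (u bh bv : ℤ × ℤ → ℝ) : ℤ × ℤ → ℝ :=
  byParity u (fun k => u k + bh k / 2) (fun k => u k + bv k / 2) (centreValue u bh bv)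

open Classical in
/-- The refined horizontal strain. -/
def refineH (bh bv : ℤ × ℤ → ℝ) : ℤ × ℤ → ℝ :=
  byParity (fun k => bh k / 2) (fun k => bh k / 2)
    (fun k => if circ bh bv k = 0 then (bh k + bh (k + (0, 1))) / 4
      else crossing bh bv k - nearestInt (crossing bh bv k))
    (fun k => if circ bh bv k = 0 then (bh k + bh (k + (0, 1))) / 4 else 0)

open Classical in
/-- The refined vertical strain. -/
def refineV (bh bv : ℤ × ℤ → ℝ) : ℤ × ℤ → ℝ :=
  byParity (fun k => bv k / 2)
    (fun k => if circ bh bv k = 0 then (bv k + bv (k + (1, 0))) / 4 else (bh k + bv (k + (1, 0))) / 2)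
    (fun k => bv k / 2)
    (fun k => if circ bh bv k = 0 then (bv k + bv (k + (1, 0))) / 4
      else (bv (k + (1, 0)) - bh (k + (0, 1))) / 2)

variable {u bh bv}

theorem IsStrain.circ_int (h : IsStrain u bh bv) (k : ℤ × ℤ) : ∃ m : ℤ, circ bh bv k = m := by
  obtain ⟨n1, h1⟩ := h.horizontal k
  obtain ⟨n2, h2⟩ := h.vertical (k + (1, 0))
  obtain ⟨n3, h3⟩ := h.horizontal (k + (0, 1))
  obtain ⟨n4, h4⟩ := h.vertical k
  rw [add_right_up] at h2
  rw [add_up_right] at h3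
  refine ⟨n3 + n4 - n1 - n2, ?_⟩
  rw [circ]; push_cast; linarith

theorem step_right (a b : ℤ) : (a, b) + ((1, 0) : ℤ × ℤ) = (a + 1, b) := by simp

theorem step_up (a b : ℤ) : (a, b) + ((0, 1) : ℤ × ℤ) = (a, b + 1) := by simp

theorem two_mul_succ (a : ℤ) : 2 * a + 1 + 1 = 2 * (a + 1) := by ring

theorem IsStrain.refine (h : IsStrain u bh bv) :
    IsStrain (refine u bh bv) (refineH bh bv) (refineV bh bv) := by
  classical
  have hh := fun k => abs_le.1 (h.abs_horizontal_le k)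
  have hv := fun k => abs_le.1 (h.abs_vertical_le k)
  refine ⟨?_, ?_, ?_, ?_⟩
  · refine parity_cases ?_ ?_ ?_ ?_ <;> intro a b <;>
      simp only [VarEq.refine, refineH, step_right, two_mul_succ, byParity_00, byParity_10, byParity_01, byParity_11,
        centreValue, crossing, step_up]
    · exact ⟨0, by push_cast; ring⟩
    · obtain ⟨n, hn⟩ := h.horizontal (a, b)
      rw [step_right] at hn
      exact ⟨n, by linarith⟩
    · split_ifs with hc
      · rw [circ, step_right, step_up] at hc
        exact ⟨0, by push_cast; linarith⟩
      · exact ⟨_, by ring⟩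
    · obtain ⟨n, hn⟩ := h.horizontal (a, b)
      rw [step_right] at hn
      split_ifs with hc
      · rw [circ, step_right, step_up] at hc
        exact ⟨n, by linarith⟩
      · exact ⟨n, by linarith⟩
  · refine parity_cases ?_ ?_ ?_ ?_ <;> intro a b <;>
      simp only [VarEq.refine, refineV, step_up, two_mul_succ, byParity_00, byParity_10, byParity_01, byParity_11,
        centreValue, step_right]
    · exact ⟨0, by push_cast; ring⟩
    · split_ifs with hc
      · exact ⟨0, by push_cast; ring⟩
      · exact ⟨0, by push_cast; ring⟩
    · obtain ⟨n, hn⟩ := h.vertical (a, b)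
      rw [step_up] at hn
      exact ⟨n, by linarith⟩
    · obtain ⟨n, hn⟩ := h.vertical (a, b)
      obtain ⟨m, hm⟩ := h.circ_int (a, b)
      rw [step_up] at hn
      split_ifs with hc
      · rw [circ, step_right, step_up] at hc
        exact ⟨n, by linarith⟩
      · rw [circ, step_right, step_up] at hm
        exact ⟨n - m, by push_cast; linarith⟩
  · refine parity_cases ?_ ?_ ?_ ?_ <;> intro a b <;>
      simp only [refineH, byParity_00, byParity_10, byParity_01, byParity_11]
    · exact abs_le.2 ⟨by linarith [hh (a, b)], by linarith [hh (a, b)]⟩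
    · exact abs_le.2 ⟨by linarith [hh (a, b)], by linarith [hh (a, b)]⟩
    · split_ifs
      · exact abs_le.2 ⟨by linarith [hh (a, b), hh ((a, b) + (0, 1))],
          by linarith [hh (a, b), hh ((a, b) + (0, 1))]⟩
      · exact abs_sub_nearestInt_le _
    · split_ifs
      · exact abs_le.2 ⟨by linarith [hh (a, b), hh ((a, b) + (0, 1))],
          by linarith [hh (a, b), hh ((a, b) + (0, 1))]⟩
      · simp
  · refine parity_cases ?_ ?_ ?_ ?_ <;> intro a b <;>
      simp only [refineV, byParity_00, byParity_10, byParity_01, byParity_11]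
    · exact abs_le.2 ⟨by linarith [hv (a, b)], by linarith [hv (a, b)]⟩
    · split_ifs
      · exact abs_le.2 ⟨by linarith [hv (a, b), hv ((a, b) + (1, 0))],
          by linarith [hv (a, b), hv ((a, b) + (1, 0))]⟩
      · exact abs_le.2 ⟨by linarith [hh (a, b), hv ((a, b) + (1, 0))],
          by linarith [hh (a, b), hv ((a, b) + (1, 0))]⟩
    · exact abs_le.2 ⟨by linarith [hv (a, b)], by linarith [hv (a, b)]⟩
    · split_ifs
      · exact abs_le.2 ⟨by linarith [hv (a, b), hv ((a, b) + (1, 0))],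
          by linarith [hv (a, b), hv ((a, b) + (1, 0))]⟩
      · exact abs_le.2 ⟨by linarith [hh ((a, b) + (0, 1)), hv ((a, b) + (1, 0))],
          by linarith [hh ((a, b) + (0, 1)), hv ((a, b) + (1, 0))]⟩

/-- The sum over the four children of a lattice square. -/
def childSum (F : ℤ × ℤ → ℝ) (k : ℤ × ℤ) : ℝ :=
  F (2 * k.1, 2 * k.2) + F (2 * k.1 + 1, 2 * k.2) + F (2 * k.1, 2 * k.2 + 1) +
    F (2 * k.1 + 1, 2 * k.2 + 1)

theorem nearestInt_between {z : ℝ} {m : ℤ} (h : |z - m / 2| ≤ 1 / 2) :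
    |(nearestInt z : ℝ)| + |(m : ℝ) - nearestInt z| ≤ |(m : ℝ)| ∨ m = 0 := by
  have h1 := abs_le.1 (abs_sub_nearestInt_le z)
  have h2 := abs_le.1 h
  set n := nearestInt z
  rcases lt_trichotomy m 0 with hm | hm | hm
  · left
    have hm' : (m : ℝ) ≤ -1 := by exact_mod_cast (by omega : m ≤ -1)
    have a1 : n ≤ 0 := by
      by_contra hn
      have : (1 : ℝ) ≤ n := by exact_mod_cast (by omega : 1 ≤ n)
      have hz : z ≤ 0 := by linarith
      linarith
    have a2 : m ≤ n := by
      by_contra hn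
      have h3 : (n : ℝ) + 1 ≤ m := by exact_mod_cast (by omega : n + 1 ≤ m)
      linarith
    have b1 : (n : ℝ) ≤ 0 := by exact_mod_cast a1
    have b2 : (m : ℝ) ≤ n := by exact_mod_cast a2
    rw [abs_of_nonpos b1, abs_of_nonpos (by linarith : (m : ℝ) - n ≤ 0), abs_of_nonpos (by linarith)]
    linarith
  · exact Or.inr hm
  · left
    have hm' : (1 : ℝ) ≤ m := by exact_mod_cast (by omega : 1 ≤ m)
    have a1 : 0 ≤ n := by
      by_contra hn
      have : (n : ℝ) ≤ -1 := by exact_mod_cast (by omega : n ≤ -1)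
      linarith
    have a2 : n ≤ m := by
      by_contra hn
      have h3 : (m : ℝ) + 1 ≤ n := by exact_mod_cast (by omega : m + 1 ≤ n)
      linarith
    have b1 : (0 : ℝ) ≤ n := by exact_mod_cast a1
    have b2 : (n : ℝ) ≤ m := by exact_mod_cast a2
    rw [abs_of_nonneg b1, abs_of_nonneg (by linarith : 0 ≤ (m : ℝ) - n), abs_of_nonneg (by linarith)]
    linarith

theorem IsStrain.childSum_le (h : IsStrain u bh bv) (k : ℤ × ℤ) :
    childSum (fun j => |circ (refineH bh bv) (refineV bh bv) j|) k ≤ |circ bh bv k| ∧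
    childSum (edgeSum (fun j => refineH bh bv j ^ 2) fun j => refineV bh bv j ^ 2) k ≤
      edgeSum (fun k => bh k ^ 2) (fun k => bv k ^ 2) k + 3 / 2 * |circ bh bv k| ∧
    childSum (fun j => ‖uv (VarEq.refine u bh bv j) - uv (u k)‖ ^ 2) k ≤
      48 * π ^ 2 * edgeSum (fun k => bh k ^ 2) (fun k => bv k ^ 2) k := by
  classical
  obtain ⟨a, b⟩ := k
  obtain ⟨m, hm⟩ := h.circ_int (a, b)
  have hN : ∀ s t : ℝ, ‖uv t - uv s‖ ^ 2 ≤ 4 * π ^ 2 * (t - s) ^ 2 := by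
    intro s t
    rw [norm_uv_sub_sq]
    have h := sq_le_sq.2 (Real.abs_sin_le_abs (x := π * (t - s)))
    nlinarith
  have b1 := h.abs_horizontal_le (a, b)
  have b2 := h.abs_vertical_le ((a, b) + (1, 0))
  have b3 := h.abs_horizontal_le ((a, b) + (0, 1))
  have b4 := h.abs_vertical_le (a, b)
  by_cases hc : circ bh bv (a, b) = 0
  · have hc' := hc
    simp only [circ, step_right, step_up] at hc'
    simp only [childSum, circ, edgeSum, refineH, refineV, VarEq.refine, step_right, step_up, two_mul_succ, byParity_00,
      byParity_10, byParity_01, byParity_11, centreValue, if_pos hc']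
    rw [hc']
    set p := bh (a, b)
    set q := bv (a + 1, b)
    set r := bh (a, b + 1)
    set s := bv (a, b)
    have hp : p = r + s - q := by linarith
    refine ⟨?_, ?_, ?_⟩
    · have e1 : p / 2 + (s + q) / 4 - (p + r) / 4 - s / 2 = 0 := by rw [hp]; ring
      have e2 : p / 2 + q / 2 - (p + r) / 4 - (s + q) / 4 = 0 := by rw [hp]; ring
      have e3 : (p + r) / 4 + (s + q) / 4 - r / 2 - s / 2 = 0 := by rw [hp]; ring
      have e4 : (p + r) / 4 + q / 2 - r / 2 - (s + q) / 4 = 0 := by rw [hp]; ring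
      rw [e1, e2, e3, e4]; simp
    · simp only [abs_zero]
      nlinarith [sq_nonneg (p - r), sq_nonneg (q - s)]
    · have n1 := hN (u (a, b)) (u (a, b) + p / 2)
      have n2 := hN (u (a, b)) (u (a, b) + s / 2)
      have n3 := hN (u (a, b)) (u (a, b) + (2 * p + q + s) / 4)
      rw [add_sub_cancel_left] at n1 n2 n3
      simp only [sub_self, norm_zero]
      have e : (p / 2) ^ 2 + (s / 2) ^ 2 + ((2 * p + q + s) / 4) ^ 2 ≤ 12 * (p ^ 2 + q ^ 2 + r ^ 2 + s ^ 2) := by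
        nlinarith [sq_nonneg (p - q), sq_nonneg (p - s), sq_nonneg (q - s), sq_nonneg r,
          sq_nonneg p, sq_nonneg q, sq_nonneg s]
      have := mul_le_mul_of_nonneg_left e (by positivity : 0 ≤ 4 * π ^ 2)
      linarith
  · have hm' := hm
    have hm1 : 1 ≤ |circ bh bv (a, b)| := by
      rw [hm] at hc ⊢
      have : m ≠ 0 := fun h0 => hc (by rw [h0]; simp)
      exact_mod_cast Int.one_le_abs this
    rw [circ, step_right, step_up] at hm'
    have hc' := hc
    simp only [circ, step_right, step_up] at hc'
    have hx := abs_sub_nearestInt_le (crossing bh bv (a, b))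
    simp only [childSum, circ, edgeSum, refineH, refineV, VarEq.refine, step_right, step_up, two_mul_succ, byParity_00,
      byParity_10, byParity_01, byParity_11, centreValue, if_neg hc']
    rw [step_right] at b2
    rw [step_up] at b3
    rw [circ, step_right, step_up] at hm1
    have hz : crossing bh bv (a, b) = bh (a, b) + bv (a + 1, b) / 2 - bv (a, b) / 2 := by
      rw [crossing, step_right]
    set z := crossing bh bv (a, b)
    set p := bh (a, b)
    set q := bv (a + 1, b)
    set r := bh (a, b + 1)
    set s := bv (a, b)
    rw [abs_le] at b1 b2 b3 b4
    refine ⟨?_, ?_, ?_⟩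
    · have e1 : p / 2 + (p + q) / 2 - (z - nearestInt z) - s / 2 = nearestInt z := by rw [hz]; ring
      have e2 : p / 2 + q / 2 - 0 - (p + q) / 2 = 0 := by ring
      have e3 : z - nearestInt z + (q - r) / 2 - r / 2 - s / 2 = m - nearestInt z := by
        rw [← hm', hz]; ring
      have e4 : 0 + q / 2 - r / 2 - (q - r) / 2 = 0 := by ring
      rw [e1, e2, e3, e4, hm']
      have := nearestInt_between (z := z) (m := m) (abs_le.2 ⟨by rw [← hm', hz]; linarith,
        by rw [← hm', hz]; linarith⟩)
      rcases this with h | h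
      · simpa using h
      · rw [hm'] at hm1
        rw [h] at hm1; norm_num at hm1
    · set x := z - nearestInt z
      have hx2 : x ^ 2 ≤ 1 / 4 := by rw [← sq_abs]; nlinarith [abs_nonneg x]
      have t1 : ((p + q) / 2) ^ 2 ≤ 1 / 4 := by nlinarith
      have t2 : ((q - r) / 2) ^ 2 ≤ 1 / 4 := by nlinarith
      nlinarith [sq_nonneg p, sq_nonneg q, sq_nonneg r, sq_nonneg s]
    · have n1 := hN (u (a, b)) (u (a, b) + p / 2)
      have n2 := hN (u (a, b)) (u (a, b) + s / 2)
      have n3 := hN (u (a, b)) (u (a, b) + p + q / 2)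
      rw [add_sub_cancel_left] at n1 n2
      rw [add_assoc, add_sub_cancel_left] at n3
      simp only [sub_self, norm_zero]
      have e : (p / 2) ^ 2 + (s / 2) ^ 2 + (p + q / 2) ^ 2 ≤ 12 * (p ^ 2 + q ^ 2 + r ^ 2 + s ^ 2) := by
        nlinarith [sq_nonneg (p - q), sq_nonneg r, sq_nonneg p, sq_nonneg q, sq_nonneg s]
      rw [← add_assoc] at n3
      have := mul_le_mul_of_nonneg_left e (by positivity : 0 ≤ 4 * π ^ 2)
      linarith

end Refinement

section Refinement

/-- The four children of a lattice square. -/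
def quad (k : ℤ × ℤ) : Finset (ℤ × ℤ) :=
  {(2 * k.1, 2 * k.2), (2 * k.1 + 1, 2 * k.2), (2 * k.1, 2 * k.2 + 1), (2 * k.1 + 1, 2 * k.2 + 1)}

theorem mem_quad {j k : ℤ × ℤ} : j ∈ quad k ↔ parent j = k := by
  simp only [quad, Finset.mem_insert, Finset.mem_singleton, parent, Prod.ext_iff]
  omega

theorem sum_quad (F : ℤ × ℤ → ℝ) (k : ℤ × ℤ) : ∑ j ∈ quad k, F j = childSum F k := by
  rw [quad, sum_insert, sum_insert, sum_insert, Finset.sum_singleton, childSum]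
  · ring
  all_goals simp [Prod.ext_iff]

/-- The children of the squares in `P`. -/
def children (P : Finset (ℤ × ℤ)) : Finset (ℤ × ℤ) := P.biUnion quad

theorem mem_children {P : Finset (ℤ × ℤ)} {j : ℤ × ℤ} : j ∈ children P ↔ parent j ∈ P := by
  simp [children, mem_quad]

theorem sum_children (P : Finset (ℤ × ℤ)) (F : ℤ × ℤ → ℝ) :
    ∑ j ∈ children P, F j = ∑ k ∈ P, childSum F k := by
  rw [children, Finset.sum_biUnion]
  · exact sum_congr rfl fun k _ => sum_quad F k
  · intro a _ b _ hab
    rw [Function.onFun, Finset.disjoint_left]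
    intro j h1 h2
    exact hab ((mem_quad.1 h1).symm.trans (mem_quad.1 h2))

theorem childSum_mono {F G : ℤ × ℤ → ℝ} {k : ℤ × ℤ} (h : ∀ j, parent j = k → F j ≤ G j) :
    childSum F k ≤ childSum G k := by
  rw [← sum_quad, ← sum_quad]
  exact sum_le_sum fun j hj => h j (mem_quad.1 hj)

theorem IsStrain.exists_refinement {u bh bv : ℤ × ℤ → ℝ} (h : IsStrain u bh bv)
    (P : Finset (ℤ × ℤ)) (n : ℕ) :
    ∃ (u' bh' bv' : ℤ × ℤ → ℝ) (Q : Finset (ℤ × ℤ)), IsStrain u' bh' bv' ∧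
      (∀ j, j ∈ Q ↔ parent^[n] j ∈ P) ∧
      ∑ j ∈ Q, |circ bh' bv' j| ≤ ∑ k ∈ P, |circ bh bv k| ∧
      ∑ j ∈ Q, edgeSum (fun j => bh' j ^ 2) (fun j => bv' j ^ 2) j ≤
        ∑ k ∈ P, edgeSum (fun k => bh k ^ 2) (fun k => bv k ^ 2) k +
          3 / 2 * n * ∑ k ∈ P, |circ bh bv k| ∧
      ∑ j ∈ Q, ‖uv (u' j) - uv (u (parent^[n] j))‖ ^ 2 ≤ 14 * π ^ 2 * (8 ^ n - 1) *
        (∑ k ∈ P, edgeSum (fun k => bh k ^ 2) (fun k => bv k ^ 2) k +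
          3 / 2 * n * ∑ k ∈ P, |circ bh bv k|) := by
  induction n with
  | zero => exact ⟨u, bh, bv, P, h, by simp, by simp, by simp, by simp⟩
  | succ n ih =>
    obtain ⟨u', bh', bv', Q, h1, h2, h3, h4, h5⟩ := ih
    set E := ∑ k ∈ P, edgeSum (fun k => bh k ^ 2) (fun k => bv k ^ 2) k
    set N := ∑ k ∈ P, |circ bh bv k|
    have hN : 0 ≤ N := sum_nonneg fun k _ => abs_nonneg _
    have H := h1.childSum_le
    refine ⟨VarEq.refine u' bh' bv', refineH bh' bv', refineV bh' bv', children Q, h1.refine, ?_, ?_, ?_, ?_⟩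
    · intro j
      rw [mem_children, h2, Function.iterate_succ_apply]
    · rw [sum_children]
      exact (sum_le_sum fun k _ => (H k).1).trans h3
    · rw [sum_children]
      refine (sum_le_sum fun k _ => (H k).2.1).trans ?_
      rw [sum_add_distrib, ← mul_sum]
      push_cast
      linarith
    · rw [sum_children]
      have e : ∀ k ∈ Q, childSum (fun j => ‖uv (VarEq.refine u' bh' bv' j) - uv (u (parent^[n + 1] j))‖ ^ 2) k ≤
          2 * (48 * π ^ 2 * edgeSum (fun k => bh' k ^ 2) (fun k => bv' k ^ 2) k) +
            8 * ‖uv (u' k) - uv (u (parent^[n] k))‖ ^ 2 := by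
        intro k _
        have a1 : childSum (fun j => ‖uv (VarEq.refine u' bh' bv' j) - uv (u (parent^[n + 1] j))‖ ^ 2) k ≤
            childSum (fun j => 2 * ‖uv (VarEq.refine u' bh' bv' j) - uv (u' k)‖ ^ 2 +
              2 * ‖uv (u' k) - uv (u (parent^[n] k))‖ ^ 2) k := by
          refine childSum_mono fun j hj => ?_
          rw [Function.iterate_succ_apply, hj]
          have t := norm_sub_le_norm_sub_add_norm_sub (uv (VarEq.refine u' bh' bv' j)) (uv (u' k))
            (uv (u (parent^[n] k)))
          have t2 := pow_le_pow_left₀ (norm_nonneg _) t 2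
          nlinarith [sq_nonneg (‖uv (VarEq.refine u' bh' bv' j) - uv (u' k)‖ -
            ‖uv (u' k) - uv (u (parent^[n] k))‖)]
        refine a1.trans ?_
        have := (H k).2.2
        simp only [childSum] at this ⊢
        linarith
      refine (sum_le_sum e).trans ?_
      rw [sum_add_distrib, ← mul_sum, ← mul_sum, ← mul_sum]
      push_cast
      have q1 := mul_le_mul_of_nonneg_left h4 (by positivity : 0 ≤ π ^ 2)
      have hM : 0 ≤ E + 3 / 2 * n * N := by
        have : 0 ≤ E := sum_nonneg fun k _ => by unfold edgeSum; positivity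
        positivity
      have q2 : 14 * π ^ 2 * (8 ^ (n + 1) - 1) * (E + 3 / 2 * n * N) ≤
          14 * π ^ 2 * (8 ^ (n + 1) - 1) * (E + 3 / 2 * (n + 1) * N) := by
        have : (1 : ℝ) ≤ 8 ^ (n + 1) := one_le_pow₀ (by norm_num)
        have : (0 : ℝ) ≤ 8 ^ (n + 1) - 1 := by linarith
        gcongr
        linarith
      refine le_trans ?_ q2
      have q3 : 0 ≤ π ^ 2 * (E + 3 / 2 * n * N) := by positivity
      rw [pow_succ (8 : ℝ) n]
      linarith

theorem iterate_parent_cellIndex {δ : ℝ} (x : E2) (n : ℕ) :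
    parent^[n] (cellIndex δ x) = cellIndex (2 ^ n * δ) x := by
  have half : ∀ t : ℝ, ⌊t⌋ / 2 = ⌊t / 2⌋ := by
    intro t
    symm
    rw [Int.floor_eq_iff]
    have h1 := Int.floor_le t
    have h2 := Int.lt_floor_add_one t
    have a1 : (2 * (⌊t⌋ / 2) : ℤ) ≤ ⌊t⌋ := by omega
    have a2 : ⌊t⌋ + 1 ≤ (2 * (⌊t⌋ / 2) + 2 : ℤ) := by omega
    have b1 : (2 : ℝ) * ((⌊t⌋ / 2 : ℤ) : ℝ) ≤ (⌊t⌋ : ℝ) := by exact_mod_cast a1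
    have b2 : (⌊t⌋ : ℝ) + 1 ≤ 2 * ((⌊t⌋ / 2 : ℤ) : ℝ) + 2 := by exact_mod_cast a2
    constructor <;> linarith
  induction n with
  | zero => simp
  | succ n ih =>
    rw [Function.iterate_succ_apply', ih]
    simp only [parent, cellIndex, half, pow_succ]
    have e : ∀ s : ℝ, s / (2 ^ n * δ) / 2 = s / (2 ^ n * 2 * δ) := by
      intro s; rw [div_div]; congr 1; ring
    rw [e, e]

/-- The strains of a displacement. -/
theorem isStrain_elastic (u : ℤ × ℤ → ℝ) : IsStrain u (strainH u) (strainV u) :=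
  ⟨fun _ => ⟨_, (sub_add_cancel _ _).symm⟩, fun _ => ⟨_, (sub_add_cancel _ _).symm⟩,
    fun _ => abs_elastic_le _ _ _, fun _ => abs_elastic_le _ _ _⟩

theorem elastic_sq_le_of_congr {u : ℤ × ℤ → ℝ} {i j : ℤ × ℤ} {b : ℝ} {n : ℤ}
    (h : u j - u i = b + n) : elastic u i j ^ 2 ≤ b ^ 2 := by
  have h1 := abs_elastic_le u i j
  set N := nearestInt (u j - u i) with hN
  have e : elastic u i j = b + ((n - N : ℤ) : ℝ) := by
    rw [elastic, ← hN, h]; push_cast; ring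
  rcases eq_or_ne (n - N) 0 with h0 | h0
  · rw [e, h0]; simp
  · have h2 : (1 : ℝ) ≤ |((n - N : ℤ) : ℝ)| := by exact_mod_cast Int.one_le_abs h0
    have h3 : |((n - N : ℤ) : ℝ)| ≤ |elastic u i j| + |b| := by
      have := abs_sub (elastic u i j) b
      rwa [e, add_sub_cancel_left, ← e] at this
    exact sq_le_sq.2 (by linarith)

theorem IsStrain.cellStrain_le {u bh bv : ℤ × ℤ → ℝ} (h : IsStrain u bh bv) (k : ℤ × ℤ) :
    cellStrain u k ≤ edgeSum (fun k => bh k ^ 2) (fun k => bv k ^ 2) k := by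
  have a : ∀ k, strainH u k ^ 2 ≤ bh k ^ 2 := fun k => by
    obtain ⟨n, hn⟩ := h.horizontal k
    exact elastic_sq_le_of_congr hn
  have b : ∀ k, strainV u k ^ 2 ≤ bv k ^ 2 := fun k => by
    obtain ⟨n, hn⟩ := h.vertical k
    exact elastic_sq_le_of_congr hn
  rw [cellStrain, edgeSum, edgeSum]
  linarith [a k, b (k + (1, 0)), a (k + (0, 1)), b k]

/-- The energy of the bonds of `Ω` is controlled by the squares next to them. -/
theorem sdEnergy_le_sum_cellStrain {Ω : Set E2} {δ : ℝ} (hb : IsBounded Ω) (hδ : 0 < δ)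
    {Q : Finset (ℤ × ℤ)} (hQ : ∀ k, pt δ k ∈ Ω → k ∈ Q ∧ k - (1, 0) ∈ Q ∧ k - (0, 1) ∈ Q)
    (u : ℤ × ℤ → ℝ) : sdEnergy Ω δ u ≤ 1 / 4 * ∑ k ∈ Q, cellStrain u k := by
  obtain ⟨H, W, hH, hW, h⟩ := finsum_bonds hb hδ
  have shift : ∀ (p : ℤ × ℤ → ℝ), (∀ k, 0 ≤ p k) → ∀ (S : Finset (ℤ × ℤ)) (e : ℤ × ℤ),
      (∀ k ∈ S, k - e ∈ Q) → ∑ k ∈ S, p k ≤ ∑ k ∈ Q, p (k + e) := by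
    intro p hp S e he
    have : ∑ k ∈ Q, p (k + e) = ∑ k ∈ Q.map (addRightEmbedding e), p k := by
      rw [sum_map]; rfl
    rw [this]
    refine sum_le_sum_of_subset_of_nonneg (fun k hk => ?_) fun k _ _ => hp k
    exact Finset.mem_map.2 ⟨k - e, he k hk, by simp⟩
  have a1 := shift (fun k => strainH u k ^ 2) (fun k => sq_nonneg _) H 0 fun k hk => by
    simpa using (hQ k ((hH k).1 hk).1).1
  have a2 := shift (fun k => strainH u k ^ 2) (fun k => sq_nonneg _) H (0, 1) fun k hk =>
    (hQ k ((hH k).1 hk).1).2.2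
  have a3 := shift (fun k => strainV u k ^ 2) (fun k => sq_nonneg _) W 0 fun k hk => by
    simpa using (hQ k ((hW k).1 hk).1).1
  have a4 := shift (fun k => strainV u k ^ 2) (fun k => sq_nonneg _) W (1, 0) fun k hk =>
    (hQ k ((hW k).1 hk).1).2.1
  simp only [add_zero] at a1 a3
  rw [sdEnergy, h fun b => elastic u b.1 b.2 ^ 2]
  simp only [cellStrain, edgeSum, sum_add_distrib]
  simp only [strainH, strainV] at a1 a2 a3 a4 ⊢
  linarith

end Refinement

/-! ### Mollification -/

section Mollification

open Metric

/-- The mollification of `a` by a bump function. -/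
def moll (ρ : ContDiffBump (0 : E2)) (a : E2 → ℝ) (x : E2) : ℝ :=
  ∫ t, ρ.normed volume t * a (x - t)

variable {ρ : ContDiffBump (0 : E2)} {a b : E2 → ℝ}

theorem moll_eq_convolution (ρ : ContDiffBump (0 : E2)) (a : E2 → ℝ) :
    moll ρ a = convolution (ρ.normed volume) a (lsmul ℝ ℝ) volume := rfl

theorem integrable_moll_integrand (ρ : ContDiffBump (0 : E2)) (ha : LocallyIntegrable a) (x : E2) :
    Integrable fun t => ρ.normed volume t * a (x - t) :=
  ρ.hasCompactSupport_normed.convolutionExists_left (lsmul ℝ ℝ)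
    ρ.continuous_normed ha x

theorem continuous_moll (ρ : ContDiffBump (0 : E2)) (ha : LocallyIntegrable a) :
    Continuous (moll ρ a) :=
  ρ.hasCompactSupport_normed.continuous_convolution_left (lsmul ℝ ℝ)
    (ρ.continuous_normed (μ := volume)) ha

theorem moll_sub (ρ : ContDiffBump (0 : E2)) (ha : LocallyIntegrable a) (hb : LocallyIntegrable b)
    (x : E2) : moll ρ (fun y => a y - b y) x = moll ρ a x - moll ρ b x := by
  unfold moll
  rw [← integral_sub (integrable_moll_integrand ρ ha x) (integrable_moll_integrand ρ hb x)]
  simp only [mul_sub]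

theorem locallyIntegrable_of_sq (ha : MemLp a 2) : LocallyIntegrable a :=
  ha.locallyIntegrable (by norm_num)

/-- Jensen's inequality for mollifications. -/
theorem moll_sq_le (ρ : ContDiffBump (0 : E2)) (ha : MemLp a 2) (x : E2) :
    moll ρ a x ^ 2 ≤ moll ρ (fun y => a y ^ 2) x := by
  set m := moll ρ a x with hm
  have i1 := integrable_moll_integrand ρ (locallyIntegrable_of_sq ha) x
  have i2 := integrable_moll_integrand ρ ha.integrable_sq.locallyIntegrable x
  have i3 := ρ.integrable_normed (μ := volume)
  have h : 0 ≤ ∫ t, ρ.normed volume t * (a (x - t) - m) ^ 2 :=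
    integral_nonneg fun t => mul_nonneg (ρ.nonneg_normed t) (sq_nonneg _)
  have e : ∫ t, ρ.normed volume t * (a (x - t) - m) ^ 2 =
      moll ρ (fun y => a y ^ 2) x - 2 * m * moll ρ a x + m ^ 2 * 1 := by
    unfold moll
    have i4 : Integrable fun t => ρ.normed volume t * a (x - t) ^ 2 -
        2 * m * (ρ.normed volume t * a (x - t)) := i2.sub (i1.const_mul _)
    rw [← ρ.integral_normed (μ := volume), ← integral_const_mul, ← integral_const_mul,
      ← integral_sub i2 (i1.const_mul _), ← integral_add i4 (i3.const_mul _)]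
    congr 1; ext t; ring
  rw [e, ← hm] at h
  nlinarith

theorem integrable_moll_sq (ρ : ContDiffBump (0 : E2)) (ha : MemLp a 2) :
    Integrable fun x => moll ρ a x ^ 2 := by
  refine (Integrable.integrable_convolution (lsmul ℝ ℝ)
    (ρ.integrable_normed (μ := volume)) ha.integrable_sq).mono'
    ((continuous_moll ρ (locallyIntegrable_of_sq ha)).pow 2).aestronglyMeasurable
    (of_forall fun x => ?_)
  rw [norm_of_nonneg (sq_nonneg _)]
  exact moll_sq_le ρ ha x

theorem memLp_moll (ρ : ContDiffBump (0 : E2)) (ha : MemLp a 2) : MemLp (moll ρ a) 2 :=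
  (memLp_two_iff_integrable_sq (continuous_moll ρ (locallyIntegrable_of_sq ha)).aestronglyMeasurable).2
    (integrable_moll_sq ρ ha)

theorem integral_moll_sq_le (ρ : ContDiffBump (0 : E2)) (ha : MemLp a 2) :
    ∫ x, moll ρ a x ^ 2 ≤ ∫ x, a x ^ 2 := by
  have h := integral_convolution (lsmul ℝ ℝ)
    (ρ.integrable_normed (μ := volume)) ha.integrable_sq
  rw [ρ.integral_normed] at h
  refine (integral_mono (integrable_moll_sq ρ ha) (Integrable.integrable_convolution
    (lsmul ℝ ℝ) (ρ.integrable_normed (μ := volume)) ha.integrable_sq)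
    fun x => moll_sq_le ρ ha x).trans (h.trans_le ?_)
  simp

/-- Mollifications converge in `L²`. -/
theorem exists_integral_moll_sub_sq_le (ha : MemLp a 2) {η : ℝ} (hη : 0 < η) :
    ∃ r > 0, ∀ ρ : ContDiffBump (0 : E2), ρ.rOut ≤ r → ∫ x, (moll ρ a x - a x) ^ 2 ≤ η := by
  obtain ⟨h, hc, h1, hcont, hmem⟩ := MemLp.exists_hasCompactSupport_integral_rpow_sub_le
    (p := 2) (by norm_num) (f := a) (μ := volume) (by simpa using ha) (ε := η / 12) (by positivity)
  replace hmem : MemLp h 2 := by simpa using hmem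
  replace h1 : ∫ x, (a x - h x) ^ 2 ≤ η / 12 := by
    simpa only [Real.rpow_two, norm_eq_abs, sq_abs] using h1
  obtain ⟨R, hR⟩ := hc.isCompact.isBounded.subset_ball (0 : E2)
  set B := closedBall (0 : E2) (R + 1)
  set v := volume.real B
  obtain ⟨κ, hκ, hκv⟩ : ∃ κ > 0, κ ^ 2 * v ≤ η / 12 := by
    refine ⟨√(η / (12 * (v + 1))), sqrt_pos.2 (by positivity), ?_⟩
    rw [sq_sqrt (by positivity), div_mul_eq_mul_div, div_le_div_iff₀ (by positivity) (by norm_num)]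
    nlinarith [measureReal_nonneg (μ := volume) (s := B)]
  obtain ⟨r, hr, hu⟩ := Metric.uniformContinuous_iff.1
    (hc.uniformContinuous_of_continuous hcont) κ hκ
  refine ⟨min r 1, by positivity, fun ρ hρ => ?_⟩
  have la := locallyIntegrable_of_sq ha
  have lh := locallyIntegrable_of_sq hmem
  have hd : ∀ x, (moll ρ h x - h x) ^ 2 ≤ B.indicator (fun _ => κ ^ 2) x := by
    intro x
    by_cases hx : x ∈ B
    · rw [indicator_of_mem hx]
      have := ρ.dist_normed_convolution_le (μ := volume) (x₀ := x) hcont.aestronglyMeasurable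
        (fun y hy => (hu ((mem_ball.1 hy).trans_le (hρ.trans (min_le_left _ _)))).le)
      rw [Real.dist_eq] at this
      exact sq_le_sq.2 (this.trans (le_abs_self κ))
    · rw [Set.indicator_of_notMem hx]
      have hz : ∀ y ∈ closedBall x 1, h y = 0 := by
        intro y hy
        by_contra hne
        have h2 := mem_ball.1 (hR (subset_tsupport h hne))
        refine hx (mem_closedBall.2 ?_)
        have := dist_triangle x y 0
        rw [mem_closedBall, dist_comm] at hy
        linarith
      have := ρ.dist_normed_convolution_le (μ := volume) (x₀ := x) (g := h) (ε := 0)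
        hcont.aestronglyMeasurable (fun y hy => by
          rw [hz y (ball_subset_closedBall (ball_subset_ball (hρ.trans (min_le_right _ _)) hy)),
            hz x (mem_closedBall_self zero_le_one), dist_self])
      rw [Real.dist_eq] at this
      have h0 : moll ρ h x - h x = 0 := abs_nonpos_iff.1 this
      rw [h0]; norm_num
  have i1 := integrable_moll_sq ρ (ha.sub hmem)
  have i2 : Integrable (B.indicator fun _ : E2 => κ ^ 2) :=
    (integrable_indicator_iff measurableSet_closedBall).2
      (integrableOn_const (isCompact_closedBall _ _).measure_ne_top)
  have i3 := (ha.sub hmem).integrable_sq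
  have i4 : Integrable fun x => 3 * moll ρ (a - h) x ^ 2 + 3 * B.indicator (fun _ => κ ^ 2) x :=
    (i1.const_mul 3).add (i2.const_mul 3)
  calc ∫ x, (moll ρ a x - a x) ^ 2
      ≤ ∫ x, (3 * moll ρ (a - h) x ^ 2 + 3 * B.indicator (fun _ => κ ^ 2) x + 3 * (a - h) x ^ 2) := by
        refine integral_mono_of_nonneg (of_forall fun x => sq_nonneg _)
          (i4.add (i3.const_mul 3))
          (of_forall fun x => ?_)
        have e : moll ρ (a - h) x = moll ρ a x - moll ρ h x := moll_sub ρ la lh x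
        simp only [e, Pi.sub_apply]
        nlinarith [hd x, sq_nonneg (moll ρ a x - moll ρ h x - (moll ρ h x - h x)),
          sq_nonneg (moll ρ a x - moll ρ h x + (a x - h x)),
          sq_nonneg ((moll ρ h x - h x) + (a x - h x))]
    _ = 3 * (∫ x, moll ρ (a - h) x ^ 2) + 3 * (∫ x, B.indicator (fun _ => κ ^ 2) x) +
          3 * ∫ x, (a - h) x ^ 2 := by
        rw [integral_add i4 (i3.const_mul 3),
          integral_add (i1.const_mul 3) (i2.const_mul 3), integral_const_mul, integral_const_mul,
          integral_const_mul]
    _ ≤ η := by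
        have h2 := integral_moll_sq_le ρ (ha.sub hmem)
        have h3 : ∫ x, B.indicator (fun _ : E2 => κ ^ 2) x = κ ^ 2 * v := by
          rw [integral_indicator measurableSet_closedBall, setIntegral_const, smul_eq_mul, mul_comm]
        have h4 : ∫ x, (a - h) x ^ 2 ≤ η / 12 := h1
        rw [h3]
        linarith

/-- Products of mollifications converge in `L¹`. -/
theorem exists_integral_moll_mul_sub_le (ha : MemLp a 2) (hb : MemLp b 2) {η : ℝ} (hη : 0 < η) :
    ∃ r > 0, ∀ ρ : ContDiffBump (0 : E2), ρ.rOut ≤ r →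
      ∫ x, |moll ρ a x * moll ρ b x - a x * b x| ≤ η := by
  set m := (∫ x, a x ^ 2) + ∫ x, b x ^ 2 with hm
  have hm0 : 0 ≤ m := add_nonneg (integral_nonneg fun x => sq_nonneg _)
    (integral_nonneg fun x => sq_nonneg _)
  set κ := η / (m + 1) with hκ
  have hκ0 : 0 < κ := by positivity
  obtain ⟨r, hr, h1⟩ := exists_integral_moll_sub_sq_le ha (η := η * κ / 2) (by positivity)
  obtain ⟨s, hs, h2⟩ := exists_integral_moll_sub_sq_le hb (η := η * κ / 2) (by positivity)
  refine ⟨min r s, by positivity, fun ρ hρ => ?_⟩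
  have k1 := h1 ρ (hρ.trans (min_le_left _ _))
  have k2 := h2 ρ (hρ.trans (min_le_right _ _))
  have i1 := integrable_moll_sq ρ ha
  have i2 := hb.integrable_sq
  have i3 : Integrable fun x => (moll ρ a x - a x) ^ 2 := ((memLp_moll ρ ha).sub ha).integrable_sq
  have i4 : Integrable fun x => (moll ρ b x - b x) ^ 2 := ((memLp_moll ρ hb).sub hb).integrable_sq
  have i5 : Integrable fun x => κ / 2 * (moll ρ a x ^ 2 + b x ^ 2) := (i1.add i2).const_mul _
  have i6 : Integrable fun x => 1 / (2 * κ) * ((moll ρ a x - a x) ^ 2 + (moll ρ b x - b x) ^ 2) :=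
    (i3.add i4).const_mul _
  calc ∫ x, |moll ρ a x * moll ρ b x - a x * b x|
      ≤ ∫ x, (κ / 2 * (moll ρ a x ^ 2 + b x ^ 2) +
          1 / (2 * κ) * ((moll ρ a x - a x) ^ 2 + (moll ρ b x - b x) ^ 2)) := by
        refine integral_mono_of_nonneg (of_forall fun x => abs_nonneg _) (i5.add i6)
          (of_forall fun x => ?_)
        have amgm : ∀ p q : ℝ, |p * q| ≤ κ / 2 * p ^ 2 + 1 / (2 * κ) * q ^ 2 := by
          intro p q
          have e : κ / 2 * p ^ 2 + 1 / (2 * κ) * q ^ 2 - |p * q| =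
              1 / (2 * κ) * (κ * |p| - |q|) ^ 2 := by
            rw [abs_mul, ← sq_abs p, ← sq_abs q]; field_simp; ring
          have : 0 ≤ 1 / (2 * κ) * (κ * |p| - |q|) ^ 2 := by positivity
          linarith
        have e : moll ρ a x * moll ρ b x - a x * b x =
            moll ρ a x * (moll ρ b x - b x) + b x * (moll ρ a x - a x) := by ring
        have t1 := amgm (moll ρ a x) (moll ρ b x - b x)
        have t2 := amgm (b x) (moll ρ a x - a x)
        simp only [e]
        refine (abs_add_le _ _).trans ?_
        linarith
    _ = κ / 2 * ((∫ x, moll ρ a x ^ 2) + ∫ x, b x ^ 2) + 1 / (2 * κ) *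
          ((∫ x, (moll ρ a x - a x) ^ 2) + ∫ x, (moll ρ b x - b x) ^ 2) := by
        rw [integral_add i5 i6, integral_const_mul, integral_const_mul, integral_add i1 i2,
          integral_add i3 i4]
    _ ≤ κ / 2 * m + 1 / (2 * κ) * (η * κ / 2 + η * κ / 2) := by
        have := integral_moll_sq_le ρ ha
        gcongr
        linarith
    _ ≤ η := by
        have e1 : 1 / (2 * κ) * (η * κ / 2 + η * κ / 2) = η / 2 := by field_simp; ring
        have e2 : κ * m ≤ η := by
          rw [hκ, div_mul_eq_mul_div, div_le_iff₀ (by positivity)]; nlinarith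
        linarith

end Mollification

theorem setIntegral_le_of_subset {f : E2 → ℝ} {A B : Set E2} (hf : IntegrableOn f B)
    (h0 : ∀ x, 0 ≤ f x) (h : A ⊆ B) : ∫ x in A, f x ≤ ∫ x in B, f x :=
  setIntegral_mono_set hf (of_forall h0) (LE.le.eventuallyLE h)

section MollifiedFields

open Metric

variable {Ω : Set E2} {ρ : ContDiffBump (0 : E2)}

theorem moll_eq_swap (ρ : ContDiffBump (0 : E2)) (a : E2 → ℝ) (x : E2) :
    moll ρ a x = ∫ t, ρ.normed volume (x - t) * a t :=
  convolution_lsmul_swap (𝕜 := ℝ) (F := ℝ) (f := ρ.normed volume)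

theorem contDiff_moll (ρ : ContDiffBump (0 : E2)) {a : E2 → ℝ} (ha : LocallyIntegrable a) :
    ContDiff ℝ 1 (moll ρ a) :=
  ρ.hasCompactSupport_normed.contDiff_convolution_left (lsmul ℝ ℝ)
    (n := 1) (ρ.contDiff_normed (μ := volume)) ha

theorem fderiv_moll (ρ : ContDiffBump (0 : E2)) {a : E2 → ℝ} (ha : LocallyIntegrable a) (x v : E2) :
    fderiv ℝ (moll ρ a) x v = ∫ t, fderiv ℝ (ρ.normed volume) (x - t) v * a t := by
  have hc := ρ.hasCompactSupport_normed (μ := volume)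
  have hd : ContDiff ℝ 1 (ρ.normed volume) := ρ.contDiff_normed (n := 1)
  have h := hc.hasFDerivAt_convolution_left (lsmul ℝ ℝ) hd ha x
  have hi := (hc.fderiv ℝ).convolutionExists_left
    ((lsmul ℝ ℝ).precompL E2) (hd.continuous_fderiv one_ne_zero) ha x
  rw [moll_eq_convolution, h.fderiv, convolution_def, ContinuousLinearMap.integral_apply hi,
    ← integral_sub_left_eq_self _ volume x]
  refine integral_congr_ae (of_forall fun t => ?_)
  simp [ContinuousLinearMap.precompL_apply]

/-- In the interior, the gradient of the mollification is the mollification of the gradient. -/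
theorem HasWeakGradient.fderiv_moll {f : E2 → ℝ} {g : E2 → E2} (h : HasWeakGradient Ω f g)
    (ho : IsOpen Ω) (hf : LocallyIntegrable (Ω.indicator f)) {x : E2}
    (hx : closedBall x ρ.rOut ⊆ Ω) (l : Fin 2) :
    fderiv ℝ (moll ρ (Ω.indicator f)) x (single l 1) =
      moll ρ (Ω.indicator fun y => g y l) x := by
  have hm := ho.measurableSet
  have hts : tsupport (fun t => ρ.normed volume (x - t)) ⊆ closedBall x ρ.rOut := by
    refine closure_minimal (fun t ht => ?_) isClosed_closedBall
    have : x - t ∈ Function.support (ρ.normed volume) := ht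
    rw [ρ.support_normed_eq, mem_ball_zero_iff] at this
    rw [mem_closedBall, dist_comm, dist_eq_norm]
    exact this.le
  have hd : ContDiff ℝ ∞ (ρ.normed volume) := ρ.contDiff_normed (n := ⊤)
  have key := h (fun t => ρ.normed volume (x - t)) (hd.comp (contDiff_const.sub contDiff_id))
    ((isCompact_closedBall x ρ.rOut).of_isClosed_subset (isClosed_tsupport _) hts) (hts.trans hx) l
  have ed : ∀ t, fderiv ℝ (fun t => ρ.normed volume (x - t)) t =
      -fderiv ℝ (ρ.normed volume) (x - t) := fun t => by
    have h1 := ((hd.differentiable (by simp)) (x - t)).hasFDerivAt.comp t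
      ((hasFDerivAt_id t).const_sub x)
    exact h1.fderiv.trans (by ext; simp)
  rw [VarEq.fderiv_moll ρ hf, moll_eq_swap]
  have e1 : ∀ t, fderiv ℝ (ρ.normed volume) (x - t) (single l 1) * Ω.indicator f t =
      Ω.indicator (fun t => -(f t * fderiv ℝ (fun t => ρ.normed volume (x - t)) t
        (single l 1))) t := by
    intro t
    by_cases ht : t ∈ Ω
    · simp only [indicator_of_mem ht, ed, neg_apply]; ring
    · simp [ht]
  have e2 : ∀ t, ρ.normed volume (x - t) * Ω.indicator (fun y => g y l) t =
      Ω.indicator (fun t => g t l * ρ.normed volume (x - t)) t := by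
    intro t
    by_cases ht : t ∈ Ω
    · simp only [indicator_of_mem ht]; ring
    · simp [ht]
  simp only [e1, e2]
  rw [integral_indicator hm, integral_indicator hm, integral_neg, key, neg_neg]

theorem moll_le_one (ρ : ContDiffBump (0 : E2)) {a : E2 → ℝ} (ha : LocallyIntegrable a)
    (h1 : ∀ᵐ x, a x ≤ 1) (x : E2) : moll ρ a x ≤ 1 := by
  rw [← ρ.integral_normed (μ := volume)]
  refine integral_mono_ae (integrable_moll_integrand ρ ha x) ρ.integrable_normed ?_
  filter_upwards [(quasiMeasurePreserving_sub_left_of_right_invariant volume x).ae h1] with t ht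
  exact mul_le_of_le_one_right (ρ.nonneg_normed t) ht

theorem hasCompactSupport_moll (ρ : ContDiffBump (0 : E2)) {a : E2 → ℝ} (ha : HasCompactSupport a) :
    HasCompactSupport (moll ρ a) :=
  (ρ.hasCompactSupport_normed (μ := volume)).convolution (lsmul ℝ ℝ) ha

theorem memLp_indicator (ho : IsOpen Ω) {g : E2 → E2} (hg : MemLp g 2 (volume.restrict Ω))
    (l : Fin 2) : MemLp (Ω.indicator fun y => g y l) 2 :=
  (memLp_indicator_iff_restrict ho.measurableSet).2
    ((proj (𝕜 := ℝ) l).comp_memLp' hg)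

theorem setIntegral_abs_le_of_le_add {U : Set E2} (hU : MeasurableSet U) {f p q : E2 → ℝ} {η : ℝ}
    (hp : Integrable p) (hq : Integrable q) (h : ∀ x ∈ U, |f x| ≤ |p x| + |q x|)
    (h1 : ∫ x, |p x| ≤ η / 4) (h2 : ∫ x, |q x| ≤ η / 4) : ∫ x in U, |f x| ≤ η := by
  have i : Integrable fun x => |p x| + |q x| := hp.abs.add hq.abs
  have h0 : ∫ x in U, |f x| ≤ ∫ x in U, (|p x| + |q x|) :=
    integral_mono_of_nonneg (of_forall fun x => abs_nonneg _) i.integrableOn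
      ((ae_restrict_iff' hU).2 (of_forall h))
  have h3 := h0.trans (setIntegral_le_integral i (of_forall fun x => by
    simp only [Pi.zero_apply]; positivity))
  rw [integral_add hp.abs hq.abs] at h3
  have : 0 ≤ ∫ x, |p x| := integral_nonneg fun x => abs_nonneg _
  linarith

/-- Smooth approximation of a field with values in the disc, in the interior of `Ω`. -/
theorem H1Field.exists_mollification (ho : IsOpen Ω) (hb : IsBounded Ω) (w : H1Field Ω)
    (hw : w.InBall) {s η : ℝ} (hs : 0 < s) (hη : 0 < η) :
    ∃ V : E2 → E2, ContDiff ℝ 1 V ∧ LipBdd V ∧ (∀ x, ‖V x‖ ≤ 1) ∧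
      (∫ x in (thickening s Ωᶜ)ᶜ, dens V x) ≤ ∫ x in Ω, (‖w.grad 0 x‖ ^ 2 + ‖w.grad 1 x‖ ^ 2) ∧
      (∫ x in (thickening s Ωᶜ)ᶜ, (1 - ‖V x‖) ^ 2) ≤ 2 * (∫ x in Ω, (1 - ‖w.toFun x‖) ^ 2) + η ∧
      (∫ x in (thickening s Ωᶜ)ᶜ, |mjac V x - w.jac x|) ≤ η ∧
      ∀ l, (∫ x in (thickening s Ωᶜ)ᶜ, |mcur l V x - w.current x l|) ≤ η := by
  set U := (thickening s Ωᶜ)ᶜ with hUdef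
  have hm := ho.measurableSet
  have hU : MeasurableSet U := isOpen_thickening.measurableSet.compl
  have hUΩ : ∀ x ∈ U, ball x s ⊆ Ω := by
    intro x hx y hy
    by_contra hyΩ
    exact hx (mem_thickening_iff.2 ⟨y, hyΩ, by rwa [dist_comm, ← mem_ball]⟩)
  have hUsub : U ⊆ Ω := fun x hx => hUΩ x hx (mem_ball_self hs)
  set a : Fin 2 → E2 → ℝ := fun i => Ω.indicator fun x => w.toFun x i with ha
  set g : Fin 2 → Fin 2 → E2 → ℝ := fun k l => Ω.indicator fun x => w.grad k x l with hg
  have ma : ∀ i, MemLp (a i) 2 := fun i => memLp_indicator ho w.memLp_toFun i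
  have mg : ∀ k l, MemLp (g k l) 2 := fun k l => memLp_indicator ho (w.memLp_grad k) l
  have la := fun i => locallyIntegrable_of_sq (ma i)
  have unif : ∀ {ι : Type} [Finite ι] [Nonempty ι] {p : ι → ContDiffBump (0 : E2) → Prop},
      (∀ i, ∃ r > 0, ∀ ρ, ρ.rOut ≤ r → p i ρ) → ∃ r > 0, ∀ ρ, ρ.rOut ≤ r → ∀ i, p i ρ := by
    intro ι _ _ p h
    choose r hr H using h
    obtain ⟨i₀, h₀⟩ := Finite.exists_min r
    exact ⟨r i₀, hr i₀, fun ρ hρ i => H i ρ (hρ.trans (h₀ i))⟩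
  have hη4 : 0 < η / 4 := by positivity
  obtain ⟨r₁, hr₁, H₁⟩ := unif fun i => exists_integral_moll_sub_sq_le (ma i) hη4
  obtain ⟨r₂, hr₂, H₂⟩ := unif fun i : Fin 2 × Fin 2 =>
    exists_integral_moll_mul_sub_le (mg 0 i.1) (mg 1 i.2) hη4
  obtain ⟨r₃, hr₃, H₃⟩ := unif fun i : Fin 2 × Fin 2 =>
    exists_integral_moll_mul_sub_le (ma i.1) (mg (1 - i.1) i.2) hη4
  set R := min (min r₁ r₂) (min r₃ (s / 2)) with hR
  have hR0 : 0 < R := lt_min (lt_min hr₁ hr₂) (lt_min hr₃ (by positivity))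
  obtain ⟨ρ, hρ⟩ : ∃ ρ : ContDiffBump (0 : E2), ρ.rOut = R := ⟨⟨R / 2, R, by positivity, by linarith⟩, rfl⟩
  replace H₁ := H₁ ρ (by rw [hρ, hR]; exact (min_le_left _ _).trans (min_le_left _ _))
  replace H₂ := H₂ ρ (by rw [hρ, hR]; exact (min_le_left _ _).trans (min_le_right _ _))
  replace H₃ := H₃ ρ (by rw [hρ, hR]; exact (min_le_right _ _).trans (min_le_left _ _))
  have hρs : ρ.rOut < s := by
    rw [hρ, hR]
    exact ((min_le_right _ _).trans (min_le_right _ _)).trans_lt (by linarith)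
  set V : E2 → E2 := fun x => !₂[moll ρ (a 0) x, moll ρ (a 1) x] with hV
  have V0 : ∀ x i, V x i = moll ρ (a i) x := fun x i => by fin_cases i <;> rfl
  have hcs : ∀ i, HasCompactSupport (a i) := fun i => by
    refine HasCompactSupport.of_support_subset_isCompact hb.isCompact_closure
      ((Set.support_indicator_subset).trans subset_closure)
  have hnorm : ∀ x, ‖V x‖ ≤ 1 := by
    intro x
    have h1 := moll_sq_le ρ (ma 0) x
    have h2 := moll_sq_le ρ (ma 1) x
    have i1 := integrable_moll_integrand ρ (ma 0).integrable_sq.locallyIntegrable x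
    have i2 := integrable_moll_integrand ρ (ma 1).integrable_sq.locallyIntegrable x
    have h3 : moll ρ (fun y => a 0 y ^ 2) x + moll ρ (fun y => a 1 y ^ 2) x ≤ 1 := by
      have e : moll ρ (fun y => a 0 y ^ 2) x + moll ρ (fun y => a 1 y ^ 2) x =
          moll ρ (fun y => a 0 y ^ 2 + a 1 y ^ 2) x := by
        rw [moll, moll, ← integral_add i1 i2, moll]
        simp only [mul_add]
      rw [e]
      refine moll_le_one ρ ((ma 0).integrable_sq.locallyIntegrable.add
        (ma 1).integrable_sq.locallyIntegrable) ?_ x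
      filter_upwards [(ae_restrict_iff' hm).1 hw] with y hy
      by_cases hyΩ : y ∈ Ω
      · have := hy hyΩ
        simp only [Pi.add_apply, ha, indicator_of_mem hyΩ]
        rw [← norm_sq_eq]
        exact pow_le_one₀ (norm_nonneg _) this
      · simp [ha, hyΩ]
    have h4 := norm_sq_eq (V x)
    rw [V0, V0] at h4
    exact abs_le_of_sq_le_sq' (by linarith) zero_le_one |>.2
  have hdiff : ContDiff ℝ 1 V := by
    rw [contDiff_euclidean]
    intro i
    simp only [V0]
    exact contDiff_moll ρ (la i)
  have hVcs : HasCompactSupport V := by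
    refine HasCompactSupport.intro ((hasCompactSupport_moll ρ (hcs 0)).isCompact.union
      (hasCompactSupport_moll ρ (hcs 1)).isCompact) fun x hx => ?_
    rw [Set.mem_union, not_or] at hx
    ext i
    rw [V0]
    fin_cases i
    · exact image_eq_zero_of_notMem_tsupport hx.1
    · exact image_eq_zero_of_notMem_tsupport hx.2
  have hLip : LipBdd V := ⟨hdiff.lipschitzWith_of_hasCompactSupport hVcs one_ne_zero, 1, hnorm⟩
  have hpd : ∀ x ∈ U, ∀ l i, pd l V x i = moll ρ (g i l) x := by
    intro x hx l i
    have hd := (hdiff.differentiable one_ne_zero) x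
    have h1 : fderiv ℝ (fun y => V y i) x (single l 1) = pd l V x i := by
      have := ((proj (𝕜 := ℝ) i).hasFDerivAt (x := V x)).comp x hd.hasFDerivAt
      exact congrArg (fun L : E2 →L[ℝ] ℝ => L (single l 1)) this.fderiv
    rw [← h1]
    simp only [V0]
    exact (w.weak_grad i).fderiv_moll ho (la i)
      ((closedBall_subset_ball hρs).trans (hUΩ x hx)) l
  have hUfin : volume U ≠ ⊤ := ((measure_mono hUsub).trans_lt hb.measure_lt_top).ne
  refine ⟨V, hdiff, hLip, hnorm, ?_, ?_, ?_, ?_⟩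
  · have e : ∀ x ∈ U, dens V x = moll ρ (g 0 0) x ^ 2 + moll ρ (g 1 0) x ^ 2 +
        (moll ρ (g 0 1) x ^ 2 + moll ρ (g 1 1) x ^ 2) := by
      intro x hx
      simp only [dens, norm_sq_eq, hpd x hx]
    have is := fun k l => integrable_moll_sq ρ (mg k l)
    have it := fun k l => (mg k l).integrable_sq
    rw [setIntegral_congr_fun hU e]
    have e2 : ∫ x in Ω, (‖w.grad 0 x‖ ^ 2 + ‖w.grad 1 x‖ ^ 2) =
        ∫ x, (g 0 0 x ^ 2 + g 1 0 x ^ 2 + (g 0 1 x ^ 2 + g 1 1 x ^ 2)) := by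
      rw [← integral_indicator hm]
      congr 1; ext x
      by_cases hx : x ∈ Ω
      · simp only [hg, indicator_of_mem hx, norm_sq_eq]; ring
      · simp [hg, hx]
    rw [e2]
    have j1 : Integrable fun x => moll ρ (g 0 0) x ^ 2 + moll ρ (g 1 0) x ^ 2 := (is _ _).add (is _ _)
    have j2 : Integrable fun x => moll ρ (g 0 1) x ^ 2 + moll ρ (g 1 1) x ^ 2 := (is _ _).add (is _ _)
    have j3 : Integrable fun x => g 0 0 x ^ 2 + g 1 0 x ^ 2 := (it _ _).add (it _ _)
    have j4 : Integrable fun x => g 0 1 x ^ 2 + g 1 1 x ^ 2 := (it _ _).add (it _ _)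
    refine (setIntegral_le_integral (j1.add j2) (of_forall fun x => by
      simp only [Pi.zero_apply, Pi.add_apply]; positivity)).trans ?_
    simp only [Pi.add_apply]
    rw [integral_add j1 j2, integral_add j3 j4, integral_add (is _ _) (is _ _),
      integral_add (is _ _) (is _ _), integral_add (it _ _) (it _ _), integral_add (it _ _) (it _ _)]
    linarith [integral_moll_sq_le ρ (mg 0 0), integral_moll_sq_le ρ (mg 0 1),
      integral_moll_sq_le ρ (mg 1 0), integral_moll_sq_le ρ (mg 1 1)]
  · have is : ∀ i, Integrable fun x => (moll ρ (a i) x - a i x) ^ 2 := fun i =>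
      ((memLp_moll ρ (ma i)).sub (ma i)).integrable_sq
    have : IsFiniteMeasure (volume.restrict Ω) := ⟨by simpa using hb.measure_lt_top⟩
    have ip : IntegrableOn (fun x => (1 - ‖w.toFun x‖) ^ 2) Ω :=
      ((memLp_const 1).sub w.memLp_toFun.norm).integrable_sq
    have j : Integrable fun x => 2 * ((moll ρ (a 0) x - a 0 x) ^ 2 + (moll ρ (a 1) x - a 1 x) ^ 2) :=
      ((is 0).add (is 1)).const_mul 2
    calc ∫ x in U, (1 - ‖V x‖) ^ 2 ≤ ∫ x in U, (2 * (1 - ‖w.toFun x‖) ^ 2 +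
          2 * ((moll ρ (a 0) x - a 0 x) ^ 2 + (moll ρ (a 1) x - a 1 x) ^ 2)) := by
          refine setIntegral_mono_on (((BM.const 1).sub hLip.bm_norm).pow 2 |>.integrableOn hUfin)
            (((ip.mono_set hUsub).const_mul 2).add j.integrableOn) hU fun x hx => ?_
          have h1 := norm_sq_eq (V x - w.toFun x)
          simp only [PiLp.sub_apply, V0] at h1
          simp only [ha, indicator_of_mem (hUsub hx)] at h1 ⊢
          have h2 := abs_le.1 (abs_norm_sub_norm_le (V x) (w.toFun x))
          rw [← h1]
          nlinarith [norm_nonneg (V x - w.toFun x), sq_nonneg ((1 - ‖w.toFun x‖) + (‖V x‖ - ‖w.toFun x‖)),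
            mul_self_nonneg (‖V x - w.toFun x‖), abs_le_abs h2.2 (by linarith [h2.1]),
            sq_le_sq.2 (show |‖V x‖ - ‖w.toFun x‖| ≤ |‖V x - w.toFun x‖| from by
              rw [abs_of_nonneg (norm_nonneg (V x - w.toFun x))]; exact abs_le.2 h2)]
      _ = 2 * (∫ x in U, (1 - ‖w.toFun x‖) ^ 2) +
          ∫ x in U, 2 * ((moll ρ (a 0) x - a 0 x) ^ 2 + (moll ρ (a 1) x - a 1 x) ^ 2) := by
          rw [integral_add ((ip.mono_set hUsub).const_mul 2) j.integrableOn, integral_const_mul]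
      _ ≤ 2 * (∫ x in Ω, (1 - ‖w.toFun x‖) ^ 2) +
          ∫ x, 2 * ((moll ρ (a 0) x - a 0 x) ^ 2 + (moll ρ (a 1) x - a 1 x) ^ 2) := by
          refine add_le_add (mul_le_mul_of_nonneg_left (setIntegral_le_of_subset ip
            (fun _ => sq_nonneg _) hUsub) zero_le_two) (setIntegral_le_integral j (of_forall fun x => ?_))
          simp only [Pi.zero_apply]; positivity
      _ ≤ _ := by
          rw [integral_const_mul, integral_add (is 0) (is 1)]
          linarith [H₁ 0, H₁ 1]
  · have q : ∀ i l, Integrable fun x => moll ρ (g 0 i) x * moll ρ (g 1 l) x - g 0 i x * g 1 l x :=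
      fun i l => ((memLp_moll ρ (mg 0 i)).integrable_mul (memLp_moll ρ (mg 1 l))).sub
        ((mg 0 i).integrable_mul (mg 1 l))
    refine setIntegral_abs_le_of_le_add hU (q 0 1) (q 1 0) (fun x hx => ?_) (H₂ (0, 1)) (H₂ (1, 0))
    simp only [mjac, crs, hpd x hx, H1Field.jac, hg, indicator_of_mem (hUsub hx)]
    refine le_trans (le_of_eq ?_) (abs_sub _ _)
    congr 1; ring
  · intro l
    have q : ∀ i, Integrable fun x => moll ρ (a i) x * moll ρ (g (1 - i) l) x - a i x * g (1 - i) l x :=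
      fun i => ((memLp_moll ρ (ma i)).integrable_mul (memLp_moll ρ (mg (1 - i) l))).sub
        ((ma i).integrable_mul (mg (1 - i) l))
    refine setIntegral_abs_le_of_le_add hU (q 0) (q 1) (fun x hx => ?_) (H₃ (0, l)) (H₃ (1, l))
    simp only [mcur, crs, hpd x hx, V0, H1Field.current, PiLp.sub_apply, PiLp.smul_apply,
      smul_eq_mul, sub_zero, sub_self, hg, ha, indicator_of_mem (hUsub hx)]
    refine le_trans (le_of_eq ?_) (abs_sub _ _)
    congr 1; ring

end MollifiedFields

section InteriorApproximation

open Metric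

variable {Ω : Set E2}

theorem H1Field.abs_jac_le (w : H1Field Ω) (x : E2) :
    |w.jac x| ≤ 1 / 2 * (‖w.grad 0 x‖ ^ 2 + ‖w.grad 1 x‖ ^ 2) := by
  have := abs_crs_le (w.grad 0 x) (w.grad 1 x)
  simp only [crs] at this
  rw [H1Field.jac]
  nlinarith [sq_nonneg (‖w.grad 0 x‖ - ‖w.grad 1 x‖)]

theorem H1Field.norm_current_sq_le (w : H1Field Ω) {x : E2} (hx : ‖w.toFun x‖ ≤ 1) :
    ‖w.current x‖ ^ 2 ≤ ‖w.grad 0 x‖ ^ 2 + ‖w.grad 1 x‖ ^ 2 := by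
  have h1 : ‖w.current x‖ ≤ |w.toFun x 0| * ‖w.grad 1 x‖ + |w.toFun x 1| * ‖w.grad 0 x‖ := by
    rw [H1Field.current]
    refine (norm_sub_le _ _).trans_eq ?_
    rw [norm_smul, norm_smul, norm_eq_abs, norm_eq_abs]
  have h2 := norm_sq_eq (w.toFun x)
  rw [← sq_abs (w.toFun x 0), ← sq_abs (w.toFun x 1)] at h2
  have h3 : ‖w.toFun x‖ ^ 2 ≤ 1 := pow_le_one₀ (norm_nonneg _) hx
  set p := |w.toFun x 0|
  set q := |w.toFun x 1|
  set b := ‖w.grad 1 x‖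
  set a := ‖w.grad 0 x‖
  have h4 := pow_le_pow_left₀ (norm_nonneg _) h1 2
  have h5 : (p ^ 2 + q ^ 2) * (b ^ 2 + a ^ 2) ≤ 1 * (b ^ 2 + a ^ 2) :=
    mul_le_mul_of_nonneg_right (by linarith) (by positivity)
  nlinarith [sq_nonneg (p * a - q * b)]

theorem H1Field.abs_current_le (w : H1Field Ω) {x : E2} (hx : ‖w.toFun x‖ ≤ 1) (l : Fin 2) :
    |w.current x l| ≤ 1 / 2 * (‖w.grad 0 x‖ ^ 2 + ‖w.grad 1 x‖ ^ 2 + 1) := by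
  have h1 := abs_apply_le (w.current x) l
  have h2 := w.norm_current_sq_le hx
  nlinarith [sq_nonneg (‖w.current x‖ - 1)]

theorem H1Field.aestronglyMeasurable_apply (w : H1Field Ω) (k l : Fin 2) :
    AEStronglyMeasurable (fun x => w.grad k x l) (volume.restrict Ω) :=
  ((proj (𝕜 := ℝ) l).comp_memLp' (w.memLp_grad k)).aestronglyMeasurable

theorem H1Field.integrable_jac (w : H1Field Ω) : IntegrableOn w.jac Ω := by
  refine (w.integrable_dens.const_mul (1 / 2)).mono'
    (((w.aestronglyMeasurable_apply 0 0).mul (w.aestronglyMeasurable_apply 1 1)).sub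
      ((w.aestronglyMeasurable_apply 0 1).mul (w.aestronglyMeasurable_apply 1 0)))
    (of_forall w.abs_jac_le)

theorem H1Field.integrable_current (hb : IsBounded Ω) (w : H1Field Ω) (hw : w.InBall)
    (l : Fin 2) : IntegrableOn (fun x => w.current x l) Ω := by
  have hf : ∀ i : Fin 2, AEStronglyMeasurable (fun x => w.toFun x i) (volume.restrict Ω) := fun i =>
    ((proj (𝕜 := ℝ) i).comp_memLp' w.memLp_toFun).aestronglyMeasurable
  refine ((w.integrable_dens.add (integrableOn_const (C := (1 : ℝ)) hb.measure_lt_top.ne)).const_mul (1 / 2)).mono'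
    (((hf 0).mul (w.aestronglyMeasurable_apply 1 l)).sub
      ((hf 1).mul (w.aestronglyMeasurable_apply 0 l))) ?_
  filter_upwards [hw] with x hx using w.abs_current_le hx l

/-- Changing an integrand in the interior, and dropping a boundary layer. -/
theorem abs_setIntegral_mul_sub_le (ho : IsOpen Ω) {s : ℝ} (hs : 0 < s) (φ : LipC Ω) {f g : E2 → ℝ}
    (hf : IntegrableOn f (thickening s Ωᶜ)ᶜ) (hg : IntegrableOn g Ω) {η I : ℝ}
    (h : ∫ x in (thickening s Ωᶜ)ᶜ, |f x - g x| ≤ η) (hI : ∫ x in Ω, |g x| ≤ I) :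
    |(∫ x in (thickening s Ωᶜ)ᶜ, f x * φ x) - ∫ x in Ω, g x * φ x| ≤ (η + s * I) * ‖φ‖ := by
  set U := (thickening s Ωᶜ)ᶜ with hUdef
  have hm := ho.measurableSet
  have hU : MeasurableSet U := isOpen_thickening.measurableSet.compl
  have hUsub : U ⊆ Ω := fun x hx => by
    by_contra hxΩ
    exact hx (mem_thickening_iff.2 ⟨x, hxΩ, by simpa using hs⟩)
  have mulφ : ∀ {A : Set E2} {k : E2 → ℝ}, IntegrableOn k A → IntegrableOn (fun x => k x * φ x) A :=
    fun hk => hk.mul_bdd φ.continuous.aestronglyMeasurable (of_forall φ.abs_le)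
  have hgU := hg.mono_set hUsub
  have hgD : IntegrableOn g (Ω \ U) := hg.mono_set sdiff_subset
  have e : ∫ x in Ω, g x * φ x = (∫ x in U, g x * φ x) + ∫ x in Ω \ U, g x * φ x := by
    rw [← setIntegral_union Set.disjoint_sdiff_right (hm.diff hU) (mulφ hgU) (mulφ hgD),
      Set.union_sdiff_cancel hUsub]
  rw [e, ← sub_sub, ← integral_sub (mulφ hf) (mulφ hgU)]
  refine (abs_sub _ _).trans ?_
  rw [add_mul]
  refine add_le_add ?_ ?_
  · refine abs_integral_le_integral_abs.trans ?_
    refine le_trans ?_ (mul_le_mul_of_nonneg_right h (norm_nonneg φ))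
    rw [← integral_mul_const]
    refine integral_mono (((mulφ hf).sub (mulφ hgU)).abs) ((hf.sub hgU).abs.mul_const _) fun x => ?_
    simp only
    rw [← sub_mul, abs_mul]
    exact mul_le_mul_of_nonneg_left (φ.abs_le x) (abs_nonneg _)
  · refine abs_integral_le_integral_abs.trans ?_
    calc ∫ x in Ω \ U, |g x * φ x| ≤ ∫ x in Ω \ U, |g x| * (s * ‖φ‖) := by
          refine setIntegral_mono_on (mulφ hgD).abs (hgD.abs.mul_const _) (hm.diff hU) fun x hx => ?_
          rw [abs_mul]
          refine mul_le_mul_of_nonneg_left ?_ (abs_nonneg _)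
          obtain ⟨z, hz, hxz⟩ := mem_thickening_iff.1 (Set.notMem_compl_iff.1 hx.2)
          have := φ.abs_sub_le x z
          rw [φ.eq_zero hz, sub_zero] at this
          nlinarith [norm_nonneg φ]
      _ ≤ ∫ x in Ω, |g x| * (s * ‖φ‖) := setIntegral_le_of_subset (hg.abs.mul_const _)
          (fun x => by positivity) sdiff_subset
      _ ≤ s * I * ‖φ‖ := by
          rw [integral_mul_const]
          nlinarith [mul_le_mul_of_nonneg_right hI (mul_nonneg hs.le (norm_nonneg φ))]

/-- A field with values in the disc is approximated by Lipschitz maps that control its energy up to a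
neighbourhood of `Ω`. -/
theorem H1Field.exists_interior_approx (ho : IsOpen Ω) (hb : IsBounded Ω) (w : H1Field Ω)
    (hw : w.InBall) {Φ : E2 → E2} {τ s η : ℝ} (h : NearId Φ τ) (hτ : τ ≤ 1 / 8) (hs : 0 < s)
    (hΦ : ∀ y ∈ Ω, ball (Φ y) (2 * s) ⊆ Ω) (hη : 0 < η) {I P : ℝ}
    (hI : ∫ x in Ω, (‖w.grad 0 x‖ ^ 2 + ‖w.grad 1 x‖ ^ 2) ≤ I)
    (hP : ∫ x in Ω, (1 - ‖w.toFun x‖) ^ 2 ≤ P) :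
    ∃ W : E2 → E2, ContDiff ℝ 1 W ∧ LipBdd W ∧ (∀ x, ‖W x‖ ≤ 1) ∧
      (∫ x in thickening (s / 2) Ω, dens W x) ≤ (1 + 21 * τ) * I ∧
      (∫ x in thickening (s / 2) Ω, (1 - ‖W x‖) ^ 2) ≤ 2 * (2 * P + η) ∧
      (∀ φ : LipC Ω, |(∫ x in Ω, mjac W x * φ x) - ∫ x in Ω, w.jac x * φ x| ≤
        (η + (13 * τ + s) * (I + volume.real Ω)) * ‖φ‖) ∧
      ∀ (l : Fin 2) (φ : LipC Ω), |(∫ x in Ω, mcur l W x * φ x) - ∫ x in Ω, w.current x l * φ x| ≤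
        (η + (13 * τ + s) * (I + volume.real Ω)) * ‖φ‖ := by
  obtain ⟨V, hVd, hV, hV1, h1, h2, h3, h4⟩ := w.exists_mollification ho hb hw hs hη
  set U := (thickening s Ωᶜ)ᶜ with hUdef
  set D := thickening (s / 2) Ω
  have hτ0 := h.nonneg
  have hU : MeasurableSet U := isOpen_thickening.measurableSet.compl
  have hD : MeasurableSet D := isOpen_thickening.measurableSet
  have hUsub : U ⊆ Ω := fun x hx => by
    by_contra hxΩ
    exact hx (mem_thickening_iff.2 ⟨x, hxΩ, by simpa using hs⟩)
  have hUfin : volume U ≠ ⊤ := ((measure_mono hUsub).trans_lt hb.measure_lt_top).ne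
  have hDfin : volume D ≠ ⊤ := hb.thickening.measure_lt_top.ne
  have hDU : ∀ x ∈ D, Φ x ∈ U := by
    intro x hx hxU
    obtain ⟨y, hy, hxy⟩ := mem_thickening_iff.1 hx
    obtain ⟨z, hz, hxz⟩ := mem_thickening_iff.1 hxU
    refine hz (hΦ y hy ?_)
    have d1 := h.dist_le (by linarith) x y
    have d2 := dist_triangle z (Φ x) (Φ y)
    rw [dist_comm] at hxz
    rw [mem_ball]
    linarith
  have hΩU : ∀ x ∈ Ω, Φ x ∈ U := fun x hx => hDU x (self_subset_thickening (by positivity) Ω hx)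
  have hI0 : 0 ≤ ∫ x in U, dens V x := integral_nonneg fun x => dens_nonneg V x
  have hvU : volume.real U ≤ volume.real Ω := measureReal_mono hUsub hb.measure_lt_top.ne
  have hv0 : 0 ≤ volume.real U := measureReal_nonneg
  have J1 : ∫ x in U, |mjac V x| ≤ 1 / 2 * I := by
    refine (integral_mono (hV.bm_mjac.abs.integrableOn hUfin)
      ((hV.bm_dens.integrableOn hUfin).const_mul _) fun x => abs_mjac_le V x).trans ?_
    rw [integral_const_mul]; linarith
  have J2 : ∀ l, ∫ x in U, |mcur l V x| ≤ 1 / 2 * (I + volume.real Ω) := by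
    intro l
    have i1 := hV.bm_dens.integrableOn hUfin
    have i2 : IntegrableOn (fun _ : E2 => (1 : ℝ)) U := integrableOn_const hUfin
    have : ∫ x in U, |mcur l V x| ≤ ∫ x in U, 1 / 2 * (dens V x + 1) := by
      refine integral_mono ((hV.bm_mcur l).abs.integrableOn hUfin) ((i1.add i2).const_mul _)
        fun x => ?_
      have a1 := abs_crs_le (V x) (pd l V x)
      have a2 : ‖V x‖ * ‖pd l V x‖ ≤ 1 * ‖pd l V x‖ :=
        mul_le_mul_of_nonneg_right (hV1 x) (norm_nonneg _)
      have a3 : ‖pd l V x‖ ^ 2 ≤ dens V x := by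
        fin_cases l <;> simp only [dens, Fin.zero_eta, Fin.mk_one] <;>
          nlinarith [sq_nonneg ‖pd 0 V x‖, sq_nonneg ‖pd 1 V x‖]
      simp only [mcur]
      nlinarith [sq_nonneg (‖pd l V x‖ - 1)]
    refine this.trans ?_
    rw [integral_const_mul, integral_add i1 i2, setIntegral_const]
    simp only [smul_eq_mul, mul_one]
    linarith
  have K1 : ∫ x in Ω, |w.jac x| ≤ I + volume.real Ω := by
    refine (integral_mono w.integrable_jac.abs (w.integrable_dens.const_mul _)
      w.abs_jac_le).trans ?_
    rw [integral_const_mul]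
    linarith
  have K2 : ∀ l, ∫ x in Ω, |w.current x l| ≤ I + volume.real Ω := by
    intro l
    have i2 : IntegrableOn (fun _ : E2 => (1 : ℝ)) Ω := integrableOn_const hb.measure_lt_top.ne
    refine (integral_mono_ae (w.integrable_current hb hw l).abs
      ((w.integrable_dens.add i2).const_mul (1 / 2)) ?_).trans ?_
    · filter_upwards [hw] with x hx using w.abs_current_le hx l
    · rw [integral_const_mul]
      simp only [Pi.add_apply]
      rw [integral_add w.integrable_dens i2, setIntegral_const]
      simp only [smul_eq_mul, mul_one]
      linarith
  refine ⟨V ∘ Φ, hVd.comp h.1, hV.comp_nearId h hτ, fun x => hV1 _, ?_, ?_, fun φ => ?_, fun l φ => ?_⟩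
  · refine (hV.integral_dens_comp_le h hτ hD hU hUfin hDfin hDU).trans ?_
    exact mul_le_mul_of_nonneg_left (h1.trans hI) (by positivity)
  · have := h.setIntegral_comp_le hτ hD hU (g := fun x => (1 - ‖V x‖) ^ 2)
      ((((BM.const 1).sub hV.bm_norm).pow 2).integrableOn hUfin) (fun x _ => sq_nonneg _) hDU
    refine this.trans ?_
    have h0 : 0 ≤ ∫ x in U, (1 - ‖V x‖) ^ 2 := integral_nonneg fun x => sq_nonneg _
    have : (1 + 6 * τ) * ∫ x in U, (1 - ‖V x‖) ^ 2 ≤ 2 * ∫ x in U, (1 - ‖V x‖) ^ 2 :=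
      mul_le_mul_of_nonneg_right (by linarith) h0
    linarith
  · have a1 := hV.abs_integral_mjac_comp_sub_le h hτ φ hU hUfin hΩU
    have a2 := abs_setIntegral_mul_sub_le ho hs φ (hV.bm_mjac.integrableOn hUfin)
      w.integrable_jac h3 K1
    have a3 : 13 * τ * ‖φ‖ * ∫ x in U, |mjac V x| ≤ 13 * τ * ‖φ‖ * (I + volume.real Ω) :=
      mul_le_mul_of_nonneg_left (by linarith) (by positivity)
    have := (abs_sub_le _ _ _).trans (add_le_add (a1.trans a3) a2)
    linarith
  · have a1 := hV.abs_integral_mcur_comp_sub_le h hτ φ hU hUfin hΩU l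
    have a2 := abs_setIntegral_mul_sub_le ho hs φ ((hV.bm_mcur l).integrableOn hUfin)
      (w.integrable_current hb hw l) (h4 l) (K2 l)
    have a3 : 13 * τ * ‖φ‖ * ((∫ x in U, |mcur 0 V x|) + ∫ x in U, |mcur 1 V x|) ≤
        13 * τ * ‖φ‖ * (I + volume.real Ω) :=
      mul_le_mul_of_nonneg_left (by linarith [J2 0, J2 1]) (by positivity)
    have := (abs_sub_le _ _ _).trans (add_le_add (a1.trans a3) a2)
    linarith

end InteriorApproximation

/-! ### Differences at dyadic scales -/

section Differences

open Metric

variable {W : E2 → E2} {Ω A D : Set E2}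

theorem sq_integral_le_integral_sq {X : Type*} [MeasurableSpace X] (μ : Measure X)
    [IsProbabilityMeasure μ] {f : X → ℝ} (hf : MemLp f 2 μ) :
    (∫ x, f x ∂μ) ^ 2 ≤ ∫ x, f x ^ 2 ∂μ := by
  set m := ∫ x, f x ∂μ with hm
  have i1 := hf.integrable_sq
  have i2 := (hf.integrable (by norm_num)).const_mul (2 * m)
  have h : 0 ≤ ∫ x, (f x - m) ^ 2 ∂μ := integral_nonneg fun x => sq_nonneg _
  have e : ∫ x, (f x - m) ^ 2 ∂μ = (∫ x, f x ^ 2 ∂μ) - 2 * m * m + m ^ 2 := by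
    have i3 : Integrable (fun x => f x ^ 2 - 2 * m * f x) μ := i1.sub i2
    have h3 : ∫ _, m ^ 2 ∂μ = m ^ 2 := by simp
    rw [← h3]
    nth_rewrite 3 [hm]
    rw [← integral_const_mul, ← integral_sub i1 i2, ← integral_add i3 (integrable_const _)]
    congr 1; ext x; ring
  rw [e] at h
  nlinarith

theorem LipBdd.exists_norm_fderiv_le (hL : LipBdd W) : ∃ K : ℝ, ∀ x, ‖fderiv ℝ W x‖ ≤ K :=
  let ⟨K, hK⟩ := hL.lip
  ⟨K, fun _ => norm_fderiv_le_of_lipschitz ℝ hK⟩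

theorem setIntegral_comp_add_le {g : E2 → ℝ} (hg : IntegrableOn g D) (h0 : ∀ x, 0 ≤ g x)
    (ξ : E2) (h : ∀ x ∈ A, x + ξ ∈ D) : ∫ x in A, g (x + ξ) ≤ ∫ x in D, g x := by
  have e : ∫ x in A, g (x + ξ) = ∫ x in (fun x => x - ξ) ⁻¹' A, g x := by
    rw [← (measurePreserving_sub_right volume ξ).setIntegral_preimage_emb
      (measurableEmbedding_subRight _) (fun x => g (x + ξ)) A]
    simp
  rw [e]
  refine setIntegral_le_of_subset hg h0 fun x hx => ?_
  simpa using h _ hx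

/-- Translations are controlled by derivatives. -/
theorem integral_translation_le (hW : ContDiff ℝ 1 W) (hL : LipBdd W) (ξ : E2)
    (hDfin : volume D ≠ ⊤)
    (hAD : ∀ x ∈ A, ∀ t ∈ Set.Icc (0 : ℝ) 1, x + t • ξ ∈ D) :
    ∫ x in A, ‖W (x + ξ) - W x‖ ^ 2 ≤ ∫ x in D, ‖fderiv ℝ W x ξ‖ ^ 2 := by
  obtain ⟨K, hK⟩ := hL.exists_norm_fderiv_le
  set F : E2 → ℝ := fun x => ‖fderiv ℝ W x ξ‖ with hF
  have hFc : Continuous F := ((hW.continuous_fderiv one_ne_zero).clm_apply continuous_const).norm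
  have hFb : ∀ x, F x ≤ K * ‖ξ‖ := fun x => (fderiv ℝ W x).le_of_opNorm_le (hK x) ξ
  have hF0 : ∀ x, 0 ≤ F x := fun x => norm_nonneg _
  have hF2 : ∀ x, ‖F x ^ 2‖ ≤ (K * ‖ξ‖) ^ 2 := fun x => by
    rw [norm_of_nonneg (sq_nonneg _)]; exact pow_le_pow_left₀ (hF0 x) (hFb x) 2
  have hAfin : volume A ≠ ⊤ := ne_top_of_le_ne_top hDfin (measure_mono fun x hx => by
    simpa using hAD x hx 0 (by simp))
  set μ : Measure ℝ := volume.restrict (Set.Ioc 0 1)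
  have hμ : IsProbabilityMeasure μ := ⟨by simp [μ]⟩
  have hνA : IsFiniteMeasure (volume.restrict A) := ⟨by simpa using hAfin.lt_top⟩
  have hpt : ∀ x, ‖W (x + ξ) - W x‖ ^ 2 ≤ ∫ t, F (x + t • ξ) ^ 2 ∂μ := by
    intro x
    have hc : Continuous fun t : ℝ => x + t • ξ := by fun_prop
    have hd : ∀ t : ℝ, HasDerivAt (fun t : ℝ => W (x + t • ξ)) (fderiv ℝ W (x + t • ξ) ξ) t := by
      intro t
      have h1 : HasDerivAt (fun t : ℝ => x + t • ξ) ξ t := by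
        simpa using ((hasDerivAt_id t).smul_const ξ).const_add x
      exact ((hW.differentiable one_ne_zero) _).hasFDerivAt.comp_hasDerivAt t h1
    have h1 : W (x + ξ) - W x = ∫ t in (0 : ℝ)..1, fderiv ℝ W (x + t • ξ) ξ := by
      rw [intervalIntegral.integral_eq_sub_of_hasDerivAt (fun t _ => hd t)
        (Continuous.intervalIntegrable (by
          exact ((hW.continuous_fderiv one_ne_zero).comp hc).clm_apply continuous_const) _ _)]
      simp
    have h2 : ‖W (x + ξ) - W x‖ ≤ ∫ t, F (x + t • ξ) ∂μ := by
      rw [h1, intervalIntegral.integral_of_le zero_le_one]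
      exact norm_integral_le_integral_norm _
    refine (pow_le_pow_left₀ (norm_nonneg _) h2 2).trans (sq_integral_le_integral_sq μ ?_)
    exact MemLp.of_bound (hFc.comp hc).aestronglyMeasurable (K * ‖ξ‖) (of_forall fun t => by
      rw [norm_of_nonneg (hF0 _)]; exact hFb _)
  have hprod : Integrable (fun p : E2 × ℝ => F (p.1 + p.2 • ξ) ^ 2) ((volume.restrict A).prod μ) := by
    have hc : Continuous fun p : E2 × ℝ => F (p.1 + p.2 • ξ) ^ 2 := by fun_prop
    exact (integrable_const ((K * ‖ξ‖) ^ 2)).mono' hc.aestronglyMeasurable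
      (of_forall fun p => hF2 _)
  have hF2D : IntegrableOn (fun x => F x ^ 2) D :=
    Measure.integrableOn_of_bounded hDfin (hFc.pow 2).aestronglyMeasurable (of_forall hF2)
  calc ∫ x in A, ‖W (x + ξ) - W x‖ ^ 2 ≤ ∫ x in A, ∫ t, F (x + t • ξ) ^ 2 ∂μ :=
        integral_mono_of_nonneg (of_forall fun x => by positivity)
          hprod.integral_prod_left (of_forall hpt)
    _ = ∫ t, (∫ x in A, F (x + t • ξ) ^ 2) ∂μ := integral_integral_swap hprod
    _ ≤ ∫ _, (∫ x in D, F x ^ 2) ∂μ := by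
        refine integral_mono_ae hprod.integral_prod_right (integrable_const _) ?_
        refine (ae_restrict_iff' measurableSet_Ioc).2 (of_forall fun t ht => ?_)
        exact setIntegral_comp_add_le hF2D (fun _ => sq_nonneg _) _ fun x hx =>
          hAD x hx t ⟨ht.1.le, ht.2⟩
    _ = ∫ x in D, F x ^ 2 := by simp

theorem norm_fderiv_apply_sq_le (W : E2 → E2) (x ξ : E2) :
    ‖fderiv ℝ W x ξ‖ ^ 2 ≤ ‖ξ‖ ^ 2 * dens W x := by
  have h1 : fderiv ℝ W x ξ = ξ 0 • pd 0 W x + ξ 1 • pd 1 W x := by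
    exact map_eq_pd W x ξ
  have h2 : ‖fderiv ℝ W x ξ‖ ≤ |ξ 0| * ‖pd 0 W x‖ + |ξ 1| * ‖pd 1 W x‖ := by
    rw [h1]
    refine (norm_add_le _ _).trans_eq ?_
    rw [norm_smul, norm_smul, norm_eq_abs, norm_eq_abs]
  refine (pow_le_pow_left₀ (norm_nonneg _) h2 2).trans ?_
  rw [norm_sq_eq ξ, dens, ← sq_abs (ξ 0), ← sq_abs (ξ 1)]
  nlinarith [sq_nonneg (|ξ 0| * ‖pd 1 W x‖ - |ξ 1| * ‖pd 0 W x‖)]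

theorem LipBdd.bm_sq_comb (hL : LipBdd W) (a b c : ℝ) (ξ ζ : E2) :
    BM fun x => ‖a • W (x + ξ) + b • W (x + ζ) + c • W x‖ ^ 2 := by
  obtain ⟨M, hM⟩ := hL.bdd
  have hc := hL.continuous
  refine ⟨(by fun_prop : Continuous _).measurable, ((|a| + |b| + |c|) * M) ^ 2, fun x => ?_⟩
  rw [abs_of_nonneg (sq_nonneg _)]
  refine pow_le_pow_left₀ (norm_nonneg _) ((norm_add₃_le).trans ?_) 2
  simp only [norm_smul, norm_eq_abs]
  nlinarith [mul_le_mul_of_nonneg_left (hM (x + ξ)) (abs_nonneg a),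
    mul_le_mul_of_nonneg_left (hM (x + ζ)) (abs_nonneg b), mul_le_mul_of_nonneg_left (hM x) (abs_nonneg c)]

theorem LipBdd.integrable_diff (hL : LipBdd W) (hA : volume A ≠ ⊤) (ξ : E2) :
    IntegrableOn (fun x => ‖W (x + ξ) - W x‖ ^ 2) A := by
  simpa [sub_eq_add_neg] using (hL.bm_sq_comb 1 0 (-1) ξ 0).integrableOn hA

theorem LipBdd.integrable_diff₂ (hL : LipBdd W) (hA : volume A ≠ ⊤) (ξ : E2) :
    IntegrableOn (fun x => ‖W (x + ξ + ξ) - (2 : ℝ) • W (x + ξ) + W x‖ ^ 2) A := by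
  simpa [sub_eq_add_neg, add_assoc] using (hL.bm_sq_comb 1 (-2) 1 (ξ + ξ) ξ).integrableOn hA

/-- Doubling the step: the parallelogram identity. -/
theorem integral_diff_double_le (hL : LipBdd W) (ξ : E2)
    (hDfin : volume D ≠ ⊤) (hAD : A ⊆ D) (hAD' : ∀ x ∈ A, x + ξ ∈ D) :
    (∫ x in A, ‖W (x + ξ + ξ) - W x‖ ^ 2) + ∫ x in A, ‖W (x + ξ + ξ) - (2 : ℝ) • W (x + ξ) + W x‖ ^ 2 ≤
      4 * ∫ x in D, ‖W (x + ξ) - W x‖ ^ 2 := by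
  have hAfin : volume A ≠ ⊤ := ne_top_of_le_ne_top hDfin (measure_mono hAD)
  have i0 := hL.integrable_diff hDfin ξ
  have i1 := hL.integrable_diff hAfin ξ
  have i2 : IntegrableOn (fun x => ‖W (x + ξ + ξ) - W (x + ξ)‖ ^ 2) A := by
    simpa [sub_eq_add_neg, add_assoc] using (hL.bm_sq_comb 1 (-1) 0 (ξ + ξ) ξ).integrableOn hAfin
  have i3 := hL.integrable_diff hAfin (ξ + ξ)
  simp only [← add_assoc] at i3
  have i4 := hL.integrable_diff₂ hAfin ξ
  have h1 := setIntegral_comp_add_le i0 (fun x => sq_nonneg _) ξ hAD'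
  have h2 := setIntegral_le_of_subset i0 (fun _ => sq_nonneg _) hAD
  rw [← integral_add i3 i4]
  have e : ∀ x, ‖W (x + ξ + ξ) - W x‖ ^ 2 + ‖W (x + ξ + ξ) - (2 : ℝ) • W (x + ξ) + W x‖ ^ 2 =
      2 * ‖W (x + ξ + ξ) - W (x + ξ)‖ ^ 2 + 2 * ‖W (x + ξ) - W x‖ ^ 2 := by
    intro x
    have := parallelogram_law_with_norm ℝ (W (x + ξ + ξ) - W (x + ξ)) (W (x + ξ) - W x)
    rw [show W (x + ξ + ξ) - W (x + ξ) + (W (x + ξ) - W x) = W (x + ξ + ξ) - W x by abel,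
      show W (x + ξ + ξ) - W (x + ξ) - (W (x + ξ) - W x) =
        W (x + ξ + ξ) - (2 : ℝ) • W (x + ξ) + W x by rw [two_smul]; abel] at this
    linarith
  simp only [e]
  rw [integral_add (i2.const_mul 2) (i1.const_mul 2), integral_const_mul, integral_const_mul]
  linarith

theorem add_mem_thickening {x ξ : E2} {r s : ℝ} (hx : x ∈ thickening r Ω) (hs : r + ‖ξ‖ ≤ s) :
    x + ξ ∈ thickening s Ω := by
  obtain ⟨z, hz, h⟩ := mem_thickening_iff.1 hx
  refine mem_thickening_iff.2 ⟨z, hz, ?_⟩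
  have := dist_triangle (x + ξ) x z
  rw [dist_eq_norm (x + ξ) x, add_sub_cancel_left] at this
  linarith

theorem exists_harmonic_le {a b : ℕ → ℝ} (K : ℕ) (hK : K ≠ 0) (hb : ∀ k, 0 ≤ b k)
    (h : ∀ k, b (k + 1) + a k ≤ b k) :
    ∃ k < K, (k + 1) * a k * log (K + 1) ≤ b 0 := by
  by_contra! hne
  have hlog : 0 < log (K + 1) := Real.log_pos (by
    have : (1 : ℝ) ≤ K := by exact_mod_cast Nat.one_le_iff_ne_zero.2 hK
    linarith)
  have h1 : ∀ n, ∑ k ∈ range n, a k ≤ b 0 - b n := by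
    intro n
    induction n with
    | zero => simp
    | succ n ih => rw [Finset.sum_range_succ]; linarith [h n]
  have h2 : ∑ k ∈ range K, b 0 / log (K + 1) * ((k : ℝ) + 1)⁻¹ <
      ∑ k ∈ range K, a k := by
    refine Finset.sum_lt_sum_of_nonempty (Finset.nonempty_range_iff.2 hK) fun k hk => ?_
    have := hne k (Finset.mem_range.1 hk)
    rw [← div_eq_mul_inv, div_div, div_lt_iff₀ (by positivity)]
    linarith
  rw [← mul_sum] at h2
  have h3 : log (K + 1) ≤ ∑ k ∈ range K, ((k : ℝ) + 1)⁻¹ := by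
    have := log_add_one_le_harmonic K
    simpa [harmonic] using this
  have h4 : b 0 ≤ b 0 / log (K + 1) * ∑ k ∈ range K, ((k : ℝ) + 1)⁻¹ := by
    rw [div_mul_eq_mul_div, le_div_iff₀ hlog]
    exact mul_le_mul_of_nonneg_left h3 (hb 0)
  linarith [h1 K, hb K]

/-- The total of the squares of the differences with step `h` in the two coordinate directions. -/
def diffEnergy (W : E2 → E2) (h : ℝ) (A : Set E2) : ℝ :=
  (∫ x in A, ‖W (x + h • single 0 1) - W x‖ ^ 2) +
    ∫ x in A, ‖W (x + h • single 1 1) - W x‖ ^ 2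

/-- The total of the squares of the second differences. -/
def diffEnergy₂ (W : E2 → E2) (h : ℝ) (A : Set E2) : ℝ :=
  (∫ x in A, ‖W (x + h • single 0 1 + h • single 0 1) -
    (2 : ℝ) • W (x + h • single 0 1) + W x‖ ^ 2) +
  ∫ x in A, ‖W (x + h • single 1 1 + h • single 1 1) -
    (2 : ℝ) • W (x + h • single 1 1) + W x‖ ^ 2

/-- Among many dyadic scales there is one at which the second differences are small. -/
theorem exists_scale (hW : ContDiff ℝ 1 W) (hL : LipBdd W) (hb : IsBounded Ω) {δ R : ℝ}
    (hδ : 0 < δ) {K : ℕ} (hK : K ≠ 0) {I : ℝ} (hI : ∫ x in thickening R Ω, dens W x ≤ I) :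
    ∃ k < K, diffEnergy W (2 ^ k * δ) (thickening (R - 4 * (2 ^ k * δ)) Ω) ≤ (2 ^ k * δ) ^ 2 * I ∧
      (k + 1) * diffEnergy₂ W (2 ^ k * δ) (thickening (R - 4 * (2 ^ k * δ)) Ω) *
        log (K + 1) ≤ 4 * (2 ^ k * δ) ^ 2 * I := by
  set h : ℕ → ℝ := fun k => 2 ^ k * δ with hh
  have h0 : ∀ k, 0 < h k := fun k => by positivity
  have hs : ∀ k, h (k + 1) = 2 * h k := fun k => by simp only [hh]; ring
  set D : ℕ → Set E2 := fun k => thickening (R - 2 * h k) Ω with hD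
  have hfin : ∀ k, volume (D k) ≠ ⊤ := fun k => hb.thickening.measure_lt_top.ne
  have hsub : ∀ k, D (k + 1) ⊆ D k := fun k => thickening_mono (by rw [hs]; linarith [h0 k]) Ω
  have hmove : ∀ k (l : Fin 2), ∀ x ∈ D (k + 1), x + h k • single l (1 : ℝ) ∈ D k := by
    intro k l x hx
    refine add_mem_thickening hx ?_
    rw [norm_smul, norm_of_nonneg (h0 k).le, hs]
    simp; linarith [h0 k]
  set b : ℕ → ℝ := fun k => (h k ^ 2)⁻¹ * diffEnergy W (h k) (D k) with hbdef
  set a : ℕ → ℝ := fun k => (4 * h k ^ 2)⁻¹ * diffEnergy₂ W (h k) (D (k + 1)) with hadef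
  have ha0 : ∀ k, 0 ≤ a k := fun k => mul_nonneg (by positivity) (add_nonneg
    (integral_nonneg fun x => sq_nonneg _) (integral_nonneg fun x => sq_nonneg _))
  have hb0 : ∀ k, 0 ≤ b k := fun k => mul_nonneg (by positivity) (add_nonneg
    (integral_nonneg fun x => sq_nonneg _) (integral_nonneg fun x => sq_nonneg _))
  have step : ∀ k, b (k + 1) + a k ≤ b k := by
    intro k
    have d := fun l => integral_diff_double_le hL (h k • single l (1 : ℝ))
      (hfin k) (hsub k) (hmove k l)
    have d0 := d 0
    have d1 := d 1
    have e : ∀ (x : E2) (l : Fin 2), x + (2 * h k) • single l (1 : ℝ) =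
        x + h k • single l 1 + h k • single l 1 := fun x l => by
      rw [two_mul, add_smul, add_assoc]
    simp only [hbdef, hadef, diffEnergy, diffEnergy₂, hs, e]
    rw [mul_pow, show (2 : ℝ) ^ 2 = 4 by norm_num, ← mul_add]
    rw [inv_mul_le_iff₀ (by have := h0 k; positivity)]
    have := h0 k
    have e3 : ∀ z : ℝ, 4 * h k ^ 2 * ((h k ^ 2)⁻¹ * z) = 4 * z := fun z => by field_simp
    rw [e3]
    linarith
  have hb00 : b 0 ≤ I := by
    refine le_trans ?_ hI
    have hRfin : volume (thickening R Ω) ≠ ⊤ := hb.thickening.measure_lt_top.ne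
    have t := fun l => integral_translation_le hW hL (h 0 • single l (1 : ℝ))
      (A := D 0) (D := thickening R Ω) hRfin (fun x hx t ht => by
        refine add_mem_thickening hx ?_
        rw [norm_smul, norm_smul, norm_of_nonneg (h0 0).le, norm_of_nonneg ht.1]
        simp only [PiLp.norm_single, norm_one, mul_one]
        nlinarith [ht.2, h0 0])
    have e : ∀ l, ∫ x in thickening R Ω, ‖fderiv ℝ W x (h 0 • single l (1 : ℝ))‖ ^ 2 =
        h 0 ^ 2 * ∫ x in thickening R Ω, ‖pd l W x‖ ^ 2 := by
      intro l
      rw [← integral_const_mul]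
      congr 1; ext x
      rw [map_smul, norm_smul, mul_pow, norm_eq_abs, sq_abs]; rfl
    have t0 := t 0
    have t1 := t 1
    rw [e] at t0 t1
    have i : ∀ l, IntegrableOn (fun x => ‖pd l W x‖ ^ 2) (thickening R Ω) := fun l =>
      ((hL.bm_norm_pd l).pow 2).integrableOn hRfin
    simp only [dens]
    rw [integral_add (i 0) (i 1), hbdef]
    simp only [diffEnergy]
    rw [inv_mul_le_iff₀ (by have := h0 0; positivity)]
    linarith
  have hanti : ∀ k, b k ≤ b 0 := by
    intro k
    induction k with
    | zero => exact le_rfl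
    | succ k ih => linarith [step k, ha0 k]
  obtain ⟨k, hk, hka⟩ := exists_harmonic_le K hK hb0 step
  have hDk : thickening (R - 4 * (2 ^ k * δ)) Ω = D (k + 1) := by
    simp only [hD, hs]; congr 1; simp only [hh]; ring
  refine ⟨k, hk, ?_, ?_⟩
  · have h1 := (hanti k).trans hb00
    simp only [hbdef] at h1
    rw [inv_mul_le_iff₀ (by have := h0 k; positivity)] at h1
    refine le_trans ?_ h1
    rw [hDk]
    refine add_le_add ?_ ?_ <;>
    exact setIntegral_le_of_subset (hL.integrable_diff (hfin k) _) (fun _ => sq_nonneg _) (hsub k)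
  · have h1 := hka.trans hb00
    rw [hDk]
    have e : (k + 1) * diffEnergy₂ W (2 ^ k * δ) (D (k + 1)) * log (K + 1) =
        4 * h k ^ 2 * ((k + 1) * a k * log (K + 1)) := by
      have := (h0 k).ne'
      simp only [hadef]; field_simp; exact mul_comm _ _
    rw [e]
    exact mul_le_mul_of_nonneg_left h1 (by positivity)

end Differences

/-! ### Projection of a lattice field on the circle -/

section Projection

theorem exists_uv (V : E2) (hV : ‖V‖ ≤ 1) : ∃ t, ‖uv t - V‖ = 1 - ‖V‖ := by
  set z : ℂ := ⟨V 0, V 1⟩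
  have hz : ‖z‖ = ‖V‖ := by
    have h1 : ‖z‖ ^ 2 = ‖V‖ ^ 2 := by
      rw [norm_sq_eq, ← Complex.normSq_eq_norm_sq, Complex.normSq_apply]; ring
    exact (sq_eq_sq₀ (norm_nonneg _) (norm_nonneg _)).1 h1
  have e : V = ‖V‖ • uv (z.arg / (2 * π)) := by
    have : 2 * π * (z.arg / (2 * π)) = z.arg := by field_simp
    ext i
    fin_cases i
    · simpa [uv, this, hz] using (Complex.norm_mul_cos_arg z).symm
    · simpa [uv, this, hz] using (Complex.norm_mul_sin_arg z).symm
  refine ⟨z.arg / (2 * π), ?_⟩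
  nth_rewrite 1 [e]
  rw [show ∀ p : E2, p - ‖V‖ • p = (1 - ‖V‖) • p from fun p => by rw [sub_smul, one_smul],
    norm_smul, norm_uv, mul_one, norm_of_nonneg (by linarith)]

theorem sq_le_sin_sq_add (x : ℝ) (h0 : 0 ≤ x) (h1 : x ≤ π / 2) :
    x ^ 2 ≤ sin x ^ 2 + 4 * sin x ^ 4 := by
  have hj := Real.mul_le_sin h0 h1
  have hpi := pi_lt_d2
  have hp0 := pi_pos
  have hj' : 0.634 * x ≤ sin x := by
    refine le_trans (mul_le_mul_of_nonneg_right ?_ h0) hj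
    rw [le_div_iff₀ hp0]; linarith
  have h2 : (0.634 * x) ^ 2 ≤ sin x ^ 2 := pow_le_pow_left₀ (by positivity) hj' 2
  rcases le_or_gt x 1 with hx | hx
  · rcases h0.eq_or_lt with rfl | hx0
    · simp
    have h3 := (Real.sin_gt_sub_cube hx0).le
    have h4 : (0.634 * x) ^ 4 ≤ sin x ^ 4 := pow_le_pow_left₀ (by positivity) hj' 4
    have h5 : (x - x ^ 3 / 6) ^ 2 ≤ sin x ^ 2 :=
      pow_le_pow_left₀ (by nlinarith [mul_pos hx0 hx0]) h3 2
    nlinarith [pow_nonneg h0 4, pow_nonneg h0 6]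
  · have h6 : sin x ^ 4 = sin x ^ 2 * sin x ^ 2 := by ring
    rw [h6]
    have : 1 ≤ x ^ 2 := by nlinarith
    nlinarith [mul_le_mul h2 h2 (by positivity) (by positivity)]

theorem four_pi_sq_elastic_sq_le (u : ℤ × ℤ → ℝ) (i j : ℤ × ℤ) : 4 * π ^ 2 * elastic u i j ^ 2 ≤
    ‖uv (u j) - uv (u i)‖ ^ 2 + ‖uv (u j) - uv (u i)‖ ^ 4 := by
  have h1 := norm_uv_sub_sq_elastic u i j
  have hb := abs_elastic_le u i j
  set b := elastic u i j
  have hpi := pi_pos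
  have key := sq_le_sin_sq_add (π * |b|) (by positivity) (by nlinarith)
  have e2 : sin (π * |b|) ^ 2 = sin (π * b) ^ 2 := by
    rcases abs_choice b with h | h <;> rw [h]
    rw [mul_neg, Real.sin_neg, neg_sq]
  have e4 : ∀ t : ℝ, t ^ 4 = (t ^ 2) ^ 2 := fun t => by ring
  rw [e4 (sin _), e2, mul_pow, sq_abs] at key
  rw [e4 ‖_‖, h1]
  linarith

/-- For unit vectors the second difference controls the square of the first one. -/
theorem norm_sub_pow_four_le {p q r : E2} (hp : ‖p‖ = 1) (hq : ‖q‖ = 1) (hr : ‖r‖ = 1) :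
    ‖q - p‖ ^ 4 ≤ 4 * ‖r - (2 : ℝ) • q + p‖ ^ 2 := by
  have h1 := norm_sub_sq_real q p
  have h2 := norm_sub_sq_real q r
  rw [hp, hq] at h1
  rw [hq, hr] at h2
  have h3 := abs_real_inner_le_norm q (r - (2 : ℝ) • q + p)
  rw [inner_add_right, inner_sub_right, inner_smul_right, real_inner_self_eq_norm_sq, hq] at h3
  have h4 : ‖q - p‖ ^ 2 ≤ 2 * ‖r - (2 : ℝ) • q + p‖ := by
    have := neg_abs_le (inner ℝ q r - 2 * 1 ^ 2 + inner ℝ q p)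
    nlinarith [sq_nonneg ‖q - r‖]
  have := pow_le_pow_left₀ (sq_nonneg _) h4 2
  nlinarith

theorem norm_sub_sq_le_of_defect {V V' p p' : E2} {r r' η : ℝ} (h : ‖p - V‖ ≤ r) (h' : ‖p' - V'‖ ≤ r')
    (hη : 0 < η) (hη1 : η ≤ 1) :
    ‖p' - p‖ ^ 2 ≤ (1 + η) * ‖V' - V‖ ^ 2 + 4 / η * (r ^ 2 + r' ^ 2) := by
  have h1 : ‖p' - p‖ ≤ ‖V' - V‖ + (r + r') := by
    have := norm_add₃_le (a := p' - V') (b := V' - V) (c := V - p)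
    rw [show p' - V' + (V' - V) + (V - p) = p' - p by abel, norm_sub_rev V p] at this
    linarith
  set a := ‖V' - V‖
  have h2 := pow_le_pow_left₀ (norm_nonneg _) h1 2
  have h3 : 2 * (a * (r + r')) ≤ η * a ^ 2 + 1 / η * (r + r') ^ 2 := by
    have e : η * a ^ 2 + 1 / η * (r + r') ^ 2 - 2 * (a * (r + r')) =
        1 / η * (η * a - (r + r')) ^ 2 := by field_simp; ring
    have : 0 ≤ 1 / η * (η * a - (r + r')) ^ 2 := by positivity
    linarith
  have h4 : (r + r') ^ 2 ≤ 2 * (r ^ 2 + r' ^ 2) := by nlinarith [sq_nonneg (r - r')]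
  have h5 : 1 ≤ 1 / η := by rw [le_div_iff₀ hη]; linarith
  have h6 : 1 / η * (r + r') ^ 2 ≤ 1 / η * (2 * (r ^ 2 + r' ^ 2)) :=
    mul_le_mul_of_nonneg_left h4 (by positivity)
  have h7 : 1 * (r ^ 2 + r' ^ 2) ≤ 1 / η * (r ^ 2 + r' ^ 2) :=
    mul_le_mul_of_nonneg_right h5 (by positivity)
  have h8 : 4 / η * (r ^ 2 + r' ^ 2) = 4 * (1 / η * (r ^ 2 + r' ^ 2)) := by ring
  rw [h8]
  linarith

theorem norm_sub_pow_four_le_of_defect {V₀ V₁ V₂ p₀ p₁ p₂ : E2} {r₀ r₁ r₂ : ℝ} (h₀ : ‖p₀ - V₀‖ ≤ r₀)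
    (h₁ : ‖p₁ - V₁‖ ≤ r₁) (h₂ : ‖p₂ - V₂‖ ≤ r₂) (u₀ : ‖p₀‖ = 1) (u₁ : ‖p₁‖ = 1) (u₂ : ‖p₂‖ = 1) :
    ‖p₁ - p₀‖ ^ 4 ≤ 8 * ‖V₂ - (2 : ℝ) • V₁ + V₀‖ ^ 2 + 64 * (r₀ ^ 2 + r₁ ^ 2 + r₂ ^ 2) := by
  refine (norm_sub_pow_four_le u₀ u₁ u₂).trans ?_
  have h3 : ‖p₂ - (2 : ℝ) • p₁ + p₀‖ ≤ ‖V₂ - (2 : ℝ) • V₁ + V₀‖ + (r₀ + 2 * r₁ + r₂) := by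
    have e : p₂ - (2 : ℝ) • p₁ + p₀ =
        (V₂ - (2 : ℝ) • V₁ + V₀) + (((p₂ - V₂) - (2 : ℝ) • (p₁ - V₁)) + (p₀ - V₀)) := by
      rw [smul_sub]; abel
    have a1 := norm_add_le (V₂ - (2 : ℝ) • V₁ + V₀) (((p₂ - V₂) - (2 : ℝ) • (p₁ - V₁)) + (p₀ - V₀))
    have a2 := norm_add_le ((p₂ - V₂) - (2 : ℝ) • (p₁ - V₁)) (p₀ - V₀)
    have a3 := norm_sub_le (p₂ - V₂) ((2 : ℝ) • (p₁ - V₁))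
    rw [norm_smul, Real.norm_ofNat] at a3
    rw [e]
    linarith
  have h4 := pow_le_pow_left₀ (norm_nonneg _) h3 2
  set a := ‖V₂ - (2 : ℝ) • V₁ + V₀‖
  nlinarith [sq_nonneg (a - (r₀ + 2 * r₁ + r₂)), sq_nonneg (r₀ - r₁), sq_nonneg (r₁ - r₂),
    sq_nonneg (r₀ - r₂), sq_nonneg r₀, sq_nonneg r₂]

/-- The squared second differences, summed over the edges of a square. -/
def cellIncr₂ (V : ℤ × ℤ → E2) : ℤ × ℤ → ℝ :=
  edgeSum (fun k => ‖V (k + (1, 0) + (1, 0)) - (2 : ℝ) • V (k + (1, 0)) + V k‖ ^ 2)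
    fun k => ‖V (k + (0, 1) + (0, 1)) - (2 : ℝ) • V (k + (0, 1)) + V k‖ ^ 2

/-- The squared distances from the circle, summed over the edges of a square and the next points. -/
def cellDefect (V : ℤ × ℤ → E2) : ℤ × ℤ → ℝ :=
  edgeSum (fun k => (1 - ‖V k‖) ^ 2 + (1 - ‖V (k + (1, 0))‖) ^ 2 + (1 - ‖V (k + (1, 0) + (1, 0))‖) ^ 2)
    fun k => (1 - ‖V k‖) ^ 2 + (1 - ‖V (k + (0, 1))‖) ^ 2 + (1 - ‖V (k + (0, 1) + (0, 1))‖) ^ 2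

theorem sq_defect_le_cellDefect (V : ℤ × ℤ → E2) (k : ℤ × ℤ) : (1 - ‖V k‖) ^ 2 ≤ cellDefect V k := by
  unfold cellDefect edgeSum
  have p := fun k => sq_nonneg (1 - ‖V k‖)
  linarith [p k, p (k + (1, 0)), p (k + (1, 0) + (1, 0)), p (k + (1, 0) + (0, 1)),
    p (k + (1, 0) + (0, 1) + (0, 1)), p (k + (0, 1)), p (k + (0, 1) + (1, 0)),
    p (k + (0, 1) + (1, 0) + (1, 0)), p (k + (0, 1) + (0, 1))]

variable {u : ℤ × ℤ → ℝ} {V : ℤ × ℤ → E2} (h : ∀ k, ‖uv (u k) - V k‖ ≤ 1 - ‖V k‖)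
include h

theorem cellStrain_le_of_projection {η : ℝ} (hη : 0 < η) (hη1 : η ≤ 1) (k : ℤ × ℤ) :
    4 * π ^ 2 * cellStrain u k ≤
      (1 + η) * cellIncr V k + 8 * cellIncr₂ V k + (64 + 4 / η) * cellDefect V k := by
  have E : ∀ (e k : ℤ × ℤ), 4 * π ^ 2 * elastic u k (k + e) ^ 2 ≤
      (1 + η) * ‖V (k + e) - V k‖ ^ 2 + 8 * ‖V (k + e + e) - (2 : ℝ) • V (k + e) + V k‖ ^ 2 +
        (64 + 4 / η) * ((1 - ‖V k‖) ^ 2 + (1 - ‖V (k + e)‖) ^ 2 + (1 - ‖V (k + e + e)‖) ^ 2) := by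
    intro e k
    have a1 := four_pi_sq_elastic_sq_le u k (k + e)
    have a2 := norm_sub_sq_le_of_defect (h k) (h (k + e)) hη hη1
    have a3 := norm_sub_pow_four_le_of_defect (h k) (h (k + e)) (h (k + e + e)) (norm_uv _) (norm_uv _)
      (norm_uv _)
    have a4 : 0 ≤ 4 / η * (1 - ‖V (k + e + e)‖) ^ 2 := by positivity
    linarith
  simp only [cellStrain, cellIncr, cellIncr₂, cellDefect, edgeSum, strainH, strainV]
  linarith [E (1, 0) k, E (0, 1) (k + (1, 0)), E (1, 0) (k + (0, 1)), E (0, 1) k]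

theorem abs_circ_le_of_projection (k : ℤ × ℤ) :
    |circ (strainH u) (strainV u) k| ≤ 8 * cellIncr₂ V k + 64 * cellDefect V k := by
  have E : ∀ (e k : ℤ × ℤ), 16 * |elastic u k (k + e)| - 3 ≤
      8 * ‖V (k + e + e) - (2 : ℝ) • V (k + e) + V k‖ ^ 2 +
        64 * ((1 - ‖V k‖) ^ 2 + (1 - ‖V (k + e)‖) ^ 2 + (1 - ‖V (k + e + e)‖) ^ 2) := by
    intro e k
    have a1 := elastic_sq_le u k (k + e)
    have a3 := norm_sub_pow_four_le_of_defect (h k) (h (k + e)) (h (k + e + e)) (norm_uv _) (norm_uv _)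
      (norm_uv _)
    refine le_trans ?_ a3
    rw [← sq_abs (elastic _ _ _)] at a1
    set b := |elastic u k (k + e)|
    have hb : 0 ≤ b := abs_nonneg _
    have := pow_le_pow_left₀ (by positivity) a1 2
    have e1 : 256 * b ^ 4 - 16 * b + 3 = (4 * b - 1) ^ 2 * (16 * b ^ 2 + 8 * b + 3) := by ring
    have e2 : 0 ≤ (4 * b - 1) ^ 2 * (16 * b ^ 2 + 8 * b + 3) := by positivity
    nlinarith
  obtain ⟨n, hn⟩ := (isStrain_elastic u).circ_int k
  rcases eq_or_ne n 0 with rfl | h0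
  · rw [hn]
    unfold cellIncr₂ cellDefect edgeSum
    simp only [Int.cast_zero, abs_zero]
    positivity
  · have h1 : (1 : ℝ) ≤ |circ (strainH u) (strainV u) k| := by
      rw [hn]; exact_mod_cast Int.one_le_abs h0
    have h2 : |circ (strainH u) (strainV u) k| ≤ |elastic u k (k + (1, 0))| +
        |elastic u (k + (1, 0)) (k + (1, 0) + (0, 1))| + |elastic u (k + (0, 1)) (k + (0, 1) + (1, 0))| +
          |elastic u k (k + (0, 1))| := by
      simp only [circ, strainH, strainV]
      exact (abs_sub _ _).trans (add_le_add_left ((abs_sub _ _).trans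
        (add_le_add_left (abs_add_le _ _) _)) _)
    simp only [cellIncr₂, cellDefect, edgeSum]
    linarith [E (1, 0) k, E (0, 1) (k + (1, 0)), E (1, 0) (k + (0, 1)), E (0, 1) k]

end Projection

/-! ### Sampling on a translated lattice -/

section Sampling

open Metric

variable {W : E2 → E2} {Ω : Set E2} {h : ℝ}

theorem pt_add (h : ℝ) (k m : ℤ × ℤ) : pt h (k + m) = pt h k + pt h m := by
  ext i; fin_cases i <;> simp [pt, mul_add]

theorem pt_right (h : ℝ) : pt h (1, 0) = h • single 0 1 := by
  ext i; fin_cases i <;> simp [pt]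

theorem pt_up (h : ℝ) : pt h (0, 1) = h • single 1 1 := by
  ext i; fin_cases i <;> simp [pt]

theorem pt_zero (h : ℝ) : pt h 0 = 0 := by
  ext i; fin_cases i <;> simp [pt]

theorem norm_pt_right (hh : 0 < h) : ‖pt h (1, 0)‖ = h := by
  rw [pt_right, norm_smul, norm_of_nonneg hh.le]; simp

theorem norm_pt_up (hh : 0 < h) : ‖pt h (0, 1)‖ = h := by
  rw [pt_up, norm_smul, norm_of_nonneg hh.le]; simp

theorem cellIndex_sub_pt (hh : 0 < h) (x : E2) (k : ℤ × ℤ) :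
    cellIndex h (x - pt h k) = 0 ↔ cellIndex h x = k := by
  rw [cellIndex_eq_iff hh, cellIndex_eq_iff hh]
  simp only [pt, PiLp.sub_apply, mem_Ico, Prod.fst_zero, Prod.snd_zero, Int.cast_zero, mul_zero]
  simp only [Matrix.cons_val_zero, Matrix.cons_val_one]
  constructor <;> rintro ⟨⟨a, b⟩, c, d⟩ <;> exact ⟨⟨by linarith, by linarith⟩, by linarith, by linarith⟩

theorem cellIndex_add_pt (hh : 0 < h) {ξ : E2} (hξ : cellIndex h ξ = 0) (k : ℤ × ℤ) :
    cellIndex h (ξ + pt h k) = k := by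
  rw [← cellIndex_sub_pt hh, add_sub_cancel_right, hξ]

/-- An integral over a union of lattice squares, as an integral over one square. -/
theorem integral_squares_eq_sum_translate (hh : 0 < h) (P : Finset (ℤ × ℤ)) {g : E2 → ℝ}
    (hg : IntegrableOn g (squares h P)) :
    (∀ k ∈ P, IntegrableOn (fun y => g (y + pt h k)) {y | cellIndex h y = 0}) ∧
      ∫ x in squares h P, g x = ∑ k ∈ P, ∫ y in {y | cellIndex h y = 0}, g (y + pt h k) := by
  set Q : Set E2 := {y | cellIndex h y = 0} with hQ
  have hpre : ∀ k, Q = (fun y => y + pt h k) ⁻¹' {x | cellIndex h x = k} := by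
    intro k; ext y
    have := cellIndex_sub_pt hh (y + pt h k) k
    rwa [add_sub_cancel_right] at this
  have hsq : ∀ k ∈ P, {x | cellIndex h x = k} ⊆ squares h P := fun k hk x hx => by
    change cellIndex h x ∈ P
    rw [show cellIndex h x = k from hx]; exact hk
  refine ⟨fun k hk => ?_, ?_⟩
  · rw [hpre k]
    exact ((measurePreserving_add_right volume (pt h k)).integrableOn_comp_preimage
      (measurableEmbedding_addRight _)).2 (hg.mono_set (hsq k hk))
  · have hU : squares h P = ⋃ k ∈ P, {x | cellIndex h x = k} := by ext x; simp [squares]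
    rw [hU, integral_biUnion_finset]
    · refine sum_congr rfl fun k _ => ?_
      rw [hpre k]
      exact ((measurePreserving_add_right volume (pt h k)).setIntegral_preimage_emb
        (measurableEmbedding_addRight _) g _).symm
    · exact fun k _ => measurable_cellIndex h (measurableSet_singleton k)
    · intro a _ b _ hab
      exact Set.disjoint_left.2 fun x h1 h2 => hab (Eq.trans (Eq.symm h1) h2)
    · exact fun k hk => hg.mono_set (hsq k hk)

/-- Some translate of the lattice samples a function no worse than the average. -/
theorem exists_sample (hh : 0 < h) (P : Finset (ℤ × ℤ)) {g : E2 → ℝ}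
    (hg : IntegrableOn g (squares h P)) :
    ∃ y, cellIndex h y = 0 ∧ h ^ 2 * ∑ k ∈ P, g (y + pt h k) ≤ ∫ x in squares h P, g x := by
  obtain ⟨hi, e⟩ := integral_squares_eq_sum_translate hh P hg
  set Q : Set E2 := {y | cellIndex h y = 0} with hQ
  have hQv : volume Q = ofReal (h ^ 2) := volume_square hh 0
  rw [← integral_finsetSum P hi] at e
  obtain ⟨y, hy, hle⟩ := exists_le_setAverage (μ := volume) (s := Q)
    (f := fun y => ∑ k ∈ P, g (y + pt h k))
    (by rw [hQv]; simpa using hh.ne') (by rw [hQv]; exact ENNReal.ofReal_ne_top)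
    (integrable_finsetSum P hi)
  refine ⟨y, hy, ?_⟩
  rw [setAverage_eq, ← e, measureReal_def, hQv, ENNReal.toReal_ofReal (sq_nonneg h), smul_eq_mul] at hle
  rwa [inv_mul_eq_div, le_div_iff₀ (by positivity), mul_comm] at hle

theorem BM.comp_add {g : E2 → ℝ} (hg : BM g) (ξ : E2) : BM fun x => g (x + ξ) :=
  let ⟨M, hM⟩ := hg.2
  ⟨hg.1.comp (measurable_add_const ξ), M, fun x => hM (x + ξ)⟩

theorem integral_edgeSum_le (hh : 0 < h) {F G : E2 → ℝ} (hF : BM F) (hG : BM G) (F0 : ∀ x, 0 ≤ F x)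
    (G0 : ∀ x, 0 ≤ G x) {S : Set E2} {r s : ℝ} (hb : IsBounded Ω)
    (hS : S ⊆ thickening r Ω) (hrs : r + h ≤ s) :
    BM (fun x => edgeSum (fun m => F (x + pt h m)) (fun m => G (x + pt h m)) 0) ∧
      ∫ x in S, edgeSum (fun m => F (x + pt h m)) (fun m => G (x + pt h m)) 0 ≤
        2 * ((∫ x in thickening s Ω, F x) + ∫ x in thickening s Ω, G x) := by
  have e : ∀ x, edgeSum (fun m => F (x + pt h m)) (fun m => G (x + pt h m)) 0 =
      F x + G (x + pt h (1, 0)) + F (x + pt h (0, 1)) + G x := fun x => by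
    simp only [edgeSum, zero_add, pt_zero, add_zero]
  have b1 := hG.comp_add (pt h (1, 0))
  have b2 := hF.comp_add (pt h (0, 1))
  simp only [e]
  refine ⟨((hF.add b1).add b2).add hG, ?_⟩
  have hTfin : volume (thickening s Ω) ≠ ⊤ := hb.thickening.measure_lt_top.ne
  have hSsub : S ⊆ thickening s Ω := hS.trans (thickening_mono (by linarith) Ω)
  have hSfin : volume S ≠ ⊤ := ne_top_of_le_ne_top hTfin (measure_mono hSsub)
  rw [integral_add (((hF.add b1).add b2).integrableOn hSfin) (hG.integrableOn hSfin),
    integral_add ((hF.add b1).integrableOn hSfin) (b2.integrableOn hSfin),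
    integral_add (hF.integrableOn hSfin) (b1.integrableOn hSfin)]
  have t1 := setIntegral_comp_add_le (A := S) (hG.integrableOn hTfin) G0 (pt h (1, 0)) fun x hx =>
    add_mem_thickening (hS hx) (by rw [norm_pt_right hh]; exact hrs)
  have t2 := setIntegral_comp_add_le (A := S) (hF.integrableOn hTfin) F0 (pt h (0, 1)) fun x hx =>
    add_mem_thickening (hS hx) (by rw [norm_pt_up hh]; exact hrs)
  have t3 := setIntegral_le_of_subset (hF.integrableOn hTfin) F0 hSsub
  have t4 := setIntegral_le_of_subset (hG.integrableOn hTfin) G0 hSsub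
  linarith

theorem edgeSum_shift (f g : E2 → ℝ) (h : ℝ) (y : E2) (k : ℤ × ℤ) :
    edgeSum (fun m => f (y + pt h k + pt h m)) (fun m => g (y + pt h k + pt h m)) 0 =
      edgeSum (fun m => f (y + pt h m)) (fun m => g (y + pt h m)) k := by
  simp only [edgeSum, zero_add, pt_add, pt_zero, add_zero, add_assoc]

/-- The mean square oscillation of `W` near `x` at scale `h`. -/
def oscillation (W : E2 → E2) (h : ℝ) (x : E2) : ℝ :=
  ∫ ξ in {y : E2 | cellIndex h y = 0}, ‖W (x + ξ) - W x‖ ^ 2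

theorem norm_sq_le_of_cellIndex (hh : 0 < h) {ξ : E2} (hξ : cellIndex h ξ = 0) :
    ‖ξ‖ ^ 2 ≤ 2 * h ^ 2 := by
  rw [cellIndex_eq_iff hh] at hξ
  simp only [Prod.fst_zero, Prod.snd_zero, Int.cast_zero, mul_zero, zero_add, mem_Ico] at hξ
  rw [norm_sq_eq]
  nlinarith [hξ.1.1, hξ.1.2, hξ.2.1, hξ.2.2]

theorem norm_le_of_cellIndex (hh : 0 < h) {ξ : E2} (hξ : cellIndex h ξ = 0) : ‖ξ‖ ≤ 2 * h := by
  have := norm_sq_le_of_cellIndex hh hξ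
  nlinarith [norm_nonneg ξ, sq_nonneg h]

theorem integral_translation_le_dens (hW : ContDiff ℝ 1 W) (hL : LipBdd W) (hb : IsBounded Ω)
    (hh : 0 < h) {ξ : E2} (hξ : cellIndex h ξ = 0) {S : Set E2} {r s I : ℝ} (hS : S ⊆ thickening r Ω)
    (hrs : r + 2 * h ≤ s) (hI : ∫ x in thickening s Ω, dens W x ≤ I) :
    ∫ x in S, ‖W (x + ξ) - W x‖ ^ 2 ≤ 2 * h ^ 2 * I := by
  have hTfin : volume (thickening s Ω) ≠ ⊤ := hb.thickening.measure_lt_top.ne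
  have hξ2 := norm_sq_le_of_cellIndex hh hξ
  have hI0 : 0 ≤ ∫ x in thickening s Ω, dens W x := integral_nonneg fun x => dens_nonneg W x
  refine (integral_translation_le hW hL ξ hTfin fun x hx t ht => ?_).trans ?_
  · refine add_mem_thickening (hS hx) ?_
    rw [norm_smul, norm_of_nonneg ht.1]
    nlinarith [norm_le_of_cellIndex hh hξ, norm_nonneg ξ, ht.2]
  · calc ∫ x in thickening s Ω, ‖fderiv ℝ W x ξ‖ ^ 2 ≤ ∫ x in thickening s Ω, ‖ξ‖ ^ 2 * dens W x :=
          integral_mono_of_nonneg (of_forall fun x => sq_nonneg _)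
            ((hL.bm_dens.integrableOn hTfin).const_mul _)
            (of_forall fun x => norm_fderiv_apply_sq_le W x ξ)
      _ = ‖ξ‖ ^ 2 * ∫ x in thickening s Ω, dens W x := integral_const_mul _ _
      _ ≤ _ := mul_le_mul hξ2 hI hI0 (by positivity)

theorem integral_oscillation_le (hW : ContDiff ℝ 1 W) (hL : LipBdd W) (hb : IsBounded Ω)
    (hh : 0 < h) {S : Set E2} {r s I : ℝ} (hS : S ⊆ thickening r Ω)
    (hrs : r + 2 * h ≤ s) (hI : ∫ x in thickening s Ω, dens W x ≤ I) :
    IntegrableOn (oscillation W h) S ∧ ∫ x in S, oscillation W h x ≤ 2 * h ^ 4 * I := by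
  set Q : Set E2 := {y | cellIndex h y = 0} with hQ
  have hQm : MeasurableSet Q := measurable_cellIndex h (measurableSet_singleton _)
  have hQv : volume.real Q = h ^ 2 := by
    rw [measureReal_def, volume_square hh 0, ENNReal.toReal_ofReal (sq_nonneg h)]
  have hQfin : IsFiniteMeasure (volume.restrict Q) :=
    ⟨by rw [Measure.restrict_apply_univ, volume_square hh 0]; exact ENNReal.ofReal_lt_top⟩
  have hSfin : IsFiniteMeasure (volume.restrict S) := ⟨by
    rw [Measure.restrict_apply_univ]
    exact (measure_mono hS).trans_lt hb.thickening.measure_lt_top⟩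
  obtain ⟨M, hM⟩ := hL.bdd
  have hc := hL.continuous
  have hprod : Integrable (fun p : E2 × E2 => ‖W (p.1 + p.2) - W p.1‖ ^ 2)
      ((volume.restrict S).prod (volume.restrict Q)) := by
    refine (integrable_const ((2 * M) ^ 2)).mono'
      (by fun_prop : Continuous fun p : E2 × E2 => ‖W (p.1 + p.2) - W p.1‖ ^ 2).aestronglyMeasurable
      (of_forall fun p => ?_)
    rw [norm_of_nonneg (sq_nonneg _)]
    refine pow_le_pow_left₀ (norm_nonneg _) ((norm_sub_le _ _).trans ?_) 2
    linarith [hM (p.1 + p.2), hM p.1]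
  refine ⟨hprod.integral_prod_left, ?_⟩
  calc ∫ x in S, oscillation W h x = ∫ ξ in Q, ∫ x in S, ‖W (x + ξ) - W x‖ ^ 2 :=
        integral_integral_swap hprod
    _ ≤ ∫ _ in Q, 2 * h ^ 2 * I := by
        refine integral_mono_ae hprod.integral_prod_right (integrable_const _) ?_
        exact (ae_restrict_iff' hQm).2 (of_forall fun ξ hξ =>
          integral_translation_le_dens hW hL hb hh hξ hS hrs hI)
    _ = 2 * h ^ 4 * I := by
        rw [setIntegral_const, hQv, smul_eq_mul]; ring

/-- A translate of the lattice on which the first and second differences, the distances from the circle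
and the oscillations of `W` are all controlled by the corresponding integrals. -/
theorem exists_good_sample (hW : ContDiff ℝ 1 W) (hL : LipBdd W) (hb : IsBounded Ω)
    (hh : 0 < h) {P : Finset (ℤ × ℤ)} (hP : squares h P ⊆ thickening (4 * h) Ω) {R I p : ℝ}
    (hR : 9 * h ≤ R) (hI : ∫ x in thickening R Ω, dens W x ≤ I)
    (hp : ∫ x in thickening R Ω, (1 - ‖W x‖) ^ 2 ≤ p) {A B M : ℝ} (hA : 0 ≤ A) (hB : 0 ≤ B)
    (hM : 0 ≤ M) :
    ∃ y, cellIndex h y = 0 ∧ h ^ 2 * (1 / 4 * ∑ k ∈ P, cellIncr (fun m => W (y + pt h m)) k +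
        A * ∑ k ∈ P, cellIncr₂ (fun m => W (y + pt h m)) k +
        M * ∑ k ∈ P, cellDefect (fun m => W (y + pt h m)) k +
        B * ∑ k ∈ P, oscillation W h (y + pt h k)) ≤
      1 / 2 * diffEnergy W h (thickening (R - 4 * h) Ω) +
        A * (2 * diffEnergy₂ W h (thickening (R - 4 * h) Ω)) + M * (12 * p) + B * (2 * h ^ 4 * I) := by
  have hTfin : ∀ r, volume (thickening r Ω) ≠ ⊤ := fun r => hb.thickening.measure_lt_top.ne
  have hSfin : volume (squares h P) ≠ ⊤ := volume_squares_ne_top hh P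
  set g₁ : E2 → E2 → ℝ := fun ξ x => ‖W (x + ξ) - W x‖ ^ 2 with hg₁
  set g₂ : E2 → E2 → ℝ := fun ξ x => ‖W (x + ξ + ξ) - (2 : ℝ) • W (x + ξ) + W x‖ ^ 2 with hg₂
  set g₃ : E2 → E2 → ℝ := fun ξ x =>
    (1 - ‖W x‖) ^ 2 + (1 - ‖W (x + ξ)‖) ^ 2 + (1 - ‖W (x + ξ + ξ)‖) ^ 2 with hg₃
  have b₁ : ∀ ξ, BM (g₁ ξ) := fun ξ => by
    simpa [sub_eq_add_neg, hg₁] using hL.bm_sq_comb 1 0 (-1) ξ 0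
  have b₂ : ∀ ξ, BM (g₂ ξ) := fun ξ => by
    simpa [sub_eq_add_neg, add_assoc, hg₂] using hL.bm_sq_comb 1 (-2) 1 (ξ + ξ) ξ
  have br : BM fun x => (1 - ‖W x‖) ^ 2 := ((BM.const 1).sub hL.bm_norm).pow 2
  have b₃ : ∀ ξ, BM (g₃ ξ) := fun ξ =>
    (br.add (br.comp_add ξ)).add ((br.comp_add ξ).comp_add ξ)
  have r : pt h (1, 0) = h • single 0 1 := pt_right h
  have up : pt h (0, 1) = h • single 1 1 := pt_up h
  obtain ⟨m₁, t₁⟩ := integral_edgeSum_le hh (b₁ (pt h (1, 0))) (b₁ (pt h (0, 1)))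
    (fun x => sq_nonneg _) (fun x => sq_nonneg _) hb hP (s := R - 4 * h) (by linarith)
  obtain ⟨m₂, t₂⟩ := integral_edgeSum_le hh (b₂ (pt h (1, 0))) (b₂ (pt h (0, 1)))
    (fun x => sq_nonneg _) (fun x => sq_nonneg _) hb hP (s := R - 4 * h) (by linarith)
  obtain ⟨m₃, t₃⟩ := integral_edgeSum_le hh (b₃ (pt h (1, 0))) (b₃ (pt h (0, 1)))
    (fun x => by simp only [hg₃]; positivity) (fun x => by simp only [hg₃]; positivity) hb hP
    (s := R - 4 * h) (by linarith)
  obtain ⟨m₄, t₄⟩ := integral_oscillation_le hW hL hb hh hP (s := R) (by linarith) hI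
  have d₃ : ∀ ξ, ‖ξ‖ = h → ∫ x in thickening (R - 4 * h) Ω, g₃ ξ x ≤ 3 * p := by
    intro ξ hξ
    have i0 := br.integrableOn (hTfin (R - 4 * h))
    have i1 := (br.comp_add ξ).integrableOn (hTfin (R - 4 * h))
    have i2 := ((br.comp_add ξ).comp_add ξ).integrableOn (hTfin (R - 4 * h))
    have s0 := setIntegral_le_of_subset (br.integrableOn (hTfin R)) (fun _ => sq_nonneg _)
      (thickening_mono (show R - 4 * h ≤ R by linarith) Ω)
    have s1 := setIntegral_comp_add_le (A := thickening (R - 4 * h) Ω) (br.integrableOn (hTfin R))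
      (fun x => sq_nonneg _) ξ fun x hx => add_mem_thickening hx (by linarith)
    have s2 := setIntegral_comp_add_le (A := thickening (R - 4 * h) Ω) (br.integrableOn (hTfin R))
      (fun x => sq_nonneg _) (ξ + ξ) fun x hx => add_mem_thickening hx (by
        linarith [norm_add_le ξ ξ])
    simp only [← add_assoc] at s2
    have e : ∫ x in thickening (R - 4 * h) Ω, g₃ ξ x =
        (∫ x in thickening (R - 4 * h) Ω, (1 - ‖W x‖) ^ 2) +
        (∫ x in thickening (R - 4 * h) Ω, (1 - ‖W (x + ξ)‖) ^ 2) +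
        ∫ x in thickening (R - 4 * h) Ω, (1 - ‖W (x + ξ + ξ)‖) ^ 2 := by
      rw [← integral_add' i0 i1, ← integral_add' (i0.add i1) i2]
      rfl
    rw [e]
    linarith
  set G₁ : E2 → ℝ := fun x => edgeSum (fun m => g₁ (pt h (1, 0)) (x + pt h m))
    (fun m => g₁ (pt h (0, 1)) (x + pt h m)) 0 with hG₁
  set G₂ : E2 → ℝ := fun x => edgeSum (fun m => g₂ (pt h (1, 0)) (x + pt h m))
    (fun m => g₂ (pt h (0, 1)) (x + pt h m)) 0 with hG₂
  set G₃ : E2 → ℝ := fun x => edgeSum (fun m => g₃ (pt h (1, 0)) (x + pt h m))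
    (fun m => g₃ (pt h (0, 1)) (x + pt h m)) 0 with hG₃
  have i₁ := (m₁.integrableOn hSfin).const_mul (1 / 4)
  have i₂ := (m₂.integrableOn hSfin).const_mul A
  have i₃ := (m₃.integrableOn hSfin).const_mul M
  have i₄ := m₄.const_mul B
  obtain ⟨y, hy, hle⟩ := exists_sample hh P (((i₁.add i₂).add i₃).add i₄)
  refine ⟨y, hy, ?_⟩
  rw [integral_add' ((i₁.add i₂).add i₃) i₄, integral_add' (i₁.add i₂) i₃, integral_add' i₁ i₂] at hle
  simp only [integral_const_mul, Pi.add_apply] at hle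
  have e₁ : ∀ k, G₁ (y + pt h k) = cellIncr (fun m => W (y + pt h m)) k := fun k => by
    simp only [hG₁]
    rw [edgeSum_shift]
    simp only [cellIncr, hg₁, pt_add, add_assoc]
  have e₂ : ∀ k, G₂ (y + pt h k) = cellIncr₂ (fun m => W (y + pt h m)) k := fun k => by
    simp only [hG₂]
    rw [edgeSum_shift]
    simp only [cellIncr₂, hg₂, pt_add, add_assoc]
  have e₃ : ∀ k, G₃ (y + pt h k) = cellDefect (fun m => W (y + pt h m)) k := fun k => by
    simp only [hG₃]
    rw [edgeSum_shift]
    simp only [cellDefect, hg₃, pt_add, add_assoc]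
  simp only [sum_add_distrib, ← mul_sum, e₁, e₂, e₃] at hle
  refine hle.trans ?_
  have q₁ : diffEnergy W h (thickening (R - 4 * h) Ω) =
      (∫ x in thickening (R - 4 * h) Ω, g₁ (pt h (1, 0)) x) +
        ∫ x in thickening (R - 4 * h) Ω, g₁ (pt h (0, 1)) x := by rw [r, up]; rfl
  have q₂ : diffEnergy₂ W h (thickening (R - 4 * h) Ω) =
      (∫ x in thickening (R - 4 * h) Ω, g₂ (pt h (1, 0)) x) +
        ∫ x in thickening (R - 4 * h) Ω, g₂ (pt h (0, 1)) x := by rw [r, up]; rfl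
  rw [← q₁] at t₁
  rw [← q₂] at t₂
  have t₃' := t₃.trans (show _ ≤ 12 * p by
    linarith [d₃ _ (norm_pt_right hh), d₃ _ (norm_pt_up hh)])
  have k₁ := mul_le_mul_of_nonneg_left t₂ hA
  have k₂ := mul_le_mul_of_nonneg_left t₃' hM
  have k₃ := mul_le_mul_of_nonneg_left t₄ hB
  linarith

end Sampling

/-! ### From a map to a displacement -/

section Displacement

open Metric

variable {W : E2 → E2} {Ω : Set E2} {h δ : ℝ}

theorem norm_sub_le_of_mem_cell (hh : 0 < h) {k : ℤ × ℤ} {x y : E2} (hx : x ∈ cell h k)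
    (hy : y ∈ cell h k) : ‖x - y‖ ≤ 2 * h := by
  obtain ⟨⟨a, b⟩, c, d⟩ := hx
  obtain ⟨⟨a', b'⟩, c', d'⟩ := hy
  have h2 : ‖x - y‖ ^ 2 ≤ 2 * h ^ 2 := by
    rw [norm_sq_eq, PiLp.sub_apply, PiLp.sub_apply]
    nlinarith
  nlinarith [norm_nonneg (x - y), sq_nonneg h]

theorem cellIndex_pt (hh : 0 < h) (k : ℤ × ℤ) : cellIndex h (pt h k) = k := by
  rw [← cellIndex_sub_pt hh, sub_self]; simp [cellIndex]

/-- The lattice squares that meet a neighbourhood of a bounded set. -/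
theorem exists_squares_near (hb : IsBounded Ω) (hh : 0 < h) :
    ∃ P : Finset (ℤ × ℤ), (∀ x ∈ thickening (2 * h) Ω, cellIndex h x ∈ P) ∧
      squares h P ⊆ thickening (4 * h) Ω := by
  have near : ∀ x y, x ∈ thickening (2 * h) Ω → cellIndex h y = cellIndex h x →
      y ∈ thickening (4 * h) Ω := fun x y hx e => by
    have b := norm_sub_le_of_mem_cell hh (mem_cell_of_cellIndex hh e) (mem_cell_of_cellIndex hh rfl)
    have := add_mem_thickening (s := 4 * h) (ξ := y - x) hx (by linarith)
    rwa [add_sub_cancel] at this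
  have fin : {k | ∃ x ∈ thickening (2 * h) Ω, cellIndex h x = k}.Finite :=
    (finite_pts (hb.thickening (δ := 4 * h)) hh).subset fun k ⟨x, hx, e⟩ =>
      near x _ hx ((cellIndex_pt hh k).trans e.symm)
  refine ⟨fin.toFinset, fun x hx => fin.mem_toFinset.2 ⟨x, hx, rfl⟩, fun y hy => ?_⟩
  obtain ⟨x, hx, e⟩ := fin.mem_toFinset.1 (show cellIndex h y ∈ fin.toFinset from hy)
  exact near x y hx e.symm

/-- A dyadic scale and a translate of the lattice at which `W` is sampled well. -/
theorem exists_good_scale (hW : ContDiff ℝ 1 W) (hL : LipBdd W) (hb : IsBounded Ω)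
    (hδ : 0 < δ) {K : ℕ} (hK : K ≠ 0) {R I p L ℓ : ℝ} (hR : 9 * (2 ^ K * δ) ≤ R)
    (hI : ∫ x in thickening R Ω, dens W x ≤ I) (hp : ∫ x in thickening R Ω, (1 - ‖W x‖) ^ 2 ≤ p)
    (h1 : 0 < L) (hℓ : 0 < ℓ) (hℓK : ℓ ^ 2 = log (K + 1)) :
    ∃ k < K, ∃ (h : ℝ) (P : Finset (ℤ × ℤ)) (y : E2), h = 2 ^ k * δ ∧ 9 * h ≤ R ∧
      (∀ x ∈ thickening (2 * h) Ω, cellIndex h x ∈ P) ∧ cellIndex h y = 0 ∧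
      1 / 4 * ∑ k ∈ P, cellIncr (fun m => W (y + pt h m)) k +
        ℓ * (k + 1) * ∑ k ∈ P, cellIncr₂ (fun m => W (y + pt h m)) k +
        L ^ 3 * ∑ k ∈ P, cellDefect (fun m => W (y + pt h m)) k +
        1 / (h ^ 2 * L) * ∑ k ∈ P, oscillation W h (y + pt h k) ≤
      I * (1 / 2 + 8 / ℓ + 2 / L) + 12 * p * L ^ 3 / δ ^ 2 := by
  obtain ⟨k, hk, e1, e2⟩ := exists_scale hW hL hb hδ hK hI
  set h : ℝ := 2 ^ k * δ with hh'
  have hh : 0 < h := by positivity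
  have hδh : δ ≤ h := le_mul_of_one_le_left hδ.le (one_le_pow₀ one_le_two)
  have hR' : 9 * h ≤ R := (mul_le_mul_of_nonneg_left (mul_le_mul_of_nonneg_right
    (pow_le_pow_right₀ one_le_two hk.le) hδ.le) (by norm_num)).trans hR
  have hp0 : 0 ≤ p := (integral_nonneg fun x => sq_nonneg _).trans hp
  obtain ⟨P, hP1, hP2⟩ := exists_squares_near hb hh
  obtain ⟨y, hy, e⟩ := exists_good_sample hW hL hb hh hP2 hR' hI hp (A := ℓ * (k + 1))
    (B := 1 / (h ^ 2 * L)) (M := L ^ 3) (by positivity) (by positivity) (by positivity)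
  refine ⟨k, hk, h, P, y, rfl, hR', hP1, hy, ?_⟩
  rw [← hℓK] at e2
  set D₂ := diffEnergy₂ W h (thickening (R - 4 * h) Ω)
  have t2 : ℓ * (k + 1) * (2 * D₂) ≤ h ^ 2 * (I * (8 / ℓ)) := by
    rw [mul_div_assoc', mul_div_assoc', le_div_iff₀ hℓ]
    linarith
  have t3 : L ^ 3 * (12 * p) ≤ h ^ 2 * (12 * p * L ^ 3 / δ ^ 2) := by
    have : 1 ≤ h ^ 2 / δ ^ 2 := by
      rw [le_div_iff₀ (by positivity), one_mul]; exact pow_le_pow_left₀ hδ.le hδh 2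
    calc L ^ 3 * (12 * p) ≤ (12 * p * L ^ 3) * (h ^ 2 / δ ^ 2) := by
          rw [mul_comm (L ^ 3)]; exact le_mul_of_one_le_right (by positivity) this
      _ = _ := by ring
  have t4 : 1 / (h ^ 2 * L) * (2 * h ^ 4 * I) = h ^ 2 * (I * (2 / L)) := by
    field_simp
  refine le_of_mul_le_mul_left (e.trans ?_) (sq_pos_of_pos hh)
  linarith

theorem norm_add_five_sq_le (a b c d e : E2) :
    ‖a + b + c + d + e‖ ^ 2 ≤ 5 * (‖a‖ ^ 2 + ‖b‖ ^ 2 + ‖c‖ ^ 2 + ‖d‖ ^ 2 + ‖e‖ ^ 2) := by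
  have h : ‖a + b + c + d + e‖ ≤ ‖a‖ + ‖b‖ + ‖c‖ + ‖d‖ + ‖e‖ := by
    refine (norm_add_le _ _).trans (add_le_add_left ?_ _)
    refine (norm_add_le _ _).trans (add_le_add_left ?_ _)
    exact (norm_add_le _ _).trans (add_le_add_left (norm_add_le _ _) _)
  refine (pow_le_pow_left₀ (norm_nonneg _) h 2).trans ?_
  nlinarith [sq_nonneg (‖a‖ - ‖b‖), sq_nonneg (‖a‖ - ‖c‖), sq_nonneg (‖a‖ - ‖d‖), sq_nonneg (‖a‖ - ‖e‖),
    sq_nonneg (‖b‖ - ‖c‖), sq_nonneg (‖b‖ - ‖d‖), sq_nonneg (‖b‖ - ‖e‖), sq_nonneg (‖c‖ - ‖d‖),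
    sq_nonneg (‖c‖ - ‖e‖), sq_nonneg (‖d‖ - ‖e‖)]

theorem norm_interp_sub_sq_le {S : Finset (ℤ × ℤ)} (hδ : 0 < δ) (u : ℤ × ℤ → ℝ) {x : E2}
    (hS : corners (cellIndex δ x) ⊆ S) :
    ‖interp S δ (fun k => uv (u k)) x - uv (u (cellIndex δ x))‖ ^ 2 ≤
      160 * cellStrain u (cellIndex δ x) := by
  have a := norm_interp_sub_le (v := fun k => uv (u k)) hδ rfl hS
  have b := cellIncr_uv_le u (cellIndex δ x)
  rw [cellIncr_eq] at b
  have c := mul_le_mul_of_nonneg_right pi_sq_le_ten (cellStrain_nonneg u (cellIndex δ x))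
  have d := pow_le_pow_left₀ (norm_nonneg _) a 2
  set p := ‖uv (u (cellIndex δ x + (1, 0))) - uv (u (cellIndex δ x))‖
  set q := ‖uv (u (cellIndex δ x + (1, 1))) - uv (u (cellIndex δ x + (1, 0)))‖
  set r := ‖uv (u (cellIndex δ x + (1, 1))) - uv (u (cellIndex δ x + (0, 1)))‖
  set s := ‖uv (u (cellIndex δ x + (0, 1))) - uv (u (cellIndex δ x))‖
  nlinarith [sq_nonneg (p - q), sq_nonneg (p - r), sq_nonneg (p - s), sq_nonneg (q - r),
    sq_nonneg (q - s), sq_nonneg (r - s)]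

theorem integral_comp_cellIndex_le (hδ : 0 < δ) {Q : Finset (ℤ × ℤ)} (hΩ : Ω ⊆ squares δ Q)
    {f : ℤ × ℤ → ℝ} (hf : ∀ k, 0 ≤ f k) :
    IntegrableOn (fun x => f (cellIndex δ x)) Ω ∧
      ∫ x in Ω, f (cellIndex δ x) ≤ δ ^ 2 * ∑ k ∈ Q, f k := by
  obtain ⟨h1, h2⟩ := integrableOn_cell hδ Q f
  exact ⟨h1.mono_set hΩ, h2 ▸ setIntegral_le_of_subset h1 (fun x => hf _) hΩ⟩

/-- The mean square distance between translates of `W` and the sample of `W`. -/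
theorem integral_sub_sample_le (hL : LipBdd W) (hh : 0 < h) {P : Finset (ℤ × ℤ)}
    (hΩ : Ω ⊆ squares h P) (y : E2) :
    IntegrableOn (fun x => ‖W (y + pt h (cellIndex h x)) - W (x + y)‖ ^ 2) Ω ∧
      ∫ x in Ω, ‖W (y + pt h (cellIndex h x)) - W (x + y)‖ ^ 2 ≤
        ∑ k ∈ P, oscillation W h (y + pt h k) := by
  obtain ⟨M, hM⟩ := hL.bdd
  have hc := hL.continuous
  have m : Measurable fun x => W (y + pt h (cellIndex h x)) :=
    (measurable_of_countable fun k => W (y + pt h k)).comp (measurable_cellIndex h)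
  have bm : BM fun x => ‖W (y + pt h (cellIndex h x)) - W (x + y)‖ ^ 2 := by
    refine ⟨((m.sub (by fun_prop : Continuous fun x => W (x + y)).measurable).norm.pow_const 2),
      (2 * M) ^ 2, fun x => ?_⟩
    rw [abs_of_nonneg (sq_nonneg _)]
    refine pow_le_pow_left₀ (norm_nonneg _) ((norm_sub_le _ _).trans ?_) 2
    linarith [hM (y + pt h (cellIndex h x)), hM (x + y)]
  have i := bm.integrableOn (volume_squares_ne_top hh P)
  refine ⟨i.mono_set hΩ, (setIntegral_le_of_subset i (fun _ => sq_nonneg _)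
    hΩ).trans (le_of_eq ?_)⟩
  rw [(integral_squares_eq_sum_translate hh P i).2]
  refine sum_congr rfl fun k _ => setIntegral_congr_fun
    (measurable_cellIndex h (measurableSet_singleton _)) fun ξ hξ => ?_
  simp only [cellIndex_add_pt hh hξ, norm_sub_rev (W (y + pt h k))]
  rw [show ξ + pt h k + y = y + pt h k + ξ by abel]

end Displacement

section Displacement

open Metric

variable {W : E2 → E2} {Ω : Set E2} {δ : ℝ}

theorem nine_le_pi_sq : 9 ≤ π ^ 2 := by nlinarith [pi_gt_three]

/-- The energy of the projected and refined sample. -/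
theorem refined_energy_le {a₁ a₂ a₃ e c k ℓ L T : ℝ} (h1 : 1 ≤ L) (hk : 0 ≤ k) (hkL : k ≤ L)
    (hℓ : 0 < ℓ) (p1 : 0 ≤ a₁) (p2 : 0 ≤ a₂) (p3 : 0 ≤ a₃) (pc : 0 ≤ c)
    (hT : 1 / 4 * a₁ + ℓ * (k + 1) * a₂ + L ^ 3 * a₃ ≤ T)
    (he : 4 * π ^ 2 * e ≤ (1 + 1 / L) * a₁ + 8 * a₂ + (64 + 4 * L) * a₃)
    (hc : c ≤ 8 * a₂ + 64 * a₃) :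
    π ^ 2 * (e + 3 / 2 * k * c) ≤ T * (1 + 120 / ℓ + 978 / L) := by
  have L0 : 0 < L := by linarith
  have hkc := mul_le_mul_of_nonneg_left hc hk
  have hpi : π ^ 2 * (3 / 2 * k * c) ≤ 15 * (k * c) := by
    nlinarith [pi_sq_le_ten, mul_nonneg hk pc]
  have t2 : (2 + 120 * k) * a₂ ≤ 120 / ℓ * (ℓ * (k + 1) * a₂) := by
    rw [show 120 / ℓ * (ℓ * (k + 1) * a₂) = 120 * (k + 1) * a₂ by field_simp]
    nlinarith
  have t3 : (16 + L + 960 * k) * a₃ ≤ 977 / L * (L ^ 3 * a₃) := by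
    rw [show 977 / L * (L ^ 3 * a₃) = 977 * L ^ 2 * a₃ by field_simp]
    refine mul_le_mul_of_nonneg_right ?_ p3
    nlinarith
  have t1 : 0 ≤ 1 / L := by positivity
  have q2 : 0 ≤ ℓ * (k + 1) * a₂ := by positivity
  have q3 : 0 ≤ L ^ 3 * a₃ := by positivity
  have r1 : 1 / L * (1 / 4 * a₁) ≤ 1 / L * T := mul_le_mul_of_nonneg_left (by linarith) t1
  have r2 : 120 / ℓ * (ℓ * (k + 1) * a₂) ≤ 120 / ℓ * T :=
    mul_le_mul_of_nonneg_left (by linarith) (by positivity)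
  have r3 : 977 / L * (L ^ 3 * a₃) ≤ 977 / L * T :=
    mul_le_mul_of_nonneg_left (by linarith) (by positivity)
  have e3 : 978 / L = 977 / L + 1 / L := by ring
  rw [e3]
  linarith

set_option maxHeartbeats 400000 in
/-- A map of small Ginzburg-Landau energy is close to the interpolation of a field of unit vectors on
the lattice, whose displacement has no larger energy. -/
theorem exists_displacement (hW : ContDiff ℝ 1 W) (hL : LipBdd W) (hW1 : ∀ x, ‖W x‖ ≤ 1)
    (hb : IsBounded Ω) (hΩ : MeasurableSet Ω)
    (hδ : 0 < δ) {K : ℕ} (hK : K ≠ 0) {R I p L ℓ T : ℝ} (hR : 9 * (2 ^ K * δ) ≤ R)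
    (hI : ∫ x in thickening R Ω, dens W x ≤ I) (hp : ∫ x in thickening R Ω, (1 - ‖W x‖) ^ 2 ≤ p)
    (h1 : 1 ≤ L) (hKL : K ≤ L) (hℓ : 1 / 2 ≤ ℓ) (hℓK : ℓ ^ 2 = log (K + 1))
    (hT : T = I * (1 / 2 + 8 / ℓ + 2 / L) + 12 * p * L ^ 3 / δ ^ 2) :
    ∃ (u : ℤ × ℤ → ℝ) (S : Finset (ℤ × ℤ)), (∀ x ∈ Ω, corners (cellIndex δ x) ⊆ S) ∧
      4 * π ^ 2 * sdEnergy Ω δ u ≤ T * (1 + 120 / ℓ + 978 / L) ∧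
      ∫ x in Ω, dens (interp S δ fun k => uv (u k)) x ≤ 2500 * T ∧
      ∫ x in Ω, ‖interp S δ (fun k => uv (u k)) x - W x‖ ^ 2 ≤ 210000 * (8 ^ K * δ ^ 2 * L * T) := by
  have L0 : 0 < L := by linarith
  have l0 : 0 < ℓ := by linarith
  obtain ⟨k, hk, h, P, y, hh', hR', hP, hy, hle⟩ := exists_good_scale hW hL hb hδ hK hR hI hp L0 l0 hℓK
  rw [← hT] at hle
  have hh : 0 < h := by rw [hh']; positivity
  have hδh : δ ≤ h := by rw [hh']; exact le_mul_of_one_le_left hδ.le (one_le_pow₀ one_le_two)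
  have hI0 : 0 ≤ I := (integral_nonneg fun x => dens_nonneg W x).trans hI
  have hp0 : 0 ≤ p := (integral_nonneg fun x => sq_nonneg _).trans hp
  set V : ℤ × ℤ → E2 := fun m => W (y + pt h m) with hV
  choose u₀ hu₀ using fun m => exists_uv (V m) (hW1 _)
  have hproj : ∀ m, ‖uv (u₀ m) - V m‖ ≤ 1 - ‖V m‖ := fun m => (hu₀ m).le
  obtain ⟨u, bh, bv, Q, hstr, hQ, hcirc, hen, hdist⟩ := (isStrain_elastic u₀).exists_refinement P k
  set a₁ := ∑ m ∈ P, cellIncr V m with ha₁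
  set a₂ := ∑ m ∈ P, cellIncr₂ V m with ha₂
  set a₃ := ∑ m ∈ P, cellDefect V m with ha₃
  set a₄ := ∑ m ∈ P, oscillation W h (y + pt h m) with ha₄
  set c := ∑ m ∈ P, |circ (strainH u₀) (strainV u₀) m| with hc
  set e := ∑ m ∈ P, edgeSum (fun m => strainH u₀ m ^ 2) (fun m => strainV u₀ m ^ 2) m with he
  have p1 : 0 ≤ a₁ := sum_nonneg fun m _ => cellIncr_nonneg V m
  have p2 : 0 ≤ a₂ := sum_nonneg fun m _ => by unfold cellIncr₂ edgeSum; positivity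
  have p3 : 0 ≤ a₃ := sum_nonneg fun m _ => (sq_nonneg _).trans (sq_defect_le_cellDefect V m)
  have p4 : 0 ≤ a₄ := sum_nonneg fun m _ => integral_nonneg fun x => sq_nonneg _
  have q2 : 0 ≤ ℓ * (k + 1) * a₂ := by positivity
  have q3 : 0 ≤ L ^ 3 * a₃ := by positivity
  have q4 : 0 ≤ 1 / (h ^ 2 * L) * a₄ := by positivity
  have hkL : (k : ℝ) ≤ L := le_trans (by exact_mod_cast hk.le) hKL
  have main : π ^ 2 * (e + 3 / 2 * k * c) ≤ T * (1 + 120 / ℓ + 978 / L) := by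
    refine refined_energy_le h1 (Nat.cast_nonneg k) hkL l0 p1 p2 p3
      (sum_nonneg fun m _ => abs_nonneg _) (by linarith) ?_ ?_
    · rw [he, ha₁, ha₂, ha₃, mul_sum, mul_sum, mul_sum, mul_sum,
        ← sum_add_distrib, ← sum_add_distrib]
      refine sum_le_sum fun m _ => ?_
      have := cellStrain_le_of_projection hproj (η := 1 / L) (by positivity)
        ((div_le_one L0).2 h1) m
      rwa [div_div_eq_mul_div, div_one] at this
    · rw [hc, ha₂, ha₃, mul_sum, mul_sum, ← sum_add_distrib]
      exact sum_le_sum fun m _ => abs_circ_le_of_projection hproj m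
  set E := e + 3 / 2 * k * c with hE
  have hT0 : 0 ≤ T := by linarith
  have s3 : T * (1 + 120 / ℓ + 978 / L) ≤ T * 1219 := by
    have s1 : 120 / ℓ ≤ 240 := by rw [div_le_iff₀ l0]; linarith
    have s2 : 978 / L ≤ 978 := div_le_self (by norm_num) h1
    exact mul_le_mul_of_nonneg_left (by linarith) hT0
  have hE0 : 0 ≤ E := by
    have e0 : 0 ≤ e := sum_nonneg fun m _ => by unfold edgeSum; positivity
    have c0 : 0 ≤ c := sum_nonneg fun m _ => abs_nonneg _
    positivity
  have hET : E ≤ 136 * T := by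
    have : 9 * E ≤ π ^ 2 * E :=
      mul_le_mul_of_nonneg_right nine_le_pi_sq hE0
    linarith
  have hSt : ∑ j ∈ Q, cellStrain u j ≤ E :=
    (sum_le_sum fun j _ => hstr.cellStrain_le j).trans hen
  have hΩP : ∀ x ∈ thickening (2 * h) Ω, cellIndex δ x ∈ Q := fun x hx => by
    rw [hQ, iterate_parent_cellIndex, ← hh']; exact hP x hx
  have hsub : Ω ⊆ thickening (2 * h) Ω := self_subset_thickening (by positivity) Ω
  have hΩQ : Ω ⊆ squares δ Q := fun x hx => hΩP x (hsub hx)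
  have hΩP' : Ω ⊆ squares h P := fun x hx => hP x (hsub hx)
  have hcor : ∀ x ∈ Ω, corners (cellIndex δ x) ⊆ nodes Q := fun x hx => corners_subset_nodes (hΩQ hx)
  have h8 : h ^ 2 ≤ 8 ^ K * δ ^ 2 := by
    rw [hh', mul_pow, ← pow_mul, mul_comm k, pow_mul]
    norm_num
    exact mul_le_mul_of_nonneg_right ((pow_le_pow_left₀ (by norm_num) (by norm_num) k).trans
      (pow_le_pow_right₀ (by norm_num : (1 : ℝ) ≤ 8) hk.le)) (sq_nonneg δ)
  refine ⟨u, nodes Q, hcor, ?_, ?_, ?_⟩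
  · have := sdEnergy_le_sum_cellStrain hb hδ (Q := Q) (fun j hj => ?_) u
    · have := mul_le_mul_of_nonneg_left (this.trans (mul_le_mul_of_nonneg_left hSt (by norm_num)))
        (by positivity : 0 ≤ 4 * π ^ 2)
      linarith
    · have near : ∀ d : ℤ × ℤ, ‖pt δ d‖ = δ → j - d ∈ Q := fun d hd => by
        rw [← cellIndex_pt hδ (j - d)]
        refine hΩP _ (mem_thickening_iff.2 ⟨pt δ j, hj, ?_⟩)
        have : pt δ j = pt δ (j - d) + pt δ d := by rw [← pt_add, sub_add_cancel]
        rw [this, dist_self_add_right, hd]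
        linarith
      refine ⟨?_, near _ (norm_pt_right hδ), near _ (norm_pt_up hδ)⟩
      rw [← cellIndex_pt hδ j]
      exact hΩQ hj
  · have hLI : LipBdd (interp (nodes Q) δ fun k => uv (u k)) := LipBdd.interp hδ _
    have i := integral_dens_interp (fun k => uv (u k)) hδ (T := Q) (S := nodes Q)
      fun k hk => corners_subset_nodes hk
    have j := setIntegral_le_of_subset (hLI.bm_dens.integrableOn (volume_squares_ne_top hδ Q))
      (dens_nonneg _) hΩQ
    have s := sum_le_sum fun m (_ : m ∈ Q) => cellIncr_uv_le u m
    rw [← mul_sum] at s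
    have s' := mul_le_mul_of_nonneg_left hSt (by positivity : 0 ≤ 4 * π ^ 2)
    rw [i] at j
    linarith
  · obtain ⟨i1, j1⟩ := integral_comp_cellIndex_le hδ hΩQ (f := fun m => 160 * cellStrain u m)
      fun m => mul_nonneg (by norm_num) (cellStrain_nonneg u m)
    obtain ⟨i2, j2⟩ := integral_comp_cellIndex_le hδ hΩQ
      (f := fun j => ‖uv (u j) - uv (u₀ (parent^[k] j))‖ ^ 2) fun m => sq_nonneg _
    obtain ⟨i3, j3⟩ := integral_comp_cellIndex_le hh hΩP' (f := cellDefect V)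
      fun m => (sq_nonneg _).trans (sq_defect_le_cellDefect V m)
    obtain ⟨i4, j4⟩ := integral_sub_sample_le hL hh hΩP' y
    have j5 := integral_translation_le_dens hW hL hb hh hy hsub (by linarith) hI
    have i5 := hL.integrable_diff hb.measure_lt_top.ne y
    have i1234 := ((i1.add i2).add i3).add i4
    have bound := integral_mono_of_nonneg
      (f := fun x => ‖interp (nodes Q) δ (fun k => uv (u k)) x - W x‖ ^ 2)
      (of_forall fun x => sq_nonneg _) ((i1234.add i5).const_mul 5)
      ((ae_restrict_iff' hΩ).2 (of_forall fun x hx => by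
        have b1 := norm_interp_sub_sq_le hδ u (hcor x hx)
        have b3 := (pow_le_pow_left₀ (norm_nonneg _) (hproj (cellIndex h x)) 2).trans
          (sq_defect_le_cellDefect V (cellIndex h x))
        have b := norm_add_five_sq_le
          (interp (nodes Q) δ (fun k => uv (u k)) x - uv (u (cellIndex δ x)))
          (uv (u (cellIndex δ x)) - uv (u₀ (parent^[k] (cellIndex δ x))))
          (uv (u₀ (cellIndex h x)) - V (cellIndex h x))
          (W (y + pt h (cellIndex h x)) - W (x + y)) (W (x + y) - W x)
        simp only [Pi.add_apply]
        have ep : parent^[k] (cellIndex δ x) = cellIndex h x := by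
          rw [iterate_parent_cellIndex, ← hh']
        rw [ep] at b ⊢
        rw [sub_add_sub_cancel, sub_add_sub_cancel, sub_add_sub_cancel, sub_add_sub_cancel] at b
        refine b.trans ?_
        linarith))
    rw [integral_const_mul, integral_add' i1234 i5, integral_add' ((i1.add i2).add i3) i4,
      integral_add' (i1.add i2) i3, integral_add' i1 i2] at bound
    rw [← mul_sum] at j1
    set X := 8 ^ K * δ ^ 2 * L * T with hX
    have one8 : (1 : ℝ) ≤ 8 ^ K := one_le_pow₀ (by norm_num)
    have X1 : δ ^ 2 * T ≤ X := by
      rw [hX]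
      refine mul_le_mul_of_nonneg_right ?_ hT0
      have := mul_le_mul one8 h1 zero_le_one (by linarith)
      have := mul_le_mul_of_nonneg_right this (sq_nonneg δ)
      linarith
    have X2 : δ ^ 2 * (8 ^ k * T) ≤ X := by
      have a : (8 : ℝ) ^ k ≤ 8 ^ K := pow_le_pow_right₀ (by norm_num) hk.le
      have b : (8 : ℝ) ^ k ≤ 8 ^ K * L := a.trans (le_mul_of_one_le_right (by positivity) h1)
      refine (mul_le_mul_of_nonneg_left (mul_le_mul_of_nonneg_right b hT0) (sq_nonneg δ)).trans_eq ?_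
      rw [hX]; ring
    have X3 : h ^ 2 * L * T ≤ X :=
      mul_le_mul_of_nonneg_right (mul_le_mul_of_nonneg_right h8 L0.le) hT0
    have X4 : h ^ 2 * T ≤ X := (mul_le_mul_of_nonneg_right
      (le_mul_of_one_le_right (sq_nonneg h) h1) hT0).trans X3
    have m1 : δ ^ 2 * (160 * ∑ j ∈ Q, cellStrain u j) ≤ 21760 * X := by
      have := mul_le_mul_of_nonneg_left (hSt.trans hET) (sq_nonneg δ)
      linarith
    have m2 : δ ^ 2 * ∑ j ∈ Q, ‖uv (u j) - uv (u₀ (parent^[k] j))‖ ^ 2 ≤ 19040 * X := by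
      have e8 : (1 : ℝ) ≤ 8 ^ k := one_le_pow₀ (by norm_num)
      have : 14 * π ^ 2 * (8 ^ k - 1) * E ≤ 140 * 8 ^ k * (136 * T) := by
        have a : 14 * π ^ 2 * (8 ^ k - 1) ≤ 140 * 8 ^ k :=
          mul_le_mul (by linarith [pi_sq_le_ten]) (by linarith) (by linarith) (by norm_num)
        have b : 0 ≤ 14 * π ^ 2 * (8 ^ k - 1) := mul_nonneg (by positivity) (by linarith)
        exact (mul_le_mul_of_nonneg_left hET b).trans (mul_le_mul_of_nonneg_right a (by positivity))
      have := mul_le_mul_of_nonneg_left (hdist.trans this) (sq_nonneg δ)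
      linarith
    have m3 : h ^ 2 * a₃ ≤ X := by
      refine le_trans (mul_le_mul_of_nonneg_left ?_ (sq_nonneg h)) X4
      have := le_mul_of_one_le_left p3 (one_le_pow₀ h1 : (1 : ℝ) ≤ L ^ 3)
      linarith
    have m4 : a₄ ≤ X := by
      refine le_trans ?_ X3
      have : 1 / (h ^ 2 * L) * a₄ ≤ T := by linarith
      rwa [one_div_mul_eq_div, div_le_iff₀ (by positivity), mul_comm] at this
    have m5 : 2 * h ^ 2 * I ≤ 4 * X := by
      have : I ≤ 2 * T := by
        have x1 : 0 ≤ I * (8 / ℓ) := by positivity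
        have x2 : 0 ≤ I * (2 / L) := by positivity
        have x3 : 0 ≤ 12 * p * L ^ 3 / δ ^ 2 := by positivity
        linarith
      have := mul_le_mul_of_nonneg_left this (sq_nonneg h)
      linarith
    have X0 : 0 ≤ X := by positivity
    linarith

end Displacement

section GLToScrew

open Metric

variable {Ω : Set E2} {ε δ : ℝ}

/-- The part of a domain that is not covered by its lattice squares contributes little to a pairing. -/
theorem abs_setIntegral_mul_sub_squares_le (ho : IsOpen Ω) (hb : IsBounded Ω) (hδ : 0 < δ)
    {T : Finset (ℤ × ℤ)} (hT : ∀ k, k ∈ T ↔ k ∈ cells Ω δ) (φ : LipC Ω) {f : E2 → ℝ} (hf : BM f)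
    {I : ℝ} (hI : ∫ x in Ω, |f x| ≤ I) :
    |(∫ x in Ω, f x * φ x) - ∫ x in squares δ T, f x * φ x| ≤ 2 * δ * I * ‖φ‖ := by
  have hfin : volume Ω ≠ ⊤ := hb.measure_lt_top.ne
  have hsub := squares_subset hδ hT
  have hTm : MeasurableSet (squares δ T) := measurable_cellIndex δ T.measurableSet
  have i := (hf.mul φ.bm).integrableOn hfin
  have hN := norm_nonneg φ
  have ia : IntegrableOn (fun x => |f x|) Ω := (hf.integrableOn hfin).abs
  rw [← integral_inter_add_sdiff hTm i, Set.inter_eq_right.2 hsub, add_sub_cancel_left]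
  have key : ∀ x ∈ Ω \ squares δ T, ‖f x * φ x‖ ≤ 2 * δ * ‖φ‖ * |f x| := fun x hx => by
    have hx2 : cellIndex δ x ∉ cells Ω δ := fun h => hx.2 ((hT _).2 h)
    obtain ⟨z, hz, hzΩ⟩ := Set.not_subset.1 hx2
    have h1 := φ.abs_sub_le x z
    rw [φ.eq_zero hzΩ, sub_zero, dist_eq_norm] at h1
    have h2 := mul_le_mul_of_nonneg_left
      (norm_sub_le_of_mem_cell hδ (mem_cell_of_cellIndex hδ rfl) hz) hN
    rw [norm_mul, norm_eq_abs, norm_eq_abs, mul_comm]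
    exact mul_le_mul_of_nonneg_right (by linarith) (abs_nonneg _)
  rw [← norm_eq_abs]
  calc ‖∫ x in Ω \ squares δ T, f x * φ x‖ ≤ ∫ x in Ω \ squares δ T, 2 * δ * ‖φ‖ * |f x| :=
        norm_integral_le_of_norm_le ((ia.mono_set sdiff_subset).const_mul _)
          ((ae_restrict_iff' (ho.measurableSet.diff hTm)).2 (of_forall key))
    _ = 2 * δ * ‖φ‖ * ∫ x in Ω \ squares δ T, |f x| := integral_const_mul _ _
    _ ≤ 2 * δ * ‖φ‖ * I := by
        refine mul_le_mul_of_nonneg_left (le_trans ?_ hI) (by positivity)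
        exact setIntegral_le_of_subset ia (fun x => abs_nonneg _) sdiff_subset
    _ = _ := by ring

/-- The Jacobian and the current of the interpolation of a field of unit vectors, compared with the
dislocations and the strain. -/
theorem abs_integral_interp_sub_le (ho : IsOpen Ω) (hb : IsBounded Ω) (hδ : 0 < δ)
    {S : Finset (ℤ × ℤ)} (u : ℤ × ℤ → ℝ) (hS : ∀ x ∈ Ω, corners (cellIndex δ x) ⊆ S) {X : ℝ}
    (h1 : 4 * π ^ 2 * sdEnergy Ω δ u ≤ X)
    (h2 : ∫ x in Ω, dens (interp S δ fun k => uv (u k)) x ≤ 1250 * X) (φ : LipC Ω) :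
    |(∫ x in Ω, mjac (interp S δ fun k => uv (u k)) x * φ x) -
      π * dislocationMeasure Ω δ u φ| ≤ δ * (2 * volume.real Ω + 2700 * X) * ‖φ‖ ∧
    ∀ l, |(∫ x in Ω, mcur l (interp S δ fun k => uv (u k)) x * φ x) -
      ∫ x in Ω, 2 * π * strainField Ω δ u x l * φ x| ≤
        δ * (2 * volume.real Ω + 2700 * X) * ‖φ‖ := by
  have hfin : volume Ω ≠ ⊤ := hb.measure_lt_top.ne
  have hT : ∀ k, k ∈ (finite_cells hb hδ).toFinset ↔ k ∈ cells Ω δ := fun k => by simp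
  set T := (finite_cells hb hδ).toFinset
  have hLI : LipBdd (interp S δ fun k => uv (u k)) := LipBdd.interp hδ _
  have hST : ∀ k ∈ T, corners k ⊆ S := fun k hk => by
    have := hS (pt δ k) ((hT k).1 hk (corner_mem_cell hδ (by simp [corners])))
    rwa [cellIndex_pt hδ] at this
  have hN := norm_nonneg φ
  have hc := sum_cellStrain_le hb hδ hT u
  have hc2 : π ^ 2 * ∑ k ∈ T, cellStrain u k ≤ X :=
    (mul_le_mul_of_nonneg_left hc (sq_nonneg π)).trans (by linarith)
  have hd := hLI.bm_dens.integrableOn hfin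
  set V := interp S δ fun k => uv (u k)
  have hD0 : 0 ≤ ∫ x in Ω, dens V x := integral_nonneg fun x => dens_nonneg V x
  have hX0 : 0 ≤ X := by linarith
  have hvol : 0 ≤ volume.real Ω := measureReal_nonneg
  have c2 := mul_le_mul_of_nonneg_right (mul_le_mul_of_nonneg_left hc2 hδ.le) hN
  have pos1 : 0 ≤ δ * volume.real Ω * ‖φ‖ := by positivity
  have pos2 : 0 ≤ δ * X * ‖φ‖ := by positivity
  refine ⟨?_, fun l => ?_⟩
  · have a := abs_setIntegral_mul_sub_squares_le ho hb hδ hT φ hLI.bm_mjac (I := 625 * X) (by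
      calc ∫ x in Ω, |mjac V x| ≤ ∫ x in Ω, 1 / 2 * dens V x :=
            integral_mono_of_nonneg (of_forall fun x => abs_nonneg _) (hd.const_mul _)
              (of_forall fun x => abs_mjac_le V x)
        _ = 1 / 2 * ∫ x in Ω, dens V x := integral_const_mul _ _
        _ ≤ _ := by linarith)
    have b := abs_integral_mjac_interp_sub_le (u := u) hδ hT hST φ
    rw [← dislocationMeasure_eq hT] at b
    refine (abs_sub_le _ _ _).trans ((add_le_add a b).trans ?_)
    linarith
  · have a := abs_setIntegral_mul_sub_squares_le ho hb hδ hT φ (hLI.bm_mcur l)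
      (I := volume.real Ω + 1250 * X) (by
      have i1 : IntegrableOn (fun _ => (1 : ℝ)) Ω := integrableOn_const hfin
      have i : IntegrableOn (fun x => 1 + dens V x) Ω := i1.add hd
      calc ∫ x in Ω, |mcur l V x| ≤ ∫ x in Ω, (1 + dens V x) := by
            refine integral_mono_of_nonneg (of_forall fun x => abs_nonneg _) i
              ((ae_restrict_iff' ho.measurableSet).2 (of_forall fun x hx => ?_))
            have a := (abs_crs_le (V x) (pd l V x)).trans (mul_le_of_le_one_left (norm_nonneg _)
              (norm_interp_le_one _ hδ (hS x hx) fun k => (norm_uv (u k)).le))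
            have b : ‖pd l V x‖ ^ 2 ≤ dens V x := by
              fin_cases l
              · exact le_add_of_nonneg_right (sq_nonneg _)
              · exact le_add_of_nonneg_left (sq_nonneg _)
            refine (show |mcur l V x| ≤ _ from a).trans ?_
            nlinarith [sq_nonneg (‖pd l V x‖ - 1)]
        _ = volume.real Ω + ∫ x in Ω, dens V x := by
            rw [integral_add i1 hd]; simp
        _ ≤ _ := by linarith)
    have b := abs_integral_mcur_interp_sub_le hδ ho hT hST u φ l
    refine (abs_sub_le _ _ _).trans ((add_le_add a b).trans ?_)
    linarith

theorem exp_log_bounds (hε : 0 < ε) (h1 : ε < 1) {E Λ : ℝ} (hE : E = exp (-|log ε| / 8))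
    (hΛ : Λ = 5 + |log ε|) : √ε = E ^ 4 ∧ ε = E ^ 8 ∧ scale ε ≤ E ^ 8 * Λ ^ 3 ∧
      2 ^ ⌊|log ε| / 4⌋₊ * E ^ 2 ≤ 1 ∧ 8 ^ ⌊|log ε| / 4⌋₊ * E ^ 6 ≤ 1 := by
  have e8 : ε = E ^ 8 := by
    rw [hE, ← Real.exp_nat_mul, abs_of_neg (log_neg hε h1)]
    nth_rw 1 [← Real.exp_log hε]
    congr 1; push_cast; ring
  have hK := Nat.floor_le (by positivity : 0 ≤ |log ε| / 4)
  have h2 : (2 : ℝ) ^ ⌊|log ε| / 4⌋₊ * E ^ 2 ≤ 1 := by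
    have : (2 : ℝ) ≤ exp 1 := by linarith [Real.add_one_le_exp (1 : ℝ)]
    refine (mul_le_mul_of_nonneg_right (pow_le_pow_left₀ zero_le_two this _) (sq_nonneg E)).trans ?_
    rw [hE, ← Real.exp_nat_mul, ← Real.exp_nat_mul, ← Real.exp_add]
    refine Real.exp_le_one_iff.2 ?_
    push_cast
    linarith
  refine ⟨?_, e8, ?_, h2, ?_⟩
  · nth_rw 1 [e8]
    rw [show E ^ 8 = (E ^ 4) ^ 2 by ring]
    exact Real.sqrt_sq (by rw [hE]; positivity)
  · rw [← e8, hΛ, scale]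
    have := log_one_add_inv_nonneg hε
    exact mul_le_mul_of_nonneg_left (pow_le_pow_left₀ (by linarith)
      (by linarith [log_one_add_inv_le hε h1]) 3) hε.le
  · rw [show (8 : ℝ) = 2 ^ 3 by norm_num, ← pow_mul, mul_comm 3, pow_mul,
      show E ^ 6 = (E ^ 2) ^ 3 by ring, ← mul_pow]
    exact pow_le_one₀ (by positivity) h2

theorem tendsto_exp_mul_pow : Tendsto
    (fun ε : ℝ => exp (-|log ε| / 8) * (5 + |log ε|) ^ 6) (𝓝[>] 0) (𝓝 0) := by
  have h := (Real.tendsto_pow_mul_exp_neg_atTop_nhds_zero 6).comp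
    ((tendsto_atTop_add_const_left _ 5 tendsto_abs_log).atTop_div_const (by norm_num : (0 : ℝ) < 8))
  have h2 := h.const_mul (8 ^ 6 * exp (5 / 8))
  rw [mul_zero] at h2
  refine h2.congr fun ε => ?_
  rw [Function.comp_apply, show -|log ε| / 8 = 5 / 8 + -((5 + |log ε|) / 8) by ring,
    Real.exp_add]
  ring

end GLToScrew

section GLToScrew

open Metric

variable {Ω : Set E2} {ε : ℝ}

set_option maxHeartbeats 1000000 in
/-- A field of bounded rescaled Ginzburg-Landau energy is close to a lattice displacement of almost no
larger energy. -/
theorem H1Field.exists_displacement (ho : IsOpen Ω) (hb : IsBounded Ω) (w : H1Field Ω)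
    (hw : w.InBall) (hε : 0 < ε) (hε1 : ε < 1) {Φ : E2 → E2} {c C₀ A L ℓ M N Y σ r g : ℝ} (hc : 0 < c)
    (hC₀ : 0 ≤ C₀) (hΦ : NearId Φ (C₀ * √ε)) (hτ : C₀ * √ε ≤ 1 / 8)
    (hball : ∀ y ∈ Ω, ball (Φ y) (c * √ε) ⊆ Ω) (hLdef : L = |log ε|) (hL : 4 ≤ L) (hA : 0 ≤ A)
    (hwA : w.energy ε ≤ A * L ^ 2) (hM : M = 2 * A + 1) (hℓ : ℓ = √(log (⌊L / 4⌋₊ + 1)))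
    (hY : Y = (1 + 21 * (C₀ * √ε)) * (1 + 16 / ℓ + 4 / L)) (hσ : σ = 1 + 120 / ℓ + 978 / L)
    (hr : r = 12 * (4 * A + 2) / L) (hY2 : Y ≤ 2) (hσ2 : σ ≤ 2) (hr1 : r ≤ 1)
    (hg : g = exp (-L / 8) * (5 + L) ^ 6) (hgc : 36 * g ≤ c)
    (hN : N = 1 + (13 * C₀ + c / 2) * (2 * A + volume.real Ω) +
      500 * √M * (200 * √M + √(volume.real Ω)) + 2 * volume.real Ω + 5400 * M) :
    ∃ u : ℤ × ℤ → ℝ, 4 * π ^ 2 * sdEnergy Ω (scale ε) u ≤ (Y * w.energy ε + r) * σ ∧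
      4 * π ^ 2 * sdEnergy Ω (scale ε) u ≤ 2 * M * L ^ 2 ∧
      ∀ φ : LipC Ω, |(∫ x in Ω, w.jac x * φ x) - π * dislocationMeasure Ω (scale ε) u φ| ≤
        N * g * ‖φ‖ ∧
      ∀ l, |(∫ x in Ω, w.current x l * φ x) -
        ∫ x in Ω, 2 * π * strainField Ω (scale ε) u x l * φ x| ≤
        N * g * ‖φ‖ := by
  have L0 : 0 < L := by linarith
  have hδ : 0 < scale ε := scale_pos hε
  have hδL := mul_abs_log_pow_le_scale hε hε1
  obtain ⟨hE4, hE8, hδE, h2E, h8E⟩ := exp_log_bounds hε hε1 (E := exp (-L / 8)) (Λ := 5 + L)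
    (by rw [hLdef]) (by rw [hLdef])
  rw [← hLdef] at h2E h8E hδL
  set δ := scale ε with hδdef
  set K := ⌊L / 4⌋₊ with hK
  set E := exp (-L / 8) with hE
  set vol := volume.real Ω with hvol
  have hvol0 : 0 ≤ vol := measureReal_nonneg
  have hE0 : 0 < E := Real.exp_pos _
  have hE1 : E ≤ 1 := Real.exp_le_one_iff.2 (by linarith)
  set Λ := 5 + L with hΛ
  have hΛ1 : 1 ≤ Λ := by linarith
  have hg0 : 0 < g := by rw [hg]; positivity
  have gpow : ∀ {i j : ℕ}, i ≠ 0 → j ≤ 6 → E ^ i * Λ ^ j ≤ g := fun hi hj => by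
    rw [hg]
    refine mul_le_mul ?_ (pow_le_pow_right₀ hΛ1 hj) (by positivity) hE0.le
    exact pow_le_of_le_one hE0.le hE1 hi
  have hK0 : K ≠ 0 := (Nat.floor_pos.2 (by linarith)).ne'
  have hKL : (K : ℝ) ≤ L := (Nat.floor_le (by linarith)).trans (by linarith)
  have hlog : 1 / 4 ≤ log (K + 1) := by
    have : (2 : ℝ) ≤ K + 1 := by
      have : (1 : ℝ) ≤ K := by exact_mod_cast Nat.one_le_iff_ne_zero.2 hK0
      linarith
    linarith [log_le_log two_pos this, Real.log_two_gt_d9]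
  have hℓ2 : ℓ ^ 2 = log (K + 1) := by rw [hℓ]; exact sq_sqrt (by linarith)
  have hℓ1 : 1 / 2 ≤ ℓ := by rw [hℓ]; exact Real.le_sqrt_of_sq_le (by linarith)
  have l0 : 0 < ℓ := by linarith
  have hs : 0 < √ε := sqrt_pos.2 hε
  set I := ∫ x in Ω, (‖w.grad 0 x‖ ^ 2 + ‖w.grad 1 x‖ ^ 2) with hI
  set P := ∫ x in Ω, (1 - ‖w.toFun x‖) ^ 2 with hP
  have hI0 : 0 ≤ I := integral_nonneg fun x => by positivity
  have hP0 : 0 ≤ P := integral_nonneg fun x => sq_nonneg _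
  have hen := w.energy_eq hb ε
  have hP1 : 0 ≤ 1 / ε ^ 2 * P := by positivity
  have hIe : 1 / 2 * I ≤ w.energy ε := by linarith
  have hPle : P ≤ ε ^ 2 * (A * L ^ 2) := by
    have : 1 / ε ^ 2 * P ≤ A * L ^ 2 := by linarith
    rwa [one_div_mul_eq_div, div_le_iff₀ (by positivity), mul_comm] at this
  obtain ⟨W, hW, hWL, hW1, hD, hpot, hJ, hj⟩ := w.exists_interior_approx ho hb hw hΦ hτ
    (s := c * √ε / 2) (by positivity) (by rwa [mul_div_cancel₀ _ two_ne_zero]) (η := ε ^ 2)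
    (by positivity) le_rfl hPle
  set τ := C₀ * √ε with hτdef
  have hτ0 : 0 ≤ τ := by positivity
  set p := 2 * (2 * (ε ^ 2 * (A * L ^ 2)) + ε ^ 2) with hp
  obtain ⟨T, hT⟩ : ∃ T, T = (1 + 21 * τ) * I * (1 / 2 + 8 / ℓ + 2 / L) + 12 * p * L ^ 3 / δ ^ 2 := ⟨_, rfl⟩
  have hR : 9 * (2 ^ K * δ) ≤ c * √ε / 2 / 2 := by
    have a : 2 ^ K * δ ≤ E ^ 6 * Λ ^ 3 := by
      have := mul_le_mul_of_nonneg_right h2E (by positivity : 0 ≤ E ^ 6 * Λ ^ 3)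
      have := mul_le_mul_of_nonneg_left hδE (by positivity : (0 : ℝ) ≤ 2 ^ K)
      linarith
    have b := mul_le_mul_of_nonneg_left (gpow (i := 2) (by norm_num) (by norm_num : 3 ≤ 6)) (by positivity : 0 ≤ 36 * E ^ 4)
    have d := mul_le_mul_of_nonneg_left hgc (by positivity : 0 ≤ E ^ 4)
    rw [hE4]
    linarith
  obtain ⟨u, S, hS, hsd, hdens, hdist⟩ := VarEq.exists_displacement hW hWL hW1 hb ho.measurableSet hδ
    hK0 hR hD hpot (by linarith) hKL hℓ1 hℓ2 hT
  rw [← hσ] at hsd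
  have hpr : 12 * p * L ^ 3 / δ ^ 2 ≤ r := by
    rw [hr, div_le_div_iff₀ (by positivity) L0]
    have a := pow_le_pow_left₀ (by positivity) hδL 2
    have b : 1 ≤ L ^ 2 := one_le_pow₀ (by linarith)
    have d : p ≤ ε ^ 2 * ((4 * A + 2) * L ^ 2) := by
      rw [hp]
      have := mul_le_mul_of_nonneg_left b (sq_nonneg ε)
      linarith
    calc 12 * p * L ^ 3 * L ≤ 12 * (ε ^ 2 * ((4 * A + 2) * L ^ 2)) * L ^ 3 * L := by gcongr
      _ = 12 * (4 * A + 2) * (ε * L ^ 3) ^ 2 := by ring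
      _ ≤ _ := by gcongr
  have hY0 : 0 ≤ Y := by rw [hY]; positivity
  have hσ1 : 1 ≤ σ := by
    have a : 0 ≤ 120 / ℓ := by positivity
    have b : 0 ≤ 978 / L := by positivity
    rw [hσ]; linarith
  have hTY : T ≤ Y * w.energy ε + r := by
    have : (1 + 21 * τ) * I * (1 / 2 + 8 / ℓ + 2 / L) = Y * (1 / 2 * I) := by rw [hY]; ring
    rw [hT, this]
    exact add_le_add (mul_le_mul_of_nonneg_left hIe hY0) hpr
  have hL2 : 1 ≤ L ^ 2 := one_le_pow₀ (by linarith)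
  have hAL : 0 ≤ A * L ^ 2 := by positivity
  have hTM : T ≤ M * L ^ 2 := by
    have a := mul_le_mul_of_nonneg_left hwA hY0
    have b := mul_le_mul_of_nonneg_right hY2 hAL
    rw [hM]
    linarith
  have hM0 : 0 < M := by linarith
  have hD2 : (1 + 21 * τ) * I ≤ 2 * T := by
    have a : 0 ≤ (1 + 21 * τ) * I := by positivity
    have b : 0 ≤ (1 + 21 * τ) * I * (8 / ℓ + 2 / L) := by positivity
    have d : 0 ≤ 12 * p * L ^ 3 / δ ^ 2 := by positivity
    linarith
  have hT0 : 0 ≤ T := by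
    have a : 0 ≤ (1 + 21 * τ) * I := by positivity
    linarith
  have hsd2 : 4 * π ^ 2 * sdEnergy Ω δ u ≤ 2 * M * L ^ 2 := by
    have := mul_le_mul_of_nonneg_left hσ2 hT0
    linarith
  have hLI : LipBdd (interp S δ fun k => uv (u k)) := LipBdd.interp hδ _
  have hM2 : √M ^ 2 = M := sq_sqrt hM0.le
  set d := 500 * √M * (E * Λ ^ 5) with hd
  set m := 50 * √M * L with hm
  have hm2 : 2500 * (M * L ^ 2) = m ^ 2 := by rw [hm, mul_pow, mul_pow, hM2]; ring
  have hLΛ : L ≤ Λ := by linarith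
  have hdd : ∫ x in Ω, ‖interp S δ (fun k => uv (u k)) x - W x‖ ^ 2 ≤ d ^ 2 := by
    refine hdist.trans ?_
    have a : 8 ^ K * δ ^ 2 ≤ E ^ 10 * Λ ^ 6 := by
      have x1 := pow_le_pow_left₀ hδ.le hδE 2
      have x2 := mul_le_mul_of_nonneg_left x1 (by positivity : (0 : ℝ) ≤ 8 ^ K)
      have x3 := mul_le_mul_of_nonneg_right h8E (by positivity : 0 ≤ E ^ 10 * Λ ^ 6)
      linarith
    have b : L * T ≤ Λ ^ 3 * M := by
      have := mul_le_mul_of_nonneg_left hTM L0.le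
      have := mul_le_mul_of_nonneg_right (pow_le_pow_left₀ L0.le hLΛ 3) hM0.le
      linarith
    have e := mul_le_mul a b (by positivity) (by positivity)
    have f : E ^ 10 * Λ ^ 9 * M ≤ E ^ 2 * Λ ^ 10 * M := by
      refine mul_le_mul_of_nonneg_right (mul_le_mul ?_ ?_ (by positivity) (by positivity)) hM0.le
      · exact pow_le_pow_of_le_one hE0.le hE1 (by norm_num)
      · exact pow_le_pow_right₀ hΛ1 (by norm_num)
    have pos : 0 ≤ E ^ 2 * Λ ^ 10 * M := by positivity
    rw [hd, mul_pow, mul_pow, hM2]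
    linarith
  have hWΩ : ∫ x in Ω, dens W x ≤ m ^ 2 := by
    refine (setIntegral_le_of_subset (hWL.bm_dens.integrableOn hb.thickening.measure_lt_top.ne)
      (dens_nonneg W) (self_subset_thickening (by positivity : 0 < c * √ε / 2 / 2) Ω)).trans
      (hD.trans ?_)
    linarith
  have hIΩ : ∫ x in Ω, dens (interp S δ fun k => uv (u k)) x ≤ m ^ 2 := by linarith
  have hd0 : 0 ≤ d := by positivity
  have hm0 : 0 ≤ m := by positivity
  have b1 : ε ^ 2 + (13 * τ + c * √ε / 2) * (I + vol) ≤ (1 + (13 * C₀ + c / 2) * (2 * A + vol)) * g := by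
    have x1 : ε ^ 2 ≤ g := by
      have := gpow (i := 16) (by norm_num) (by norm_num : 0 ≤ 6)
      rw [hE8]
      linarith
    have x2 : √ε * (I + vol) ≤ (2 * A + vol) * g := by
      have y0 : √ε ≤ g := by
        have := gpow (i := 4) (by norm_num) (by norm_num : 0 ≤ 6)
        rw [hE4]; linarith
      have y1 : √ε * L ^ 2 ≤ g := by
        rw [hE4]
        exact (mul_le_mul_of_nonneg_left (pow_le_pow_left₀ L0.le hLΛ 2) (by positivity)).trans
          (gpow (i := 4) (by norm_num) (by norm_num))
      have y2 := mul_le_mul_of_nonneg_left (by linarith : I ≤ 2 * (A * L ^ 2)) hs.le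
      have y3 := mul_le_mul_of_nonneg_left y1 hA
      have y4 := mul_le_mul_of_nonneg_left y0 hvol0
      linarith
    have x3 := mul_le_mul_of_nonneg_left x2 (by positivity : 0 ≤ 13 * C₀ + c / 2)
    rw [hτdef]
    linarith
  have b2 : d * (4 * m + √vol) ≤ 500 * √M * (200 * √M + √vol) * g := by
    have x1 : E * Λ ^ 5 ≤ g := by
      simpa using gpow (i := 1) (by norm_num) (by norm_num : 5 ≤ 6)
    have x2 : E * Λ ^ 5 * L ≤ g := by
      have := mul_le_mul_of_nonneg_left hLΛ (by positivity : 0 ≤ E * Λ ^ 5)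
      rw [hg]
      linarith
    have y1 := mul_le_mul_of_nonneg_left x1 (by positivity : 0 ≤ 500 * √M * √vol)
    have y2 := mul_le_mul_of_nonneg_left x2 (by positivity : 0 ≤ 500 * √M * (200 * √M))
    rw [hd, hm]
    linarith
  have b3 : δ * (2 * vol + 2700 * (2 * M * L ^ 2)) ≤ (2 * vol + 5400 * M) * g := by
    have x1 : δ ≤ g := hδE.trans (gpow (i := 8) (by norm_num) (by norm_num))
    have x2 : δ * L ^ 2 ≤ g := by
      have := mul_le_mul hδE (pow_le_pow_left₀ L0.le hLΛ 2) (by positivity) (by positivity)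
      refine this.trans ?_
      rw [mul_assoc, ← pow_add]
      exact gpow (i := 8) (by norm_num) (by norm_num)
    have y1 := mul_le_mul_of_nonneg_left x1 hvol0
    have y2 := mul_le_mul_of_nonneg_left x2 hM0.le
    linarith
  refine ⟨u, hsd.trans (mul_le_mul_of_nonneg_right hTY (by linarith)), hsd2, fun φ => ?_⟩
  have hφ := norm_nonneg φ
  rw [hN]
  obtain ⟨k1, k2⟩ := abs_integral_interp_sub_le ho hb hδ u hS hsd2 (by linarith) φ
  have c1 := mul_le_mul_of_nonneg_right b1 hφ
  have c2 := mul_le_mul_of_nonneg_right b2 hφ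
  have c3 := mul_le_mul_of_nonneg_right b3 hφ
  have hv : 0 ≤ d * √vol * ‖φ‖ := by positivity
  have hdm : 0 ≤ d * m * ‖φ‖ := by positivity
  refine ⟨?_, fun l => ?_⟩
  · have j1 := hJ φ
    have j2 := hWL.abs_integral_mjac_sub_le' hLI hb φ hd0 hm0 hdd hIΩ hWΩ
    rw [abs_sub_comm] at j1 j2
    refine (abs_sub_le _ _ _).trans ((add_le_add_left (abs_sub_le _ _ _) _).trans
      ((add_le_add (add_le_add j1 j2) k1).trans ?_))
    linarith
  · have j1 := hj l φ
    have j2 := hWL.abs_integral_mcur_sub_le' hLI ho hb (fun x _ => hW1 x) φ l hd0 hm0 hdd hIΩ hWΩ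
    rw [abs_sub_comm] at j1 j2
    refine (abs_sub_le _ _ _).trans ((add_le_add_left (abs_sub_le _ _ _) _).trans
      ((add_le_add (add_le_add j1 j2) (k2 l)).trans ?_))
    linarith

end GLToScrew

section GLToScrew

variable {Ω : Set E2}

set_option maxHeartbeats 1000000 in
theorem admLE_GL_SD (ho : IsOpen Ω) (hb : IsBounded Ω) (hlip : HasLipschitzBoundary Ω) :
    AdmLE (AdmGL Ω) (AdmSD Ω) scale := by
  obtain ⟨c, C₀, t₀, hc, hC₀, ht₀, hpush⟩ := hlip.exists_push ho hb
  intro C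
  set V := volume.real Ω with hV
  have hV0 : 0 ≤ V := measureReal_nonneg
  obtain ⟨A, hA⟩ : ∃ A, A = |C| := ⟨_, rfl⟩
  have hA0 : 0 ≤ A := hA ▸ abs_nonneg C
  obtain ⟨M, hM⟩ : ∃ M, M = 2 * A + 1 := ⟨_, rfl⟩
  have hM0 : 0 < M := by linarith
  obtain ⟨N, hN⟩ : ∃ N, N = 1 + (13 * C₀ + c / 2) * (2 * A + V) + 500 * √M * (200 * √M + √V) +
    2 * V + 5400 * M := ⟨_, rfl⟩
  have hN0 : 0 ≤ N := by rw [hN]; positivity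
  set ℓ : ℝ → ℝ := fun ε => √(log (⌊|log ε| / 4⌋₊ + 1)) with hℓ
  set Y : ℝ → ℝ := fun ε => (1 + 21 * (C₀ * √ε)) * (1 + 16 / ℓ ε + 4 / |log ε|) with hY
  set σ : ℝ → ℝ := fun ε => 1 + 120 / ℓ ε + 978 / |log ε| with hσ
  set r : ℝ → ℝ := fun ε => 12 * (4 * A + 2) / |log ε| with hr
  set g : ℝ → ℝ := fun ε => exp (-|log ε| / 8) * (5 + |log ε|) ^ 6 with hg
  set s : ℝ → ℝ := fun ε => |log ε| / |log (scale ε)| with hs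
  set s' : ℝ → ℝ := fun ε => |log (scale ε)| / |log ε| with hs'
  have ts : Tendsto s (𝓝[>] 0) (𝓝 1) := tendsto_log_ratio
  have tg : Tendsto g (𝓝[>] 0) (𝓝 0) := tendsto_exp_mul_pow
  have tr : Tendsto r (𝓝[>] 0) (𝓝 0) := tendsto_const_nhds.div_atTop tendsto_abs_log
  have tℓ : Tendsto ℓ (𝓝[>] 0) atTop :=
    Real.tendsto_sqrt_atTop.comp (Real.tendsto_log_atTop.comp (tendsto_atTop_add_const_right _ 1
      (tendsto_natCast_atTop_atTop.comp (tendsto_nat_floor_atTop.comp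
        (tendsto_abs_log.atTop_div_const (by norm_num))))))
  have tτ : Tendsto (fun ε : ℝ => C₀ * √ε) (𝓝[>] 0) (𝓝 0) := by
    simpa using tendsto_sqrt_zero.const_mul C₀
  have dl : ∀ a : ℝ, Tendsto (fun ε => a / ℓ ε) (𝓝[>] 0) (𝓝 0) := fun a =>
    tendsto_const_nhds.div_atTop tℓ
  have dL : ∀ a : ℝ, Tendsto (fun ε => a / |log ε|) (𝓝[>] 0) (𝓝 0) := fun a =>
    tendsto_const_nhds.div_atTop tendsto_abs_log
  have tY : Tendsto Y (𝓝[>] 0) (𝓝 1) := by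
    simpa using ((tτ.const_mul 21).const_add 1).mul (((dl 16).const_add 1).add (dL 4))
  have tσ : Tendsto σ (𝓝[>] 0) (𝓝 1) := by
    simpa using ((dl 120).const_add 1).add (dL 978)
  have tsσ : Tendsto (fun ε => s ε ^ 2 * σ ε) (𝓝[>] 0) (𝓝 1) := by simpa using (ts.pow 2).mul tσ
  refine ⟨fun ε => A * |s ε ^ 2 * σ ε * Y ε - 1| + s ε ^ 2 * σ ε * r ε +
    |1 - s' ε| * (14 * √V * √M) + N * g ε, 2 * √A + 6 * √M, ?_, ?_⟩
  · have := (((((tsσ.mul tY).sub_const 1).abs.const_mul A).add (tsσ.mul tr)).add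
      ((tendsto_log_scale.const_sub 1).abs.mul_const (14 * √V * √M))).add (tg.const_mul N)
    simpa using this
  have ev : ∀ {f : ℝ → ℝ} {a b : ℝ}, Tendsto f (𝓝[>] 0) (𝓝 a) → a < b →
      ∀ᶠ ε in 𝓝[>] (0 : ℝ), f ε ≤ b := fun h hab => (h.eventually_lt_const hab).mono fun _ h => h.le
  filter_upwards [self_mem_nhdsWithin, eventually_lt_one, tendsto_abs_log.eventually_ge_atTop 4,
    ev tτ (by norm_num : (0 : ℝ) < 1 / 8), ev tendsto_sqrt_zero ht₀, ev tY one_lt_two,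
    ev tσ one_lt_two, ev tr one_pos, ev tg (by positivity : 0 < c / 36), ev ts one_lt_two,
    tendsto_scale.eventually eventually_lt_one] with
    ε hε hε1 hL4 hτ8 ht hY2 hσ2 hr1 hgc hs2 hs1
  rintro p e ⟨w, hw, hp1, hp2, rfl⟩ he
  rw [mem_Ioi] at hε
  obtain ⟨Φ, hΦ, hball⟩ := hpush (√ε) (sqrt_pos.2 hε) ht
  have hδ0 : 0 < scale ε := scale_pos hε
  set L := |log ε| with hL
  set L' := |log (scale ε)| with hL'
  have hL0 : 0 < L := by linarith
  have hL'0 : 0 < L' := abs_pos.2 (log_neg hδ0 hs1).ne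
  have hen0 : 0 ≤ w.energy ε := integral_nonneg fun x => by positivity
  have hwA : w.energy ε ≤ A * L ^ 2 := by
    have := he.trans (le_abs_self C)
    rwa [← hA, one_div, inv_mul_le_iff₀ (by positivity), mul_comm] at this
  obtain ⟨u, hu1, hu2, hu3⟩ := w.exists_displacement ho hb hw hε hε1 hc hC₀.le hΦ hτ8 hball hL hL4
    hA0 hwA hM rfl rfl rfl rfl hY2 hσ2 hr1 rfl (by linarith) hN
  obtain ⟨q, hq1, hq2⟩ := exists_admSD_of_displacement hb hδ0 u
  rw [← hL'] at hq1 hq2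
  set δ := scale ε
  change ∀ φ : LipC Ω, _ ≤ N * g ε * ‖φ‖ ∧ ∀ l, _ ≤ N * g ε * ‖φ‖ at hu3
  have hLL' : L ≤ 2 * L' := (div_le_iff₀ hL'0).1 hs2
  have hT : ∀ k, k ∈ (finite_cells hb hδ0).toFinset ↔ k ∈ cells Ω δ := fun k => by simp
  have hsqrt : √(∑ k ∈ (finite_cells hb hδ0).toFinset, cellStrain u k) ≤ 2 * √M * L' := by
    refine sqrt_le_iff.2 ⟨by positivity, ?_⟩
    rw [mul_pow, mul_pow, sq_sqrt hM0.le]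
    have a := sum_cellStrain_le hb hδ0 hT u
    have b := mul_le_mul_of_nonneg_right nine_le_pi_sq (sdEnergy_nonneg hb hδ0 u)
    have d := mul_le_mul_of_nonneg_left (pow_le_pow_left₀ hL0.le hLL' 2) hM0.le
    have : 0 ≤ M * L' ^ 2 := by positivity
    linarith
  have e0 : 0 ≤ 1 / L ^ 2 * w.energy ε := by positivity
  have hY0 : 0 ≤ Y ε := by simp only [hY]; positivity
  have hσ0 : 0 ≤ σ ε := by simp only [hσ]; positivity
  have hr0 : 0 ≤ r ε := by simp only [hr]; positivity
  have hg0 : 0 ≤ g ε := by simp only [hg]; positivity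
  have n0 : 0 ≤ A * |s ε ^ 2 * σ ε * Y ε - 1| := by positivity
  have n1 : 0 ≤ s ε ^ 2 * σ ε * r ε := by positivity
  have n2 : 0 ≤ |1 - s' ε| * (14 * √V * √M) := by positivity
  have n3 : 0 ≤ N * g ε := by positivity
  have hL1 : 1 / L ≤ 1 := (div_le_one hL0).2 (by linarith)
  refine ⟨q, _, ⟨u, hq1, hq2, rfl⟩, ?_, ⟨fun φ => ?_, fun l φ => ?_⟩, ?_⟩
  · have a : 4 * π ^ 2 / L' ^ 2 * sdEnergy Ω δ u ≤
        s ε ^ 2 * σ ε * (Y ε * (1 / L ^ 2 * w.energy ε) + r ε * (1 / L ^ 2)) := by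
      calc _ = 1 / L' ^ 2 * (4 * π ^ 2 * sdEnergy Ω δ u) := by ring
        _ ≤ 1 / L' ^ 2 * ((Y ε * w.energy ε + r ε) * σ ε) :=
            mul_le_mul_of_nonneg_left hu1 (by positivity)
        _ = _ := by
            simp only [hs]
            rw [← hL, ← hL']
            field_simp
    have b : 1 / L ^ 2 ≤ 1 := (div_le_one (by positivity)).2 (one_le_pow₀ (by linarith))
    have b' := mul_le_mul_of_nonneg_left b n1
    have d : 1 / L ^ 2 * w.energy ε * (s ε ^ 2 * σ ε * Y ε - 1) ≤ A * |s ε ^ 2 * σ ε * Y ε - 1| :=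
      (mul_le_mul_of_nonneg_left (le_abs_self _) e0).trans
        (mul_le_mul_of_nonneg_right (he.trans (hA ▸ le_abs_self C)) (abs_nonneg _))
    linarith
  · have hφ := norm_nonneg φ
    have e1 : p.1 φ = 1 / L * (1 / π * ∫ x in Ω, w.jac x * φ x) := by
      rw [hp2]; field_simp
    rw [hq2, e1, abs_sub_comm]
    have h1 : |dislocationMeasure Ω δ u φ| ≤ (14 * √V * √M * ‖φ‖) * L' := by
      refine (abs_dislocationMeasure_le hb hδ0 hT u φ).trans ?_
      have := mul_le_mul_of_nonneg_left hsqrt (by positivity : 0 ≤ 6 * √V * ‖φ‖)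
      have : 0 ≤ √V * √M * ‖φ‖ * L' := by positivity
      linarith
    have h2 : |1 / π * (∫ x in Ω, w.jac x * φ x) - dislocationMeasure Ω δ u φ| ≤
        N * g ε * ‖φ‖ := abs_inv_pi_mul_sub_le (hu3 φ).1
    refine (abs_scaled_sub_le hL'0 hL0 h1 h2).trans ?_
    have := mul_le_of_le_one_left (mul_nonneg n3 hφ) hL1
    have := mul_nonneg (add_nonneg n0 n1) hφ
    change |1 - s' ε| * _ + _ ≤ _
    linarith
  · have hφ := norm_nonneg φ
    rw [integral_field_sub_mul p q hp1 hq1, integral_lattice_field_mul, abs_sub_comm]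
    have e1 : ∫ x in Ω, ((1 / L) • w.current x) l * φ x = 1 / L * ∫ x in Ω, w.current x l * φ x := by
      rw [← integral_const_mul]
      simp only [PiLp.smul_apply, smul_eq_mul, mul_assoc]
    rw [e1]
    have h1 : |∫ x in Ω, 2 * π * strainField Ω δ u x l * φ x| ≤ (14 * √V * √M * ‖φ‖) * L' := by
      refine (abs_integral_strainField_le ho hb hδ0 hT u φ l).trans ?_
      have := mul_le_mul_of_nonneg_left hsqrt (by positivity : 0 ≤ 2 * π * √V * ‖φ‖)
      have := mul_le_mul_of_nonneg_right Real.pi_lt_d2.le (by positivity : 0 ≤ √V * √M * ‖φ‖ * L')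
      have : 0 ≤ √V * √M * ‖φ‖ * L' := by positivity
      linarith
    refine (abs_scaled_sub_le hL'0 hL0 h1 ((hu3 φ).2 l)).trans ?_
    have := mul_le_of_le_one_left (mul_nonneg n3 hφ) hL1
    have := mul_nonneg (add_nonneg n0 n1) hφ
    change |1 - s' ε| * _ + _ ≤ _
    linarith
  · have h1 : ‖p.field‖ ≤ 2 * √A := by
      refine norm_field_le p hp1 (by positivity) ?_
      have hI := w.energy_eq hb ε
      have hP : 0 ≤ 1 / ε ^ 2 * ∫ x in Ω, (1 - ‖w.toFun x‖) ^ 2 :=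
        mul_nonneg (by positivity) (integral_nonneg fun x => sq_nonneg _)
      calc ∫ x in Ω, ‖(1 / L) • w.current x‖ ^ 2 ≤
            ∫ x in Ω, 1 / L ^ 2 * (‖w.grad 0 x‖ ^ 2 + ‖w.grad 1 x‖ ^ 2) := by
            refine integral_mono_of_nonneg (ae_of_all _ fun x => by positivity)
              (w.integrable_dens.const_mul _) ?_
            filter_upwards [hw] with x hx
            rw [norm_smul, mul_pow, norm_eq_abs, sq_abs, div_pow, one_pow]
            exact mul_le_mul_of_nonneg_left (w.norm_current_sq_le hx) (by positivity)
        _ = 1 / L ^ 2 * ∫ x in Ω, (‖w.grad 0 x‖ ^ 2 + ‖w.grad 1 x‖ ^ 2) := integral_const_mul _ _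
        _ ≤ 1 / L ^ 2 * (4 * (A * L ^ 2)) := by
            refine mul_le_mul_of_nonneg_left ?_ (by positivity)
            have : 0 ≤ A * L ^ 2 := by positivity
            linarith
        _ = (2 * √A) ^ 2 := by rw [mul_pow, sq_sqrt hA0]; field_simp; ring
    have h2 : ‖q.field‖ ≤ 6 * √M := norm_lattice_field_le ho hb hδ0 q hq1 (by positivity) (by
      rw [mul_pow, sq_sqrt hM0.le, div_mul_eq_mul_div, div_le_iff₀ (by positivity)]
      have d := mul_le_mul_of_nonneg_left (pow_le_pow_left₀ hL0.le hLL' 2) hM0.le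
      have : 0 ≤ M * L' ^ 2 := by positivity
      linarith)
    exact (norm_sub_le _ _).trans (add_le_add h1 h2)

end GLToScrew

end VarEq

end

namespace VarEq

theorem varEquiv_of_admLE {Ω : Set E2} (ho : IsOpen Ω) (h₁ : AdmLE (AdmSD Ω) (AdmXY Ω) id)
    (h₂ : AdmLE (AdmXY Ω) (AdmGL Ω) scale) (h₃ : AdmLE (AdmGL Ω) (AdmSD Ω) scale) :
    VarEquiv (enrichedGL Ω) (enrichedXY Ω) ∧ VarEquiv (enrichedXY Ω) (enrichedSD Ω) ∧
      VarEquiv (enrichedGL Ω) (enrichedSD Ω) := by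
  have hc := continuousOn_scale
  have hm := strictMonoOn_scale
  have maps : Set.MapsTo scale (Set.Ici 0) (Set.Ici 0) := fun x hx => by
    have := hm.monotoneOn Set.self_mem_Ici hx hx
    rwa [scale_zero] at this
  have hid : Tendsto (id : ℝ → ℝ) (𝓝[>] 0) (𝓝[>] 0) := tendsto_id
  have k₁ := h₃.trans tendsto_scale h₁
  have k₂ := h₂.trans tendsto_scale h₃
  have k₃ := h₁.trans hid h₂
  refine ⟨⟨?_, ?_⟩, ⟨?_, ?_⟩, ⟨?_, ?_⟩⟩
  · exact AdmLE.varLE ho hc hm scale_zero exists_admXY enrichedGL_le h₂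
  · exact AdmLE.varLE ho hc hm scale_zero exists_admGL enrichedXY_le k₁
  · exact AdmLE.varLE ho continuousOn_id strictMonoOn_id rfl exists_admSD enrichedXY_le h₁
  · exact AdmLE.varLE ho (hc.comp hc maps) (fun x hx y hy h => hm (maps hx) (maps hy) (hm hx hy h))
      (by simp [scale_zero]) exists_admXY enrichedSD_le k₂
  · exact AdmLE.varLE ho hc hm scale_zero exists_admSD enrichedGL_le k₃
  · exact AdmLE.varLE ho hc hm scale_zero exists_admGL enrichedSD_le h₃

end VarEq

theorem theorem6p4 (Ω : Set VarEq.E2) (hΩ_open : IsOpen Ω) (hΩ_bdd : Bornology.IsBounded Ω)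
    (hΩ_lip : VarEq.HasLipschitzBoundary Ω) (hΩ_star : StarConvex ℝ 0 Ω) :
    VarEq.VarEquiv (VarEq.enrichedGL Ω) (VarEq.enrichedXY Ω) ∧
      VarEq.VarEquiv (VarEq.enrichedXY Ω) (VarEq.enrichedSD Ω) ∧
      VarEq.VarEquiv (VarEq.enrichedGL Ω) (VarEq.enrichedSD Ω) :=
  VarEq.varEquiv_of_admLE hΩ_open (VarEq.admLE_SD_XY hΩ_open hΩ_bdd)
    (VarEq.admLE_XY_GL hΩ_open hΩ_bdd hΩ_lip)
    (VarEq.admLE_GL_SD hΩ_open hΩ_bdd hΩ_lip)
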